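/- **Conventions.** A convex polygon $P\subset\mathbb R^2$ is given by its vertices in clockwise order: $m\ge 2$ distinct points, any three of which, in this order, make a strict right turn (for $m=2$ it is a line segment). Let $0<\omega<\pi$. An $\omega$-wedge is the closed region between two rays (its left and right arm, as seen from their common origin, the apex) that form the angle $\omega$. It is minimal for $P$ if it contains $P$ and both of its arms touch $P$. The $\omega$-cloud of $P$ is the locus of the apices of all minimal $\omega$-wedges. Its arcs are the portions, of more than one point, on which the left arm touches one fixed vertex and the right arm touches one fixed vertex; they are circular arcs, and the $\omega$-cloud is regarded as the cyclic sequence of its arcs in clockwise order. The maximal $\omega$-cloud is obtained by merging consecutive arcs that have the same supporting circle. A circular arc sequence of $n$ arcs is a cyclic sequence of $n$ directed circular arcs (each a proper part of a circle, with two distinct end points, run through clockwise or counterclockwise) in which each arc ends where the next one begins. **Model of computation.** A real RAM with exact real arithmetic ($+,-,\cdot,/$, square root, $\sin,\cos,\arccos$, comparison, rational constants), each operation and each access taking one step. The input consists of $\omega$, $n$ and the sequence, which is read-only and circular: each arc is given by the coordinates of its centre, start point and end point and by its orientation, and is read through pointers that start at the first arc and can only be moved forward, one arc at a time. The output is write-only.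 The working space consists of the memory cells, each holding one real number, and of the pointers. The algorithm makes two passes if no pointer is moved forward more than $2n$ times, i.e. goes around the input more than twice. **Theorem.** There is an algorithm (one program, with a fixed finite number of memory cells and pointers, hence $O(1)$ working space) with the following property. For every angle $\omega$ with $0<\omega<\pi$ there is a constant $C$, depending only on $\omega$, such that on every circular arc sequence $\Omega^*$ of $n>1$ arcs the algorithm makes at most two passes through the input, stops after at most $C\,n$ steps, and * answers "yes" and outputs the vertices, in clockwise order, of a convex polygon whose maximal $\omega$-cloud is $\Omega^*$, if such a polygon exists; * answers "no", if $\Omega^*$ is not the maximal $\omega$-cloud of any convex polygon. -/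

import Mathlib

namespace OmegaCloud

/-! ### Convex polygons. The Euclidean plane is `ℂ`. -/

/-- The cross product of `b - a` and `c - a`; it is negative when `a, b, c` make a right turn. -/
def cross (a b c : ℂ) : ℝ :=
  (b - a).re * (c - a).im - (b - a).im * (c - a).re

/-- `vs` lists the vertices of a convex polygon in clockwise order: there are at least two of
them, they are distinct, and any three of them, taken in the order of the list, make a right turn
(so each point of the list is a true corner). A line segment is the polygon with two vertices. -/
def IsConvexPolygon (vs : List ℂ) : Prop :=
  2 ≤ vs.length ∧ vs.Nodup ∧
    ∀ (i j k : ℕ) (hk : k < vs.length) (hij : i < j) (hjk : j < k),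
      cross (vs[i]'(by omega)) (vs[j]'(by omega)) (vs[k]'hk) < 0

/-- The polygon, as a set of points, with the given vertices. -/
def polygon (vs : List ℂ) : Set ℂ := convexHull ℝ {v | v ∈ vs}

/-! ### Wedges and the cloud -/

/-- The ray from `q` in the direction with polar angle `φ`. -/
def ray (q : ℂ) (φ : ℝ) : Set ℂ :=
  {z | ∃ r : ℝ, 0 ≤ r ∧ z = q + r * Complex.exp (φ * Complex.I)}

/-- The closed wedge of angle `ω` with apex `q` whose bisector has polar angle `θ`. -/
def wedge (ω : ℝ) (q : ℂ) (θ : ℝ) : Set ℂ :=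
  {z | ∃ φ : ℝ, θ - ω / 2 ≤ φ ∧ φ ≤ θ + ω / 2 ∧ z ∈ ray q φ}

/-- The left arm of the wedge, as seen from its apex. -/
def leftArm (ω : ℝ) (q : ℂ) (θ : ℝ) : Set ℂ := ray q (θ + ω / 2)

/-- The right arm of the wedge, as seen from its apex. -/
def rightArm (ω : ℝ) (q : ℂ) (θ : ℝ) : Set ℂ := ray q (θ - ω / 2)

/-- The wedge is minimal for `P`: it contains `P` and both of its arms touch `P`. -/
def IsMinimalWedge (ω : ℝ) (P : Set ℂ) (q : ℂ) (θ : ℝ) : Prop :=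
  P ⊆ wedge ω q θ ∧ (leftArm ω q θ ∩ P).Nonempty ∧ (rightArm ω q θ ∩ P).Nonempty

/-- The `ω`-cloud is the locus of the apices of the minimal wedges. This is the portion of the
cloud of the polygon `vs` that consists of the apices of those minimal wedges whose left arm
touches the polygon in the vertex `a` and whose right arm touches it in `b`. -/
def cloudPortion (ω : ℝ) (vs : List ℂ) (a b : ℂ) : Set ℂ :=
  {q | ∃ θ : ℝ, IsMinimalWedge ω (polygon vs) q θ ∧ a ∈ leftArm ω q θ ∧ b ∈ rightArm ω q θ}

/-- `S` is an arc of the cloud of the polygon `vs`: the portion that belongs to some pair of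
vertices, provided that this portion is more than one point. -/
def IsCloudArc (ω : ℝ) (vs : List ℂ) (S : Set ℂ) : Prop :=
  ∃ a ∈ vs, ∃ b ∈ vs, S = cloudPortion ω vs a b ∧ S.Nontrivial

/-! ### Circular arc sequences -/

/-- A directed circular arc: it runs from `start` to `finish` on the circle about `center`
through `start`, clockwise or counterclockwise. -/
structure DirArc where
  center : ℂ
  start : ℂ
  finish : ℂ
  clockwise : Bool

/-- Both end points lie on the supporting circle, and they are distinct
(the arc is neither a point nor the whole circle). -/
def DirArc.Valid (A : DirArc) : Prop :=
  A.start ≠ A.finish ∧ dist A.start A.center = dist A.finish A.center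

/-- The image of `z` under the rotation about `A.center` by the angle `s ≥ 0` in the direction in
which `A` runs. -/
noncomputable def DirArc.turn (A : DirArc) (s : ℝ) (z : ℂ) : ℂ :=
  A.center + (z - A.center) * Complex.exp ((if A.clockwise then -s else s : ℝ) * Complex.I)

/-- The set of points of the arc; `t` is its angular measure. -/
def DirArc.carrier (A : DirArc) : Set ℂ :=
  {z | ∃ s t : ℝ, 0 ≤ s ∧ s ≤ t ∧ t < 2 * Real.pi ∧ A.finish = A.turn t A.start ∧
    z = A.turn s A.start}

/-- The two arcs have the same supporting circle. -/
def SameCircle (A B : DirArc) : Prop :=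
  A.center = B.center ∧ dist A.start A.center = dist B.start B.center

/-- The pairs of cyclically consecutive elements of a list. -/
def consecutive (l : List DirArc) : List (DirArc × DirArc) := l.zip (l.rotate 1)

/-- A circular arc sequence: each arc ends where the next one begins, cyclically. -/
def IsArcSequence (l : List DirArc) : Prop :=
  (∀ A ∈ l, A.Valid) ∧ ∀ p ∈ consecutive l, p.1.finish = p.2.start

/-- The circular arc sequence `l` is the `ω`-cloud of the polygon `vs`: it consists of the arcs of
the cloud, each exactly once, in the order in which they are met when the cloud is traversed
clockwise (each arc is then run through clockwise). -/
def IsCloud (ω : ℝ) (vs : List ℂ) (l : List DirArc) : Prop :=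
  IsArcSequence l ∧ (∀ A ∈ l, A.clockwise = true) ∧ (l.map DirArc.carrier).Nodup ∧
    ∀ S : Set ℂ, S ∈ l.map DirArc.carrier ↔ IsCloudArc ω vs S

/-- `A` is the result of merging the consecutive arcs `b`, all on the same circle, into one. -/
def IsMergeOf (A : DirArc) (b : List DirArc) : Prop :=
  ∃ h : b ≠ [], (b.head h).start = A.start ∧ (b.getLast h).finish = A.finish ∧
    ∀ B ∈ b, SameCircle B A ∧ B.clockwise = A.clockwise

/-- The sequence `m` of at least two arcs is the maximal `ω`-cloud of the polygon `vs`: it results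
from the `ω`-cloud by merging blocks of consecutive arcs with the same supporting circle, until
(cyclically) consecutive arcs have distinct supporting circles. -/
def IsMaximalCloud (ω : ℝ) (vs : List ℂ) (m : List DirArc) : Prop :=
  ∃ blocks : List (List DirArc), IsCloud ω vs blocks.flatten ∧
    List.Forall₂ IsMergeOf m blocks ∧ ∀ p ∈ consecutive m, ¬ SameCircle p.1 p.2

/-! ### The machine: a real RAM with `K` memory cells and a read-only circular input, which is
accessed through `H` pointers that move forward only, and with a write-only output. -/

/-- The real numbers that describe an arc of the input. -/
inductive ArcField where
  | centerX | centerY | startX | startY | finishX | finishY | orientation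

/-- The value of a field; the orientation is `1` for a clockwise arc and `0` otherwise. -/
def ArcField.value (A : DirArc) : ArcField → ℝ
  | .centerX => A.center.re
  | .centerY => A.center.im
  | .startX => A.start.re
  | .startY => A.start.im
  | .finishX => A.finish.re
  | .finishY => A.finish.im
  | .orientation => if A.clockwise then 1 else 0

/-- Expressions over rational constants, the memory cells and the arcs under the pointers. -/
inductive Expr (K H : ℕ) where
  | const (c : ℚ)
  | cell (i : Fin K)
  | read (h : Fin H) (f : ArcField)
  | add (a b : Expr K H)
  | sub (a b : Expr K H)
  | mul (a b : Expr K H)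
  | div (a b : Expr K H)
  | sqrt (a : Expr K H)
  | sin (a : Expr K H)
  | cos (a : Expr K H)
  | arccos (a : Expr K H)

/-- Programs. `emit` writes a point to the output, `answer` sets the yes/no answer. -/
inductive Program (K H : ℕ) where
  | skip
  | assign (i : Fin K) (e : Expr K H)
  | advance (h : Fin H)
  | emit (x y : Expr K H)
  | answer (b : Bool)
  | seq (p q : Program K H)
  | ifLt (a b : Expr K H) (p q : Program K H)
  | whileLt (a b : Expr K H) (p : Program K H)

/-- The state of the machine: the cells, the number of forward moves that each pointer has made,
the points written so far, and the answer. -/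
structure State (K H : ℕ) where
  mem : Fin K → ℝ
  pos : Fin H → ℕ
  out : List ℂ
  verdict : Option Bool

/-- The arc reached from the first one by `p` forward moves in the circular sequence `l`. -/
def arcAt (l : List DirArc) (p : ℕ) : DirArc := l.getD (p % l.length) ⟨0, 0, 0, true⟩

noncomputable def Expr.eval {K H : ℕ} (l : List DirArc) (s : State K H) : Expr K H → ℝ
  | .const c => c
  | .cell i => s.mem i
  | .read h f => f.value (arcAt l (s.pos h))
  | .add a b => a.eval l s + b.eval l s
  | .sub a b => a.eval l s - b.eval l s
  | .mul a b => a.eval l s * b.eval l s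
  | .div a b => a.eval l s / b.eval l s
  | .sqrt a => Real.sqrt (a.eval l s)
  | .sin a => Real.sin (a.eval l s)
  | .cos a => Real.cos (a.eval l s)
  | .arccos a => Real.arccos (a.eval l s)

/-- The number of elementary steps needed to evaluate an expression. -/
def Expr.cost {K H : ℕ} : Expr K H → ℕ
  | .const _ | .cell _ | .read _ _ => 1
  | .add a b | .sub a b | .mul a b | .div a b => a.cost + b.cost + 1
  | .sqrt a | .sin a | .cos a | .arccos a => a.cost + 1

/-- `Exec l p s s' t`: on the input `l`, the program `p`, started in the state `s`, stops in the
state `s'` after `t` elementary steps. -/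
inductive Exec {K H : ℕ} (l : List DirArc) :
    Program K H → State K H → State K H → ℕ → Prop where
  | skip (s) : Exec l .skip s s 1
  | assign (s i e) :
      Exec l (.assign i e) s { s with mem := Function.update s.mem i (e.eval l s) } (e.cost + 1)
  | advance (s h) :
      Exec l (.advance h) s { s with pos := Function.update s.pos h (s.pos h + 1) } 1
  | emit (s x y) :
      Exec l (.emit x y) s { s with out := s.out ++ [⟨x.eval l s, y.eval l s⟩] }
        (x.cost + y.cost + 1)
  | answer (s b) : Exec l (.answer b) s { s with verdict := some b } 1
  | seq {p q s₁ s₂ s₃ t₁ t₂} (h₁ : Exec l p s₁ s₂ t₁) (h₂ : Exec l q s₂ s₃ t₂) :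
      Exec l (.seq p q) s₁ s₃ (t₁ + t₂)
  | ifTrue {a b p q s s' t} (hc : a.eval l s < b.eval l s) (h : Exec l p s s' t) :
      Exec l (.ifLt a b p q) s s' (a.cost + b.cost + 1 + t)
  | ifFalse {a b p q s s' t} (hc : ¬ a.eval l s < b.eval l s) (h : Exec l q s s' t) :
      Exec l (.ifLt a b p q) s s' (a.cost + b.cost + 1 + t)
  | whileTrue {a b p s₁ s₂ s₃ t₁ t₂} (hc : a.eval l s₁ < b.eval l s₁) (h₁ : Exec l p s₁ s₂ t₁)
      (h₂ : Exec l (.whileLt a b p) s₂ s₃ t₂) :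
      Exec l (.whileLt a b p) s₁ s₃ (a.cost + b.cost + 1 + t₁ + t₂)
  | whileFalse {a b p s} (hc : ¬ a.eval l s < b.eval l s) :
      Exec l (.whileLt a b p) s s (a.cost + b.cost + 1)

/-- The initial state: the first two cells hold the angle `ω` and the number of arcs, the other
cells hold `0`, all pointers are at the first arc, nothing has been written. -/
def initial (K H : ℕ) (ω : ℝ) (l : List DirArc) : State K H where
  mem i := if i.val = 0 then ω else if i.val = 1 then l.length else 0
  pos _ := 0
  out := []
  verdict := none

end OmegaCloud

/-! A minimal wedge is governed by the direction `φ` of its left arm: the left arm touches a vertex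
that is extreme for `φ`, the right arm one that is extreme for `φ + (π - ω)`
(`mem_cloudPortion_iff`). Let `φ` decrease through a full turn. While both contacts `a`, `b` stay
fixed, the apex runs clockwise on a circle through `a` and `b`, at twice the angular speed
(inscribed angle theorem, `apex`). At the end of a cloud arc either an arm takes up a new vertex, or
the apex has reached `a` itself; in the second case it rests there while the wedge pivots about this
vertex by at most `ω`, after which the vertex is on the right arm. Two consecutive arcs of the cloud
lie on the same circle only if they are separated by a pivot, and then its angle is exactly `π - ω`
(`Chain.finish_eq_of_center_eq`, `Chain.pivot_angle`). So merging loses no information: the maximal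
cloud, together with the position `τ` of the left contact on the first circle, determines the whole
motion. `Sim.step` computes it event by event.

Soundness. Suppose that the simulation closes up after one round with total rotation `2 π`, that its
local checks hold, and that each right contact is the left contact of the rotation `π - ω` before.
Then the left contacts form a closed walk whose edge directions decrease by one full turn, hence a
convex polygon, and both arms touch this polygon (`Passes.track`, `Track.isConvexPolygon`). Since
contacts are determined by intervals of support directions (`Supp.unique`), the arcs run through are
exactly its cloud (`Track.isCloud`), and grouping them gives back the input
(`Passes.isMaximalCloud`).

Completeness. If the input is the maximal cloud of a polygon, the simulation started from the true
`τ` follows the arcs of the cloud and passes (`Merged.passes`). It remains to guess `τ`. Starting at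
the first or the second input arc, one of three values is right (`Merged.exists_candidate`): the
start is a vertex just left by a pivot; or the left vertex survives the next transition and is the
second intersection of two consecutive circles; or there is no pivot during a turn by `π - ω`, and
then the vertex lies on the line from the start to the apex reached by that turn.

Complexity. Pivots inside one input arc are `2 (π - ω)` apart, after the first one, so the number of
events per arc is bounded in terms of `ω` (`sim_index_le`). The two arms are compared by running two
simulations in parallel and merging their lists of contacts (`lagPath`); the right arm needs less
than two rounds. Each phase of each of the six trials has its own pointers. -/

namespace OmegaCloud
open Complex (I)
open scoped ComplexConjugate

/-! ### Unit vectors and heights -/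

/-- The unit vector with polar angle `φ`. -/
noncomputable def cis (φ : ℝ) : ℂ := Complex.exp (φ * I)

@[simp] theorem cis_re (φ : ℝ) : (cis φ).re = Real.cos φ := Complex.exp_ofReal_mul_I_re φ
@[simp] theorem cis_im (φ : ℝ) : (cis φ).im = Real.sin φ := Complex.exp_ofReal_mul_I_im φ

theorem cis_add (x y : ℝ) : cis (x + y) = cis x * cis y := by
  simp [cis, ← Complex.exp_add, add_mul]

@[simp] theorem cis_zero : cis 0 = 1 := by simp [cis]

theorem conj_cis (x : ℝ) : conj (cis x) = cis (-x) := by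
  apply Complex.ext <;> simp

theorem cis_neg_mul (x : ℝ) : cis (-x) * cis x = 1 := by
  rw [← cis_add]; simp

theorem cis_mul_neg (x : ℝ) : cis x * cis (-x) = 1 := by
  rw [← cis_add]; simp

theorem cis_ne_zero (x : ℝ) : cis x ≠ 0 := Complex.exp_ne_zero _

theorem cis_sub (x y : ℝ) : cis (x - y) = cis x * cis (-y) := by
  rw [sub_eq_add_neg, cis_add]

@[simp] theorem norm_cis (x : ℝ) : ‖cis x‖ = 1 := Complex.norm_exp_ofReal_mul_I x

theorem cis_eq_iff {x y : ℝ} : cis x = cis y ↔ ∃ k : ℤ, x = y + k * (2 * Real.pi) := by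
  unfold cis
  rw [Complex.exp_eq_exp_iff_exists_int]
  refine exists_congr fun k => ?_
  constructor
  · intro h
    have := congrArg Complex.im h
    simpa using this
  · intro h
    rw [h]; push_cast; ring

theorem cis_add_int_mul (x : ℝ) (k : ℤ) : cis (x + k * (2 * Real.pi)) = cis x :=
  cis_eq_iff.2 ⟨k, rfl⟩

theorem cis_add_two_pi (x : ℝ) : cis (x + 2 * Real.pi) = cis x :=
  cis_eq_iff.2 ⟨1, by simp⟩

theorem cis_pi : cis Real.pi = -1 := by apply Complex.ext <;> simp

theorem cis_add_pi (x : ℝ) : cis (x + Real.pi) = -cis x := by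
  rw [cis_add, cis_pi, mul_neg_one]

theorem eq_norm_mul_cis_arg (z : ℂ) : z = ‖z‖ * cis z.arg :=
  (Complex.norm_mul_exp_arg_mul_I z).symm

theorem cis_sub_cis_neg (x : ℝ) : cis x - cis (-x) = 2 * I * Real.sin x := by
  apply Complex.ext
  · simp [-Complex.ofReal_sin]
  · simp [-Complex.ofReal_sin]; ring

/-- The signed distance of `v` from the line through the origin of direction `φ`, positive on
the left. -/
noncomputable def ht (v : ℂ) (φ : ℝ) : ℝ := v.im * Real.cos φ - v.re * Real.sin φ

theorem ht_add (v w : ℂ) (φ : ℝ) : ht (v + w) φ = ht v φ + ht w φ := by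
  simp [ht]; ring

theorem ht_sub (v w : ℂ) (φ : ℝ) : ht (v - w) φ = ht v φ - ht w φ := by
  simp [ht]; ring

theorem ht_real_mul (r : ℝ) (v : ℂ) (φ : ℝ) : ht (r * v) φ = r * ht v φ := by
  simp [ht]; ring

theorem ht_cis (x φ : ℝ) : ht (cis x) φ = Real.sin (x - φ) := by
  simp [ht, Real.sin_sub]

theorem ht_add_pi (v : ℂ) (φ : ℝ) : ht v (φ + Real.pi) = -ht v φ := by
  simp [ht, Real.sin_add_pi, Real.cos_add_pi]; ring

theorem ht_add_int_mul (v : ℂ) (φ : ℝ) (k : ℤ) : ht v (φ + k * (2 * Real.pi)) = ht v φ := by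
  simp [ht, Real.sin_add_int_mul_two_pi, Real.cos_add_int_mul_two_pi]

/-- `ht v` is a sinusoid in the angle, so its values at two angles determine all others; for `x ≤ z
≤ y` with `y - x < π` the coefficients are nonnegative. -/
theorem ht_between (v : ℂ) (x y z : ℝ) :
    Real.sin (y - x) * ht v z = Real.sin (y - z) * ht v x + Real.sin (z - x) * ht v y := by
  simp only [ht, Real.sin_sub]
  have hx := Real.sin_sq_add_cos_sq x
  have hy := Real.sin_sq_add_cos_sq y
  have hz := Real.sin_sq_add_cos_sq z
  ring_nf

/-- Two lines that are not parallel meet in one point only. -/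
theorem ht_ext {v w : ℂ} {x y : ℝ} (hxy : Real.sin (y - x) ≠ 0) (h1 : ht v x = ht w x)
    (h2 : ht v y = ht w y) : v = w := by
  have key : ∀ u : ℂ, ht u x = 0 → ht u y = 0 → u = 0 := by
    intro u h1 h2
    have e1 := ht_between u x y 0
    have e2 := ht_between u x y (Real.pi / 2)
    rw [h1, h2] at e1 e2
    have e1' : ht u 0 = 0 := by
      have : Real.sin (y - x) * ht u 0 = 0 := by rw [e1]; ring
      exact (mul_eq_zero.1 this).resolve_left hxy
    have e2' : ht u (Real.pi / 2) = 0 := by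
      have : Real.sin (y - x) * ht u (Real.pi / 2) = 0 := by rw [e2]; ring
      exact (mul_eq_zero.1 this).resolve_left hxy
    simp [ht] at e1' e2'
    apply Complex.ext <;> simp [e1', e2']
  have := key (v - w) (by rw [ht_sub, h1, sub_self]) (by rw [ht_sub, h2, sub_self])
  exact sub_eq_zero.1 this

/-- A point at the same height lies on the line. -/
theorem exists_eq_add_of_ht_eq {v w : ℂ} {φ : ℝ} (h : ht v φ = ht w φ) :
    ∃ r : ℝ, v = w + r * cis φ := by
  refine ⟨((v - w) * conj (cis φ)).re, ?_⟩
  have hs := Real.sin_sq_add_cos_sq φ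
  simp only [ht] at h
  have h' : (v.im - w.im) * Real.cos φ = (v.re - w.re) * Real.sin φ := by linarith
  apply Complex.ext
  · simp only [Complex.add_re, Complex.mul_re, Complex.ofReal_re, Complex.ofReal_im, cis_re,
      cis_im, Complex.conj_re, Complex.conj_im, Complex.sub_re, Complex.sub_im]
    linear_combination (v.re - w.re) * (-hs) - Real.sin φ * h'
  · simp only [Complex.add_im, Complex.mul_re, Complex.mul_im, Complex.ofReal_re,
      Complex.ofReal_im, cis_re, cis_im, Complex.conj_re, Complex.conj_im, Complex.sub_re,
      Complex.sub_im]
    linear_combination (v.im - w.im) * (-hs) + Real.cos φ * h'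

/-! ### Support -/

/-- `a` has maximal height over `V` in the direction `φ`. -/
def Supp (V : Set ℂ) (a : ℂ) (φ : ℝ) : Prop := ∀ w ∈ V, ht w φ ≤ ht a φ

theorem Supp.add_int {V : Set ℂ} {a : ℂ} {φ : ℝ} (h : Supp V a φ) (k : ℤ) :
    Supp V a (φ + k * (2 * Real.pi)) := by
  intro w hw
  rw [ht_add_int_mul, ht_add_int_mul]; exact h w hw

theorem Supp.between {V : Set ℂ} {a : ℂ} {x y z : ℝ} (hx : Supp V a x) (hy : Supp V a y)
    (hxz : x ≤ z) (hzy : z ≤ y) (hd : y - x < Real.pi) : Supp V a z := by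
  intro w hw
  rcases eq_or_lt_of_le (hxz.trans hzy) with h | h
  · have : z = x := by linarith
    rw [this]; exact hx w hw
  · have hp : 0 < Real.sin (y - x) := Real.sin_pos_of_pos_of_lt_pi (by linarith) hd
    have e1 := ht_between w x y z
    have e2 := ht_between a x y z
    have h1 : 0 ≤ Real.sin (y - z) := Real.sin_nonneg_of_nonneg_of_le_pi (by linarith) (by linarith)
    have h2 : 0 ≤ Real.sin (z - x) := Real.sin_nonneg_of_nonneg_of_le_pi (by linarith) (by linarith)
    have := mul_le_mul_of_nonneg_left (hx w hw) h1
    have := mul_le_mul_of_nonneg_left (hy w hw) h2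
    have : Real.sin (y - x) * ht w z ≤ Real.sin (y - x) * ht a z := by linarith
    exact le_of_mul_le_mul_left this hp

/-- A point extreme in two directions less than a half turn apart is the intersection of two support
lines. Applied to short intervals of directions, this identifies contacts without any genericity
assumption. -/
theorem Supp.unique {V : Set ℂ} {a b : ℂ} {x y : ℝ} (ha : a ∈ V) (hb : b ∈ V)
    (hax : Supp V a x) (hay : Supp V a y) (hbx : Supp V b x) (hby : Supp V b y)
    (hxy : x < y) (hd : y - x < Real.pi) : a = b :=
  ht_ext (Real.sin_pos_of_pos_of_lt_pi (by linarith) hd).ne'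
    (le_antisymm (hbx a ha) (hax b hb)) (le_antisymm (hby a ha) (hay b hb))

/-! ### Wedges as intersections of half planes -/

theorem exists_polar (z q : ℂ) : ∃ r φ : ℝ, 0 ≤ r ∧ z = q + r * cis φ :=
  ⟨‖z - q‖, (z - q).arg, norm_nonneg _, by rw [← eq_norm_mul_cis_arg]; ring⟩

/-- Because `ω < π`, the wedge is the intersection of the half planes bounded by the lines of its
arms. -/
theorem mem_wedge_iff {ω : ℝ} (h0 : 0 < ω) (hπ : ω < Real.pi) (q z : ℂ) (θ : ℝ) :
    z ∈ wedge ω q θ ↔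
      ht z (θ + ω / 2) ≤ ht q (θ + ω / 2) ∧ ht q (θ - ω / 2) ≤ ht z (θ - ω / 2) := by
  constructor
  · rintro ⟨φ, h1, h2, r, hr, rfl⟩
    change ht (q + r * cis φ) _ ≤ _ ∧ _ ≤ ht (q + r * cis φ) _
    rw [ht_add, ht_add, ht_real_mul, ht_real_mul, ht_cis, ht_cis]
    have e1 : Real.sin (φ - (θ + ω / 2)) ≤ 0 :=
      Real.sin_nonpos_of_nonpos_of_neg_pi_le (by linarith) (by linarith)
    have e2 : 0 ≤ Real.sin (φ - (θ - ω / 2)) :=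
      Real.sin_nonneg_of_nonneg_of_le_pi (by linarith) (by linarith)
    constructor
    · nlinarith
    · nlinarith
  · rintro ⟨h1, h2⟩
    obtain ⟨r, ψ, hr, hz⟩ := exists_polar z q
    -- The polar angle is measured from the bisector and taken in `(-π, π]`, so that the signs of
    -- the two sines locate it.
    obtain ⟨φ, hφ1, hφ2, hφ⟩ : ∃ φ : ℝ, -Real.pi < φ ∧ φ ≤ Real.pi ∧ z = q + r * cis (θ + φ) := by
      refine ⟨toIocMod Real.two_pi_pos (-Real.pi) (ψ - θ), ?_, ?_, ?_⟩
      · exact left_lt_toIocMod _ _ _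
      · have := toIocMod_le_right Real.two_pi_pos (-Real.pi) (ψ - θ); linarith
      · rw [hz]; congr 2
        rw [cis_eq_iff]
        refine ⟨toIocDiv Real.two_pi_pos (-Real.pi) (ψ - θ), ?_⟩
        have := toIocMod_add_toIocDiv_zsmul Real.two_pi_pos (-Real.pi) (ψ - θ)
        rw [zsmul_eq_mul] at this
        linarith
    rcases hr.eq_or_lt with h | hr
    · exact ⟨θ, by linarith, by linarith, 0, le_rfl, by rw [hφ, ← h]; simp⟩
    · rw [hφ, ht_add, ht_real_mul, ht_cis] at h1 h2
      have h1' : Real.sin (φ - ω / 2) ≤ 0 := by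
        have e : θ + φ - (θ + ω / 2) = φ - ω / 2 := by ring
        rw [e] at h1
        by_contra hc
        have := mul_pos hr (not_le.1 hc); linarith
      have h2' : 0 ≤ Real.sin (φ + ω / 2) := by
        have e : θ + φ - (θ - ω / 2) = φ + ω / 2 := by ring
        rw [e] at h2
        by_contra hc
        have := mul_neg_of_pos_of_neg hr (not_le.1 hc); linarith
      refine ⟨θ + φ, ?_, ?_, r, hr.le, hφ⟩
      · by_contra hc
        have := Real.sin_neg_of_neg_of_neg_pi_lt (x := φ + ω / 2) (by linarith) (by linarith)
        linarith
      · by_contra hc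
        have := Real.sin_pos_of_pos_of_lt_pi (x := φ - ω / 2) (by linarith) (by linarith)
        linarith

theorem ht_eq_of_mem_ray {q z : ℂ} {φ : ℝ} (h : z ∈ ray q φ) : ht z φ = ht q φ := by
  obtain ⟨r, -, rfl⟩ := h
  change ht (q + r * cis φ) φ = _
  rw [ht_add, ht_real_mul, ht_cis]; simp

/-- The minimal wedge whose left arm has direction `φ` and touches `V` in `a`, whose right arm
touches `V` in `b`, and whose apex is `q`. -/
structure IsTouch (ω : ℝ) (V : Set ℂ) (a b : ℂ) (φ : ℝ) (q : ℂ) : Prop where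
  ma : a ∈ V
  mb : b ∈ V
  sa : Supp V a φ
  sb : Supp V b (φ + (Real.pi - ω))
  qa : ht q φ = ht a φ
  qb : ht q (φ + (Real.pi - ω)) = ht b (φ + (Real.pi - ω))

/-! ### Minimal wedges described by support directions -/

section
variable {ω : ℝ} {V : Set ℂ} {a b q : ℂ} {φ : ℝ}

/-- The contact is on the line of the left arm by `qa`; the support line of the right arm leaves
only the half of it in front of the apex. -/
theorem IsTouch.left_eq (h0 : 0 < ω) (hπ : ω < Real.pi) (h : IsTouch ω V a b φ q) :
    ∃ r : ℝ, 0 ≤ r ∧ a = q + r * cis φ := by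
  obtain ⟨r, hr⟩ := exists_eq_add_of_ht_eq h.qa.symm
  refine ⟨r, ?_, hr⟩
  have := h.sb a h.ma
  rw [← h.qb, hr, ht_add, ht_real_mul, ht_cis] at this
  have e : Real.sin (φ - (φ + (Real.pi - ω))) < 0 :=
    Real.sin_neg_of_neg_of_neg_pi_lt (by linarith) (by linarith)
  by_contra hc
  have := mul_pos_of_neg_of_neg (not_le.1 hc) e
  linarith

theorem IsTouch.right_eq (h0 : 0 < ω) (hπ : ω < Real.pi) (h : IsTouch ω V a b φ q) :
    ∃ r : ℝ, 0 ≤ r ∧ b = q - r * cis (φ + (Real.pi - ω)) := by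
  obtain ⟨r, hr⟩ := exists_eq_add_of_ht_eq h.qb.symm
  refine ⟨-r, ?_, by rw [hr]; push_cast; ring⟩
  have := h.sa b h.mb
  rw [← h.qa, hr, ht_add, ht_real_mul, ht_cis] at this
  have e : 0 < Real.sin (φ + (Real.pi - ω) - φ) :=
    Real.sin_pos_of_pos_of_lt_pi (by linarith) (by linarith)
  by_contra hc
  have := mul_pos (a := r) (by linarith) e
  linarith

theorem ht_mem_convexHull_le {a z : ℂ} (h : Supp V a φ) (hz : z ∈ convexHull ℝ V) :
    ht z φ ≤ ht a φ := by
  have hc : Convex ℝ {z : ℂ | ht z φ ≤ ht a φ} := by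
    have hl : IsLinearMap ℝ (fun z : ℂ => ht z φ) :=
      ⟨fun x y => ht_add x y φ, fun c x => by
        rw [Complex.real_smul, ht_real_mul, smul_eq_mul]⟩
    exact convex_halfSpace_le hl _
  exact convexHull_min (s := V) (fun w hw => h w hw) hc hz

/-- The right arm has direction `φ - ω`. Traversed towards the apex it has direction `φ + (π - ω)`,
and then the polygon lies to the right of it, as for the left arm; so both contacts are maxima of a
height. -/
theorem mem_cloudPortion_iff (h0 : 0 < ω) (hπ : ω < Real.pi) {vs : List ℂ} {a b : ℂ}
    (ha : a ∈ vs) (hb : b ∈ vs) (q : ℂ) :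
    q ∈ cloudPortion ω vs a b ↔ ∃ φ : ℝ, IsTouch ω {v | v ∈ vs} a b φ q := by
  have sub : ∀ v ∈ vs, v ∈ polygon vs := fun v hv => subset_convexHull ℝ _ hv
  have flip : ∀ (v : ℂ) (θ : ℝ),
      ht v (θ + ω / 2 + (Real.pi - ω)) = -ht v (θ - ω / 2) := by
    intro v θ
    rw [← ht_add_pi]; congr 1; ring
  constructor
  · rintro ⟨θ, ⟨hP, -, -⟩, hla, hrb⟩
    have e1 := ht_eq_of_mem_ray hla
    have e2 := ht_eq_of_mem_ray hrb
    refine ⟨θ + ω / 2, ha, hb, ?_, ?_, e1.symm, ?_⟩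
    · intro w hw
      rw [e1]
      exact ((mem_wedge_iff h0 hπ _ _ _).1 (hP (sub w hw))).1
    · intro w hw
      rw [flip, flip, e2]
      exact neg_le_neg ((mem_wedge_iff h0 hπ _ _ _).1 (hP (sub w hw))).2
    · rw [flip, flip, e2]
  · rintro ⟨φ, h⟩
    have eφ : φ - ω / 2 + ω / 2 = φ := by ring
    have hla : a ∈ leftArm ω q (φ - ω / 2) := by
      obtain ⟨r, hr, e⟩ := h.left_eq h0 hπ
      refine ⟨r, hr, ?_⟩
      rw [eφ]; exact e
    have hrb : b ∈ rightArm ω q (φ - ω / 2) := by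
      obtain ⟨r, hr, e⟩ := h.right_eq h0 hπ
      refine ⟨r, hr, ?_⟩
      have : φ + (Real.pi - ω) = (φ - ω / 2 - ω / 2) + Real.pi := by ring
      rw [e, this, cis_add_pi, sub_eq_add_neg, mul_neg, neg_neg]; rfl
    refine ⟨φ - ω / 2, ⟨?_, ⟨a, hla, sub a ha⟩, ⟨b, hrb, sub b hb⟩⟩, hla, hrb⟩
    intro z hz
    rw [mem_wedge_iff h0 hπ, eφ]
    constructor
    · rw [h.qa]; exact ht_mem_convexHull_le h.sa hz
    · have := ht_mem_convexHull_le h.sb hz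
      rw [← h.qb] at this
      have f1 := flip z (φ - ω / 2)
      have f2 := flip q (φ - ω / 2)
      rw [eφ] at f1 f2
      linarith

theorem eq_int_mul_pi {x : ℝ} (h : Real.sin x = 0) : ∃ n : ℤ, x = n * Real.pi := by
  obtain ⟨n, hn⟩ := Real.sin_eq_zero_iff.1 h; exact ⟨n, hn.symm⟩

/-- The contact `a` differs from the apex and lies in the second wedge, so the direction `φ` points
into that wedge. -/
theorem IsTouch.sin_sub_nonpos (h0 : 0 < ω) (hπ : ω < Real.pi) {a' b' : ℂ} {ψ : ℝ}
    (h : IsTouch ω V a b φ q) (h' : IsTouch ω V a' b' ψ q) (hq : q ≠ a) :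
    Real.sin (φ - ψ) ≤ 0 ∧ Real.sin (φ - ψ - (Real.pi - ω)) ≤ 0 := by
  obtain ⟨r, hr, e⟩ := h.left_eq h0 hπ
  have hr : 0 < r := lt_of_le_of_ne hr (by rintro rfl; apply hq; simp [e])
  have e1 := h'.sa a h.ma
  have e2 := h'.sb a h.ma
  rw [← h'.qa, e, ht_add, ht_real_mul, ht_cis] at e1
  rw [← h'.qb, e, ht_add, ht_real_mul, ht_cis] at e2
  have e3 : φ - ψ - (Real.pi - ω) = φ - (ψ + (Real.pi - ω)) := by ring
  rw [e3]
  constructor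
  · by_contra hc
    have := mul_pos hr (not_le.1 hc); linarith
  · by_contra hc
    have := mul_pos hr (not_le.1 hc); linarith

/-- The left arm of each wedge points into the other one, which makes the two arms parallel;
opposite directions are excluded by `0 < ω`. If the apex were a left contact, the wedge might be
free to turn about it. -/
theorem IsTouch.angle_unique (h0 : 0 < ω) (hπ : ω < Real.pi) {a' b' : ℂ} {ψ : ℝ}
    (h : IsTouch ω V a b φ q) (h' : IsTouch ω V a' b' ψ q) (hq : q ≠ a) (hq' : q ≠ a') :
    ∃ k : ℤ, ψ = φ + k * (2 * Real.pi) := by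
  obtain ⟨h1, -⟩ := h.sin_sub_nonpos h0 hπ h' hq
  obtain ⟨h3, h4⟩ := h'.sin_sub_nonpos h0 hπ h hq'
  have e : Real.sin (ψ - φ) = 0 := by
    have : Real.sin (φ - ψ) = -Real.sin (ψ - φ) := by rw [← Real.sin_neg]; congr 1; ring
    linarith
  obtain ⟨n, hn⟩ := eq_int_mul_pi e
  rcases Int.even_or_odd' n with ⟨k, hk | hk⟩
  · exact ⟨k, by rw [hk] at hn; push_cast at hn; linarith⟩
  · exfalso
    rw [hn, hk] at h4
    have : ((2 * k + 1 : ℤ) : ℝ) * Real.pi - (Real.pi - ω) = ω + k * (2 * Real.pi) := by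
      push_cast; ring
    rw [this, Real.sin_add_int_mul_two_pi] at h4
    have := Real.sin_pos_of_pos_of_lt_pi h0 hπ
    linarith

/-- If the apex is a point of `V` and `a` still supports at a slightly larger angle, then `a` is
the apex. -/
theorem IsTouch.eq_left_of_mem (h0 : 0 < ω) (hπ : ω < Real.pi) (h : IsTouch ω V a b φ q)
    (hq : q ∈ V) {x : ℝ} (hx : Supp V a x) (h1 : φ < x) (h2 : x - φ < Real.pi) : a = q := by
  obtain ⟨r, hr, e⟩ := h.left_eq h0 hπ
  by_contra hne
  have hr : 0 < r := lt_of_le_of_ne hr (by rintro rfl; apply hne; simp [e])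
  have := hx q hq
  rw [e, ht_add, ht_real_mul, ht_cis] at this
  have hs : Real.sin (φ - x) < 0 := Real.sin_neg_of_neg_of_neg_pi_lt (by linarith) (by linarith)
  have := mul_neg_of_pos_of_neg hr hs
  linarith

/-- Mirror image of `IsTouch.eq_left_of_mem`: here the right contact persists at a smaller
direction. -/
theorem IsTouch.eq_right_of_mem (h0 : 0 < ω) (hπ : ω < Real.pi) (h : IsTouch ω V a b φ q)
    (hq : q ∈ V) {x : ℝ} (hx : Supp V b (x + (Real.pi - ω))) (h1 : x < φ)
    (h2 : φ - x < Real.pi) : b = q := by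
  obtain ⟨r, hr, e⟩ := h.right_eq h0 hπ
  by_contra hne
  have hr : 0 < r := lt_of_le_of_ne hr (by rintro rfl; apply hne; simp [e])
  have := hx q hq
  rw [e, ht_sub, ht_real_mul, ht_cis] at this
  have hs : 0 < Real.sin (φ + (Real.pi - ω) - (x + (Real.pi - ω))) :=
    Real.sin_pos_of_pos_of_lt_pi (by linarith) (by linarith)
  have := mul_pos hr hs
  linarith

/-! ### The apex -/

/-- The centre of the circle on which the apices of the wedges with the arms through `a` and `b`
lie. -/
noncomputable def ctr (ω : ℝ) (a b : ℂ) : ℂ :=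
  (b * cis ω - a * cis (-ω)) / (2 * I * Real.sin ω)

/-- The apex of the wedge with left arm of direction `φ` through `a` and right arm through `b`. -/
noncomputable def apex (ω : ℝ) (a b : ℂ) (φ : ℝ) : ℂ :=
  ctr ω a b - conj (a - ctr ω a b) * cis (2 * φ)

theorem ctr_of_rotation (h0 : 0 < ω) (hπ : ω < Real.pi) (c X : ℂ) :
    ctr ω (c + X) (c + X * cis (2 * (Real.pi - ω))) = c := by
  have hs : (Real.sin ω : ℂ) ≠ 0 := by
    exact_mod_cast (Real.sin_pos_of_pos_of_lt_pi h0 hπ).ne'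
  have e1 : cis (2 * (Real.pi - ω)) * cis ω = cis (-ω) := by
    rw [← cis_add, ← cis_add_two_pi (-ω)]; congr 1; ring
  have e2 := cis_sub_cis_neg ω
  unfold ctr
  rw [div_eq_iff (by simpa using hs), ← e2]
  linear_combination X * e1

/-- The inscribed angle theorem: a chord seen under the angle `ω` spans the central angle `2 ω`, and
`-2 ω` equals `2 (π - ω)` modulo a full turn. `ctr` is the solution of this equation for the centre.
-/
theorem rotation_of_ctr (h0 : 0 < ω) (hπ : ω < Real.pi) (a b : ℂ) :
    b = ctr ω a b + (a - ctr ω a b) * cis (2 * (Real.pi - ω)) := by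
  have hs : (Real.sin ω : ℂ) ≠ 0 := by
    exact_mod_cast (Real.sin_pos_of_pos_of_lt_pi h0 hπ).ne'
  have e1 : cis (2 * (Real.pi - ω)) = cis (-ω) * cis (-ω) := by
    rw [← cis_add, ← cis_add_two_pi (-ω + -ω)]; congr 1; ring
  have e2 := cis_sub_cis_neg ω
  have e3 : ctr ω a b * (cis ω - cis (-ω)) = b * cis ω - a * cis (-ω) := by
    rw [ctr, e2, div_mul_cancel₀]; simpa using hs
  have e4 := cis_mul_neg ω
  have key : cis ω * b =
      cis ω * (ctr ω a b + (a - ctr ω a b) * cis (2 * (Real.pi - ω))) := by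
    rw [e1]
    linear_combination (-1 : ℂ) * e3 - (a - ctr ω a b) * cis (-ω) * e4
  exact mul_left_cancel₀ (cis_ne_zero ω) key

/-- On the circle about `c`, the chord of direction `x` from `c + X` ends at `c - conj X * cis (2 *
x)`. By `rotation_of_ctr` the chords from `a` and from `b`, in their respective directions, have the
same second end. -/
theorem ht_apex (h0 : 0 < ω) (hπ : ω < Real.pi) (a b : ℂ) (φ : ℝ) :
    ht (apex ω a b φ) φ = ht a φ ∧
      ht (apex ω a b φ) (φ + (Real.pi - ω)) = ht b (φ + (Real.pi - ω)) := by
  have key : ∀ (c X : ℂ) (x : ℝ), ht (c - conj X * cis (2 * x)) x = ht (c + X) x := by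
    intro c X x
    simp only [ht, Complex.sub_im, Complex.mul_im, Complex.add_im, Complex.sub_re, Complex.mul_re,
      Complex.add_re, Complex.conj_re, Complex.conj_im, cis_re, cis_im, Real.cos_two_mul,
      Real.sin_two_mul]
    have hs := Real.sin_sq_add_cos_sq x
    linear_combination (2 * X.im * Real.cos x) * hs
  constructor
  · have := key (ctr ω a b) (a - ctr ω a b) φ
    rw [add_sub_cancel] at this
    exact this
  · have := key (ctr ω a b) ((a - ctr ω a b) * cis (2 * (Real.pi - ω))) (φ + (Real.pi - ω))
    rw [← rotation_of_ctr h0 hπ a b, map_mul, conj_cis, mul_assoc, ← cis_add] at this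
    rw [← this, apex]; congr 4; ring

theorem eq_apex (h0 : 0 < ω) (hπ : ω < Real.pi) (ha : ht q φ = ht a φ)
    (hb : ht q (φ + (Real.pi - ω)) = ht b (φ + (Real.pi - ω))) : q = apex ω a b φ := by
  obtain ⟨e1, e2⟩ := ht_apex h0 hπ a b φ
  refine ht_ext (x := φ) (y := φ + (Real.pi - ω)) ?_ (ha.trans e1.symm) (hb.trans e2.symm)
  exact (Real.sin_pos_of_pos_of_lt_pi (by linarith) (by linarith)).ne'

theorem IsTouch.eq_apex (h0 : 0 < ω) (hπ : ω < Real.pi) (h : IsTouch ω V a b φ q) :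
    q = apex ω a b φ := OmegaCloud.eq_apex h0 hπ h.qa h.qb

theorem isTouch_apex (h0 : 0 < ω) (hπ : ω < Real.pi) (ma : a ∈ V) (mb : b ∈ V)
    (sa : Supp V a φ) (sb : Supp V b (φ + (Real.pi - ω))) :
    IsTouch ω V a b φ (apex ω a b φ) :=
  ⟨ma, mb, sa, sb, (ht_apex h0 hπ a b φ).1, (ht_apex h0 hπ a b φ).2⟩

theorem IsTouch.add_int (h : IsTouch ω V a b φ q) (k : ℤ) :
    IsTouch ω V a b (φ + k * (2 * Real.pi)) q := by
  refine ⟨h.ma, h.mb, h.sa.add_int k, ?_, ?_, ?_⟩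
  · have := h.sb.add_int k
    rwa [add_right_comm] at this
  · rw [ht_add_int_mul, ht_add_int_mul]; exact h.qa
  · rw [add_right_comm, ht_add_int_mul, ht_add_int_mul]; exact h.qb

theorem apex_self (h0 : 0 < ω) (hπ : ω < Real.pi) (a : ℂ) (φ : ℝ) : apex ω a a φ = a :=
  (OmegaCloud.eq_apex h0 hπ rfl rfl).symm

theorem ctr_ne_left (h0 : 0 < ω) (hπ : ω < Real.pi) (hab : a ≠ b) : a - ctr ω a b ≠ 0 := by
  intro h
  apply hab
  rw [rotation_of_ctr h0 hπ a b, h, zero_mul, add_zero]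
  exact sub_eq_zero.1 h

end
end OmegaCloud

namespace OmegaCloud
open Complex (I)
open scoped ComplexConjugate

/-! ### Angles between vectors -/

/-- The clockwise angle in `(0, 2π)` from `z` to `w`, for two vectors of different directions. -/
noncomputable def cwAngle (z w : ℂ) : ℝ :=
  2 * Real.arccos (-((w * conj z).im / Real.sqrt ((w * conj z).im * (w * conj z).im)) *
    Real.sqrt ((1 + (w * conj z).re /
      Real.sqrt ((w * conj z).re * (w * conj z).re + (w * conj z).im * (w * conj z).im)) / 2))

/-- The unsigned angle in `[0, π]` between `z` and `w`. -/
noncomputable def unAngle (z w : ℂ) : ℝ :=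
  Real.arccos ((w * conj z).re /
    Real.sqrt ((w * conj z).re * (w * conj z).re + (w * conj z).im * (w * conj z).im))

theorem cwAngle_nonneg (z w : ℂ) : 0 ≤ cwAngle z w :=
  mul_nonneg zero_le_two (Real.arccos_nonneg _)

theorem cwAngle_le (z w : ℂ) : cwAngle z w ≤ 2 * Real.pi :=
  mul_le_mul_of_nonneg_left (Real.arccos_le_pi _) zero_le_two

theorem sqrt_normSq (p : ℂ) : Real.sqrt (p.re * p.re + p.im * p.im) = ‖p‖ := by
  rw [Complex.norm_def, Complex.normSq_apply]

theorem mul_conj_rotate (z : ℂ) (r θ : ℝ) :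
    r * (z * cis θ) * conj z = ((r * Complex.normSq z : ℝ) : ℂ) * cis θ := by
  push_cast
  rw [Complex.normSq_eq_conj_mul_self]; ring

theorem cwAngle_eq {z w : ℂ} {r θ : ℝ} (hz : z ≠ 0) (hr : 0 < r) (h : w = r * (z * cis (-θ)))
    (h0 : 0 < θ) (h2 : θ < 2 * Real.pi) : cwAngle z w = θ := by
  have hp : w * conj z = ((r * Complex.normSq z : ℝ) : ℂ) * cis (-θ) := by
    rw [h, mul_conj_rotate]
  have hm : 0 < r * Complex.normSq z := mul_pos hr (Complex.normSq_pos.2 hz)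
  unfold cwAngle
  rw [sqrt_normSq, hp]
  generalize r * Complex.normSq z = m at *
  have e1 : ‖(m : ℂ) * cis (-θ)‖ = m := by
    rw [norm_mul, norm_cis, mul_one, Complex.norm_real, Real.norm_of_nonneg hm.le]
  rw [e1, Complex.re_ofReal_mul, Complex.im_ofReal_mul, cis_re, cis_im, Real.cos_neg, Real.sin_neg,
    Real.sqrt_mul_self_eq_abs, mul_div_cancel_left₀ _ hm.ne']
  have e2 : (1 + Real.cos θ) / 2 = Real.cos (θ / 2) ^ 2 := by
    rw [Real.cos_sq]; ring_nf
  rw [e2, Real.sqrt_sq_eq_abs]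
  -- The quotient is the sign of `sin θ`, which for `0 < θ < 2 π` is the sign of `cos (θ / 2)`.
  have e3 : -(m * -Real.sin θ / |m * -Real.sin θ|) * |Real.cos (θ / 2)| = Real.cos (θ / 2) := by
    rcases lt_trichotomy θ Real.pi with hθ | hθ | hθ
    · have hs : 0 < Real.sin θ := Real.sin_pos_of_pos_of_lt_pi h0 hθ
      have hc : 0 < Real.cos (θ / 2) :=
        Real.cos_pos_of_mem_Ioo ⟨by linarith, by linarith⟩
      have : m * -Real.sin θ < 0 := by nlinarith
      rw [abs_of_neg this, abs_of_pos hc, div_neg, div_self this.ne]; ring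
    -- At `θ = π` the sign is `0 / 0 = 0`, in agreement with `cos (π / 2) = 0`.
    · rw [hθ]; simp
    · have hs : Real.sin θ < 0 := by
        have := Real.sin_pos_of_pos_of_lt_pi (x := θ - Real.pi) (by linarith) (by linarith)
        rw [Real.sin_sub_pi] at this; linarith
      have hc : Real.cos (θ / 2) < 0 :=
        Real.cos_neg_of_pi_div_two_lt_of_lt (by linarith) (by linarith)
      have : 0 < m * -Real.sin θ := by nlinarith
      rw [abs_of_pos this, abs_of_neg hc, div_self this.ne']; ring
  rw [e3, Real.arccos_cos (by linarith) (by linarith)]; ring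

theorem exists_cw {z : ℂ} (hz : z ≠ 0) (w : ℂ) :
    ∃ θ : ℝ, 0 ≤ θ ∧ θ < 2 * Real.pi ∧ w = (‖w‖ / ‖z‖ : ℝ) * (z * cis (-θ)) := by
  refine ⟨toIcoMod Real.two_pi_pos 0 (z.arg - w.arg), left_le_toIcoMod _ _ _, ?_, ?_⟩
  · simpa using toIcoMod_lt_right Real.two_pi_pos 0 (z.arg - w.arg)
  · have : cis (-toIcoMod Real.two_pi_pos 0 (z.arg - w.arg)) = cis (w.arg - z.arg) := by
      rw [cis_eq_iff]
      refine ⟨toIcoDiv Real.two_pi_pos 0 (z.arg - w.arg), ?_⟩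
      have := toIcoMod_add_toIcoDiv_zsmul Real.two_pi_pos 0 (z.arg - w.arg)
      rw [zsmul_eq_mul] at this
      linarith
    rw [this, cis_sub]
    have hz' : ‖z‖ ≠ 0 := norm_ne_zero_iff.2 hz
    have hz'' : (‖z‖ : ℂ) ≠ 0 := by exact_mod_cast hz'
    have e := cis_mul_neg z.arg
    calc w = ‖w‖ * cis w.arg := eq_norm_mul_cis_arg w
      _ = (‖w‖ / ‖z‖) * ((‖z‖ * cis z.arg) * (cis w.arg * cis (-z.arg))) := by
        field_simp
        linear_combination (-‖w‖ * cis w.arg) * e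
      _ = _ := by rw [← eq_norm_mul_cis_arg z]; push_cast; ring

theorem cwAngle_spec {z w : ℂ} (hz : z ≠ 0) (hn : ‖z‖ = ‖w‖) (hne : z ≠ w) :
    0 < cwAngle z w ∧ cwAngle z w < 2 * Real.pi ∧ w = z * cis (-cwAngle z w) := by
  obtain ⟨θ, h0, h2, h⟩ := exists_cw hz w
  rw [← hn, div_self (norm_ne_zero_iff.2 hz)] at h
  have h0 : 0 < θ := lt_of_le_of_ne h0 (by rintro rfl; apply hne; simp [h])
  have := cwAngle_eq hz one_pos h h0 h2
  rw [this]
  exact ⟨h0, h2, by simpa using h⟩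

theorem unAngle_eq {z w : ℂ} {r θ : ℝ} (hz : z ≠ 0) (hr : 0 < r) (h : w = r * (z * cis (-θ)))
    (h0 : 0 ≤ θ) (h2 : θ ≤ Real.pi) : unAngle z w = θ ∧ (w * conj z).im ≤ 0 := by
  have hp : w * conj z = ((r * Complex.normSq z : ℝ) : ℂ) * cis (-θ) := by
    rw [h, mul_conj_rotate]
  have hm : 0 < r * Complex.normSq z := mul_pos hr (Complex.normSq_pos.2 hz)
  unfold unAngle
  rw [sqrt_normSq, hp]
  generalize r * Complex.normSq z = m at *
  have e1 : ‖(m : ℂ) * cis (-θ)‖ = m := by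
    rw [norm_mul, norm_cis, mul_one, Complex.norm_real, Real.norm_of_nonneg hm.le]
  rw [e1, Complex.re_ofReal_mul, Complex.im_ofReal_mul, cis_re, cis_im, Real.cos_neg, Real.sin_neg,
    mul_div_cancel_left₀ _ hm.ne', Real.arccos_cos h0 h2]
  refine ⟨rfl, ?_⟩
  have := mul_nonneg hm.le (Real.sin_nonneg_of_nonneg_of_le_pi h0 h2)
  linarith

theorem unAngle_spec {z w : ℂ} (hz : z ≠ 0) (hw : w ≠ 0) (him : (w * conj z).im ≤ 0) :
    0 ≤ unAngle z w ∧ w = (‖w‖ / ‖z‖ : ℝ) * (z * cis (-unAngle z w)) := by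
  obtain ⟨θ, h0, h2, h⟩ := exists_cw hz w
  have hr : 0 < ‖w‖ / ‖z‖ := div_pos (norm_pos_iff.2 hw) (norm_pos_iff.2 hz)
  have hπ : θ ≤ Real.pi := by
    by_contra hc
    rw [h, mul_conj_rotate, Complex.im_ofReal_mul, cis_im, Real.sin_neg] at him
    have hs : Real.sin θ < 0 := by
      have := Real.sin_pos_of_pos_of_lt_pi (x := θ - Real.pi) (by linarith) (by linarith)
      rw [Real.sin_sub_pi] at this; linarith
    have hm : 0 < ‖w‖ / ‖z‖ * Complex.normSq z := mul_pos hr (Complex.normSq_pos.2 hz)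
    nlinarith
  rw [(unAngle_eq hz hr h h0 hπ).1]
  exact ⟨h0, h⟩

/-! ### Directed arcs -/

/-- The angular measure of a clockwise arc. -/
noncomputable def DirArc.meas (A : DirArc) : ℝ :=
  cwAngle (A.start - A.center) (A.finish - A.center)

/-- The point reached from the start of a clockwise arc after an angle `x`. -/
noncomputable def DirArc.pt (A : DirArc) (x : ℝ) : ℂ :=
  A.center + (A.start - A.center) * cis (-x)

namespace DirArc
variable {A : DirArc}

theorem Valid.start_sub_ne (h : A.Valid) : A.start - A.center ≠ 0 := by
  intro h0
  apply h.1
  have h2 := h.2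
  rw [dist_eq_norm, dist_eq_norm, h0, norm_zero, eq_comm, norm_eq_zero] at h2
  rw [sub_eq_zero.1 h0, sub_eq_zero.1 h2]

theorem Valid.norm_eq (h : A.Valid) : ‖A.start - A.center‖ = ‖A.finish - A.center‖ := by
  rw [← dist_eq_norm, ← dist_eq_norm]; exact h.2

theorem Valid.finish_sub_ne (h : A.Valid) : A.finish - A.center ≠ 0 := by
  rw [← norm_ne_zero_iff, ← h.norm_eq]; exact norm_ne_zero_iff.2 h.start_sub_ne

theorem Valid.meas_spec (h : A.Valid) :
    0 < A.meas ∧ A.meas < 2 * Real.pi ∧ A.finish = A.pt A.meas := by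
  obtain ⟨h1, h2, h3⟩ := cwAngle_spec h.start_sub_ne h.norm_eq
    (fun hc => h.1 (sub_left_injective hc))
  refine ⟨h1, h2, ?_⟩
  rw [pt]; unfold meas; rw [← h3]; ring

theorem pt_zero : A.pt 0 = A.start := by simp [pt]

theorem turn_eq_pt (hc : A.clockwise = true) (s : ℝ) : A.turn s A.start = A.pt s := by
  simp [turn, pt, hc, cis]

theorem pt_inj (h : A.Valid) {x y : ℝ} (hxy : A.pt x = A.pt y) :
    ∃ k : ℤ, x = y + k * (2 * Real.pi) := by
  unfold pt at hxy
  have := mul_left_cancel₀ h.start_sub_ne (add_left_cancel hxy)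
  obtain ⟨k, hk⟩ := cis_eq_iff.1 this
  exact ⟨-k, by push_cast; linarith⟩

theorem eq_of_int_mul {x y : ℝ} {k : ℤ} (h : x = y + k * (2 * Real.pi)) (h1 : -(2 * Real.pi) < x - y)
    (h2 : x - y < 2 * Real.pi) : x = y := by
  have e : x - y = k * (2 * Real.pi) := by linarith
  rw [e] at h1 h2
  have hp := Real.two_pi_pos
  have h1' : (-1 : ℝ) < k := by
    by_contra hc
    have := mul_le_mul_of_nonneg_right (not_lt.1 hc) hp.le
    linarith
  have h2' : (k : ℝ) < 1 := by
    by_contra hc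
    have := mul_le_mul_of_nonneg_right (not_lt.1 hc) hp.le
    linarith
  have h1'' : (-1 : ℤ) < k := by exact_mod_cast h1'
  have h2'' : k < (1 : ℤ) := by exact_mod_cast h2'
  have : k = 0 := by omega
  rw [this] at h; simpa using h

theorem pt_inj' (h : A.Valid) {x y : ℝ} (hxy : A.pt x = A.pt y) (h1 : -(2 * Real.pi) < x - y)
    (h2 : x - y < 2 * Real.pi) : x = y := by
  obtain ⟨k, hk⟩ := pt_inj h hxy
  exact eq_of_int_mul hk h1 h2

theorem carrier_eq (h : A.Valid) (hc : A.clockwise = true) :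
    A.carrier = {z | ∃ x : ℝ, 0 ≤ x ∧ x ≤ A.meas ∧ z = A.pt x} := by
  obtain ⟨h1, h2, h3⟩ := h.meas_spec
  ext z
  constructor
  · rintro ⟨s, t, hs, hst, ht, hf, hz⟩
    rw [turn_eq_pt hc] at hf hz
    have := pt_inj' h (hf.symm.trans h3) (by linarith) (by linarith)
    exact ⟨s, hs, by linarith, hz⟩
  · rintro ⟨x, hx0, hx, hz⟩
    exact ⟨x, A.meas, hx0, hx, h2, by rw [turn_eq_pt hc]; exact h3, by rw [turn_eq_pt hc]; exact hz⟩

end DirArc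

/-- A sinusoid with the same value at `0`, `h` and `2 h` has no oscillating part. -/
theorem cos_sin_eq_zero {P Q h : ℝ} (h0 : 0 < h) (hπ : h < Real.pi)
    (h1 : P * Real.cos h + Q * Real.sin h = P)
    (h2 : P * Real.cos (2 * h) + Q * Real.sin (2 * h) = P) : P = 0 ∧ Q = 0 := by
  have hs : 0 < Real.sin h := Real.sin_pos_of_pos_of_lt_pi h0 hπ
  have hc : Real.cos h < 1 := by
    have := Real.cos_lt_cos_of_nonneg_of_le_pi le_rfl hπ.le h0
    simpa using this
  have e := Real.sin_sq_add_cos_sq h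
  rw [Real.cos_two_mul, Real.sin_two_mul] at h2
  have e1 : Real.sin h * (Q * Real.cos h - P * Real.sin h) = 0 := by
    linear_combination (1 / 2) * h2 - P * e
  have e2 : Q * Real.cos h = P * Real.sin h := by
    have := (mul_eq_zero.1 e1).resolve_left hs.ne'
    linarith
  have e3 : P * (1 - Real.cos h) = 0 := by
    linear_combination Real.cos h * h1 - Real.sin h * e2 - P * e
  have hP : P = 0 := (mul_eq_zero.1 e3).resolve_right (by linarith)
  subst hP
  refine ⟨rfl, ?_⟩
  have : Q * Real.sin h = 0 := by linarith
  exact (mul_eq_zero.1 this).resolve_right hs.ne'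

/-- Along the arc the squared distance to `c` is a constant plus a sinusoid with the coefficients of
`D`; being constant it forces `D = 0`, while the radius is not zero. -/
theorem DirArc.center_unique {A : DirArc} {c : ℂ} {R t : ℝ} (h : A.Valid) (h0 : 0 < t)
    (h2 : t < 2 * Real.pi) (hR : ∀ x, 0 ≤ x → x ≤ t → Complex.normSq (A.pt x - c) = R) :
    c = A.center := by
  set D := (A.start - A.center) * conj (A.center - c) with hD
  have key : ∀ x, 0 ≤ x → x ≤ t → D.re * Real.cos x + D.im * Real.sin x = D.re := by
    intro x hx hxt
    have expand : ∀ y, Complex.normSq (A.pt y - c) = Complex.normSq (A.center - c) +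
        Complex.normSq (A.start - A.center) + 2 * (D.re * Real.cos y + D.im * Real.sin y) := by
      intro y
      have hs := Real.sin_sq_add_cos_sq y
      rw [hD]
      simp only [DirArc.pt, Complex.normSq_apply, Complex.sub_re, Complex.sub_im, Complex.add_re,
        Complex.add_im, Complex.mul_re, Complex.mul_im, cis_re, cis_im, Complex.conj_re,
        Complex.conj_im, Real.cos_neg, Real.sin_neg]
      linear_combination ((A.start.re - A.center.re) ^ 2 + (A.start.im - A.center.im) ^ 2) * hs
    have e1 := (expand x).symm.trans (hR x hx hxt)
    have e2 := (expand 0).symm.trans (hR 0 le_rfl h0.le)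
    simp only [Real.cos_zero, Real.sin_zero] at e2
    linarith
  have e1 := key (t / 2) (by linarith) (by linarith)
  have e2 := key (2 * (t / 2)) (by linarith) (by linarith)
  obtain ⟨hP, hQ⟩ := cos_sin_eq_zero (by linarith) (by linarith) e1 e2
  have hD0 : D = 0 := Complex.ext hP hQ
  have := (mul_eq_zero.1 hD0).resolve_left h.start_sub_ne
  rw [map_eq_zero, sub_eq_zero] at this
  exact this.symm

/-! ### Cloud arcs are swept by continuously turning wedges -/

section
variable {ω : ℝ} {V : Set ℂ} {a b : ℂ}

theorem apex_sub_ctr (φ : ℝ) :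
    apex ω a b φ - ctr ω a b = -(conj (a - ctr ω a b) * cis (2 * φ)) := by
  unfold apex; ring

theorem apex_sub (φ x : ℝ) :
    apex ω a b (φ - x / 2) = ctr ω a b + (apex ω a b φ - ctr ω a b) * cis (-x) := by
  rw [apex_sub_ctr, apex]
  have : 2 * (φ - x / 2) = 2 * φ + -x := by ring
  rw [this, cis_add]; ring

theorem normSq_apex_sub (φ : ℝ) :
    Complex.normSq (apex ω a b φ - ctr ω a b) = Complex.normSq (a - ctr ω a b) := by
  rw [apex_sub_ctr, Complex.normSq_neg, map_mul, Complex.normSq_conj,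
    Complex.normSq_eq_norm_sq (cis _), norm_cis]; ring

/-- An arc that is a portion of the cloud is run through by the apices of a continuous family of
minimal wedges. -/
theorem DirArc.touch_of_carrier {A : DirArc} (h0 : 0 < ω) (hπ : ω < Real.pi) (hv : A.Valid)
    (hc : A.clockwise = true) (h : A.carrier = {q | ∃ φ, IsTouch ω V a b φ q}) :
    A.center = ctr ω a b ∧
      ∃ s : ℝ, ∀ x, 0 ≤ x → x ≤ A.meas → IsTouch ω V a b (s - x / 2) (A.pt x) := by
  obtain ⟨m0, m2, -⟩ := hv.meas_spec
  rw [DirArc.carrier_eq hv hc] at h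
  have ex : ∀ x, 0 ≤ x → x ≤ A.meas → ∃ φ, IsTouch ω V a b φ (A.pt x) := by
    intro x hx hxt
    have : A.pt x ∈ {q | ∃ φ, IsTouch ω V a b φ q} := by rw [← h]; exact ⟨x, hx, hxt, rfl⟩
    exact this
  have hcen : A.center = ctr ω a b := by
    refine (DirArc.center_unique (R := Complex.normSq (a - ctr ω a b)) hv m0 m2 ?_).symm
    intro x hx hxt
    obtain ⟨φ, hφ⟩ := ex x hx hxt
    rw [hφ.eq_apex h0 hπ, normSq_apex_sub]
  refine ⟨hcen, ?_⟩
  obtain ⟨s, hs⟩ := ex 0 le_rfl m0.le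
  have hstart : A.start = apex ω a b s := by
    have := hs.eq_apex h0 hπ
    rwa [DirArc.pt_zero] at this
  have ptx : ∀ x, A.pt x = apex ω a b (s - x / 2) := by
    intro x
    rw [apex_sub, ← hstart, ← hcen, DirArc.pt]
  refine ⟨s, fun x hx hxt => ?_⟩
  rcases hx.eq_or_lt with rfl | hx
  · simpa using hs
  obtain ⟨ψ, hψ⟩ := ex x hx.le hxt
  have hcis : cis (2 * ψ) = cis (2 * s - x) := by
    have e := hψ.eq_apex h0 hπ
    rw [ptx x, apex, apex, show 2 * (s - x / 2) = 2 * s - x by ring] at e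
    have hne : conj (a - ctr ω a b) ≠ 0 := by
      rw [map_ne_zero]
      intro h0'
      have := normSq_apex_sub (ω := ω) (a := a) (b := b) s
      rw [h0', map_zero, map_eq_zero, ← hstart, ← hcen] at this
      exact hv.start_sub_ne this
    exact (mul_left_cancel₀ hne (sub_right_injective e)).symm
  obtain ⟨k, hk⟩ := cis_eq_iff.1 hcis
  -- The apex moves at twice the angular speed, so it fixes the direction of its wedge modulo `π`
  -- only. The odd case has to be excluded.
  rcases Int.even_or_odd' k with ⟨j, hj | hj⟩
  · have := hψ.add_int (-j)
    have e : ψ + ((-j : ℤ) : ℝ) * (2 * Real.pi) = s - x / 2 := by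
      rw [hj] at hk; push_cast at hk ⊢; linarith
    rwa [e] at this
  · exfalso
    have hψ' := hψ.add_int (-j)
    have e : ψ + ((-j : ℤ) : ℝ) * (2 * Real.pi) = s + (Real.pi - x / 2) := by
      rw [hj] at hk; push_cast at hk ⊢; linarith
    rw [e] at hψ'
    -- In the odd case both vertices are touched at all directions from `s` to `s + π - x / 2`.
    -- Turning back by the small angle `y` gives an apex on the circle before the start, outside the
    -- arc, although the arc is the whole portion. The first bound keeps `2 π - 2 y` above `A.meas`.
    set y := min ((2 * Real.pi - A.meas) / 4) (Real.pi - x / 2) with hy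
    have hy0 : 0 < y := lt_min (by linarith) (by linarith)
    have hy1 : y ≤ (2 * Real.pi - A.meas) / 4 := min_le_left _ _
    have hy2 : y ≤ Real.pi - x / 2 := min_le_right _ _
    rw [DirArc.pt_zero] at hs
    have sa : Supp V a (s + y) :=
      hs.sa.between hψ'.sa (by linarith) (by linarith) (by linarith)
    have sb : Supp V b (s + y + (Real.pi - ω)) :=
      hs.sb.between hψ'.sb (by linarith) (by linarith) (by linarith)
    have ht := isTouch_apex h0 hπ hs.ma hs.mb sa sb
    have : apex ω a b (s + y) ∈ {z | ∃ x, 0 ≤ x ∧ x ≤ A.meas ∧ z = A.pt x} := by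
      rw [h]; exact ⟨_, ht⟩
    obtain ⟨x', hx0, hx1, hx'⟩ := this
    have e2 : apex ω a b (s + y) = A.pt (2 * Real.pi - 2 * y) := by
      rw [ptx, apex, apex, ← cis_add_two_pi (2 * (s - (2 * Real.pi - 2 * y) / 2))]
      congr 3; ring
    rw [e2] at hx'
    have := DirArc.pt_inj' hv hx' (by linarith) (by linarith)
    linarith

end
end OmegaCloud

namespace OmegaCloud
open Complex (I)
open scoped ComplexConjugate

/-! ### Cyclic indexing of arc sequences -/

theorem arcAt_mem {l : List DirArc} (hl : 0 < l.length) (i : ℕ) : arcAt l i ∈ l := by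
  have := Nat.mod_lt i hl
  unfold arcAt
  rw [List.getD_eq_getElem _ _ this]
  exact List.getElem_mem this

theorem arcAt_of_lt {l : List DirArc} {i : ℕ} (h : i < l.length) : arcAt l i = l[i] := by
  unfold arcAt
  rw [Nat.mod_eq_of_lt h, List.getD_eq_getElem _ _ h]

theorem arcAt_add_length (l : List DirArc) (i : ℕ) : arcAt l (i + l.length) = arcAt l i := by
  unfold arcAt; rw [Nat.add_mod_right]

theorem arcAt_mod (l : List DirArc) (i : ℕ) : arcAt l (i % l.length) = arcAt l i := by
  unfold arcAt; rw [Nat.mod_mod]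

theorem mem_consecutive_iff {l : List DirArc} (hl : 0 < l.length) (p : DirArc × DirArc) :
    p ∈ consecutive l ↔ ∃ i, p = (arcAt l i, arcAt l (i + 1)) := by
  unfold consecutive
  have key : ∀ i (h : i < l.length), (l.zip (l.rotate 1))[i]'(by simpa using h) =
      (arcAt l i, arcAt l (i + 1)) := by
    intro i h
    rw [List.getElem_zip, List.getElem_rotate, arcAt_of_lt h]
    congr 1
    rw [← arcAt_of_lt, arcAt_mod]
  rw [List.mem_iff_getElem]
  constructor
  · rintro ⟨i, hi, rfl⟩
    have h : i < l.length := by simpa using hi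
    exact ⟨i, key i h⟩
  · rintro ⟨i, rfl⟩
    have h := Nat.mod_lt i hl
    refine ⟨i % l.length, by simpa using h, ?_⟩
    rw [key _ h, arcAt_mod]
    congr 1
    rw [← arcAt_mod, Nat.mod_add_mod, arcAt_mod]

theorem IsArcSequence.valid {l : List DirArc} (h : IsArcSequence l) (hl : 0 < l.length) (i : ℕ) :
    (arcAt l i).Valid := h.1 _ (arcAt_mem hl i)

theorem IsArcSequence.link {l : List DirArc} (h : IsArcSequence l) (hl : 0 < l.length) (i : ℕ) :
    (arcAt l i).finish = (arcAt l (i + 1)).start :=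
  h.2 _ ((mem_consecutive_iff hl _).2 ⟨i, rfl⟩)

/-! ### The cloud as the track of one turning wedge -/

/-- The sequence of the arcs of a cloud, together with the vertices touched by the two arms and
with the direction `s i` of the left arm at the start and `e i` at the end of the `i`-th arc. -/
structure Chain (ω : ℝ) (V : Set ℂ) (l : List DirArc) (a b : ℕ → ℂ) (s e : ℕ → ℝ) : Prop where
  valid : ∀ i, (arcAt l i).Valid
  cw : ∀ i, (arcAt l i).clockwise = true
  he : ∀ i, e i = s i - (arcAt l i).meas / 2
  touch : ∀ i x, 0 ≤ x → x ≤ (arcAt l i).meas →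
    IsTouch ω V (a i) (b i) (s i - x / 2) ((arcAt l i).pt x)
  center : ∀ i, (arcAt l i).center = ctr ω (a i) (b i)
  ne : ∀ i, a i ≠ b i
  link : ∀ i, (arcAt l i).finish = (arcAt l (i + 1)).start
  step : ∀ i, (s (i + 1) = e i ∧ (arcAt l i).finish ≠ a i) ∨
    (e i - ω ≤ s (i + 1) ∧ s (i + 1) ≤ e i ∧ (arcAt l i).finish = a i ∧
      (arcAt l i).finish = b (i + 1))
  pa : ∀ i, a (i + l.length) = a i
  pb : ∀ i, b (i + l.length) = b i
  inj : ∀ i j, i < l.length → j < l.length → a i = a j → b i = b j → i = j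

section
variable {ω : ℝ} {V : Set ℂ} {l : List DirArc} {a b : ℕ → ℂ} {s e : ℕ → ℝ}

namespace Chain

theorem touch_start (h : Chain ω V l a b s e) (i : ℕ) :
    IsTouch ω V (a i) (b i) (s i) (arcAt l i).start := by
  have := h.touch i 0 le_rfl (h.valid i).meas_spec.1.le
  rw [DirArc.pt_zero] at this
  simpa using this

theorem touch_finish (h : Chain ω V l a b s e) (i : ℕ) :
    IsTouch ω V (a i) (b i) (e i) (arcAt l i).finish := by
  have := h.touch i _ (h.valid i).meas_spec.1.le le_rfl
  rwa [← (h.valid i).meas_spec.2.2, ← h.he] at this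

theorem e_lt_s (h : Chain ω V l a b s e) (i : ℕ) : e i < s i := by
  rw [h.he]; linarith [(h.valid i).meas_spec.1]

theorem s_lt_e (h : Chain ω V l a b s e) (i : ℕ) : s i < e i + Real.pi := by
  rw [h.he]; linarith [(h.valid i).meas_spec.2.1]

theorem s_succ_le (h : Chain ω V l a b s e) (i : ℕ) : s (i + 1) ≤ e i := by
  rcases h.step i with h | h
  · exact h.1.le
  · exact h.2.1

theorem le_s_succ (h0 : 0 < ω) (h : Chain ω V l a b s e) (i : ℕ) : e i - ω ≤ s (i + 1) := by
  rcases h.step i with h | h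
  · linarith [h.1]
  · exact h.1

theorem s_anti (h : Chain ω V l a b s e) : StrictAnti s :=
  strictAnti_nat_of_succ_lt fun i => (h.s_succ_le i).trans_lt (h.e_lt_s i)

theorem supp_ab (h : Chain ω V l a b s e) (i : ℕ) {x : ℝ} (h1 : e i ≤ x) (h2 : x ≤ s i) :
    Supp V (a i) x ∧ Supp V (b i) (x + (Real.pi - ω)) := by
  rw [h.he] at h1
  have := h.touch i (2 * (s i - x)) (by linarith) (by linarith)
  rw [show s i - 2 * (s i - x) / 2 = x by ring] at this
  exact ⟨this.sa, this.sb⟩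

/-- While the direction falls from `e i` to `s (i + 1)`, the apex rests on a vertex common to both
arms; it supports at both ends of the interval and hence in between. -/
theorem supp_gap (hπ : ω < Real.pi) (h : Chain ω V l a b s e) (i : ℕ) {x : ℝ}
    (h1 : s (i + 1) ≤ x) (h2 : x < e i) :
    a i = b (i + 1) ∧ Supp V (a i) x ∧ Supp V (b (i + 1)) (x + (Real.pi - ω)) := by
  rcases h.step i with hs | ⟨h3, h4, h5, h6⟩
  · linarith [hs.1]
  · have t1 := h.touch_finish i
    have t2 := h.touch_start (i + 1)
    have hab : a i = b (i + 1) := h5.symm.trans h6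
    refine ⟨hab, ?_, ?_⟩
    · have : Supp V (a i) (s (i + 1)) := by
        intro w hw
        have e1 := t2.sa w hw
        rwa [← t2.qa, ← h.link i, h5] at e1
      exact this.between t1.sa h1 h2.le (by linarith)
    · have : Supp V (b (i + 1)) (e i + (Real.pi - ω)) := by
        intro w hw
        have e1 := t1.sb w hw
        rwa [← t1.qb, h6] at e1
      exact t2.sb.between this (by linarith) (by linarith) (by linarith)

/-- A pivot belongs to the old left contact and to the new right contact: the left vertex stays `a
i` down to `s (i + 1)`, whereas the right vertex is `b (i + 1)` from `e i` on, see `supp_b`. -/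
theorem supp_a (hπ : ω < Real.pi) (h : Chain ω V l a b s e) (i : ℕ) {x : ℝ}
    (h1 : s (i + 1) ≤ x) (h2 : x ≤ s i) : Supp V (a i) x := by
  rcases lt_or_ge x (e i) with hx | hx
  · exact (h.supp_gap hπ i h1 hx).2.1
  · exact (h.supp_ab i hx h2).1

theorem supp_b (hπ : ω < Real.pi) (h : Chain ω V l a b s e) (i : ℕ) {x : ℝ}
    (h1 : e (i + 1) ≤ x) (h2 : x ≤ e i) : Supp V (b (i + 1)) (x + (Real.pi - ω)) := by
  rcases lt_or_ge (s (i + 1)) x with hx | hx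
  · rcases h2.eq_or_lt with h2 | h2
    · rcases h.step i with hs | ⟨h3, h4, h5, h6⟩
      · linarith [hs.1]
      · have t1 := h.touch_finish i
        intro w hw
        have e1 := t1.sb w hw
        rwa [← t1.qb, h6, ← h2] at e1
    · exact (h.supp_gap hπ i hx.le h2).2.2
  · exact (h.supp_ab (i + 1) h1 hx).2

theorem ma (h : Chain ω V l a b s e) (i : ℕ) : a i ∈ V := (h.touch_start i).ma
theorem mb (h : Chain ω V l a b s e) (i : ℕ) : b i ∈ V := (h.touch_start i).mb

end Chain

theorem exists_index {f : ℕ → ℝ} {x : ℝ} (N : ℕ) (h0 : x < f 0) (hN : f N ≤ x) :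
    ∃ k < N, f (k + 1) ≤ x ∧ x < f k := by
  induction N with
  | zero => linarith
  | succ N ih =>
    rcases lt_or_ge x (f N) with h | h
    · exact ⟨N, by omega, hN, h⟩
    · obtain ⟨k, hk, h⟩ := ih h
      exact ⟨k, by omega, h⟩

theorem exists_int_shift (x : ℝ) : ∃ k : ℤ, -(2 * Real.pi) < x + k * (2 * Real.pi) ∧
    x + k * (2 * Real.pi) ≤ 0 := by
  refine ⟨-toIocDiv Real.two_pi_pos (-(2 * Real.pi)) x, ?_⟩
  have h1 := left_lt_toIocMod Real.two_pi_pos (-(2 * Real.pi)) x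
  have h2 := toIocMod_le_right Real.two_pi_pos (-(2 * Real.pi)) x
  have h3 := toIocMod_add_toIocDiv_zsmul Real.two_pi_pos (-(2 * Real.pi)) x
  rw [zsmul_eq_mul] at h3
  push_cast
  constructor <;> linarith

/-- Modulo `2 π`, both `x` and `x - (π - ω)` lie in `[-π, 0]`; together this leaves `[-ω, 0]` for
`x`. -/
theorem pivot_shift (h0 : 0 < ω) {x : ℝ} (h1 : Real.sin x ≤ 0)
    (h2 : Real.sin (x - (Real.pi - ω)) ≤ 0) :
    ∃ k : ℤ, -ω ≤ x + k * (2 * Real.pi) ∧ x + k * (2 * Real.pi) ≤ 0 := by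
  obtain ⟨k, hk1, hk2⟩ := exists_int_shift x
  refine ⟨k, ?_, hk2⟩
  rw [← Real.sin_add_int_mul_two_pi _ k] at h1 h2
  rw [show x - (Real.pi - ω) + k * (2 * Real.pi) =
    x + k * (2 * Real.pi) - (Real.pi - ω) by ring] at h2
  generalize x + k * (2 * Real.pi) = y at *
  have pos : ∀ z, -(2 * Real.pi) < z → z < -Real.pi → 0 < Real.sin z := by
    intro z hz1 hz2
    rw [← Real.sin_add_two_pi]
    exact Real.sin_pos_of_pos_of_lt_pi (by linarith) (by linarith)
  have hy : -Real.pi ≤ y := by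
    by_contra hc
    linarith [pos y hk1 (not_le.1 hc)]
  by_contra hc
  linarith [pos (y - (Real.pi - ω)) (by linarith) (by linarith [not_le.1 hc])]

/-- The link between consecutive arcs of a cloud. -/
theorem exists_link {A A' : DirArc} {a b a' b' : ℂ} {s s' : ℝ} (h0 : 0 < ω) (hπ : ω < Real.pi)
    (hA : A.Valid) (hA' : A'.Valid) (hl : A.finish = A'.start) (hab' : a' ≠ b')
    (ht : ∀ x, 0 ≤ x → x ≤ A.meas → IsTouch ω V a b (s - x / 2) (A.pt x))
    (ht' : ∀ x, 0 ≤ x → x ≤ A'.meas → IsTouch ω V a' b' (s' - x / 2) (A'.pt x)) :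
    ∃ k : ℤ, (s' + k * (2 * Real.pi) = s - A.meas / 2 ∧ A.finish ≠ a) ∨
      (s - A.meas / 2 - ω ≤ s' + k * (2 * Real.pi) ∧
        s' + k * (2 * Real.pi) ≤ s - A.meas / 2 ∧ A.finish = a ∧ A.finish = b') := by
  obtain ⟨m0, m2, mf⟩ := hA.meas_spec
  obtain ⟨m0', m2', -⟩ := hA'.meas_spec
  have t := ht A.meas m0.le le_rfl
  rw [← mf] at t
  have t0 := ht 0 le_rfl m0.le
  have t' := ht' 0 le_rfl m0'.le
  rw [DirArc.pt_zero, ← hl, zero_div, sub_zero] at t'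
  have t1' := ht' A'.meas m0'.le le_rfl
  by_cases hq : A.finish = a
  -- The apex is a vertex, so it is the right contact of the following arc, whose left contact is
  -- another vertex; `pivot_shift` then bounds the turn.
  · have hb' : b' = A.finish :=
      t'.eq_right_of_mem h0 hπ (hq ▸ t.ma) t1'.sb (by linarith) (by linarith)
    have ha' : A.finish ≠ a' := fun hc => hab' (hc.symm.trans hb'.symm)
    obtain ⟨e1, e2⟩ := t'.sin_sub_nonpos h0 hπ t ha'
    obtain ⟨k, hk1, hk2⟩ := pivot_shift h0 e1 e2
    exact ⟨k, Or.inr ⟨by linarith, by linarith, hq, hb'.symm⟩⟩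
  -- Otherwise the apex is not in `V` at all, and the wedge with this apex is unique up to full
  -- turns.
  · have hqV : A.finish ∉ V := fun hc =>
      hq (t.eq_left_of_mem h0 hπ hc t0.sa (by linarith) (by linarith)).symm
    have ha' : A.finish ≠ a' := fun hc => hqV (hc ▸ t'.ma)
    obtain ⟨k, hk⟩ := t.angle_unique h0 hπ t' hq ha'
    exact ⟨-k, Or.inl ⟨by push_cast; linarith, hq⟩⟩

theorem exists_chain (h0 : 0 < ω) (hπ : ω < Real.pi) {vs : List ℂ} (hl : 0 < l.length)
    (h : IsCloud ω vs l) : ∃ a b s e, Chain ω {v | v ∈ vs} l a b s e := by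
  obtain ⟨hseq, hcw, hnd, hiff⟩ := h
  have h1 : ∀ A ∈ l, ∃ (a b : ℂ) (s : ℝ), a ≠ b ∧ A.carrier = cloudPortion ω vs a b ∧
      A.center = ctr ω a b ∧ ∀ x, 0 ≤ x → x ≤ A.meas →
        IsTouch ω {v | v ∈ vs} a b (s - x / 2) (A.pt x) := by
    intro A hA
    obtain ⟨a, ha, b, hb, hS, hnt⟩ := (hiff A.carrier).1 (List.mem_map_of_mem hA)
    have hab : a ≠ b := by
      rintro rfl
      rw [hS] at hnt
      obtain ⟨p, hp, q, hq, hpq⟩ := hnt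
      obtain ⟨φ, hφ⟩ := (mem_cloudPortion_iff h0 hπ ha hb p).1 hp
      obtain ⟨ψ, hψ⟩ := (mem_cloudPortion_iff h0 hπ ha hb q).1 hq
      apply hpq
      rw [hφ.eq_apex h0 hπ, hψ.eq_apex h0 hπ, apex_self h0 hπ, apex_self h0 hπ]
    have hS' : A.carrier = {q | ∃ φ, IsTouch ω {v | v ∈ vs} a b φ q} := by
      rw [hS]; ext q; exact mem_cloudPortion_iff h0 hπ ha hb q
    obtain ⟨hc, s, hs⟩ := DirArc.touch_of_carrier h0 hπ (hseq.1 A hA) (hcw A hA) hS'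
    exact ⟨a, b, s, hab, hS, hc, hs⟩
  choose! α β S hne hcar hctr hts using h1
  have hm := fun i => arcAt_mem hl i
  have h2 := fun i (k : ℤ) => exists_link (s := S (arcAt l i) + k * (2 * Real.pi)) h0 hπ
    (hseq.valid hl i) (hseq.valid hl (i + 1)) (hseq.link hl i) (hne _ (hm (i + 1)))
    (fun x hx hx' => by
      have := (hts _ (hm i) x hx hx').add_int k
      rwa [show S (arcAt l i) - x / 2 + k * (2 * Real.pi) =
        S (arcAt l i) + k * (2 * Real.pi) - x / 2 by ring] at this) (hts _ (hm (i + 1)))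
  choose f hf using h2
  -- The multiples of `2 π` are chosen one after the other, so that the directions never jump up at
  -- a link.
  obtain ⟨κ, hκ⟩ : ∃ κ : ℕ → ℤ, ∀ i, κ (i + 1) = f i (κ i) :=
    ⟨fun n => Nat.rec 0 f n, fun i => rfl⟩
  refine ⟨fun i => α (arcAt l i), fun i => β (arcAt l i),
    fun i => S (arcAt l i) + ((κ i : ℤ) : ℝ) * (2 * Real.pi),
    fun i => S (arcAt l i) + ((κ i : ℤ) : ℝ) * (2 * Real.pi) - (arcAt l i).meas / 2, ?_⟩
  refine ⟨hseq.valid hl, fun i => hcw _ (hm i), fun i => rfl, ?_, fun i => hctr _ (hm i),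
    fun i => hne _ (hm i), hseq.link hl, fun i => by rw [hκ]; exact hf i (κ i), ?_, ?_, ?_⟩
  · intro i x hx hx'
    have := (hts _ (hm i) x hx hx').add_int (κ i)
    rwa [show S (arcAt l i) - x / 2 + κ i * (2 * Real.pi) =
      S (arcAt l i) + κ i * (2 * Real.pi) - x / 2 by ring] at this
  · intro i; simp only [arcAt_add_length]
  · intro i; simp only [arcAt_add_length]
  · intro i j hi hj ha hb
    have : (arcAt l i).carrier = (arcAt l j).carrier := by
      rw [hcar _ (hm i), hcar _ (hm j)]
      rw [ha, hb]
    rw [arcAt_of_lt hi, arcAt_of_lt hj] at this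
    have := (List.Nodup.getElem_inj_iff hnd (i := i) (j := j) (hi := by simpa using hi)
      (hj := by simpa using hj)).1 (by simpa using this)
    exact this

namespace Chain

theorem apex_start (h0 : 0 < ω) (hπ : ω < Real.pi) (h : Chain ω V l a b s e) (i : ℕ) :
    (arcAt l i).start = apex ω (a i) (b i) (s i) := (h.touch_start i).eq_apex h0 hπ

/-- The apex at the start of an arc differs from the vertex touched by the left arm. -/
theorem start_ne_a (h0 : 0 < ω) (hπ : ω < Real.pi) (h : Chain ω V l a b s e) (i : ℕ) :
    (arcAt l i).start ≠ a i := by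
  intro hc
  have t := h.touch_start i
  have := t.eq_right_of_mem h0 hπ (hc ▸ t.ma) (h.supp_ab i le_rfl (h.e_lt_s i).le).2
    (h.e_lt_s i) (by linarith [h.s_lt_e i])
  exact h.ne i (hc.symm.trans this.symm)

/-- After a round the same wedge recurs, up to full turns. Their number is the same for all arcs,
because each start lies at most `ω < 2 π` below the preceding end. -/
theorem period_const (h0 : 0 < ω) (hπ : ω < Real.pi) (h : Chain ω V l a b s e) :
    ∃ D : ℤ, ∀ i, s (i + l.length) = s i + D * (2 * Real.pi) := by
  have h1 : ∀ i, ∃ D : ℤ, s (i + l.length) = s i + D * (2 * Real.pi) := by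
    intro i
    have t := h.touch_start i
    have t' := h.touch_start (i + l.length)
    have n' := h.start_ne_a h0 hπ (i + l.length)
    rw [arcAt_add_length] at t' n'
    exact t.angle_unique h0 hπ t' (h.start_ne_a h0 hπ i) n'
  obtain ⟨D, hD⟩ := h1 0
  refine ⟨D, fun i => ?_⟩
  induction i with
  | zero => exact hD
  | succ i ih =>
    obtain ⟨D', hD'⟩ := h1 (i + 1)
    have e1 := h.he i
    have e2 := h.he (i + l.length)
    rw [arcAt_add_length] at e2
    have b1 := h.s_succ_le i
    have b2 := h.le_s_succ h0 i
    have b3 := h.s_succ_le (i + l.length)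
    have b4 := h.le_s_succ h0 (i + l.length)
    rw [show i + l.length + 1 = i + 1 + l.length by ring] at b3 b4
    have hx := DirArc.eq_of_int_mul (x := s (i + 1 + l.length)) (k := D' - D)
      (y := s (i + 1) + D * (2 * Real.pi)) (by rw [hD']; push_cast; ring)
      (by linarith) (by linarith)
    exact hx

/-- Directions decrease, so the number of turns is negative. With two or more turns per round, the
directions of the first arc, lowered by `2 π`, would be passed before the round ends; since
directions determine contacts, the pair of the first arc would recur, against `inj`. -/
theorem period (h0 : 0 < ω) (hπ : ω < Real.pi) (hl : 0 < l.length) (h : Chain ω V l a b s e)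
    (i : ℕ) : s (i + l.length) = s i - 2 * Real.pi := by
  obtain ⟨D, hD⟩ := h.period_const h0 hπ
  have hp := Real.two_pi_pos
  have hD0 : D < 0 := by
    have h1 := h.s_anti (show 0 < 0 + l.length by omega)
    rw [hD] at h1
    by_contra hc
    have : (0 : ℝ) ≤ D := by exact_mod_cast not_lt.1 hc
    have := mul_nonneg this hp.le
    linarith
  suffices hD1 : D = -1 by rw [hD, hD1]; push_cast; ring
  by_contra hne
  have hD2 : D ≤ -2 := by omega
  have hD2' : (D : ℝ) ≤ -2 := by exact_mod_cast hD2
  have h1 := hD 0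
  rw [zero_add] at h1
  have h2 := mul_le_mul_of_nonneg_right hD2' hp.le
  have h3 := h.e_lt_s 0
  have h4 := h.s_lt_e 0
  set x := e 0 - 2 * Real.pi with hx
  obtain ⟨k, hkN, hk1, hk2⟩ := exists_index (f := s) (x := x) l.length (by linarith) (by linarith)
  have hk0 : k ≠ 0 := by
    rintro rfl
    have := h.le_s_succ h0 0
    linarith
  have sh : ∀ y, x ≤ y → y ≤ s 0 - 2 * Real.pi →
      Supp V (a 0) y ∧ Supp V (b 0) (y + (Real.pi - ω)) := by
    intro y hy1 hy2
    obtain ⟨u1, u2⟩ := h.supp_ab 0 (x := y + 2 * Real.pi) (by linarith) (by linarith)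
    constructor
    · have := u1.add_int (-1)
      rwa [show y + 2 * Real.pi + ((-1 : ℤ) : ℝ) * (2 * Real.pi) = y by push_cast; ring] at this
    · have := u2.add_int (-1)
      rwa [show y + 2 * Real.pi + (Real.pi - ω) + ((-1 : ℤ) : ℝ) * (2 * Real.pi) =
        y + (Real.pi - ω) by push_cast; ring] at this
  -- If the wedge pivots at `x`, both arms touch one vertex, against `a 0 ≠ b 0`; if the apex runs
  -- along the arc `k`, this arc has the pair of the arc `0`.
  rcases lt_or_ge x (e k) with hxe | hxe
  · set y := min (e k) (s 0 - 2 * Real.pi) with hy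
    have hy1 : y ≤ e k := min_le_left _ _
    have hy2 : y ≤ s 0 - 2 * Real.pi := min_le_right _ _
    have hxy : x < y := lt_min hxe (by linarith)
    have hd : y - x < Real.pi := by linarith
    obtain ⟨p1, p2⟩ := sh x le_rfl (by linarith)
    obtain ⟨p3, p4⟩ := sh y hxy.le hy2
    obtain ⟨g, -, -⟩ := h.supp_gap hπ k hk1 hxe
    have e1 := p1.unique (h.ma 0) (h.ma k) p3 (h.supp_a hπ k hk1 (by linarith))
      (h.supp_a hπ k (by linarith) (by linarith [h.e_lt_s k])) hxy hd
    have e2 := p2.unique (h.mb 0) (h.mb (k + 1)) p4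
      (h.supp_b hπ k (by linarith [h.e_lt_s (k + 1)]) hxe.le)
      (h.supp_b hπ k (by linarith [h.e_lt_s (k + 1)]) hy1) (by linarith) (by linarith)
    exact h.ne 0 (by rw [e1, e2, g])
  · set y := min (s k) (s 0 - 2 * Real.pi) with hy
    have hy1 : y ≤ s k := min_le_left _ _
    have hy2 : y ≤ s 0 - 2 * Real.pi := min_le_right _ _
    have hxy : x < y := lt_min hk2 (by linarith)
    have hd : y - x < Real.pi := by linarith
    obtain ⟨p1, p2⟩ := sh x le_rfl (by linarith)
    obtain ⟨p3, p4⟩ := sh y hxy.le hy2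
    obtain ⟨q1, q2⟩ := h.supp_ab k hxe hk2.le
    obtain ⟨q3, q4⟩ := h.supp_ab k (x := y) (by linarith) hy1
    have e1 := p1.unique (h.ma 0) (h.ma k) p3 q1 q3 hxy hd
    have e2 := p2.unique (h.mb 0) (h.mb k) p4 q2 q4 (by linarith) (by linarith)
    exact hk0 (h.inj 0 k hl hkN e1 e2).symm

end Chain
end
end OmegaCloud

namespace OmegaCloud
open Complex (I)
open scoped ComplexConjugate

/-! ### Convexity from strictly supporting edges -/

theorem cross_rotate (a b c : ℂ) : cross a b c = cross c a b := by
  simp [cross]; ring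

/-- Strict support by the edges yields all triples by induction on the last index; the closing edge
is not needed. -/
theorem isConvexPolygon_of_edges {vs : List ℂ} (h2 : 2 ≤ vs.length) (hnd : vs.Nodup)
    (H : ∀ t (_ : t + 1 < vs.length) i (_ : i < vs.length), i ≠ t → i ≠ t + 1 →
      cross vs[t] vs[t + 1] vs[i] < 0) : IsConvexPolygon vs := by
  refine ⟨h2, hnd, ?_⟩
  have key : ∀ k (hk : k < vs.length) i j (_ : i < j) (_ : j < k),
      cross (vs[i]'(by omega)) (vs[j]'(by omega)) vs[k] < 0 := by
    intro k
    induction k with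
    | zero => intro _ i j _ h; omega
    | succ k ih =>
      intro hk i j hij hjk
      have edge : ∀ t (_ : i < t) (_ : t + 1 < vs.length),
          cross (vs[i]'(by omega)) vs[t] vs[t + 1] < 0 := by
        intro t hit ht
        rw [← cross_rotate]
        exact H t ht i (by omega) (by omega) (by omega)
      have first : ∀ t (_ : i + 1 < t) (_ : t < vs.length),
          cross (vs[i]'(by omega)) (vs[i + 1]'(by omega)) vs[t] < 0 := by
        intro t hit ht
        exact H i (by omega) t ht (by omega) (by omega)
      rcases (show j = i + 1 ∨ i + 1 < j by omega) with rfl | hj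
      · exact first (k + 1) (by omega) hk
      rcases (show j = k ∨ j < k by omega) with rfl | hjk'
      · exact edge j hij hk
      have h1 := first k (by omega) (by omega)
      have h2 := first j hj (by omega)
      have h3 := edge k (by omega) hk
      have h4 := first (k + 1) (by omega) hk
      have h5 := ih (by omega) i j hij hjk'
      generalize vs[i]'(by omega) = p at *
      generalize vs[i + 1]'(by omega) = q at *
      generalize vs[j]'(by omega) = u at *
      generalize vs[k]'(by omega) = v at *
      generalize vs[k + 1] = w at *
      -- Plücker relation for the vectors from `p` to `q, u, v, w`. The signs of five of the six
      -- factors are known.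
      have pl : cross p q v * cross p u w = cross p q u * cross p v w + cross p q w * cross p u v := by
        simp [cross]; ring
      have := mul_pos_of_neg_of_neg h2 h3
      have := mul_pos_of_neg_of_neg h4 h5
      by_contra hc
      have := mul_nonpos_of_nonpos_of_nonneg h1.le (not_lt.1 hc)
      linarith
  intro i j k hk hij hjk
  exact key k hk i j hij hjk

/-! ### Closed tracks of a turning wedge, without a given polygon -/

/-- The combinatorial and metric data of a closed sequence of circular arcs that is run through
by the apex of a wedge whose arms touch the vertices `a i` and `b i`, while the direction of the
left arm decreases from `s i` to `e i`. -/
structure Track (ω : ℝ) (N : ℕ) (a b : ℕ → ℂ) (s e : ℕ → ℝ) : Prop where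
  pos : 0 < N
  e_lt_s : ∀ i, e i < s i
  s_lt_e : ∀ i, s i < e i + Real.pi
  s_succ_le : ∀ i, s (i + 1) ≤ e i
  ps : ∀ i, s (i + N) = s i - 2 * Real.pi
  pe : ∀ i, e (i + N) = e i - 2 * Real.pi
  pa : ∀ i, a (i + N) = a i
  pb : ∀ i, b (i + N) = b i
  edge : ∀ i, ∃ r : ℝ, 0 ≤ r ∧ a (i + 1) = a i + r * cis (s (i + 1))
  gap : ∀ i, s (i + 1) < e i → a i = b (i + 1)
  lag : ∀ i j x, s (i + 1) < x → x < s i → e (j + 1) < x - (Real.pi - ω) →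
    x - (Real.pi - ω) < e j → a i = b (j + 1)
  ne : ∀ i, a i ≠ b i
  ne_succ : ∀ i, a (i + 1) = a i → b (i + 1) ≠ b i

theorem periodic_mul {α : Type*} {f : ℕ → α} {N : ℕ} (h : ∀ i, f (i + N) = f i) (m i : ℕ) :
    f (i + m * N) = f i := by
  induction m with
  | zero => simp
  | succ m ih => rw [Nat.succ_mul, ← add_assoc, h, ih]

theorem periodic_mod {α : Type*} {f : ℕ → α} {N : ℕ} (h : ∀ i, f (i + N) = f i) (i : ℕ) :
    f (i % N) = f i := by
  conv_rhs => rw [← Nat.mod_add_div i N, mul_comm]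
  exact (periodic_mul h _ _).symm

theorem exists_index_le {f : ℕ → ℝ} {x : ℝ} (N : ℕ) (h0 : x ≤ f 0) (hN : f N < x) :
    ∃ k < N, f (k + 1) < x ∧ x ≤ f k := by
  induction N with
  | zero => linarith
  | succ N ih =>
    rcases le_or_gt x (f N) with h | h
    · exact ⟨N, by omega, hN, h⟩
    · obtain ⟨k, hk, h⟩ := ih h
      exact ⟨k, by omega, h⟩

section
variable {ω : ℝ} {N : ℕ} {a b : ℕ → ℂ} {s e : ℕ → ℝ}

namespace Track

theorem s_anti (h : Track ω N a b s e) : StrictAnti s :=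
  strictAnti_nat_of_succ_lt fun i => (h.s_succ_le i).trans_lt (h.e_lt_s i)

theorem ps_mul (h : Track ω N a b s e) (i m : ℕ) :
    s (i + m * N) = s i - m * (2 * Real.pi) := by
  induction m with
  | zero => simp
  | succ m ih => rw [Nat.succ_mul, ← add_assoc, h.ps, ih]; push_cast; ring

theorem exists_s_lt (h : Track ω N a b s e) (x : ℝ) : ∃ m, s m < x := by
  obtain ⟨m, hm⟩ := exists_nat_gt ((s 0 - x) / (2 * Real.pi))
  refine ⟨0 + m * N, ?_⟩
  rw [h.ps_mul]
  rw [div_lt_iff₀ Real.two_pi_pos] at hm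
  linarith

/-- An edge of direction `s` changes the height in direction `φ` by `r * sin (s - φ)`: the height
falls for `s` in `[φ - π, φ]` and rises in the half turn below (`ht_backward`). -/
theorem ht_forward (h : Track ω N a b s e) {k l : ℕ} (hkl : k ≤ l) {φ : ℝ}
    (H : ∀ j, k ≤ j → j < l → φ - Real.pi ≤ s (j + 1) ∧ s (j + 1) ≤ φ) :
    ht (a l) φ ≤ ht (a k) φ := by
  induction l, hkl using Nat.le_induction with
  | base => exact le_rfl
  | succ l hl ih =>
    have h1 := ih fun j h1 h2 => H j h1 (by omega)
    obtain ⟨h2, h3⟩ := H l hl (by omega)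
    obtain ⟨r, hr, er⟩ := h.edge l
    rw [er, ht_add, ht_real_mul, ht_cis]
    have := Real.sin_nonpos_of_nonpos_of_neg_pi_le (x := s (l + 1) - φ) (by linarith) (by linarith)
    have := mul_nonpos_of_nonneg_of_nonpos hr this
    linarith

theorem ht_backward (h : Track ω N a b s e) {k l : ℕ} (hkl : k ≤ l) {φ : ℝ}
    (H : ∀ j, k ≤ j → j < l → φ - 2 * Real.pi ≤ s (j + 1) ∧ s (j + 1) ≤ φ - Real.pi) :
    ht (a k) φ ≤ ht (a l) φ := by
  induction l, hkl using Nat.le_induction with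
  | base => exact le_rfl
  | succ l hl ih =>
    have h1 := ih fun j h1 h2 => H j h1 (by omega)
    obtain ⟨h2, h3⟩ := H l hl (by omega)
    obtain ⟨r, hr, er⟩ := h.edge l
    rw [er, ht_add, ht_real_mul, ht_cis]
    have := Real.sin_nonneg_of_nonneg_of_le_pi (x := s (l + 1) - φ + 2 * Real.pi) (by linarith)
      (by linarith)
    rw [Real.sin_add_two_pi] at this
    have := mul_nonneg hr this
    linarith

theorem exists_rep (h : Track ω N a b s e) (k l : ℕ) :
    ∃ l', k < l' ∧ l' ≤ k + N ∧ a l' = a l := by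
  have hN := h.pos
  have h1 := Nat.mod_lt l hN
  have h2 := Nat.mod_lt k hN
  have h3 := Nat.mod_add_div k N
  rcases lt_or_ge (k % N) (l % N) with hc | hc
  · refine ⟨l % N + k / N * N, ?_, ?_, ?_⟩
    · rw [mul_comm]; omega
    · rw [mul_comm]; omega
    · rw [periodic_mul h.pa, periodic_mod h.pa]
  · refine ⟨l % N + (k / N + 1) * N, ?_, ?_, ?_⟩
    · rw [Nat.succ_mul, mul_comm]; omega
    · rw [Nat.succ_mul, mul_comm]; omega
    · rw [periodic_mul h.pa, periodic_mod h.pa]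

/-- From `a k` on, heights fall until the edge directions have passed `φ - π`, and then rise until
the walk closes at `a (k + N) = a k`. Every point is met on one of the two stretches. -/
theorem supp_a (h : Track ω N a b s e) (k : ℕ) {φ : ℝ} (h1 : s (k + 1) ≤ φ) (h2 : φ ≤ s k) :
    Supp (Set.range a) (a k) φ := by
  rintro _ ⟨l, rfl⟩
  obtain ⟨l', hk, hN, hl⟩ := h.exists_rep k l
  rw [← hl]
  have anti := h.s_anti.antitone
  rcases le_or_gt (φ - Real.pi) (s l') with hc | hc
  · refine h.ht_forward hk.le fun j hj1 hj2 => ⟨hc.trans (anti (by omega)), ?_⟩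
    exact (anti (show k + 1 ≤ j + 1 by omega)).trans h1
  · rw [← h.pa k]
    refine h.ht_backward hN fun j hj1 hj2 => ⟨?_, ?_⟩
    · have := anti (show j + 1 ≤ k + N by omega)
      rw [h.ps] at this
      linarith
    · exact (anti (show l' ≤ j + 1 by omega)).trans hc.le

theorem ma (_ : Track ω N a b s e) (i : ℕ) : a i ∈ Set.range a := ⟨i, rfl⟩

theorem supp_b_aux (hπ : ω < Real.pi) (hω : 0 < ω) (h : Track ω N a b s e) (j : ℕ) {φ : ℝ}
    (h1 : e (j + 1) ≤ φ) (h2 : φ ≤ e j) :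
    b (j + 1) ∈ Set.range a ∧ Supp (Set.range a) (b (j + 1)) (φ + (Real.pi - ω)) := by
  -- A shift by one round brings the support direction below `s 0`, where the indices start.
  suffices H : ∀ j φ, e (j + 1) ≤ φ → φ ≤ e j → φ + (Real.pi - ω) < s 0 →
      b (j + 1) ∈ Set.range a ∧ Supp (Set.range a) (b (j + 1)) (φ + (Real.pi - ω)) by
    have := H (j + N) (φ - 2 * Real.pi) (by rw [add_right_comm, h.pe]; linarith)
      (by rw [h.pe]; linarith) (by
        have := h.s_anti.antitone (Nat.zero_le j)
        linarith [h.e_lt_s j])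
    rw [add_right_comm, h.pb] at this
    refine ⟨this.1, ?_⟩
    have h3 := this.2.add_int 1
    rwa [show φ - 2 * Real.pi + (Real.pi - ω) + ((1 : ℤ) : ℝ) * (2 * Real.pi) =
      φ + (Real.pi - ω) by push_cast; ring] at h3
  clear h1 h2 φ j
  intro j φ h1 h2 h3
  have hej : e (j + 1) < e j := (h.e_lt_s (j + 1)).trans_le (h.s_succ_le j)
  obtain ⟨m, hm⟩ := h.exists_s_lt (φ + (Real.pi - ω))
  -- `lag` speaks of interior directions only. At an end of an interval it is applied to a nearby
  -- interior direction, and `supp_a`, which holds on closed intervals, carries over to the end.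
  rcases h2.lt_or_eq with h2 | h2
  · obtain ⟨i, -, hi1, hi2⟩ := exists_index m h3 hm.le
    obtain ⟨y, hy1, hy2⟩ := exists_between (show φ + (Real.pi - ω) < min (s i) (e j + (Real.pi - ω))
      from lt_min hi2 (by linarith))
    have := lt_min_iff.1 hy2
    have e1 := h.lag i j y (by linarith) this.1 (by linarith) (by linarith [this.2])
    rw [← e1]
    exact ⟨⟨i, rfl⟩, h.supp_a i hi1 hi2.le⟩
  · obtain ⟨i, -, hi1, hi2⟩ := exists_index_le m h3.le hm
    obtain ⟨y, hy1, hy2⟩ := exists_between (show max (s (i + 1)) (e (j + 1) + (Real.pi - ω)) <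
      φ + (Real.pi - ω) from max_lt hi1 (by linarith))
    have := max_lt_iff.1 hy1
    have e1 := h.lag i j y this.1 (by linarith) (by linarith [this.2]) (by linarith)
    rw [← e1]
    exact ⟨⟨i, rfl⟩, h.supp_a i hi1.le hi2⟩

theorem supp_b (hπ : ω < Real.pi) (hω : 0 < ω) (h : Track ω N a b s e) (j : ℕ) {φ : ℝ}
    (h1 : e (j + 1) ≤ φ) (h2 : φ ≤ e j) :
    Supp (Set.range a) (b (j + 1)) (φ + (Real.pi - ω)) := (h.supp_b_aux hπ hω j h1 h2).2

theorem mb (hπ : ω < Real.pi) (hω : 0 < ω) (h : Track ω N a b s e) (j : ℕ) :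
    b j ∈ Set.range a := by
  have hN := h.pos
  obtain ⟨m, hm⟩ : ∃ m, j + N = m + 1 := ⟨j + N - 1, by omega⟩
  rw [← h.pb, hm]
  exact (h.supp_b_aux hπ hω m le_rfl ((h.e_lt_s (m + 1)).le.trans (h.s_succ_le m))).1

theorem supp_ab (hπ : ω < Real.pi) (hω : 0 < ω) (h : Track ω N a b s e) (k : ℕ) {φ : ℝ}
    (h1 : e k ≤ φ) (h2 : φ ≤ s k) :
    Supp (Set.range a) (a k) φ ∧ Supp (Set.range a) (b k) (φ + (Real.pi - ω)) := by
  refine ⟨h.supp_a k ((h.s_succ_le k).trans h1) h2, ?_⟩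
  have hN := h.pos
  obtain ⟨m, hm⟩ : ∃ m, k + N = m + 1 := ⟨k + N - 1, by omega⟩
  have h3 := h.s_succ_le m
  rw [← hm, h.ps] at h3
  have h4 := h.pe k
  rw [hm] at h4
  have := (h.supp_b hπ hω m (φ := φ - 2 * Real.pi) (by linarith) (by linarith)).add_int 1
  rw [← hm, h.pb] at this
  rwa [show φ - 2 * Real.pi + (Real.pi - ω) + ((1 : ℤ) : ℝ) * (2 * Real.pi) =
      φ + (Real.pi - ω) by push_cast; ring] at this

/-- Two vertices that are touched throughout an interval of directions belong to one of the arcs. -/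
theorem exists_arc_of_interval (hπ : ω < Real.pi) (hω : 0 < ω) (h : Track ω N a b s e) {v w : ℂ}
    (hv : v ∈ Set.range a) (hw : w ∈ Set.range a) (hvw : v ≠ w) {x y : ℝ} (hxy : x < y)
    (hd : y - x < Real.pi) (sv : ∀ z, x ≤ z → z ≤ y → Supp (Set.range a) v z)
    (sw : ∀ z, x ≤ z → z ≤ y → Supp (Set.range a) w (z + (Real.pi - ω))) :
    ∃ k < N, v = a k ∧ w = b k := by
  -- The interval is lowered by full turns until it starts below `s 0`.
  obtain ⟨m, hm⟩ := exists_nat_gt ((x - s 0) / (2 * Real.pi))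
  rw [div_lt_iff₀ Real.two_pi_pos] at hm
  have sv' : ∀ z, x - m * (2 * Real.pi) ≤ z → z ≤ y - m * (2 * Real.pi) →
      Supp (Set.range a) v z := by
    intro z h1 h2
    have := (sv (z + m * (2 * Real.pi)) (by linarith) (by linarith)).add_int (-m)
    rwa [show z + m * (2 * Real.pi) + ((-m : ℤ) : ℝ) * (2 * Real.pi) = z by push_cast; ring] at this
  have sw' : ∀ z, x - m * (2 * Real.pi) ≤ z → z ≤ y - m * (2 * Real.pi) →
      Supp (Set.range a) w (z + (Real.pi - ω)) := by
    intro z h1 h2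
    have := (sw (z + m * (2 * Real.pi)) (by linarith) (by linarith)).add_int (-m)
    rwa [show z + m * (2 * Real.pi) + (Real.pi - ω) + ((-m : ℤ) : ℝ) * (2 * Real.pi) =
      z + (Real.pi - ω) by push_cast; ring] at this
  have hx0 : x - m * (2 * Real.pi) < s 0 := by linarith
  have hxy' : x - m * (2 * Real.pi) < y - m * (2 * Real.pi) := by linarith
  have hd' : y - m * (2 * Real.pi) - (x - m * (2 * Real.pi)) < Real.pi := by linarith
  generalize x - m * (2 * Real.pi) = x' at *
  generalize y - m * (2 * Real.pi) = y' at *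
  obtain ⟨M, hM⟩ := h.exists_s_lt x'
  obtain ⟨k, -, hk1, hk2⟩ := exists_index M hx0 hM.le
  -- During a pivot both arms would touch the same vertex, against `v ≠ w`; so `x'` lies in the
  -- range swept along the arc `k`.
  rcases lt_or_ge x' (e k) with hc | hc
  · exfalso
    have hz : x' < min y' (e k) := lt_min hxy' hc
    have hz1 : min y' (e k) ≤ y' := min_le_left _ _
    have hz2 : min y' (e k) ≤ e k := min_le_right _ _
    generalize min y' (e k) = z at *
    have e1 := (sv' x' le_rfl hxy'.le).unique hv ⟨k, rfl⟩ (sv' z hz.le hz1) (h.supp_a k hk1 hk2.le)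
      (h.supp_a k (by linarith) (by linarith [h.e_lt_s k])) hz (by linarith)
    have e2 := (sw' x' le_rfl hxy'.le).unique hw (h.mb hπ hω (k + 1)) (sw' z hz.le hz1)
      (h.supp_b hπ hω k (by linarith [h.e_lt_s (k + 1)]) hc.le)
      (h.supp_b hπ hω k (by linarith [h.e_lt_s (k + 1)]) hz2) (by linarith) (by linarith)
    exact hvw (by rw [e1, e2, h.gap k (hk1.trans_lt hc)])
  · refine ⟨k % N, Nat.mod_lt _ h.pos, ?_⟩
    rw [periodic_mod h.pa, periodic_mod h.pb]
    have hz : x' < min y' (s k) := lt_min hxy' hk2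
    have hz1 : min y' (s k) ≤ y' := min_le_left _ _
    have hz2 : min y' (s k) ≤ s k := min_le_right _ _
    generalize min y' (s k) = z at *
    obtain ⟨p1, p2⟩ := h.supp_ab hπ hω k hc hk2.le
    obtain ⟨p3, p4⟩ := h.supp_ab hπ hω k (φ := z) (by linarith) hz2
    exact ⟨(sv' x' le_rfl hxy'.le).unique hv ⟨k, rfl⟩ (sv' z hz.le hz1) p1 p3 hz (by linarith),
      (sw' x' le_rfl hxy'.le).unique hw (h.mb hπ hω k) (sw' z hz.le hz1) p2 p4
        (by linarith) (by linarith)⟩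

/-- All wedges that touch in the vertices of an arc belong to that arc. -/
theorem angle_mem_of_touch (hπ : ω < Real.pi) (hω : 0 < ω) (h : Track ω N a b s e) {k : ℕ}
    {φ : ℝ} (sa : Supp (Set.range a) (a (k + 1)) φ)
    (sb : Supp (Set.range a) (b (k + 1)) (φ + (Real.pi - ω))) :
    ∃ n : ℤ, e (k + 1) ≤ φ + n * (2 * Real.pi) ∧ φ + n * (2 * Real.pi) ≤ s (k + 1) := by
  -- The direction is moved to within a half turn of the middle of the arc. The auxiliary directions
  -- `y` lie on its side of the middle, hence less than `π` away from it, and `Supp.between`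
  -- applies.
  obtain ⟨n, hn1, hn2⟩ := exists_int_shift (φ - ((e (k + 1) + s (k + 1)) / 2 + Real.pi))
  refine ⟨n, ?_⟩
  have sa := sa.add_int n
  have sb := sb.add_int n
  rw [add_right_comm] at sb
  rw [show φ - ((e (k + 1) + s (k + 1)) / 2 + Real.pi) + n * (2 * Real.pi) =
    φ + n * (2 * Real.pi) - ((e (k + 1) + s (k + 1)) / 2 + Real.pi) by ring] at hn1 hn2
  generalize φ + n * (2 * Real.pi) = ψ at *
  have hes := h.e_lt_s (k + 1)
  constructor
  · by_contra hc
    rw [not_le] at hc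
    set y := ((e (k + 1) + s (k + 1)) / 2 + e (k + 1)) / 2 with hy
    obtain ⟨y1, y2⟩ := h.supp_ab hπ hω (k + 1) (φ := y) (by linarith) (by linarith)
    have sa' : ∀ z, ψ ≤ z → z ≤ e (k + 1) → Supp (Set.range a) (a (k + 1)) z :=
      fun z h1 h2 => sa.between y1 h1 (by linarith) (by linarith)
    have sb' : ∀ z, ψ ≤ z → z ≤ e (k + 1) →
        Supp (Set.range a) (b (k + 1)) (z + (Real.pi - ω)) :=
      fun z h1 h2 => sb.between y2 (by linarith) (by linarith) (by linarith)
    -- Beyond the end of the arc there is either a pivot, where both arms share a vertex, or an arc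
    -- with another pair; neither is compatible with the old pair being touched there.
    rcases (h.s_succ_le (k + 1)).lt_or_eq with hg | hg
    · have hab := h.gap _ hg
      have hz : max ψ (s (k + 1 + 1)) < e (k + 1) := max_lt hc hg
      have hz1 : ψ ≤ max ψ (s (k + 1 + 1)) := le_max_left _ _
      have hz2 : s (k + 1 + 1) ≤ max ψ (s (k + 1 + 1)) := le_max_right _ _
      generalize max ψ (s (k + 1 + 1)) = z at *
      have := (sb' z hz1 hz.le).unique (h.mb hπ hω (k + 1)) (h.mb hπ hω (k + 1 + 1))
        (sb' _ hc.le le_rfl)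
        (h.supp_b hπ hω (k + 1) (by linarith [h.e_lt_s (k + 1 + 1)]) hz.le)
        (h.supp_b hπ hω (k + 1) (by linarith [h.e_lt_s (k + 1 + 1)]) le_rfl)
        (by linarith) (by linarith)
      exact h.ne (k + 1) (hab.trans this.symm)
    · have hz : max ψ (e (k + 1 + 1)) < e (k + 1) :=
        max_lt hc (by linarith [h.e_lt_s (k + 1 + 1)])
      have hz1 : ψ ≤ max ψ (e (k + 1 + 1)) := le_max_left _ _
      have hz2 : e (k + 1 + 1) ≤ max ψ (e (k + 1 + 1)) := le_max_right _ _
      generalize max ψ (e (k + 1 + 1)) = z at *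
      obtain ⟨p1, p2⟩ := h.supp_ab hπ hω (k + 1 + 1) hz2 (by linarith)
      obtain ⟨p3, p4⟩ := h.supp_ab hπ hω (k + 1 + 1) (φ := e (k + 1)) (by linarith) (by linarith)
      have e1 := p1.unique (h.ma (k + 1 + 1)) (h.ma (k + 1)) p3 (sa' z hz1 hz.le) (sa' _ hc.le le_rfl) hz
        (by linarith)
      have e2 := p2.unique (h.mb hπ hω _) (h.mb hπ hω _) p4 (sb' z hz1 hz.le) (sb' _ hc.le le_rfl)
        (by linarith) (by linarith)
      exact h.ne_succ _ e1 e2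
  · by_contra hc
    rw [not_le] at hc
    set y := ((e (k + 1) + s (k + 1)) / 2 + s (k + 1)) / 2 with hy
    obtain ⟨y1, y2⟩ := h.supp_ab hπ hω (k + 1) (φ := y) (by linarith) (by linarith)
    have sa' : ∀ z, s (k + 1) ≤ z → z ≤ ψ → Supp (Set.range a) (a (k + 1)) z :=
      fun z h1 h2 => y1.between sa (by linarith) h2 (by linarith)
    have sb' : ∀ z, s (k + 1) ≤ z → z ≤ ψ →
        Supp (Set.range a) (b (k + 1)) (z + (Real.pi - ω)) :=
      fun z h1 h2 => y2.between sb (by linarith) (by linarith) (by linarith)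
    rcases (h.s_succ_le k).lt_or_eq with hg | hg
    · have hab := h.gap _ hg
      have hz : s (k + 1) < min ψ (e k) := lt_min hc hg
      have hz1 : min ψ (e k) ≤ ψ := min_le_left _ _
      have hz2 : min ψ (e k) ≤ e k := min_le_right _ _
      generalize min ψ (e k) = z at *
      have := (sa' _ le_rfl hc.le).unique (h.ma (k + 1)) (h.ma k) (sa' z hz.le hz1)
        (h.supp_a k le_rfl (by linarith [h.e_lt_s k]))
        (h.supp_a k hz.le (by linarith [h.e_lt_s k])) hz (by linarith)
      exact h.ne (k + 1) (this.trans hab)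
    · have hz : s (k + 1) < min ψ (s k) := lt_min hc (by linarith [h.e_lt_s k])
      have hz1 : min ψ (s k) ≤ ψ := min_le_left _ _
      have hz2 : min ψ (s k) ≤ s k := min_le_right _ _
      generalize min ψ (s k) = z at *
      obtain ⟨p1, p2⟩ := h.supp_ab hπ hω k (φ := s (k + 1)) (by linarith) (by linarith)
      obtain ⟨p3, p4⟩ := h.supp_ab hπ hω k (φ := z) (by linarith) hz2
      have e1 := (sa' _ le_rfl hc.le).unique (h.ma (k + 1)) (h.ma k) (sa' z hz.le hz1) p1 p3 hz
        (by linarith)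
      have e2 := (sb' _ le_rfl hc.le).unique (h.mb hπ hω _) (h.mb hπ hω _) (sb' z hz.le hz1) p2 p4
        (by linarith) (by linarith)
      exact h.ne_succ _ e1 e2

end Track
end
end OmegaCloud

namespace OmegaCloud
open Complex (I)
open scoped ComplexConjugate

/-! ### The polygon and the cloud of a track -/

section
variable {ω : ℝ} {N : ℕ} {a b : ℕ → ℂ} {s e : ℕ → ℝ}

open Classical in
/-- The points of a sequence of `N` points, without repetitions of consecutive points. -/
noncomputable def vertexList (a : ℕ → ℂ) (N : ℕ) : List ℂ :=
  ((List.range N).filter fun i => a (i + 1) ≠ a i).map a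

theorem cross_add_cis (p v : ℂ) (r φ : ℝ) :
    cross p (p + r * cis φ) v = r * (ht v φ - ht p φ) := by
  simp only [cross, ht, Complex.sub_re, Complex.sub_im, Complex.add_re, Complex.add_im,
    Complex.re_ofReal_mul, Complex.im_ofReal_mul, cis_re, cis_im]
  ring

namespace Track

/-- A vertex is listed at the end of its run of equal points. The run ends, since for a constant
sequence the contact `b 0`, being one of the points, would equal `a 0`. -/
theorem exists_flip (hπ : ω < Real.pi) (hω : 0 < ω) (h : Track ω N a b s e) (i : ℕ) :
    ∃ x < N, a (x + 1) ≠ a x ∧ a x = a i := by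
  by_cases hc : ∀ j, i ≤ j → a (j + 1) = a j
  · exfalso
    have hconst : ∀ j, i ≤ j → a j = a i := by
      intro j hj
      induction j, hj using Nat.le_induction with
      | base => rfl
      | succ j hj ih => rw [hc j hj, ih]
    have hall : ∀ k, a k = a i := by
      intro k
      obtain ⟨l', h1, -, h3⟩ := h.exists_rep i k
      rw [← h3]; exact hconst _ h1.le
    obtain ⟨k, hk⟩ := h.mb hπ hω 0
    exact h.ne 0 (by rw [← hk, hall k, hall 0])
  · push Not at hc
    classical
    have hx := Nat.find_spec hc
    have hmin := fun j => Nat.find_min hc (m := j)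
    set x := Nat.find hc with hxdef
    have hconst : ∀ j, i ≤ j → j ≤ x → a j = a i := by
      intro j hj
      induction j, hj using Nat.le_induction with
      | base => intro _; rfl
      | succ j hj ih =>
        intro hjx
        rw [← ih (by omega)]
        by_contra hne
        exact hmin j (by omega) ⟨hj, hne⟩
    refine ⟨x % N, Nat.mod_lt _ h.pos, ?_, ?_⟩
    · have e1 : a (x % N + 1) = a (x + 1) := by
        have := periodic_mul h.pa (x / N) (x % N + 1)
        rw [← this]; congr 1
        have := Nat.mod_add_div x N
        rw [mul_comm] at this; omega
      rw [e1, periodic_mod h.pa]; exact hx.2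
    · rw [periodic_mod h.pa]; exact hconst x hx.1 le_rfl

/-- If a vertex were the left contact in two separate stretches of directions, one of the two gaps
between them would be shorter than `π`. By `Supp.between` the vertex would be extreme throughout
this gap, also where the next vertex is the contact. -/
theorem flip_ne (h : Track ω N a b s e) {x y : ℕ} (hxy : x < y) (hyN : y < N)
    (hx : a (x + 1) ≠ a x) (hy : a (y + 1) ≠ a y) : a x ≠ a y := by
  intro hc
  have anti := h.s_anti
  rcases lt_or_ge (s (x + 1) - s y) Real.pi with hd | hd
  · rcases (show y = x + 1 ∨ x + 2 ≤ y by omega) with rfl | hxy'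
    · exact hx hc.symm
    · have h1 : s y ≤ s (x + 1 + 1) := anti.antitone hxy'
      have h2 : s (x + 1 + 1) < s (x + 1) := anti (by omega)
      have p1 := h.supp_a x le_rfl (anti.antitone (by omega))
      have p2 := h.supp_a y (φ := s y) (anti.antitone (by omega)) le_rfl
      rw [← hc] at p2
      have p3 := p2.between p1 h1 h2.le hd
      exact hx ((h.supp_a (x + 1) le_rfl h2.le).unique (h.ma (x + 1)) (h.ma x)
        (h.supp_a (x + 1) h2.le le_rfl) p3 p1 h2 (by linarith))
  · have h0 : s (x + 1) < s x := anti (by omega)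
    have h1 : s (y + 1) < s y := anti (by omega)
    have h3 := h.ps x
    rcases (show y + 1 = x + N ∨ y + 2 ≤ x + N by omega) with hN | hN
    · apply hy
      rw [hN, h.pa, hc]
    · have h4 : s (x + N) ≤ s (y + 1 + 1) := anti.antitone hN
      have h5 : s (y + 1 + 1) < s (y + 1) := anti (by omega)
      have p1 := h.supp_a (x + N) (φ := s (x + N)) (anti.antitone (by omega)) le_rfl
      have p2 := h.supp_a y (φ := s (y + 1)) le_rfl h1.le
      rw [h.pa, hc] at p1
      have p3 := p1.between p2 h4 h5.le (by linarith)
      exact hy ((h.supp_a (y + 1) le_rfl h5.le).unique (h.ma (y + 1)) (h.ma y)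
        (h.supp_a (y + 1) h5.le le_rfl) p3 p2 h5 (by linarith))

/-- Weak support is `supp_a`. A point on the edge line lies between the ends, as directions slightly
off `φ` show. An interior point of the edge could be extreme only in directions parallel to it,
whereas each `a l` is extreme in an interval of directions. -/
theorem edge_strict (h : Track ω N a b s e) {x l : ℕ} (hx : a (x + 1) ≠ a x)
    (h1 : a l ≠ a x) (h2 : a l ≠ a (x + 1)) : cross (a x) (a (x + 1)) (a l) < 0 := by
  obtain ⟨r, hr, er⟩ := h.edge x
  have anti := h.s_anti
  have hr : 0 < r := lt_of_le_of_ne hr (by rintro rfl; apply hx; simp [er])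
  set φ := s (x + 1) with hφ
  have hs1 : φ < s x := anti (by omega)
  have hs2 : s (x + 1 + 1) < φ := anti (by omega)
  have q0 := h.supp_a x hφ.ge hs1.le (a l) ⟨l, rfl⟩
  rw [er, cross_add_cis]
  refine mul_neg_of_pos_of_neg hr (sub_neg.2 (lt_of_le_of_ne q0 fun heq => ?_))
  obtain ⟨y, hy⟩ := exists_eq_add_of_ht_eq heq
  have hy0 : 0 ≤ y := by
    have q1 := h.supp_a x (φ := min (s x) (φ + 1)) (le_min hs1.le (by linarith))
      (min_le_left _ _) (a l) ⟨l, rfl⟩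
    rw [hy, ht_add, ht_real_mul, ht_cis] at q1
    have z1 : min (s x) (φ + 1) ≤ φ + 1 := min_le_right _ _
    have z2 : φ < min (s x) (φ + 1) := lt_min hs1 (by linarith)
    have : Real.sin (φ - min (s x) (φ + 1)) < 0 :=
      Real.sin_neg_of_neg_of_neg_pi_lt (by linarith) (by linarith [Real.pi_gt_three])
    by_contra hc
    have := mul_pos_of_neg_of_neg (not_le.1 hc) this
    linarith
  have hyr : y ≤ r := by
    have q1 := h.supp_a (x + 1) (φ := max (s (x + 1 + 1)) (φ - 1)) (le_max_left _ _)
      (max_le hs2.le (by linarith)) (a l) ⟨l, rfl⟩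
    rw [hy, er, ht_add, ht_real_mul, ht_cis, ht_add, ht_real_mul, ht_cis] at q1
    have z1 : φ - 1 ≤ max (s (x + 1 + 1)) (φ - 1) := le_max_right _ _
    have z2 : max (s (x + 1 + 1)) (φ - 1) < φ := max_lt hs2 (by linarith)
    have : 0 < Real.sin (φ - max (s (x + 1 + 1)) (φ - 1)) :=
      Real.sin_pos_of_pos_of_lt_pi (by linarith) (by linarith [Real.pi_gt_three])
    exact le_of_mul_le_mul_right (by linarith) this
  have hy0 : 0 < y := lt_of_le_of_ne hy0 (by rintro rfl; apply h1; simp [hy])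
  have hyr : y < r := lt_of_le_of_ne hyr (by rintro rfl; apply h2; rw [hy, er])
  have sin0 : ∀ ψ, s (l + 1) ≤ ψ → ψ ≤ s l → Real.sin (φ - ψ) = 0 := by
    intro ψ hψ1 hψ2
    have q1 := h.supp_a l hψ1 hψ2 (a x) ⟨x, rfl⟩
    have q2 := h.supp_a l hψ1 hψ2 (a (x + 1)) ⟨x + 1, rfl⟩
    rw [hy, ht_add, ht_real_mul, ht_cis] at q1 q2
    rw [er, ht_add, ht_real_mul, ht_cis] at q2
    have q1' : 0 ≤ y * Real.sin (φ - ψ) := by linarith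
    have q2' : (r - y) * Real.sin (φ - ψ) ≤ 0 := by linarith
    refine le_antisymm ?_ ?_
    · by_contra hc
      have := mul_pos (sub_pos.2 hyr) (not_le.1 hc); linarith
    · by_contra hc
      have := mul_neg_of_pos_of_neg hy0 (not_le.1 hc); linarith
  have hl : s (l + 1) < s l := anti (by omega)
  have z1 : max (s (l + 1)) (s l - 1) < s l := max_lt hl (by linarith)
  have z2 : s l - 1 ≤ max (s (l + 1)) (s l - 1) := le_max_right _ _
  have e1 := sin0 (s l) hl.le le_rfl
  have e2 := sin0 (max (s (l + 1)) (s l - 1)) (le_max_left _ _) z1.le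
  generalize max (s (l + 1)) (s l - 1) = z at *
  have : 0 < Real.sin (s l - z) :=
    Real.sin_pos_of_pos_of_lt_pi (by linarith) (by linarith [Real.pi_gt_three])
  rw [show s l - z = (φ - z) - (φ - s l) by ring, Real.sin_sub, e1, e2] at this
  linarith

theorem mem_vertexList (hπ : ω < Real.pi) (hω : 0 < ω) (h : Track ω N a b s e) :
    {v | v ∈ vertexList a N} = Set.range a := by
  ext v
  simp only [vertexList, Set.mem_ofPred_eq, List.mem_map, List.mem_filter, List.mem_range,
    decide_eq_true_eq, Set.mem_range]
  constructor
  · rintro ⟨i, -, rfl⟩; exact ⟨i, rfl⟩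
  · rintro ⟨i, rfl⟩
    obtain ⟨x, h1, h2, h3⟩ := h.exists_flip hπ hω i
    exact ⟨x, ⟨h1, h2⟩, h3⟩

/-- The vertices touched by the left arm form a convex polygon. -/
theorem isConvexPolygon (hπ : ω < Real.pi) (hω : 0 < ω) (h : Track ω N a b s e) :
    IsConvexPolygon (vertexList a N) := by
  classical
  have hmem := h.mem_vertexList hπ hω
  obtain ⟨F, hF, hlist, hsort⟩ : ∃ F : List ℕ, (∀ x, x ∈ F ↔ x < N ∧ a (x + 1) ≠ a x) ∧
      vertexList a N = F.map a ∧ F.Pairwise (· < ·) := by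
    refine ⟨(List.range N).filter fun i => a (i + 1) ≠ a i, ?_, ?_, ?_⟩
    · intro x; simp
    · rw [vertexList]
    · exact List.pairwise_lt_range.filter _
  rw [hlist] at hmem ⊢
  have hget : ∀ t (ht : t < F.length), F[t] < N ∧ a (F[t] + 1) ≠ a F[t] :=
    fun t ht => (hF _).1 (List.getElem_mem ht)
  have hmono : ∀ t u (ht : t < F.length) (hu : u < F.length), t < u → F[t] < F[u] :=
    fun t u ht hu htu => List.pairwise_iff_getElem.1 hsort t u ht hu htu
  have hnd : (F.map a).Nodup := by
    rw [List.Nodup, List.pairwise_iff_getElem]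
    intro t u ht hu htu
    simp only [List.length_map] at ht hu
    simp only [List.getElem_map]
    exact h.flip_ne (hmono t u ht hu htu) (hget u hu).1 (hget t ht).2 (hget u hu).2
  have hlen : 2 ≤ (F.map a).length := by
    have h1 : a 0 ∈ {v | v ∈ F.map a} := by rw [hmem]; exact ⟨0, rfl⟩
    have h2 : b 0 ∈ {v | v ∈ F.map a} := by rw [hmem]; exact h.mb hπ hω 0
    have h3 := h.ne 0
    simp only [Set.mem_ofPred_eq] at h1 h2
    generalize F.map a = L at *
    match L, h1, h2 with
    | [x], h1, h2 => simp at h1 h2; exact absurd (h1.trans h2.symm) h3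
    | x :: y :: L, _, _ => simp
  refine isConvexPolygon_of_edges hlen hnd ?_
  intro t ht i hi hit hit'
  have hinj := fun u (hu : u < (F.map a).length) =>
    fun (hiu : i ≠ u) (hc : (F.map a)[i] = (F.map a)[u]) => hiu ((hnd.getElem_inj_iff).1 hc)
  have n1 := hinj t (by omega) hit
  have n2 := hinj (t + 1) ht hit'
  simp only [List.length_map] at ht hi
  simp only [List.getElem_map] at n1 n2 ⊢
  have hnext : a F[t + 1] = a (F[t] + 1) := by
    have hlt := hmono t (t + 1) (by omega) ht (by omega)
    have hconst : ∀ z, F[t] + 1 ≤ z → z ≤ F[t + 1] → a z = a (F[t] + 1) := by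
      intro z hz
      induction z, hz using Nat.le_induction with
      | base => intro _; rfl
      | succ z hz ih =>
        intro hzle
        rw [← ih (by omega)]
        by_contra hne
        have hzF : z ∈ F := (hF z).2 ⟨by have := (hget (t + 1) ht).1; omega, hne⟩
        obtain ⟨u, hu, hz'⟩ := List.getElem_of_mem hzF
        rcases (show u ≤ t ∨ t + 1 ≤ u by omega) with hut | hut
        · rcases hut.lt_or_eq with hut | rfl
          · have := hmono u t hu (by omega) hut; omega
          · omega
        · rcases hut.lt_or_eq with hut | rfl
          · have := hmono (t + 1) u ht hu hut; omega
          · omega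
    exact hconst _ hlt le_rfl
  rw [hnext] at n2 ⊢
  exact h.edge_strict (hget t (by omega)).2 n1 n2

/-- The arcs run through by the apex make up the cloud. -/
theorem isCloud (hπ : ω < Real.pi) (hω : 0 < ω) (h : Track ω N a b s e) {l : List DirArc}
    (hlen : l.length = N) (hseq : IsArcSequence l) (hcw : ∀ A ∈ l, A.clockwise = true)
    (hcen : ∀ i < N, (arcAt l i).center = ctr ω (a i) (b i))
    (hst : ∀ i < N, (arcAt l i).start = apex ω (a i) (b i) (s i))
    (hms : ∀ i < N, (arcAt l i).meas = 2 * (s i - e i)) {vs : List ℂ}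
    (hvs : {v | v ∈ vs} = Set.range a) : IsCloud ω vs l := by
  have hN := h.pos
  have hl : 0 < l.length := by omega
  have hpt : ∀ i < N, ∀ x, (arcAt l i).pt x = apex ω (a i) (b i) (s i - x / 2) := by
    intro i hi x
    rw [apex_sub, ← hst i hi, ← hcen i hi, DirArc.pt]
  have hmem : ∀ v, v ∈ Set.range a → v ∈ vs := by
    intro v hv; rw [← hvs] at hv; exact hv
  have hcar : ∀ i < N, (arcAt l i).carrier = cloudPortion ω vs (a i) (b i) := by
    intro i hi
    rw [DirArc.carrier_eq (hseq.valid hl i) (hcw _ (arcAt_mem hl i))]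
    ext q
    rw [mem_cloudPortion_iff hω hπ (hmem _ ⟨i, rfl⟩) (hmem _ (h.mb hπ hω i)), hvs]
    simp only [Set.mem_ofPred_eq]
    rw [hms i hi]
    constructor
    · rintro ⟨x, h1, h2, rfl⟩
      obtain ⟨p1, p2⟩ := h.supp_ab hπ hω i (φ := s i - x / 2) (by linarith) (by linarith)
      rw [hpt i hi]
      exact ⟨_, isTouch_apex hω hπ ⟨i, rfl⟩ (h.mb hπ hω i) p1 p2⟩
    · rintro ⟨φ, ht⟩
      obtain ⟨m, hm⟩ : ∃ m, i + N = m + 1 := ⟨i + N - 1, by omega⟩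
      have sa := ht.sa
      have sb := ht.sb
      rw [← h.pa, hm] at sa
      rw [← h.pb, hm] at sb
      obtain ⟨n, hn1, hn2⟩ := h.angle_mem_of_touch hπ hω sa sb
      rw [← hm, h.pe] at hn1
      rw [← hm, h.ps] at hn2
      have ht' := ht.add_int (n + 1)
      have hψ : φ + ((n + 1 : ℤ) : ℝ) * (2 * Real.pi) =
        φ + n * (2 * Real.pi) + 2 * Real.pi := by push_cast; ring
      rw [hψ] at ht'
      refine ⟨2 * (s i - (φ + n * (2 * Real.pi) + 2 * Real.pi)), by linarith, by linarith, ?_⟩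
      rw [hpt i hi, ht'.eq_apex hω hπ]
      congr 1; ring
  have hnt : ∀ i < N, (arcAt l i).carrier.Nontrivial := by
    intro i hi
    have hv := hseq.valid hl i
    obtain ⟨m0, m2, m3⟩ := hv.meas_spec
    rw [DirArc.carrier_eq hv (hcw _ (arcAt_mem hl i))]
    exact ⟨_, ⟨0, le_rfl, m0.le, DirArc.pt_zero.symm⟩, _, ⟨_, m0.le, le_rfl, m3⟩, hv.1⟩
  have hrange : ∀ i < N, ∀ φ, e i ≤ φ → φ ≤ s i → s 0 - 2 * Real.pi ≤ φ ∧ φ ≤ s 0 := by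
    intro i hi φ h1 h2
    have h3 := h.s_anti.antitone (Nat.zero_le i)
    have h4 := h.s_anti.antitone (show i + 1 ≤ 0 + N by omega)
    have h5 := h.s_succ_le i
    rw [h.ps] at h4
    constructor <;> linarith
  refine ⟨hseq, hcw, ?_, ?_⟩
  -- The apex in the middle of the arc `i` is not a vertex, so its wedge has a unique direction up
  -- to turns; were it also on the arc `j`, this direction would belong to two disjoint ranges.
  · have aux : ∀ i j, i < j → j < N → (arcAt l i).carrier ≠ (arcAt l j).carrier := by
      intro i j hij hj hc
      have hi : i < N := hij.trans hj
      have hes := h.e_lt_s i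
      set φ := (e i + s i) / 2 with hφ
      obtain ⟨p1, p2⟩ := h.supp_ab hπ hω i (φ := φ) (by linarith) (by linarith)
      obtain ⟨p3, -⟩ := h.supp_ab hπ hω i (φ := s i) (by linarith) (by linarith)
      obtain ⟨-, p4⟩ := h.supp_ab hπ hω i (φ := e i) (by linarith) (by linarith)
      have t := isTouch_apex hω hπ (h.ma i) (h.mb hπ hω i) p1 p2
      set q := apex ω (a i) (b i) φ with hq
      have hqV : q ∉ Set.range a := by
        intro hqV
        have e1 := t.eq_left_of_mem hω hπ hqV p3 (by linarith) (by linarith [h.s_lt_e i])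
        have e2 := t.eq_right_of_mem hω hπ hqV p4 (by linarith) (by linarith [h.s_lt_e i])
        exact h.ne i (e1.trans e2.symm)
      have hqj : q ∈ (arcAt l j).carrier := by
        rw [← hc, hcar i hi, mem_cloudPortion_iff hω hπ (hmem _ ⟨i, rfl⟩) (hmem _ (h.mb hπ hω i)),
          hvs]
        exact ⟨_, t⟩
      rw [hcar j hj, mem_cloudPortion_iff hω hπ (hmem _ ⟨j, rfl⟩) (hmem _ (h.mb hπ hω j)), hvs]
        at hqj
      obtain ⟨ψ, t'⟩ := hqj
      obtain ⟨m, hm⟩ : ∃ m, j + N = m + 1 := ⟨j + N - 1, by omega⟩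
      have sa := t'.sa
      have sb := t'.sb
      rw [← h.pa, hm] at sa
      rw [← h.pb, hm] at sb
      obtain ⟨n, hn1, hn2⟩ := h.angle_mem_of_touch hπ hω sa sb
      rw [← hm, h.pe] at hn1
      rw [← hm, h.ps] at hn2
      obtain ⟨k, hk⟩ := t.angle_unique hω hπ t' (fun hc => hqV (hc ▸ ⟨i, rfl⟩))
        (fun hc => hqV (hc ▸ ⟨j, rfl⟩))
      have r1 := hrange i hi φ (by linarith) (by linarith)
      have r2 := hrange j hj (ψ + n * (2 * Real.pi) + 2 * Real.pi) (by linarith) (by linarith)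
      have r3 : e i < φ := by linarith
      have r4 : φ < s i := by linarith
      have h3 := h.s_anti.antitone (Nat.zero_le i)
      have h4 := h.s_anti.antitone (show i + 1 ≤ 0 + N by omega)
      have h5 := h.s_succ_le i
      rw [h.ps] at h4
      have := DirArc.eq_of_int_mul (x := ψ + n * (2 * Real.pi) + 2 * Real.pi) (y := φ)
        (k := k + n + 1) (by push_cast; linarith) (by linarith) (by linarith)
      have h6 := h.s_anti.antitone (show i + 1 ≤ j by omega)
      linarith
    rw [List.Nodup, List.pairwise_iff_getElem]
    intro i j hi hj hij
    simp only [List.length_map] at hi hj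
    simp only [List.getElem_map]
    rw [← arcAt_of_lt hi, ← arcAt_of_lt hj]
    exact aux i j hij (by omega)
  · intro S
    constructor
    · intro hS
      obtain ⟨A, hA, rfl⟩ := List.mem_map.1 hS
      obtain ⟨i, hi, rfl⟩ := List.getElem_of_mem hA
      rw [← arcAt_of_lt hi]
      exact ⟨a i, hmem _ ⟨i, rfl⟩, b i, hmem _ (h.mb hπ hω i), hcar i (by omega),
        hnt i (by omega)⟩
    · rintro ⟨v, hv, w, hw, rfl, p, hp, q, hq, hpq⟩
      rw [mem_cloudPortion_iff hω hπ hv hw, hvs] at hp hq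
      have hv' : v ∈ Set.range a := by rw [← hvs]; exact hv
      have hw' : w ∈ Set.range a := by rw [← hvs]; exact hw
      obtain ⟨φ, hφ⟩ := hp
      obtain ⟨ψ, hψ⟩ := hq
      have hvw : v ≠ w := by
        rintro rfl
        apply hpq
        rw [hφ.eq_apex hω hπ, hψ.eq_apex hω hπ, apex_self hω hπ, apex_self hω hπ]
      -- Two distinct apices of the portion have directions that, up to turns, differ by less than
      -- `π`: a difference of exactly `π` would give the same apex. Both contacts then persist over
      -- the interval between.
      obtain ⟨n, hn1, hn2⟩ := exists_int_shift (ψ - (φ + Real.pi))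
      have hψ := hψ.add_int n
      rw [show ψ - (φ + Real.pi) + n * (2 * Real.pi) =
        ψ + n * (2 * Real.pi) - (φ + Real.pi) by ring] at hn1 hn2
      generalize ψ + n * (2 * Real.pi) = χ at *
      have hne : χ - φ ≠ 0 := by
        intro h0
        apply hpq
        rw [hφ.eq_apex hω hπ, hψ.eq_apex hω hπ]; congr 1; linarith
      have hne' : χ - φ ≠ Real.pi := by
        intro h0
        apply hpq
        rw [hφ.eq_apex hω hπ, hψ.eq_apex hω hπ, apex, apex, ← cis_add_two_pi (2 * φ)]
        congr 3; linarith
      have key : ∃ k < N, v = a k ∧ w = b k := by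
        rcases lt_or_gt_of_ne hne with hlt | hgt
        · exact h.exists_arc_of_interval hπ hω hv' hw' hvw (x := χ) (y := φ) (by linarith)
            (by linarith)
            (fun z h1 h2 => hψ.sa.between hφ.sa h1 h2 (by linarith))
            (fun z h1 h2 => hψ.sb.between hφ.sb (by linarith) (by linarith) (by linarith))
        · have : χ - φ < Real.pi := lt_of_le_of_ne (by linarith) hne'
          exact h.exists_arc_of_interval hπ hω hv' hw' hvw (x := φ) (y := χ) (by linarith)
            (by linarith)
            (fun z h1 h2 => hφ.sa.between hψ.sa h1 h2 (by linarith))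
            (fun z h1 h2 => hφ.sb.between hψ.sb (by linarith) (by linarith) (by linarith))
      obtain ⟨k, hk, rfl, rfl⟩ := key
      rw [← hcar k hk]
      exact List.mem_map_of_mem (arcAt_mem hl k)

end Track
end
end OmegaCloud

namespace OmegaCloud
open Complex (I)
open scoped ComplexConjugate

/-! ### The simulation of the rotating wedge along a sequence of arcs -/

/-- The state of the simulation: the index `k` of the current arc, the angle `τ` on its circle
from the apex to the vertex touched by the left arm, the angle `u` from the apex to the end of the
arc, and the angle `ρ` by which the wedge has been rotated. -/
@[ext] structure Sim where
  k : ℕ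
  τ : ℝ
  u : ℝ
  ρ : ℝ

/-- The second intersection of the circle about `c` through `q` with the line through `q` of
direction `w`. -/
noncomputable def lineHit (c q w : ℂ) : ℂ := c - conj (q - c) * (w / conj w)

namespace Sim

/-- The apex. -/
noncomputable def q (l : List DirArc) (S : Sim) : ℂ :=
  (arcAt l S.k).center + ((arcAt l S.k).finish - (arcAt l S.k).center) * cis S.u

/-- The vertex touched by the left arm. -/
noncomputable def a (l : List DirArc) (S : Sim) : ℂ :=
  (arcAt l S.k).center + ((arcAt l S.k).finish - (arcAt l S.k).center) * cis (S.u - S.τ)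

/-- The vertex touched by the right arm. -/
noncomputable def b (ω : ℝ) (l : List DirArc) (S : Sim) : ℂ :=
  (arcAt l S.k).center + ((arcAt l S.k).finish - (arcAt l S.k).center) *
    cis (S.u - S.τ + 2 * (Real.pi - ω))

/-- The vertex touched by the left arm after a transition to the next arc without rotation. -/
noncomputable def nextA (l : List DirArc) (S : Sim) : ℂ :=
  lineHit (arcAt l (S.k + 1)).center (arcAt l S.k).finish (S.a l - (arcAt l S.k).finish)

/-- The direction in which the right arm leaves a vertex, up to a rotation. -/
noncomputable def pivotIn (ω : ℝ) (l : List DirArc) (S : Sim) : ℂ :=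
  ((arcAt l S.k).finish - (arcAt l S.k).center) * cis (Real.pi - ω)

/-- If the left arm turns from `e` to `s'`, then `pivotIn` and `pivotOut` have the polar angles `e +
(π - ω) + π / 2` and `s' + (π - ω) + π / 2`, so the clockwise angle between them is the turn. -/
noncomputable def pivotOut (l : List DirArc) (S : Sim) : ℂ :=
  (arcAt l S.k).finish - (arcAt l (S.k + 1)).center

open Classical in
/-- The next state, at the next event. -/
noncomputable def step (ω : ℝ) (l : List DirArc) (S : Sim) : Sim :=
  -- The apex meets the left vertex before the end of the arc. It has to go on along the same
  -- circle, which forces a turn by `π - ω`; afterwards the apex is the right vertex and the new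
  -- left vertex is `2 (π - ω)` ahead.
  if S.τ < S.u then ⟨S.k, 2 * (Real.pi - ω), S.u - S.τ, S.ρ + S.τ / 2 + (Real.pi - ω)⟩
  -- The arc ends away from the left vertex. The line of the left arm persists, and the new left
  -- vertex is its second intersection with the next circle.
  else if S.u < S.τ then
    ⟨S.k + 1, cwAngle (S.pivotOut l) (S.nextA l - (arcAt l (S.k + 1)).center),
      (arcAt l (S.k + 1)).meas, S.ρ + S.u / 2⟩
  -- The arc ends at the left vertex; the turn about it is read off the two radii.
  else ⟨S.k + 1, 2 * (Real.pi - ω), (arcAt l (S.k + 1)).meas,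
    S.ρ + S.u / 2 + unAngle (S.pivotIn ω l) (S.pivotOut l)⟩

/-- The conditions that are checked at an event. -/
def Ok (ω : ℝ) (l : List DirArc) (S : Sim) : Prop :=
  S.τ < S.u ∨ ((arcAt l (S.k + 1)).clockwise = true ∧
    ¬ SameCircle (arcAt l S.k) (arcAt l (S.k + 1)) ∧
    -- In a clockwise turn the left contact can only move away from the apex.
    (S.u < S.τ → 0 ≤ ((S.nextA l - S.a l) * conj (S.a l - (arcAt l S.k).finish)).re) ∧
    (S.u = S.τ → (S.pivotOut l * conj (S.pivotIn ω l)).im ≤ 0 ∧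
      unAngle (S.pivotIn ω l) (S.pivotOut l) ≤ ω))

/-- The rotation at the next event, before the wedge is turned about a vertex. -/
noncomputable def eps (S : Sim) : ℝ := S.ρ + min S.τ S.u / 2

end Sim

/-- The sequence of the states of the simulation. -/
noncomputable def sim (ω : ℝ) (l : List DirArc) (τ : ℝ) (i : ℕ) : Sim :=
  (Sim.step ω l)^[i] ⟨0, τ, (arcAt l 0).meas, 0⟩

theorem sim_zero (ω : ℝ) (l : List DirArc) (τ : ℝ) :
    sim ω l τ 0 = ⟨0, τ, (arcAt l 0).meas, 0⟩ := rfl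

theorem sim_succ (ω : ℝ) (l : List DirArc) (τ : ℝ) (i : ℕ) :
    sim ω l τ (i + 1) = (sim ω l τ i).step ω l := Function.iterate_succ_apply' _ _ _

/-- The simulation has gone round once, all conditions were met, and it has returned to its initial
position. -/
structure Returns (ω : ℝ) (l : List DirArc) (τ : ℝ) (N : ℕ) : Prop where
  pos : 0 < τ
  le : τ ≤ 2 * Real.pi
  kN : (sim ω l τ N).k = l.length
  klt : ∀ i < N, (sim ω l τ i).k < l.length
  ok : ∀ i < N, (sim ω l τ i).Ok ω l
  τN : (sim ω l τ N).τ = τ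
  ρN : (sim ω l τ N).ρ = 2 * Real.pi

/-- Moreover, the same polygon is touched by both arms. -/
structure Passes (ω : ℝ) (l : List DirArc) (τ : ℝ) (N : ℕ) : Prop extends Returns ω l τ N where
  lag : ∀ i < N, ∀ j x, (sim ω l τ i).ρ < x → x < (sim ω l τ (i + 1)).ρ →
    (∀ j', j = j' + 1 → (sim ω l τ j').eps < x + (Real.pi - ω)) →
    x + (Real.pi - ω) < (sim ω l τ j).eps → (sim ω l τ i).a l = (sim ω l τ j).b ω l

namespace Sim
variable {ω : ℝ} {l : List DirArc} {S : Sim}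

theorem step_hidden (h : S.τ < S.u) : S.step ω l =
    ⟨S.k, 2 * (Real.pi - ω), S.u - S.τ, S.ρ + S.τ / 2 + (Real.pi - ω)⟩ := if_pos h

theorem step_flip (h : S.u < S.τ) : S.step ω l =
    ⟨S.k + 1, cwAngle (S.pivotOut l) (S.nextA l - (arcAt l (S.k + 1)).center),
      (arcAt l (S.k + 1)).meas, S.ρ + S.u / 2⟩ := by
  rw [step, if_neg h.not_gt, if_pos h]

theorem step_pivot (h : S.u = S.τ) : S.step ω l =
    ⟨S.k + 1, 2 * (Real.pi - ω), (arcAt l (S.k + 1)).meas,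
      S.ρ + S.u / 2 + unAngle (S.pivotIn ω l) (S.pivotOut l)⟩ := by
  rw [step, if_neg h.not_gt, if_neg h.not_lt]

/-- The invariant of the simulation: `s` is the direction of the left arm. -/
structure Inv (l : List DirArc) (S : Sim) (s : ℝ) : Prop where
  τ0 : 0 < S.τ
  τ2 : S.τ ≤ 2 * Real.pi
  u0 : 0 < S.u
  um : S.u ≤ (arcAt l S.k).meas
  ang : ∃ R : ℝ, 0 < R ∧ (arcAt l S.k).finish - (arcAt l S.k).center =
    R * cis (s + S.τ / 2 + Real.pi / 2 - S.u)

theorem cis_sub_cis (m d : ℝ) : cis (m - d) - cis (m + d) =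
    ((2 * Real.sin d : ℝ) : ℂ) * cis (m - Real.pi / 2) := by
  apply Complex.ext
  · rw [Complex.re_ofReal_mul]
    simp [Real.cos_sub, Real.cos_add]; ring
  · rw [Complex.im_ofReal_mul]
    simp [Real.sin_sub, Real.sin_add]; ring

/-- Seen from the centre, the apex and the left vertex have the polar angles `s + τ / 2 + π / 2` and
`s - τ / 2 + π / 2`, so the chord between them has direction `s` (`Inv.a_eq`, `Inv.a_sub_q`). -/
theorem Inv.q_eq {s R : ℝ} (hR : (arcAt l S.k).finish - (arcAt l S.k).center =
    R * cis (s + S.τ / 2 + Real.pi / 2 - S.u)) :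
    S.q l = (arcAt l S.k).center + R * cis (s + S.τ / 2 + Real.pi / 2) := by
  rw [q, hR, mul_assoc, ← cis_add]; congr 3; ring

theorem Inv.a_eq {s R : ℝ} (hR : (arcAt l S.k).finish - (arcAt l S.k).center =
    R * cis (s + S.τ / 2 + Real.pi / 2 - S.u)) :
    S.a l = (arcAt l S.k).center + R * cis (s - S.τ / 2 + Real.pi / 2) := by
  rw [a, hR, mul_assoc, ← cis_add]; congr 3; ring

theorem Inv.a_sub_q {s R : ℝ} (hR : (arcAt l S.k).finish - (arcAt l S.k).center =
    R * cis (s + S.τ / 2 + Real.pi / 2 - S.u)) :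
    S.a l = S.q l + ((2 * R * Real.sin (S.τ / 2) : ℝ) : ℂ) * cis s := by
  rw [Inv.q_eq hR, Inv.a_eq hR]
  have := cis_sub_cis (s + Real.pi / 2) (S.τ / 2)
  rw [show s + Real.pi / 2 - S.τ / 2 = s - S.τ / 2 + Real.pi / 2 by ring,
    show s + Real.pi / 2 + S.τ / 2 = s + S.τ / 2 + Real.pi / 2 by ring,
    show s + Real.pi / 2 - Real.pi / 2 = s by ring] at this
  push_cast at this ⊢
  linear_combination (R : ℂ) * this

theorem Inv.a_sub_finish {s R : ℝ} (hR : (arcAt l S.k).finish - (arcAt l S.k).center =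
    R * cis (s + S.τ / 2 + Real.pi / 2 - S.u)) :
    S.a l - (arcAt l S.k).finish =
      ((2 * R * Real.sin ((S.τ - S.u) / 2) : ℝ) : ℂ) * cis (s - S.u / 2) := by
  rw [Inv.a_eq hR]
  have := cis_sub_cis (s - S.u / 2 + Real.pi / 2) ((S.τ - S.u) / 2)
  rw [show s - S.u / 2 + Real.pi / 2 - (S.τ - S.u) / 2 = s - S.τ / 2 + Real.pi / 2 by ring,
    show s - S.u / 2 + Real.pi / 2 + (S.τ - S.u) / 2 = s + S.τ / 2 + Real.pi / 2 - S.u by ring,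
    show s - S.u / 2 + Real.pi / 2 - Real.pi / 2 = s - S.u / 2 by ring] at this
  push_cast at this ⊢
  linear_combination (R : ℂ) * this - hR

theorem ctr_ab (h0 : 0 < ω) (hπ : ω < Real.pi) : ctr ω (S.a l) (S.b ω l) = (arcAt l S.k).center := by
  rw [a, b, cis_add, ← mul_assoc]
  exact ctr_of_rotation h0 hπ _ _

theorem Inv.apex_eq (h0 : 0 < ω) (hπ : ω < Real.pi) {s : ℝ} (h : Inv l S s) :
    apex ω (S.a l) (S.b ω l) s = S.q l := by
  obtain ⟨R, -, hR⟩ := h.ang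
  rw [apex, ctr_ab h0 hπ, Inv.q_eq hR, Inv.a_eq hR, add_sub_cancel_left, map_mul, conj_cis,
    Complex.conj_ofReal, mul_assoc, ← cis_add, sub_eq_add_neg, ← mul_neg, ← cis_add_pi]
  congr 3; ring

theorem Inv.a_ne_b (h0 : 0 < ω) (hπ : ω < Real.pi) {s : ℝ} (h : Inv l S s) :
    S.a l ≠ S.b ω l := by
  obtain ⟨R, hR0, hR⟩ := h.ang
  intro hc
  rw [a, b, cis_add, ← mul_assoc] at hc
  have h1 := add_left_cancel hc
  have hne : ((arcAt l S.k).finish - (arcAt l S.k).center) * cis (S.u - S.τ) ≠ 0 := by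
    rw [hR]
    refine mul_ne_zero (mul_ne_zero ?_ (cis_ne_zero _)) (cis_ne_zero _)
    exact_mod_cast hR0.ne'
  have h2 : cis (2 * (Real.pi - ω)) = cis 0 := by
    rw [cis_zero]
    exact mul_left_cancel₀ hne (by rw [mul_one]; exact h1.symm)
  obtain ⟨k, hk⟩ := cis_eq_iff.1 h2
  have := DirArc.eq_of_int_mul hk (by linarith) (by linarith)
  linarith

theorem finish_sub_meas (hv : (arcAt l S.k).Valid) :
    ((arcAt l S.k).finish - (arcAt l S.k).center) * cis (arcAt l S.k).meas =
      (arcAt l S.k).start - (arcAt l S.k).center := by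
  conv_lhs => rw [hv.meas_spec.2.2, DirArc.pt, add_sub_cancel_left, mul_assoc, cis_neg_mul, mul_one]

theorem q_of_meas (hv : (arcAt l S.k).Valid) (hu : S.u = (arcAt l S.k).meas) :
    S.q l = (arcAt l S.k).start := by
  rw [q, hu, finish_sub_meas hv]; ring

/-- For `lineHit` only the line of the vector matters: the quotient does not depend on `r`, not even
on its sign. -/
theorem div_conj {r x : ℝ} (hr : r ≠ 0) :
    ((r : ℂ) * cis x) / conj ((r : ℂ) * cis x) = cis (2 * x) := by
  rw [map_mul, Complex.conj_ofReal, conj_cis]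
  have hr' : (r : ℂ) ≠ 0 := by exact_mod_cast hr
  rw [div_eq_iff (mul_ne_zero hr' (cis_ne_zero _)), two_mul, cis_add]
  have := cis_mul_neg x
  linear_combination (-(r : ℂ) * cis x) * this

/-- The outcome of an event at the end of an arc without rotation about a vertex. -/
theorem Inv.flip {s : ℝ} (hseq : IsArcSequence l) (hl : 0 < l.length) (h : Inv l S s)
    (hc : S.u < S.τ)
    (hok : 0 ≤ ((S.nextA l - S.a l) * conj (S.a l - (arcAt l S.k).finish)).re) :
    Inv l (S.step ω l) (s - S.u / 2) ∧
      ∃ r : ℝ, 0 ≤ r ∧ (S.step ω l).a l = S.a l + r * cis (s - S.u / 2) := by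
  obtain ⟨R, hR0, hR⟩ := h.ang
  have hv' := hseq.valid hl (S.k + 1)
  have hlink := hseq.link hl S.k
  have hu := h.u0
  have hτ := h.τ2
  set r1 := 2 * R * Real.sin ((S.τ - S.u) / 2) with hr1
  have hr1pos : 0 < r1 := mul_pos (by linarith)
    (Real.sin_pos_of_pos_of_lt_pi (by linarith) (by linarith))
  have haf : S.a l - (arcAt l S.k).finish = (r1 : ℂ) * cis (s - S.u / 2) := Inv.a_sub_finish hR
  set c' := (arcAt l (S.k + 1)).center with hc'
  set f := (arcAt l S.k).finish with hf
  have hfc : f - c' ≠ 0 := by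
    rw [hlink]; exact hv'.start_sub_ne
  have hnA : S.nextA l = c' - conj (f - c') * cis (2 * (s - S.u / 2)) := by
    rw [nextA, lineHit, ← hf, haf, div_conj hr1pos.ne']
  -- If the line of the left arm were tangent to the next circle, `nextA` would be the apex itself
  -- and the checked scalar product would be negative.
  have hne : f ≠ S.nextA l := by
    intro hcon
    rw [← hcon, ← neg_sub, neg_mul, Complex.neg_re, haf, Complex.mul_conj] at hok
    have : 0 < Complex.normSq ((r1 : ℂ) * cis (s - S.u / 2)) := by
      rw [Complex.normSq_pos]
      exact mul_ne_zero (by exact_mod_cast hr1pos.ne') (cis_ne_zero _)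
    rw [Complex.ofReal_re] at hok
    linarith
  have hnorm : ‖f - c'‖ = ‖S.nextA l - c'‖ := by
    rw [hnA, sub_sub_cancel_left, norm_neg, norm_mul, norm_cis, mul_one, Complex.norm_conj]
  obtain ⟨t0, t2, ht⟩ := cwAngle_spec hfc hnorm (fun hcon => hne (sub_left_injective hcon))
  rw [step_flip hc]
  set τ' := cwAngle (f - c') (S.nextA l - c') with hτ'
  have hpo : S.pivotOut l = f - c' := rfl
  -- the phase of `f - c'`
  obtain ⟨y, hy⟩ : ∃ y : ℝ, f - c' = y * cis (s - S.u / 2 + τ' / 2 + Real.pi / 2) := by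
    set Z := (f - c') * cis (-(s - S.u / 2 + τ' / 2 + Real.pi / 2)) with hZ
    have e1 : Z * cis (s - S.u / 2 + τ' / 2 + Real.pi / 2) = f - c' := by
      rw [hZ, mul_assoc, cis_neg_mul, mul_one]
    have e2 : conj Z = Z := by
      have h1 : (f - c') * cis (-τ') = -(conj (f - c') * cis (2 * (s - S.u / 2))) := by
        rw [← ht, hnA]; ring
      rw [hZ, map_mul, conj_cis, neg_neg]
      have h2 : conj (f - c') = -((f - c') * cis (-τ') * cis (-(2 * (s - S.u / 2)))) := by
        rw [h1, neg_mul, neg_neg, mul_assoc, cis_mul_neg, mul_one]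
      rw [h2, neg_mul, mul_assoc, mul_assoc, ← cis_add, ← cis_add, ← mul_neg, ← cis_add_pi,
        ← cis_add_two_pi (-(s - S.u / 2 + τ' / 2 + Real.pi / 2))]
      congr 2; ring
    obtain ⟨y, hy⟩ := Complex.conj_eq_iff_real.1 e2
    exact ⟨y, by rw [← hy, e1]⟩
  have hfin : (arcAt l (S.k + 1)).finish - c' =
      y * cis (s - S.u / 2 + τ' / 2 + Real.pi / 2 - (arcAt l (S.k + 1)).meas) := by
    have e := hv'.meas_spec.2.2
    rw [cis_sub, ← mul_assoc, ← hy, hlink, e]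
    simp only [DirArc.pt]
    ring
  have hq' : (Sim.mk (S.k + 1) τ' (arcAt l (S.k + 1)).meas (S.ρ + S.u / 2)).q l = f := by
    rw [q_of_meas hv' rfl, hlink]
  have hasub := Inv.a_sub_q (S := Sim.mk (S.k + 1) τ' (arcAt l (S.k + 1)).meas (S.ρ + S.u / 2))
    (s := s - S.u / 2) (R := y) hfin
  have hanext : (Sim.mk (S.k + 1) τ' (arcAt l (S.k + 1)).meas (S.ρ + S.u / 2)).a l = S.nextA l := by
    have : S.nextA l = c' + (f - c') * cis (-τ') := by rw [← ht]; ring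
    rw [this, a]
    simp only
    rw [cis_sub, ← mul_assoc, finish_sub_meas (S := Sim.mk (S.k + 1) τ' 0 0) hv', hlink]
  rw [hq', hanext] at hasub
  simp only at hasub
  set r2 := 2 * y * Real.sin (τ' / 2) with hr2
  have hok' : 0 ≤ (r2 - r1) * r1 := by
    have e1 : S.nextA l - S.a l = ((r2 - r1 : ℝ) : ℂ) * cis (s - S.u / 2) := by
      push_cast; linear_combination hasub - haf
    rw [e1, haf, map_mul, Complex.conj_ofReal] at hok
    have e2 : ((r2 - r1 : ℝ) : ℂ) * cis (s - S.u / 2) * ((r1 : ℂ) * conj (cis (s - S.u / 2))) =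
        (((r2 - r1) * r1 : ℝ) : ℂ) := by
      have := cis_mul_neg (s - S.u / 2)
      rw [conj_cis]; push_cast
      linear_combination ((r2 : ℂ) - r1) * r1 * this
    rwa [e2, Complex.ofReal_re] at hok
  have hr21 : 0 ≤ r2 - r1 := nonneg_of_mul_nonneg_left hok' hr1pos
  -- The phase is known up to a real factor `y` only; its sign follows from `0 < r1 ≤ r2 = 2 y sin
  -- (τ' / 2)`.
  have hy0 : 0 < y := by
    have hs : 0 < Real.sin (τ' / 2) :=
      Real.sin_pos_of_pos_of_lt_pi (by linarith) (by linarith)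
    by_contra hcon
    have := mul_nonpos_of_nonpos_of_nonneg (not_lt.1 hcon) hs.le
    linarith
  rw [hpo]
  refine ⟨⟨t0, t2.le, hv'.meas_spec.1, le_rfl, y, hy0, hfin⟩, r2 - r1, hr21, ?_⟩
  rw [hanext]; push_cast
  linear_combination hasub - haf

/-- The outcome of a rotation about a vertex. -/
theorem Inv.pivot {s J : ℝ} {S' : Sim} (h0 : 0 < ω) (hπ : ω < Real.pi)
    (hτ' : S'.τ = 2 * (Real.pi - ω)) (hu : 0 < S'.u)
    (hum : S'.u ≤ (arcAt l S'.k).meas) (hq : S'.q l = S.a l)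
    (hR : ∃ R : ℝ, 0 < R ∧ (arcAt l S'.k).finish - (arcAt l S'.k).center =
      R * cis (s - J + (Real.pi - ω) + Real.pi / 2 - S'.u)) :
    Inv l S' (s - J) ∧ S.a l = S'.b ω l ∧
      ∃ r : ℝ, 0 < r ∧ S'.a l = S.a l + r * cis (s - J) := by
  obtain ⟨R, hR0, hR⟩ := hR
  have e : s - J + (Real.pi - ω) = s - J + S'.τ / 2 := by rw [hτ']; ring
  rw [e] at hR
  refine ⟨⟨by rw [hτ']; linarith, by rw [hτ']; linarith, hu, hum, R, hR0, hR⟩, ?_, ?_⟩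
  · rw [← hq, q, b, hτ', sub_add_cancel]
  · refine ⟨2 * R * Real.sin (S'.τ / 2), ?_, ?_⟩
    · refine mul_pos (by linarith) (Real.sin_pos_of_pos_of_lt_pi ?_ ?_) <;> rw [hτ'] <;> linarith
    · rw [← hq]; exact Inv.a_sub_q hR

theorem Inv.step_of_lt {s : ℝ} (h0 : 0 < ω) (hπ : ω < Real.pi) (h : Inv l S s) (hc : S.τ < S.u) :
    Inv l (S.step ω l) (s - (S.τ / 2 + (Real.pi - ω))) ∧ S.a l = (S.step ω l).b ω l ∧
      ∃ r : ℝ, 0 < r ∧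
        (S.step ω l).a l = S.a l + r * cis (s - (S.τ / 2 + (Real.pi - ω))) := by
  rw [step_hidden hc]
  obtain ⟨R, hR0, hR⟩ := h.ang
  refine Inv.pivot h0 hπ rfl (by simpa using hc) ?_ rfl ⟨R, hR0, ?_⟩
  · have := h.um
    have := h.τ0
    simp only
    linarith
  · rw [hR]; congr 2; simp only; ring

theorem Inv.step_of_eq {s : ℝ} (h0 : 0 < ω) (hπ : ω < Real.pi) (hseq : IsArcSequence l)
    (hl : 0 < l.length) (h : Inv l S s) (hc : S.u = S.τ)
    (hok : (S.pivotOut l * conj (S.pivotIn ω l)).im ≤ 0) :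
    Inv l (S.step ω l) (s - (S.u / 2 + unAngle (S.pivotIn ω l) (S.pivotOut l))) ∧
      S.a l = (S.step ω l).b ω l ∧
      ∃ r : ℝ, 0 < r ∧ (S.step ω l).a l = S.a l + r * cis (s - (S.u / 2 +
        unAngle (S.pivotIn ω l) (S.pivotOut l))) := by
  rw [step_pivot hc]
  obtain ⟨R, hR0, hR⟩ := h.ang
  have hv' := hseq.valid hl (S.k + 1)
  have hlink := hseq.link hl S.k
  have hz : S.pivotIn ω l ≠ 0 := by
    rw [pivotIn, hR]
    refine mul_ne_zero (mul_ne_zero ?_ (cis_ne_zero _)) (cis_ne_zero _)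
    exact_mod_cast hR0.ne'
  have hw : S.pivotOut l ≠ 0 := by
    rw [pivotOut, hlink]; exact hv'.start_sub_ne
  obtain ⟨hJ0, hJ⟩ := unAngle_spec hz hw hok
  refine Inv.pivot h0 hπ rfl hv'.meas_spec.1 le_rfl ?_ ?_
  · rw [q_of_meas hv' rfl, ← hlink, a, hc, sub_self, cis_zero]; ring
  · simp only
    refine ⟨‖S.pivotOut l‖ / ‖S.pivotIn ω l‖ * R,
      mul_pos (div_pos (norm_pos_iff.2 hw) (norm_pos_iff.2 hz)) hR0, ?_⟩
    have e := hv'.meas_spec.2.2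
    have e2 : (arcAt l (S.k + 1)).finish - (arcAt l (S.k + 1)).center =
        S.pivotOut l * cis (-(arcAt l (S.k + 1)).meas) := by
      rw [pivotOut, hlink, e]
      simp only [DirArc.pt]
      ring
    rw [e2]
    clear hJ0 hok
    generalize unAngle (S.pivotIn ω l) (S.pivotOut l) = J at hJ ⊢
    generalize ‖S.pivotOut l‖ / ‖S.pivotIn ω l‖ = g at hJ ⊢
    rw [hJ, pivotIn, hR]
    push_cast
    have : cis (s - (S.u / 2 + J) + (Real.pi - ω) + Real.pi / 2 - (arcAt l (S.k + 1)).meas) =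
        cis (s + S.τ / 2 + Real.pi / 2 - S.u) * cis (Real.pi - ω) * cis (-J) *
          cis (-(arcAt l (S.k + 1)).meas) := by
      rw [← cis_add, ← cis_add, ← cis_add, hc]; congr 1; ring
    rw [this]; ring

end Sim
end OmegaCloud

namespace OmegaCloud
open Complex (I)
open scoped ComplexConjugate

/-! ### One step of the simulation, and its invariance under a full round -/

namespace Sim
variable {ω : ℝ} {l : List DirArc} {S : Sim}

/-- The circular arc run through by the apex until the next event. -/
noncomputable def micro (l : List DirArc) (S : Sim) : DirArc :=
  ⟨(arcAt l S.k).center, S.q l, (arcAt l S.k).center +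
    ((arcAt l S.k).finish - (arcAt l S.k).center) * cis (S.u - min S.τ S.u), true⟩

theorem eps_le_step (hπ : ω < Real.pi) : S.eps ≤ (S.step ω l).ρ := by
  unfold eps
  rcases lt_trichotomy S.τ S.u with h | h | h
  · rw [step_hidden h, min_eq_left h.le]; simp only; linarith
  · rw [step_pivot h.symm, h, min_self]
    have : 0 ≤ unAngle (S.pivotIn ω l) (S.pivotOut l) := Real.arccos_nonneg _
    simp only; linarith
  · rw [step_flip h, min_eq_right h.le]

theorem step_q (hseq : IsArcSequence l) (hl : 0 < l.length) :
    (S.step ω l).q l = (S.micro l).finish := by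
  have hv' := hseq.valid hl (S.k + 1)
  have hlink := hseq.link hl S.k
  unfold micro
  rcases lt_or_ge S.τ S.u with h | h
  · rw [step_hidden h, min_eq_left h.le, q]
  · simp only [min_eq_right h, sub_self, cis_zero, mul_one, add_sub_cancel]
    rw [hlink]
    rcases h.eq_or_lt with h | h
    · rw [step_pivot h, q_of_meas hv' rfl]
    · rw [step_flip h, q_of_meas hv' rfl]

/-- Apart from the invariant for the next state, the conclusions are the fields `edge`, `gap` and
`ne_succ` of a `Track`. -/
theorem Inv.step {s : ℝ} (h0 : 0 < ω) (hπ : ω < Real.pi) (hseq : IsArcSequence l)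
    (hl : 0 < l.length) (h : Inv l S s) (hok : S.Ok ω l) :
    Inv l (S.step ω l) (s + S.ρ - (S.step ω l).ρ) ∧
      (∃ r : ℝ, 0 ≤ r ∧ (S.step ω l).a l = S.a l + r * cis (s + S.ρ - (S.step ω l).ρ)) ∧
      (S.eps < (S.step ω l).ρ → S.a l = (S.step ω l).b ω l) ∧
      ((S.step ω l).a l = S.a l → (S.step ω l).b ω l ≠ S.b ω l) := by
  -- The two contacts determine the circle, so a change of the circle forces a change of the pair.
  have hsame : ¬ SameCircle (arcAt l S.k) (arcAt l (S.k + 1)) → (S.step ω l).k = S.k + 1 →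
      ((S.step ω l).a l = S.a l → (S.step ω l).b ω l ≠ S.b ω l) := by
    intro hns hk ha hb
    apply hns
    have e1 := ctr_ab (S := S) (l := l) h0 hπ
    have e2 := ctr_ab (S := S.step ω l) (l := l) h0 hπ
    rw [ha, hb, e1, hk] at e2
    refine ⟨e2, ?_⟩
    have nrm : ∀ T : Sim, ‖T.a l - (arcAt l T.k).center‖ =
        dist (arcAt l T.k).start (arcAt l T.k).center := by
      intro T
      rw [(hseq.valid hl T.k).2, dist_eq_norm, a, add_sub_cancel_left, norm_mul, norm_cis, mul_one]
    rw [← nrm S, ← hk, ← nrm (S.step ω l), ha, hk, e2]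
  rcases lt_trichotomy S.τ S.u with hc | hc | hc
  · obtain ⟨h1, h2, r, hr, h3⟩ := h.step_of_lt h0 hπ hc
    have e : s + S.ρ - (S.step ω l).ρ = s - (S.τ / 2 + (Real.pi - ω)) := by
      rw [step_hidden hc]; ring
    rw [e]
    refine ⟨h1, ⟨r, hr.le, h3⟩, fun _ => h2, fun ha => ?_⟩
    rw [ha] at h3
    have : (r : ℂ) * cis (s - (S.τ / 2 + (Real.pi - ω))) ≠ 0 :=
      mul_ne_zero (by exact_mod_cast hr.ne') (cis_ne_zero _)
    exact absurd (left_eq_add.1 h3) this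
  · have hok' := hok.resolve_left hc.not_lt
    obtain ⟨h1, h2, r, hr, h3⟩ := h.step_of_eq h0 hπ hseq hl hc.symm (hok'.2.2.2 hc.symm).1
    have e : s + S.ρ - (S.step ω l).ρ =
        s - (S.u / 2 + unAngle (S.pivotIn ω l) (S.pivotOut l)) := by
      rw [step_pivot hc.symm]; ring
    rw [e]
    exact ⟨h1, ⟨r, hr.le, h3⟩, fun _ => h2, hsame hok'.2.1 (by rw [step_pivot hc.symm])⟩
  · have hok' := hok.resolve_left hc.not_gt
    obtain ⟨h1, r, hr, h3⟩ := h.flip hseq hl hc (hok'.2.2.1 hc)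
    have e : s + S.ρ - (S.step ω l).ρ = s - S.u / 2 := by
      rw [step_flip hc]; ring
    rw [e]
    refine ⟨h1, ⟨r, hr, h3⟩, fun hlt => ?_, hsame hok'.2.1 (by rw [step_flip hc])⟩
    rw [step_flip hc, eps, min_eq_right hc.le] at hlt
    exact absurd hlt (lt_irrefl _)

/-- The state one round later. -/
noncomputable def shift (l : List DirArc) (S : Sim) : Sim :=
  ⟨S.k + l.length, S.τ, S.u, S.ρ + 2 * Real.pi⟩

theorem arcAt_shift : arcAt l (S.shift l).k = arcAt l S.k := arcAt_add_length l S.k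

theorem arcAt_shift_succ : arcAt l ((S.shift l).k + 1) = arcAt l (S.k + 1) := by
  rw [← arcAt_add_length l (S.k + 1)]; congr 1; simp only [shift]; ring

theorem shift_a : (S.shift l).a l = S.a l := by rw [a, arcAt_shift]; rfl
theorem shift_b : (S.shift l).b ω l = S.b ω l := by rw [b, arcAt_shift]; rfl
theorem shift_q : (S.shift l).q l = S.q l := by rw [q, arcAt_shift]; rfl

theorem shift_nextA : (S.shift l).nextA l = S.nextA l := by
  rw [nextA, arcAt_shift, arcAt_shift_succ, shift_a]; rfl

theorem shift_pivotIn : (S.shift l).pivotIn ω l = S.pivotIn ω l := by rw [pivotIn, arcAt_shift]; rfl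

theorem shift_pivotOut : (S.shift l).pivotOut l = S.pivotOut l := by
  rw [pivotOut, arcAt_shift, arcAt_shift_succ]; rfl

theorem shift_ok : (S.shift l).Ok ω l ↔ S.Ok ω l := by
  rw [Ok, arcAt_shift, arcAt_shift_succ, shift_a, shift_nextA, shift_pivotIn, shift_pivotOut]; rfl

theorem shift_micro : (S.shift l).micro l = S.micro l := by
  rw [micro, arcAt_shift, shift_q]; rfl

theorem shift_step : (S.shift l).step ω l = (S.step ω l).shift l := by
  rcases lt_trichotomy S.τ S.u with hc | hc | hc
  · rw [step_hidden hc, step_hidden (S := S.shift l) hc]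
    ext <;> simp only [shift]; ring
  · rw [step_pivot hc.symm, step_pivot (S := S.shift l) hc.symm, arcAt_shift_succ, shift_pivotIn,
      shift_pivotOut]
    ext <;> simp only [shift] <;> ring
  · rw [step_flip hc, step_flip (S := S.shift l) hc, arcAt_shift_succ, shift_pivotOut, shift_nextA]
    ext <;> simp only [shift] <;> ring

theorem step_k : (S.step ω l).k = S.k ∧ S.τ < S.u ∨
    (S.step ω l).k = S.k + 1 ∧ S.u ≤ S.τ ∧ (S.step ω l).u = (arcAt l (S.k + 1)).meas := by
  rcases lt_trichotomy S.τ S.u with hc | hc | hc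
  · rw [step_hidden hc]; exact Or.inl ⟨rfl, hc⟩
  · rw [step_pivot hc.symm]; exact Or.inr ⟨rfl, hc.ge, rfl⟩
  · rw [step_flip hc]; exact Or.inr ⟨rfl, hc.le, rfl⟩

end Sim

/-! ### Periodicity of a simulation that returns -/

namespace Returns
variable {ω : ℝ} {l : List DirArc} {τ : ℝ} {N : ℕ}

theorem exists_pred (hl : 0 < l.length) (h : Returns ω l τ N) : ∃ M, N = M + 1 := by
  rcases Nat.eq_zero_or_pos N with rfl | hN
  · have := h.kN
    rw [sim_zero] at this
    simp only at this; omega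
  · exact ⟨N - 1, by omega⟩

/-- The last step has just entered the first arc again, so `u` is its full measure; the other
coordinates agree by `Returns`. -/
theorem sim_N (hl : 0 < l.length) (h : Returns ω l τ N) :
    sim ω l τ N = (sim ω l τ 0).shift l := by
  obtain ⟨M, rfl⟩ := h.exists_pred hl
  have h1 := h.klt M (by omega)
  have h2 := h.kN
  have h3 := h.τN
  have h4 := h.ρN
  have hu : (sim ω l τ (M + 1)).u = (arcAt l 0).meas := by
    rw [← arcAt_add_length l 0, zero_add, ← h2]
    rw [sim_succ] at h2 ⊢
    rcases Sim.step_k (S := sim ω l τ M) (ω := ω) (l := l) with hk | hk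
    · omega
    · rw [hk.2.2, hk.1]
  ext
  · rw [h2, sim_zero]; simp [Sim.shift]
  · rw [h3, sim_zero]; rfl
  · rw [hu, sim_zero]; rfl
  · rw [h4, sim_zero]; simp [Sim.shift]

theorem sim_add (hl : 0 < l.length) (h : Returns ω l τ N) (i : ℕ) :
    sim ω l τ (i + N) = (sim ω l τ i).shift l := by
  induction i with
  | zero => rw [zero_add]; exact h.sim_N hl
  | succ i ih => rw [add_right_comm, sim_succ, ih, Sim.shift_step, sim_succ]

theorem ok_all (hl : 0 < l.length) (h : Returns ω l τ N) (i : ℕ) : (sim ω l τ i).Ok ω l := by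
  obtain ⟨M, hM⟩ := h.exists_pred hl
  induction i using Nat.strong_induction_on with
  | _ i ih =>
    rcases lt_or_ge i N with hi | hi
    · exact h.ok i hi
    · obtain ⟨j, rfl⟩ := Nat.exists_eq_add_of_le' hi
      rw [h.sim_add hl, Sim.shift_ok]
      exact ih j (by omega)

/-- The direction of the left arm at the start. -/
theorem exists_phase (hseq : IsArcSequence l) (hl : 0 < l.length) (h : Returns ω l τ N) :
    ∃ s, Sim.Inv l (sim ω l τ 0) s := by
  have hv := hseq.valid hl 0
  set z := (arcAt l 0).finish - (arcAt l 0).center with hz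
  refine ⟨z.arg - τ / 2 - Real.pi / 2 + (arcAt l 0).meas, h.pos, h.le, hv.meas_spec.1, le_rfl,
    ‖z‖, norm_pos_iff.2 hv.finish_sub_ne, ?_⟩
  rw [sim_zero]
  simp only
  rw [show z.arg - τ / 2 - Real.pi / 2 + (arcAt l 0).meas + τ / 2 + Real.pi / 2 -
    (arcAt l 0).meas = z.arg by ring]
  exact eq_norm_mul_cis_arg z

theorem inv (h0 : 0 < ω) (hπ : ω < Real.pi) (hseq : IsArcSequence l) (hl : 0 < l.length)
    (h : Returns ω l τ N) {s0 : ℝ} (hs : Sim.Inv l (sim ω l τ 0) s0) (i : ℕ) :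
    Sim.Inv l (sim ω l τ i) (s0 - (sim ω l τ i).ρ) := by
  induction i with
  | zero => rw [show (sim ω l τ 0).ρ = 0 from rfl, sub_zero]; exact hs
  | succ i ih =>
    have := (ih.step h0 hπ hseq hl (h.ok_all hl i)).1
    rwa [← sim_succ, sub_add_cancel] at this

theorem eps_succ_le (hπ : ω < Real.pi) (i : ℕ) :
    (sim ω l τ i).eps ≤ (sim ω l τ (i + 1)).ρ := by
  rw [sim_succ]; exact Sim.eps_le_step hπ

theorem ρ_lt_eps (h0 : 0 < ω) (hπ : ω < Real.pi) (hseq : IsArcSequence l) (hl : 0 < l.length)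
    (h : Returns ω l τ N) (i : ℕ) : (sim ω l τ i).ρ < (sim ω l τ i).eps := by
  obtain ⟨s0, hs⟩ := h.exists_phase hseq hl
  have hi := h.inv h0 hπ hseq hl hs i
  have := lt_min hi.τ0 hi.u0
  unfold Sim.eps; linarith

theorem ρ_mono (h0 : 0 < ω) (hπ : ω < Real.pi) (hseq : IsArcSequence l) (hl : 0 < l.length)
    (h : Returns ω l τ N) : StrictMono fun i => (sim ω l τ i).ρ :=
  strictMono_nat_of_lt_succ fun i =>
    (h.ρ_lt_eps h0 hπ hseq hl i).trans_le (eps_succ_le hπ i)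

theorem sim_add_mul (hl : 0 < l.length) (h : Returns ω l τ N) (i m : ℕ) :
    (sim ω l τ (i + m * N)).a l = (sim ω l τ i).a l ∧
    (sim ω l τ (i + m * N)).b ω l = (sim ω l τ i).b ω l ∧
    (sim ω l τ (i + m * N)).ρ = (sim ω l τ i).ρ + m * (2 * Real.pi) ∧
    (sim ω l τ (i + m * N)).eps = (sim ω l τ i).eps + m * (2 * Real.pi) := by
  induction m with
  | zero => simp
  | succ m ih =>
    rw [Nat.succ_mul, ← add_assoc, h.sim_add hl, Sim.shift_a, Sim.shift_b]
    refine ⟨ih.1, ih.2.1, ?_, ?_⟩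
    · have := ih.2.2.1
      simp only [Sim.shift] at this ⊢
      rw [this]; push_cast; ring
    · have := ih.2.2.2
      simp only [Sim.shift, Sim.eps] at this ⊢
      push_cast; linarith

end Returns

/-! ### Soundness: a passing simulation yields a polygon -/

namespace Passes
variable {ω : ℝ} {l : List DirArc} {τ : ℝ} {N : ℕ}

/-- `Passes.lag` covers left contacts of the first round only; whole rounds are subtracted from both
indices. -/
theorem lag_all (h0 : 0 < ω) (hπ : ω < Real.pi) (hseq : IsArcSequence l) (hl : 0 < l.length)
    (h : Passes ω l τ N) (i j : ℕ) (x : ℝ) (h1 : (sim ω l τ i).ρ < x)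
    (h2 : x < (sim ω l τ (i + 1)).ρ) (h3 : (sim ω l τ j).eps < x + (Real.pi - ω))
    (h4 : x + (Real.pi - ω) < (sim ω l τ (j + 1)).eps) :
    (sim ω l τ i).a l = (sim ω l τ (j + 1)).b ω l := by
  obtain ⟨M, hM⟩ := h.exists_pred hl
  have hmono := h.ρ_mono h0 hπ hseq hl
  set m := i / N with hm
  set i0 := i % N with hi0
  have hi : i = i0 + m * N := by rw [mul_comm]; exact (Nat.mod_add_div i N).symm
  have hi0N : i0 < N := Nat.mod_lt _ (by omega)
  obtain ⟨a1, -, a3, -⟩ := h.sim_add_mul hl i0 m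
  obtain ⟨-, -, a3', -⟩ := h.sim_add_mul hl (i0 + 1) m
  rw [← hi] at a1 a3
  rw [add_right_comm, ← hi] at a3'
  -- The right contact `j + 1` ends at a rotation above `m` full turns, so its index also admits the
  -- subtraction of `m` rounds.
  have hjm : m * N ≤ j + 1 := by
    have e1 := (h.sim_add_mul hl 0 m).2.2.1
    rw [zero_add, show (sim ω l τ 0).ρ = 0 from rfl, zero_add] at e1
    have e2 : (sim ω l τ 0).ρ ≤ (sim ω l τ i0).ρ := hmono.monotone (Nat.zero_le i0)
    rw [show (sim ω l τ 0).ρ = 0 from rfl] at e2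
    have e3 := Returns.eps_succ_le (l := l) (τ := τ) hπ (j + 1)
    have : m * N < j + 1 + 1 := hmono.lt_iff_lt.1 (show (sim ω l τ (m * N)).ρ <
      (sim ω l τ (j + 1 + 1)).ρ by linarith)
    omega
  obtain ⟨j0, hj0⟩ := Nat.exists_eq_add_of_le' hjm
  obtain ⟨-, b2, -, b4⟩ := h.sim_add_mul hl j0 m
  rw [← hj0] at b2 b4
  rw [a1, b2]
  refine h.lag i0 hi0N j0 (x - m * (2 * Real.pi)) (by linarith) (by linarith) ?_ (by linarith)
  rintro j' rfl
  obtain ⟨-, -, -, c4⟩ := h.sim_add_mul hl j' m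
  rw [show j' + m * N = j by omega] at c4
  linarith

/-- The simulation describes a rotating wedge. -/
theorem track (h0 : 0 < ω) (hπ : ω < Real.pi) (hseq : IsArcSequence l) (hl : 0 < l.length)
    (h : Passes ω l τ N) {s0 : ℝ} (hs : Sim.Inv l (sim ω l τ 0) s0) :
    Track ω N (fun i => (sim ω l τ i).a l) (fun i => (sim ω l τ i).b ω l)
      (fun i => s0 - (sim ω l τ i).ρ) (fun i => s0 - (sim ω l τ i).eps) := by
  have hinv := h.inv h0 hπ hseq hl hs
  have hstep := fun i => (hinv i).step h0 hπ hseq hl (h.ok_all hl i)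
  have e1 := fun i => (h.sim_add_mul hl i 1)
  simp only [one_mul, Nat.cast_one] at e1
  obtain ⟨M, hM⟩ := h.exists_pred hl
  refine ⟨by omega, ?_, ?_, ?_, ?_, ?_, fun i => (e1 i).1, fun i => (e1 i).2.1, ?_, ?_, ?_, ?_, ?_⟩
  · intro i; linarith [h.ρ_lt_eps h0 hπ hseq hl i]
  · intro i
    have h1 := (hinv i).um
    have h2 := (hseq.valid hl (sim ω l τ i).k).meas_spec.2.1
    have h3 : min (sim ω l τ i).τ (sim ω l τ i).u ≤ (sim ω l τ i).u := min_le_right _ _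
    simp only [Sim.eps]; linarith
  · intro i; linarith [Returns.eps_succ_le (l := l) (τ := τ) hπ i]
  · intro i; simp only [(e1 i).2.2.1]; ring
  · intro i; simp only [(e1 i).2.2.2]; ring
  · intro i
    have := (hstep i).2.1
    rwa [← sim_succ, sub_add_cancel] at this
  · intro i hi
    have := (hstep i).2.2.1
    rw [← sim_succ] at this
    exact this (by linarith)
  · intro i j x h1 h2 h3 h4
    exact h.lag_all h0 hπ hseq hl i j (s0 - x) (by linarith) (by linarith) (by linarith)
      (by linarith)
  · intro i; exact (hinv i).a_ne_b h0 hπ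
  · intro i
    have := (hstep i).2.2.2
    rwa [← sim_succ] at this

/-- The list of the arcs run through by the apex. -/
noncomputable def micros (ω : ℝ) (l : List DirArc) (τ : ℝ) (N : ℕ) : List DirArc :=
  (List.range N).map fun i => (sim ω l τ i).micro l

theorem arcAt_micros (hl : 0 < l.length) (h : Passes ω l τ N) (i : ℕ) :
    arcAt (micros ω l τ N) i = (sim ω l τ i).micro l := by
  obtain ⟨M, hM⟩ := h.exists_pred hl
  have hlen : (micros ω l τ N).length = N := by simp [micros]
  rw [← arcAt_mod, hlen, arcAt_of_lt (by rw [hlen]; exact Nat.mod_lt _ (by omega))]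
  simp only [micros, List.getElem_map, List.getElem_range]
  exact periodic_mod (f := fun i => (sim ω l τ i).micro l)
    (fun i => by rw [h.sim_add hl, Sim.shift_micro]) i

theorem micro_meas {S : Sim} {s : ℝ} (hinv : Sim.Inv l S s) (hv : (arcAt l S.k).Valid) :
    (S.micro l).Valid ∧ (S.micro l).meas = min S.τ S.u := by
  have hm : 0 < min S.τ S.u := lt_min hinv.τ0 hinv.u0
  have hm2 : min S.τ S.u < 2 * Real.pi :=
    (min_le_right _ _).trans_lt (hinv.um.trans_lt hv.meas_spec.2.1)
  have hz := hv.finish_sub_ne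
  have hst : (S.micro l).start - (S.micro l).center =
      ((arcAt l S.k).finish - (arcAt l S.k).center) * cis S.u := by
    simp only [Sim.micro, Sim.q]; ring
  have hfi : (S.micro l).finish - (S.micro l).center =
      ((arcAt l S.k).finish - (arcAt l S.k).center) * cis (S.u - min S.τ S.u) := by
    simp only [Sim.micro]; ring
  have hz' : (S.micro l).start - (S.micro l).center ≠ 0 := by
    rw [hst]; exact mul_ne_zero hz (cis_ne_zero _)
  have hrot : (S.micro l).finish - (S.micro l).center =
      ((1 : ℝ) : ℂ) * (((S.micro l).start - (S.micro l).center) * cis (-min S.τ S.u)) := by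
    rw [hst, hfi, cis_sub, ← mul_assoc]; simp
  refine ⟨⟨?_, ?_⟩, cwAngle_eq hz' one_pos hrot hm hm2⟩
  · intro hc
    rw [← hc] at hrot
    have : cis (-min S.τ S.u) = cis 0 := by
      rw [cis_zero]
      refine mul_left_cancel₀ hz' ?_
      rw [mul_one]
      simpa using hrot.symm
    obtain ⟨k, hk⟩ := cis_eq_iff.1 this
    have := DirArc.eq_of_int_mul hk (by linarith) (by linarith)
    linarith
  · rw [dist_eq_norm, dist_eq_norm, hst, hfi, norm_mul, norm_mul, norm_cis, norm_cis]

theorem isArcSequence_micros (h0 : 0 < ω) (hπ : ω < Real.pi) (hseq : IsArcSequence l)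
    (hl : 0 < l.length) (h : Passes ω l τ N) : IsArcSequence (micros ω l τ N) := by
  obtain ⟨M, hM⟩ := h.exists_pred hl
  obtain ⟨s0, hs⟩ := h.exists_phase hseq hl
  constructor
  · intro A hA
    obtain ⟨i, -, rfl⟩ := List.mem_map.1 hA
    exact (micro_meas (h.inv h0 hπ hseq hl hs i) (hseq.valid hl _)).1
  · intro p hp
    rw [mem_consecutive_iff (by simp [micros]; omega)] at hp
    obtain ⟨i, rfl⟩ := hp
    simp only
    rw [h.arcAt_micros hl, h.arcAt_micros hl, sim_succ, ← Sim.step_q hseq hl (ω := ω)]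
    rfl

theorem isCloud (h0 : 0 < ω) (hπ : ω < Real.pi) (hseq : IsArcSequence l)
    (hl : 0 < l.length) (h : Passes ω l τ N) :
    IsConvexPolygon (vertexList (fun i => (sim ω l τ i).a l) N) ∧
    IsCloud ω (vertexList (fun i => (sim ω l τ i).a l) N) (micros ω l τ N) := by
  obtain ⟨s0, hs⟩ := h.exists_phase hseq hl
  have ht := h.track h0 hπ hseq hl hs
  have hinv := h.inv h0 hπ hseq hl hs
  refine ⟨ht.isConvexPolygon hπ h0, ht.isCloud hπ h0 (by simp [micros])
    (h.isArcSequence_micros h0 hπ hseq hl) ?_ ?_ ?_ ?_ (ht.mem_vertexList hπ h0)⟩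
  · intro A hA
    obtain ⟨i, -, rfl⟩ := List.mem_map.1 hA
    rfl
  · intro i _
    rw [h.arcAt_micros hl, Sim.ctr_ab h0 hπ]; rfl
  · intro i _
    rw [h.arcAt_micros hl, (hinv i).apex_eq h0 hπ]; rfl
  · intro i _
    rw [h.arcAt_micros hl, (micro_meas (hinv i) (hseq.valid hl _)).2, Sim.eps]; ring

/-- The arcs run through by the apex can be grouped into the arcs of the given sequence. -/
theorem exists_blocks (h0 : 0 < ω) (hπ : ω < Real.pi) (hseq : IsArcSequence l)
    (hl : 0 < l.length) (h : Passes ω l τ N) {s0 : ℝ} (hs : Sim.Inv l (sim ω l τ 0) s0)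
    (hcw : ∀ A ∈ l, A.clockwise = true) (i : ℕ) (hi : i ≤ N) :
    ∃ (bs : List (List DirArc)) (cur : List DirArc),
      bs.flatten ++ cur = (List.range i).map (fun i => (sim ω l τ i).micro l) ∧
      List.Forall₂ IsMergeOf (l.take (sim ω l τ i).k) bs ∧
      (∀ B ∈ cur, SameCircle B (arcAt l (sim ω l τ i).k) ∧ B.clockwise = true) ∧
      (∀ hne : cur ≠ [], (cur.head hne).start = (arcAt l (sim ω l τ i).k).start ∧
        (cur.getLast hne).finish = (sim ω l τ i).q l) ∧
      (cur = [] → (sim ω l τ i).q l = (arcAt l (sim ω l τ i).k).start) ∧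
      ((∃ i', i = i' + 1 ∧ (sim ω l τ i).k ≠ (sim ω l τ i').k) → cur = []) := by
  -- `bs` are the finished blocks and `cur` is the part of the current arc run through so far; by
  -- the last clause `cur` is empty right after the passage to a new arc.
  induction i with
  | zero =>
    refine ⟨[], [], rfl, ?_, by simp, by simp, fun _ => ?_, fun _ => rfl⟩
    · rw [sim_zero]; simp
    · exact Sim.q_of_meas (hseq.valid hl _) rfl
  | succ i ih =>
    obtain ⟨bs, cur, h1, h2, h3, h4, h5, -⟩ := ih (by omega)
    have hinv := h.inv h0 hπ hseq hl hs i
    set S := sim ω l τ i with hS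
    have hv := hseq.valid hl S.k
    have hq := Sim.step_q (S := S) (ω := ω) hseq hl
    have hsame : SameCircle (S.micro l) (arcAt l S.k) ∧ (S.micro l).clockwise = true := by
      refine ⟨⟨rfl, ?_⟩, rfl⟩
      rw [hv.2, dist_eq_norm, dist_eq_norm]
      simp only [Sim.micro, Sim.q]
      rw [add_sub_cancel_left, norm_mul, norm_cis, mul_one]
    have hhead : ∀ hne : cur ++ [S.micro l] ≠ [],
        ((cur ++ [S.micro l]).head hne).start = (arcAt l S.k).start := by
      intro hne
      rcases eq_or_ne cur [] with hcur | hcur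
      · subst hcur; exact h5 rfl
      · rw [List.head_append_of_ne_nil hcur]; exact (h4 hcur).1
    have hlast : ∀ hne : cur ++ [S.micro l] ≠ [],
        ((cur ++ [S.micro l]).getLast hne).finish = (S.step ω l).q l := by
      intro hne
      rw [List.getLast_append_singleton, hq]
    have hall : ∀ B ∈ cur ++ [S.micro l], SameCircle B (arcAt l S.k) ∧ B.clockwise = true := by
      intro B hB
      rcases List.mem_append.1 hB with hB | hB
      · exact h3 B hB
      · rw [List.mem_singleton] at hB; rw [hB]; exact hsame
    have hrange : (List.range (i + 1)).map (fun i => (sim ω l τ i).micro l) =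
        bs.flatten ++ cur ++ [S.micro l] := by
      rw [List.range_succ, List.map_append, ← h1]; rfl
    rw [sim_succ, ← hS]
    rcases Sim.step_k (S := S) (ω := ω) (l := l) with ⟨hk, -⟩ | ⟨hk, hle, hu⟩
    · rw [hk]
      refine ⟨bs, cur ++ [S.micro l], by rw [hrange, List.append_assoc], h2, hall,
        fun hne => ⟨hhead hne, hlast hne⟩, fun hne => by simp at hne, ?_⟩
      rintro ⟨i', hi', hne⟩
      obtain rfl : i = i' := by omega
      exact absurd rfl hne
    · rw [hk]
      have hklt := h.klt i (by omega)
      rw [← hS] at hklt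
      have hq' : (S.step ω l).q l = (arcAt l (S.k + 1)).start := by
        rw [Sim.q_of_meas (by rw [hk]; exact hseq.valid hl _) (by rw [hu, hk]), hk]
      refine ⟨bs ++ [cur ++ [S.micro l]], [], by rw [hrange]; simp, ?_, by simp, by simp,
        fun _ => hq', fun _ => rfl⟩
      rw [List.take_add_one, List.getElem?_eq_getElem hklt, Option.toList_some]
      refine List.rel_append h2 (List.Forall₂.cons ?_ List.Forall₂.nil)
      rw [← arcAt_of_lt hklt]
      have hne : cur ++ [S.micro l] ≠ [] := by simp
      refine ⟨hne, hhead hne, ?_, fun B hB => ?_⟩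
      · rw [hlast hne, hq', hseq.link hl]
      · rw [hcw _ (arcAt_mem hl _)]; exact hall B hB

theorem checked (hl : 0 < l.length) (h : Passes ω l τ N) (i : ℕ) (hi : i ≤ N) (k : ℕ)
    (hk : k < (sim ω l τ i).k) : (arcAt l (k + 1)).clockwise = true ∧
      ¬ SameCircle (arcAt l k) (arcAt l (k + 1)) := by
  induction i with
  | zero => rw [sim_zero] at hk; simp only at hk; omega
  | succ i ih =>
    rcases Sim.step_k (S := sim ω l τ i) (ω := ω) (l := l) with ⟨hk', -⟩ | ⟨hk', hle, -⟩
    · rw [sim_succ, hk'] at hk; exact ih (by omega) hk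
    · rw [sim_succ, hk'] at hk
      rcases (show k < (sim ω l τ i).k ∨ k = (sim ω l τ i).k by omega) with hk | rfl
      · exact ih (by omega) hk
      · have := (h.ok_all hl i).resolve_left hle.not_gt
        exact ⟨this.1, this.2.1⟩

/-- If the simulation passes all checks, then the given sequence is the maximal cloud of the
polygon touched by the left arm. -/
theorem isMaximalCloud (h0 : 0 < ω) (hπ : ω < Real.pi) (hseq : IsArcSequence l)
    (hl : 0 < l.length) (h : Passes ω l τ N) :
    IsConvexPolygon (vertexList (fun i => (sim ω l τ i).a l) N) ∧
    IsMaximalCloud ω (vertexList (fun i => (sim ω l τ i).a l) N) l := by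
  obtain ⟨s0, hs⟩ := h.exists_phase hseq hl
  obtain ⟨c1, c2⟩ := h.isCloud h0 hπ hseq hl
  have hch := fun k (hk : k < l.length) => h.checked hl N le_rfl k (by rw [h.kN]; exact hk)
  have hcw : ∀ A ∈ l, A.clockwise = true := by
    intro A hA
    obtain ⟨i, hi, rfl⟩ := List.getElem_of_mem hA
    rw [← arcAt_of_lt hi]
    rcases i with _ | i
    -- The orientation of the first arc is checked when it is entered again at the end of the round.
    · have := (hch (l.length - 1) (by omega)).1
      rwa [Nat.sub_add_cancel (by omega), ← zero_add l.length, arcAt_add_length] at this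
    · exact (hch i (by omega)).1
  obtain ⟨bs, cur, h1, h2, -, -, -, h6⟩ := h.exists_blocks h0 hπ hseq hl hs hcw N le_rfl
  have hcur : cur = [] := by
    obtain ⟨M, hM⟩ := h.exists_pred hl
    have := h.klt M (by omega)
    exact h6 ⟨M, hM, by rw [h.kN]; omega⟩
  rw [hcur, List.append_nil] at h1
  rw [h.kN, List.take_length] at h2
  refine ⟨c1, bs, ?_, h2, ?_⟩
  · rw [h1]; exact c2
  · intro p hp
    rw [mem_consecutive_iff hl] at hp
    obtain ⟨i, rfl⟩ := hp
    have := (hch (i % l.length) (Nat.mod_lt _ hl)).2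
    rw [arcAt_mod, ← arcAt_mod l (i % l.length + 1), Nat.mod_add_mod, arcAt_mod] at this
    exact this

end Passes
end OmegaCloud

namespace OmegaCloud
open Complex (I)
open scoped ComplexConjugate

/-! ### The position of the apex on an arc of a cloud -/

/-- The angle from the start of the `i`-th arc clockwise to the vertex touched by the left arm. -/
noncomputable def Chain.tau (l : List DirArc) (a : ℕ → ℂ) (i : ℕ) : ℝ :=
  cwAngle ((arcAt l i).start - (arcAt l i).center) (a i - (arcAt l i).center)

/-- The positions of the start of the arc `A` and of the vertices touched by the two arms. -/
structure Phase (ω : ℝ) (A : DirArc) (a b : ℂ) (s T R : ℝ) : Prop where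
  R0 : 0 < R
  T0 : 0 < T
  T2 : T ≤ 2 * (Real.pi - ω)
  mT : A.meas ≤ T
  a_sub : a - A.center = R * cis (s - T / 2 + Real.pi / 2)
  start_sub : A.start - A.center = R * cis (s + T / 2 + Real.pi / 2)
  finish_eq_iff : A.finish = a ↔ A.meas = T
  start_eq_iff : A.start = b ↔ T = 2 * (Real.pi - ω)

theorem exists_polar_pos {z : ℂ} (hz : z ≠ 0) : ∃ R θ : ℝ, 0 < R ∧ z = R * cis θ :=
  ⟨‖z‖, z.arg, norm_pos_iff.2 hz, eq_norm_mul_cis_arg z⟩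

/-- Half of `x` matters modulo `2 π`, hence `x` modulo `4 π`; a positive sine puts the half into
`(0, π)`. -/
theorem sin_half_pos_shift {x : ℝ} (h : 0 < Real.sin (x / 2)) :
    ∃ k : ℤ, 0 < x + k * (4 * Real.pi) ∧ x + k * (4 * Real.pi) < 2 * Real.pi := by
  obtain ⟨k, hk1, hk2⟩ := exists_int_shift (x / 2)
  have hk : 0 < Real.sin (x / 2 + k * (2 * Real.pi)) := by
    rwa [Real.sin_add_int_mul_two_pi]
  refine ⟨k + 1, ?_, ?_⟩
  · push_cast; linarith
  · push_cast
    by_contra hc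
    have : Real.sin (x / 2 + k * (2 * Real.pi)) ≤ 0 :=
      Real.sin_nonpos_of_nonpos_of_neg_pi_le (by linarith) (by linarith)
    linarith

variable {ω : ℝ} {V : Set ℂ} {l : List DirArc} {a b : ℕ → ℂ} {s e : ℕ → ℝ}

theorem norm_sub_eq_one {r : ℝ} {x : ℝ} (h : 0 ≤ r) : ‖(r : ℂ) * cis x‖ = r := by
  rw [norm_mul, norm_cis, mul_one, Complex.norm_real, Real.norm_of_nonneg h]

theorem real_mul_cis_inj {r r' x : ℝ} (h : (r : ℂ) * cis x = r' * cis x) : r = r' := by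
  have := mul_right_cancel₀ (cis_ne_zero x) h
  exact_mod_cast this

theorem DirArc.Valid.finish_sub {A : DirArc} (h : A.Valid) {R x : ℝ}
    (hs : A.start - A.center = R * cis x) : A.finish - A.center = R * cis (x - A.meas) := by
  have := h.meas_spec.2.2
  rw [DirArc.pt, hs] at this
  rw [this, cis_sub]; ring

theorem Phase.finish_sub {A : DirArc} {a b : ℂ} {s T R : ℝ} (h : Phase ω A a b s T R)
    (hv : A.Valid) : A.finish - A.center = R * cis (s + T / 2 + Real.pi / 2 - A.meas) :=
  hv.finish_sub h.start_sub

theorem Chain.b_sub (h0 : 0 < ω) (hπ : ω < Real.pi) (h : Chain ω V l a b s e) (i : ℕ) :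
    b i - (arcAt l i).center = (a i - (arcAt l i).center) * cis (2 * (Real.pi - ω)) := by
  rw [h.center]
  have := rotation_of_ctr h0 hπ (a i) (b i)
  linear_combination this

/-- The chord from the apex to `a i` has direction `s i`; since the left arm runs from the apex
towards `a i`, the angle lies in `(0, 2 π)`. The same consideration of signs for the right arm at
the start gives `T ≤ 2 (π - ω)`, and for the left arm at the end `meas ≤ T`, with equality exactly
if the contact is the apex. -/
theorem Chain.exists_phase (h0 : 0 < ω) (hπ : ω < Real.pi) (h : Chain ω V l a b s e) (i : ℕ) :
    ∃ R, Phase ω (arcAt l i) (a i) (b i) (s i) (Chain.tau l a i) R := by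
  have hv := h.valid i
  obtain ⟨m0, m2, -⟩ := hv.meas_spec
  set c := (arcAt l i).center with hc
  obtain ⟨R, θ, hR, hθ⟩ := exists_polar_pos (z := a i - c)
    (by rw [hc, h.center]; exact ctr_ne_left h0 hπ (h.ne i))
  have hst : (arcAt l i).start - c = R * cis (2 * s i - θ + Real.pi) := by
    rw [h.apex_start h0 hπ i, apex, ← h.center, ← hc, hθ, map_mul, Complex.conj_ofReal, conj_cis,
      sub_sub_cancel_left, mul_assoc, ← cis_add, ← mul_neg, ← cis_add_pi]
    congr 2; ring
  -- the angle from the start to the left vertex, up to a multiple of a double turn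
  have hT : ∃ T : ℝ, 0 < T ∧ T < 2 * Real.pi ∧ a i - c = R * cis (s i - T / 2 + Real.pi / 2) ∧
      (arcAt l i).start - c = R * cis (s i + T / 2 + Real.pi / 2) := by
    obtain ⟨r, hr, her⟩ := (h.touch_start i).left_eq h0 hπ
    have hr : 0 < r := lt_of_le_of_ne hr (by
      rintro rfl
      exact h.start_ne_a h0 hπ i (by rw [her]; simp))
    have hd : (r : ℂ) * cis (s i) =
        ((2 * R * Real.sin ((2 * (s i - θ) + Real.pi) / 2) : ℝ) : ℂ) * cis (s i) := by
      have := Sim.cis_sub_cis (s i + Real.pi / 2) ((2 * (s i - θ) + Real.pi) / 2)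
      rw [show s i + Real.pi / 2 - (2 * (s i - θ) + Real.pi) / 2 = θ by ring,
        show s i + Real.pi / 2 + (2 * (s i - θ) + Real.pi) / 2 = 2 * s i - θ + Real.pi by ring,
        show s i + Real.pi / 2 - Real.pi / 2 = s i by ring] at this
      push_cast at this ⊢
      linear_combination (R : ℂ) * this + hθ - hst - her
    have hd' := real_mul_cis_inj hd
    have hsin : 0 < Real.sin ((2 * (s i - θ) + Real.pi) / 2) := by
      by_contra hcon
      have := mul_nonpos_of_nonneg_of_nonpos (by linarith : 0 ≤ 2 * R) (not_lt.1 hcon)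
      linarith
    obtain ⟨k, hk1, hk2⟩ := sin_half_pos_shift hsin
    refine ⟨_, hk1, hk2, ?_, ?_⟩
    · rw [hθ, ← cis_add_int_mul θ (-k)]; congr 2; push_cast; ring
    · rw [hst, ← cis_add_int_mul (2 * s i - θ + Real.pi) k]; congr 2; ring
  obtain ⟨T, T0, T2, ha, hq⟩ := hT
  have htau : Chain.tau l a i = T := by
    refine cwAngle_eq hv.start_sub_ne one_pos ?_ T0 T2
    rw [← hc, ha, hq, mul_assoc, ← cis_add, Complex.ofReal_one, one_mul]
    congr 2; ring
  have hb : b i - c = R * cis (s i - T / 2 + Real.pi / 2 + 2 * (Real.pi - ω)) := by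
    rw [h.b_sub h0 hπ, ← hc, ha, mul_assoc, ← cis_add]
  have hf := hv.finish_sub hq
  rw [htau]
  have dsin : ∀ m d : ℝ, (R : ℂ) * cis (m - d) - R * cis (m + d) =
      ((2 * R * Real.sin d : ℝ) : ℂ) * cis (m - Real.pi / 2) := by
    intro m d
    have := Sim.cis_sub_cis m d
    push_cast at this ⊢
    linear_combination (R : ℂ) * this
  have nonneg : ∀ {d r x : ℝ}, 0 ≤ r → (r : ℂ) * cis x = ((2 * R * Real.sin d : ℝ) : ℂ) * cis x →
      0 ≤ Real.sin d := by
    intro d r x hr he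
    have := real_mul_cis_inj he
    by_contra hcon
    have := mul_neg_of_pos_of_neg (by linarith : 0 < 2 * R) (not_le.1 hcon)
    linarith
  -- the right arm
  have ebq : b i - (arcAt l i).start = ((2 * R * Real.sin (T / 2 - (Real.pi - ω)) : ℝ) : ℂ) *
      cis (s i + (Real.pi - ω)) := by
    have := dsin (s i + (Real.pi - ω) + Real.pi / 2) (T / 2 - (Real.pi - ω))
    rw [show s i + (Real.pi - ω) + Real.pi / 2 - (T / 2 - (Real.pi - ω)) =
      s i - T / 2 + Real.pi / 2 + 2 * (Real.pi - ω) by ring,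
      show s i + (Real.pi - ω) + Real.pi / 2 + (T / 2 - (Real.pi - ω)) =
      s i + T / 2 + Real.pi / 2 by ring, ← hb, ← hq, add_sub_cancel_right] at this
    linear_combination this
  have eaf : a i - (arcAt l i).finish =
      ((2 * R * Real.sin ((T - (arcAt l i).meas) / 2) : ℝ) : ℂ) * cis (e i) := by
    have := dsin (e i + Real.pi / 2) ((T - (arcAt l i).meas) / 2)
    rw [h.he, show s i - (arcAt l i).meas / 2 + Real.pi / 2 - (T - (arcAt l i).meas) / 2 =
      s i - T / 2 + Real.pi / 2 by ring,
      show s i - (arcAt l i).meas / 2 + Real.pi / 2 + (T - (arcAt l i).meas) / 2 =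
      s i + T / 2 + Real.pi / 2 - (arcAt l i).meas by ring, ← ha, ← hf, add_sub_cancel_right] at this
    rw [h.he]
    linear_combination this
  have Tσ : T ≤ 2 * (Real.pi - ω) := by
    obtain ⟨r, hr, her⟩ := (h.touch_start i).right_eq h0 hπ
    have h1 : 0 ≤ Real.sin (-(T / 2 - (Real.pi - ω))) := by
      refine nonneg hr (x := s i + (Real.pi - ω)) ?_
      rw [Real.sin_neg]
      push_cast at ebq ⊢
      linear_combination -ebq + her
    by_contra hcon
    have : Real.sin (-(T / 2 - (Real.pi - ω))) < 0 :=
      Real.sin_neg_of_neg_of_neg_pi_lt (by linarith) (by linarith)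
    linarith
  have mT : (arcAt l i).meas ≤ T := by
    obtain ⟨r, hr, her⟩ := (h.touch_finish i).left_eq h0 hπ
    have h1 : 0 ≤ Real.sin ((T - (arcAt l i).meas) / 2) := by
      refine nonneg hr (x := e i) ?_
      linear_combination eaf - her
    by_contra hcon
    have : Real.sin ((T - (arcAt l i).meas) / 2) < 0 :=
      Real.sin_neg_of_neg_of_neg_pi_lt (by linarith) (by linarith)
    linarith
  refine ⟨R, hR, T0, Tσ, mT, ha, hq, ?_, ?_⟩
  · constructor
    · intro hfa
      by_contra hne
      have hlt := lt_of_le_of_ne mT hne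
      have : 0 < Real.sin ((T - (arcAt l i).meas) / 2) :=
        Real.sin_pos_of_pos_of_lt_pi (by linarith) (by linarith)
      rw [hfa, sub_self, eq_comm, mul_eq_zero] at eaf
      rcases eaf with h1 | h1
      · have := mul_pos (by linarith : 0 < 2 * R) this
        rw [Complex.ofReal_eq_zero] at h1; linarith
      · exact cis_ne_zero _ h1
    · intro hm
      rw [hm] at eaf
      simp at eaf
      exact (sub_eq_zero.1 eaf).symm
  · constructor
    · intro hfa
      by_contra hne
      have hlt := lt_of_le_of_ne Tσ hne
      have : Real.sin (T / 2 - (Real.pi - ω)) < 0 :=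
        Real.sin_neg_of_neg_of_neg_pi_lt (by linarith) (by linarith)
      rw [hfa, sub_self, eq_comm, mul_eq_zero] at ebq
      rcases ebq with h1 | h1
      · have := mul_neg_of_pos_of_neg (by linarith : 0 < 2 * R) this
        rw [Complex.ofReal_eq_zero] at h1; linarith
      · exact cis_ne_zero _ h1
    · intro hm
      rw [hm, show 2 * (Real.pi - ω) / 2 - (Real.pi - ω) = 0 by ring] at ebq
      simp at ebq
      exact (sub_eq_zero.1 ebq).symm

/-! ### Blocks of arcs with the same supporting circle -/

/-- The sequence `m` results from `l` by merging, for every `k`, the arcs with the indices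
`β k, …, β (k + 1) - 1`; the indices are not reduced modulo the length. -/
structure Blocks (m l : List DirArc) (β : ℕ → ℕ) : Prop where
  zero : β 0 = 0
  lt : ∀ k, β k < β (k + 1)
  add_length : ∀ k, β (k + m.length) = β k + l.length
  start : ∀ k, (arcAt l (β k)).start = (arcAt m k).start
  finish : ∀ k, (arcAt l (β (k + 1) - 1)).finish = (arcAt m k).finish
  circle : ∀ k i, β k ≤ i → i < β (k + 1) → SameCircle (arcAt l i) (arcAt m k)
  cw : ∀ k i, β k ≤ i → i < β (k + 1) → (arcAt l i).clockwise = (arcAt m k).clockwise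

/-- `β k` counts the arcs in the first `k` blocks. -/
theorem exists_blocks_of_forall₂ {m : List DirArc} {bs : List (List DirArc)}
    (h : List.Forall₂ IsMergeOf m bs) (d : DirArc) :
    ∃ β : ℕ → ℕ, β 0 = 0 ∧ β m.length = bs.flatten.length ∧ ∀ k < m.length, β k < β (k + 1) ∧
      (bs.flatten.getD (β k) d).start = (m.getD k d).start ∧
      (bs.flatten.getD (β (k + 1) - 1) d).finish = (m.getD k d).finish ∧
      ∀ i, β k ≤ i → i < β (k + 1) → SameCircle (bs.flatten.getD i d) (m.getD k d) ∧
        (bs.flatten.getD i d).clockwise = (m.getD k d).clockwise := by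
  induction h with
  | nil => exact ⟨fun _ => 0, rfl, rfl, by simp⟩
  | @cons A b m bs hA hm ih =>
    obtain ⟨β, z, hlen, hβ⟩ := ih
    obtain ⟨hb, hs, hf, hc⟩ := hA
    have hpos : 0 < b.length := List.length_pos_iff.2 hb
    refine ⟨fun k => Nat.casesOn k 0 (fun k => b.length + β k), rfl, ?_, ?_⟩
    · simp [hlen]
    · intro k hk
      rw [List.flatten_cons]
      cases k with
      | zero =>
        simp only [z, add_zero, List.getD_cons_zero]
        refine ⟨hpos, ?_, ?_, ?_⟩
        · change ((b ++ bs.flatten).getD 0 d).start = A.start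
          rw [List.getD_append _ _ _ _ hpos, List.getD_eq_getElem _ _ hpos, ← hs, List.head_eq_getElem]
        · have : b.length - 1 < b.length := by omega
          change ((b ++ bs.flatten).getD (b.length - 1) d).finish = A.finish
          rw [List.getD_append _ _ _ _ this, List.getD_eq_getElem _ _ this, ← hf,
            List.getLast_eq_getElem]
        · intro i _ hi
          rw [List.getD_append _ _ _ _ hi, List.getD_eq_getElem _ _ hi]
          exact hc _ (List.getElem_mem hi)
      | succ k =>
        simp only [List.getD_cons_succ]
        obtain ⟨g1, g2, g3, g4⟩ := hβ k (by simpa using hk)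
        refine ⟨by omega, ?_, ?_, ?_⟩
        · rw [List.getD_append_right _ _ _ _ (by omega), Nat.add_sub_cancel_left, g2]
        · rw [List.getD_append_right _ _ _ _ (by omega),
            show b.length + β (k + 1) - 1 - b.length = β (k + 1) - 1 by omega, g3]
        · intro i hi1 hi2
          rw [List.getD_append_right _ _ _ _ (by omega)]
          exact g4 _ (by omega) (by omega)

theorem arcAt_add_mul (l : List DirArc) (i q : ℕ) : arcAt l (i + q * l.length) = arcAt l i := by
  unfold arcAt; rw [Nat.add_mul_mod_self_right]

/-- The block boundaries are continued periodically beyond the first round. -/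
theorem exists_blocks' {m : List DirArc} {bs : List (List DirArc)} (hm : 0 < m.length)
    (h : List.Forall₂ IsMergeOf m bs) : ∃ β, Blocks m bs.flatten β := by
  obtain ⟨β, z, hlen, hβ⟩ := exists_blocks_of_forall₂ h ⟨0, 0, 0, true⟩
  set l := bs.flatten with hl
  set n := m.length with hn
  have mono : ∀ k ≤ n, ∀ j ≤ k, β j ≤ β k := by
    intro k hk j hj
    induction k, hj using Nat.le_induction with
    | base => exact le_rfl
    | succ k hjk ih => exact (ih (by omega)).trans (hβ k (by omega)).1.le
  have hγ : ∃ γ : ℕ → ℕ, ∀ q r, r ≤ n → γ (r + q * n) = β r + q * l.length := by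
    refine ⟨fun k => β (k % n) + k / n * l.length, fun q r hr => ?_⟩
    rcases hr.lt_or_eq with hr | rfl
    · simp only [Nat.add_mul_mod_self_right, Nat.mod_eq_of_lt hr, Nat.add_mul_div_right _ _ hm,
        Nat.div_eq_of_lt hr, zero_add]
    · simp only [Nat.add_mul_mod_self_right, Nat.mod_self, z, Nat.add_mul_div_right _ _ hm,
        Nat.div_self hm, hlen]
      ring
  obtain ⟨γ, hγ⟩ := hγ
  have ex : ∀ k, ∃ q r, r < n ∧ k = r + q * n := fun k =>
    ⟨k / n, k % n, Nat.mod_lt _ hm, by rw [mul_comm]; exact (Nat.mod_add_div k n).symm⟩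
  have getm : ∀ r q, r < n → m.getD r ⟨0, 0, 0, true⟩ = arcAt m (r + q * n) := by
    intro r q hr
    rw [hn, arcAt_add_mul, arcAt, Nat.mod_eq_of_lt hr]
  have getl : ∀ i q, i < l.length → l.getD i ⟨0, 0, 0, true⟩ = arcAt l (i + q * l.length) := by
    intro i q hi
    rw [arcAt_add_mul, arcAt, Nat.mod_eq_of_lt hi]
  refine ⟨γ, ?_, ?_, ?_, ?_, ?_, ?_, ?_⟩
  · have := hγ 0 0 (Nat.zero_le _)
    simpa [z] using this
  · intro k
    obtain ⟨q, r, hr, rfl⟩ := ex k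
    rw [hγ q r hr.le, add_right_comm, hγ q (r + 1) hr]
    have := (hβ r hr).1
    omega
  · intro k
    obtain ⟨q, r, hr, rfl⟩ := ex k
    rw [show r + q * n + n = r + (q + 1) * n by ring, hγ _ r hr.le, hγ q r hr.le]; ring
  · intro k
    obtain ⟨q, r, hr, rfl⟩ := ex k
    obtain ⟨g1, g2, -⟩ := hβ r hr
    have := mono n le_rfl (r + 1) hr
    rw [hγ q r hr.le, ← getl _ _ (by omega), ← getm _ _ hr, g2]
  · intro k
    obtain ⟨q, r, hr, rfl⟩ := ex k
    obtain ⟨g1, -, g3, -⟩ := hβ r hr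
    have := mono n le_rfl (r + 1) hr
    rw [add_right_comm, hγ q (r + 1) hr, show β (r + 1) + q * l.length - 1 =
      β (r + 1) - 1 + q * l.length by omega, ← getl _ _ (by omega), ← getm _ _ hr, g3]
  all_goals
    intro k i
    obtain ⟨q, r, hr, rfl⟩ := ex k
    obtain ⟨g1, -, -, g4⟩ := hβ r hr
    have := mono n le_rfl (r + 1) hr
    rw [add_right_comm, hγ q r hr.le, hγ q (r + 1) hr]
    intro hi1 hi2
    obtain ⟨j, rfl⟩ := Nat.exists_eq_add_of_le' (show q * l.length ≤ i by omega)
    rw [← getl _ _ (by omega), ← getm _ _ hr]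
  · exact (g4 j (by omega) (by omega)).1
  · exact (g4 j (by omega) (by omega)).2

end OmegaCloud

namespace OmegaCloud
open Complex (I)
open scoped ComplexConjugate

variable {ω : ℝ} {V : Set ℂ} {l m : List DirArc} {a b : ℕ → ℂ} {s e : ℕ → ℝ} {β : ℕ → ℕ}

/-! ### The transitions between the arcs of a cloud -/

theorem Phase.lineHit_eq {A : DirArc} {a b : ℂ} {s T R r : ℝ} (h : Phase ω A a b s T R)
    (hr : r ≠ 0) : lineHit A.center A.start (r * cis s) = a := by
  rw [lineHit, Sim.div_conj hr, h.start_sub, map_mul, Complex.conj_ofReal, conj_cis, mul_assoc,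
    ← cis_add]
  have := h.a_sub
  rw [show s - T / 2 + Real.pi / 2 = -(s + T / 2 + Real.pi / 2) + 2 * s + Real.pi by ring,
    cis_add_pi] at this
  linear_combination -this

theorem Phase.a_eq {A : DirArc} {a b : ℂ} {s T R : ℝ} (h : Phase ω A a b s T R) :
    a = A.pt T := by
  have e : a - A.center = (A.start - A.center) * cis (-T) := by
    rw [h.a_sub, h.start_sub, mul_assoc, ← cis_add]; congr 2; ring
  rw [DirArc.pt]; linear_combination e

namespace Chain

theorem index_eq (h : Chain ω V l a b s e) (hl : 0 < l.length) {i j : ℕ} (ha : a i = a j)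
    (hb : b i = b j) : i % l.length = j % l.length := by
  have pa : ∀ i, a (i % l.length) = a i := fun i => by
    have : ∀ q r, a (r + q * l.length) = a r := by
      intro q r
      induction q with
      | zero => simp
      | succ q ih => rw [Nat.succ_mul, ← add_assoc, h.pa, ih]
    rw [← this (i / l.length), mul_comm, Nat.mod_add_div]
  have pb : ∀ i, b (i % l.length) = b i := fun i => by
    have : ∀ q r, b (r + q * l.length) = b r := by
      intro q r
      induction q with
      | zero => simp
      | succ q ih => rw [Nat.succ_mul, ← add_assoc, h.pb, ih]
    rw [← this (i / l.length), mul_comm, Nat.mod_add_div]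
  exact h.inj _ _ (Nat.mod_lt _ hl) (Nat.mod_lt _ hl) (by rw [pa, pa, ha]) (by rw [pb, pb, hb])

theorem pair_ne_succ (h : Chain ω V l a b s e) (hl : 1 < l.length) {i : ℕ}
    (ha : a (i + 1) = a i) : b (i + 1) ≠ b i := by
  intro hb
  have h1 := h.index_eq (by omega) ha hb
  have h2 := Nat.mod_lt i (show 0 < l.length by omega)
  rcases (show i % l.length + 1 < l.length ∨ i % l.length + 1 = l.length by omega) with h3 | h3
  · rw [Nat.add_mod, Nat.mod_eq_of_lt hl, Nat.mod_eq_of_lt h3] at h1; omega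
  · rw [Nat.add_mod, Nat.mod_eq_of_lt hl, h3, Nat.mod_self] at h1; omega

/-- A transition without rotation about a vertex: the left arm touches both left vertices. -/
theorem flip (h0 : 0 < ω) (hπ : ω < Real.pi) (h : Chain ω V l a b s e) {i : ℕ}
    (hf : (arcAt l i).finish ≠ a i) : s (i + 1) = e i ∧ ∃ r r' : ℝ, 0 < r ∧ r ≤ r' ∧
      a i - (arcAt l i).finish = r * cis (e i) ∧
      a (i + 1) - (arcAt l i).finish = r' * cis (e i) := by
  have hs : s (i + 1) = e i := by
    rcases h.step i with hs | hs
    · exact hs.1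
    · exact absurd hs.2.2.1 hf
  obtain ⟨r, hr, er⟩ := (h.touch_finish i).left_eq h0 hπ
  obtain ⟨r', -, er'⟩ := (h.touch_start (i + 1)).left_eq h0 hπ
  rw [← h.link, hs] at er'
  have hr : 0 < r := lt_of_le_of_ne hr (by rintro rfl; apply hf; rw [er]; simp)
  refine ⟨hs, r, r', hr, ?_, by rw [er]; ring, by rw [er']; ring⟩
  have := (h.supp_ab i le_rfl (h.e_lt_s i).le).1
  have h1 := (h.supp_ab i (h.e_lt_s i).le le_rfl).1 _ (h.ma (i + 1))
  rw [er, er', ht_add, ht_add, ht_real_mul, ht_real_mul, ht_cis] at h1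
  have hsin : Real.sin (e i - s i) < 0 :=
    Real.sin_neg_of_neg_of_neg_pi_lt (by linarith [h.e_lt_s i]) (by linarith [h.s_lt_e i])
  by_contra hcon
  have := mul_pos_of_neg_of_neg (sub_neg.2 (not_le.1 hcon)) hsin
  linarith

theorem tau_lt (h0 : 0 < ω) (hπ : ω < Real.pi) (h : Chain ω V l a b s e) (i : ℕ) :
    Chain.tau l a i < 2 * Real.pi := by
  obtain ⟨R, hR⟩ := h.exists_phase h0 hπ i
  linarith [hR.T2]

theorem pt_ne_a (h0 : 0 < ω) (hπ : ω < Real.pi) (h : Chain ω V l a b s e) {i : ℕ} {x : ℝ}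
    (hx0 : 0 ≤ x) (hx : x < (arcAt l i).meas) : (arcAt l i).pt x ≠ a i := by
  obtain ⟨R, hR⟩ := h.exists_phase h0 hπ i
  intro hc
  rw [hR.a_eq] at hc
  have := h.tau_lt h0 hπ i
  have := hR.mT
  have := DirArc.pt_inj' (h.valid i) hc (by linarith) (by linarith)
  linarith

/-- Two consecutive arcs on the same circle meet in a vertex about which the wedge is rotated. -/
theorem finish_eq_of_center_eq (h0 : 0 < ω) (hπ : ω < Real.pi) (h : Chain ω V l a b s e)
    (hl : 1 < l.length) {i : ℕ} (hc : (arcAt l i).center = (arcAt l (i + 1)).center) :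
    (arcAt l i).finish = a i := by
  by_contra hf
  obtain ⟨hs, r, r', hr, hrr, e1, e2⟩ := h.flip h0 hπ hf
  obtain ⟨R, p⟩ := h.exists_phase h0 hπ i
  obtain ⟨R', p'⟩ := h.exists_phase h0 hπ (i + 1)
  rw [hs] at p'
  -- With the circle and the line of the left arm unchanged, their second intersection is unchanged,
  -- and then so is `b`; but consecutive arcs have different pairs.
  have ha : a (i + 1) = a i := by
    have g1 := p'.lineHit_eq hr.ne'
    rw [← g1, lineHit, Sim.div_conj hr.ne', ← h.link, ← hc, p.finish_sub (h.valid i), map_mul,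
      Complex.conj_ofReal, conj_cis, mul_assoc, ← cis_add]
    have g2 := p.a_sub
    rw [show s i - tau l a i / 2 + Real.pi / 2 = -(s i + tau l a i / 2 + Real.pi / 2 -
      (arcAt l i).meas) + 2 * e i + Real.pi by rw [h.he]; ring, cis_add_pi] at g2
    linear_combination -g2
  refine h.pair_ne_succ hl ha ?_
  have b1 := h.b_sub h0 hπ i
  have b2 := h.b_sub h0 hπ (i + 1)
  rw [← hc, ha, ← b1] at b2
  exact sub_left_injective b2

theorem pivot (h0 : 0 < ω) (hπ : ω < Real.pi) (h : Chain ω V l a b s e) {i : ℕ}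
    (hf : (arcAt l i).finish = a i) : e i - ω ≤ s (i + 1) ∧ s (i + 1) ≤ e i ∧
      (arcAt l i).meas = tau l a i ∧ tau l a (i + 1) = 2 * (Real.pi - ω) := by
  rcases h.step i with hs | ⟨h1, h2, -, h4⟩
  · exact absurd hf hs.2
  · obtain ⟨R, p⟩ := h.exists_phase h0 hπ i
    obtain ⟨R', p'⟩ := h.exists_phase h0 hπ (i + 1)
    exact ⟨h1, h2, p.finish_eq_iff.1 hf, p'.start_eq_iff.1 (by rw [← h.link, h4])⟩

/-- The apex arrives in the position of the left vertex and leaves in that of the right one. On a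
common circle the polar angles of this point can be compared, which gives the turn modulo `2 π`; its
range `[0, ω]` decides. -/
theorem pivot_angle (h0 : 0 < ω) (hπ : ω < Real.pi) (h : Chain ω V l a b s e) {i : ℕ}
    (hf : (arcAt l i).finish = a i) (hc : (arcAt l i).center = (arcAt l (i + 1)).center) :
    s (i + 1) = e i - (Real.pi - ω) := by
  obtain ⟨h1, h2, h3, h4⟩ := h.pivot h0 hπ hf
  obtain ⟨R, p⟩ := h.exists_phase h0 hπ i
  obtain ⟨R', p'⟩ := h.exists_phase h0 hπ (i + 1)
  have g1 := p.finish_sub (h.valid i)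
  have g2 := p'.start_sub
  rw [← h.link, ← hc, g1] at g2
  have hRR : R = R' := by
    have := congrArg norm g2
    rwa [norm_sub_eq_one p.R0.le, norm_sub_eq_one p'.R0.le] at this
  subst hRR
  have hR : (R : ℂ) ≠ 0 := by exact_mod_cast p.R0.ne'
  obtain ⟨k, hk⟩ := cis_eq_iff.1 (mul_left_cancel₀ hR g2)
  rw [h3, h4] at hk
  rw [h.he, h3] at h1 h2 ⊢
  exact DirArc.eq_of_int_mul (k := -k) (by push_cast; linarith) (by linarith) (by linarith)

end Chain

/-! ### Merged arcs as unions of blocks of cloud arcs -/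

namespace Blocks

theorem strictMono (hB : Blocks m l β) : StrictMono β := strictMono_nat_of_lt_succ hB.lt

theorem β_length (hB : Blocks m l β) : β m.length = l.length := by
  have := hB.add_length 0
  rwa [zero_add, hB.zero, zero_add] at this

theorem one_lt_length (hB : Blocks m l β) (hm : 1 < m.length) : 1 < l.length := by
  rw [← hB.β_length]
  have := hB.strictMono.id_le m.length
  exact lt_of_lt_of_le hm this

theorem center (hB : Blocks m l β) {k i : ℕ} (h1 : β k ≤ i) (h2 : i < β (k + 1)) :
    (arcAt l i).center = (arcAt m k).center := (hB.circle k i h1 h2).1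

theorem exists_block (hB : Blocks m l β) (i : ℕ) : ∃ k, β k ≤ i ∧ i < β (k + 1) := by
  induction i with
  | zero => exact ⟨0, hB.zero.le, by have := hB.lt 0; omega⟩
  | succ i ih =>
    obtain ⟨k, h1, h2⟩ := ih
    have := hB.lt (k + 1)
    rcases Nat.lt_or_ge (i + 1) (β (k + 1)) with h3 | h3
    · exact ⟨k, by omega, h3⟩
    · exact ⟨k + 1, h3, by omega⟩

end Blocks

theorem Chain.pt_add (h : Chain ω V l a b s e) (hB : Blocks m l β) {k i : ℕ} (h1 : β k ≤ i)
    (h2 : i < β (k + 1)) (x : ℝ) :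
    (arcAt l i).pt x = (arcAt l (β k)).pt (∑ j ∈ Finset.Ico (β k) i, (arcAt l j).meas + x) := by
  induction i, h1 using Nat.le_induction generalizing x with
  | base => simp
  | succ i hi ih =>
    have hc : (arcAt l (i + 1)).center = (arcAt l i).center := by
      rw [hB.center (by omega) h2, hB.center hi (by omega)]
    rw [Finset.sum_Ico_succ_top hi, add_assoc, ← ih (by omega)]
    have := (h.valid i).meas_spec.2.2
    rw [h.link] at this
    simp only [DirArc.pt] at this ⊢
    rw [this, hc, neg_add, cis_add]; ring

/-- A longer block would overrun its own start. The overlap contains apices that are not left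
contacts, so the wedge there is unique up to turns; but the two passages have directions that differ
by less than a full turn. -/
theorem Chain.block_meas_le (h0 : 0 < ω) (hπ : ω < Real.pi) (h : Chain ω V l a b s e)
    (hB : Blocks m l β) (hm : 1 < m.length) (k : ℕ) :
    ∑ j ∈ Finset.Ico (β k) (β (k + 1)), (arcAt l j).meas ≤ 2 * Real.pi := by
  by_contra! hcon
  have hl := hB.one_lt_length hm
  set P : ℕ → ℝ := fun i => ∑ j ∈ Finset.Ico (β k) i, (arcAt l j).meas with hP
  obtain ⟨m0, m2, -⟩ := (h.valid (β k)).meas_spec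
  set y := min (P (β (k + 1))) (2 * Real.pi + (arcAt l (β k)).meas) with hy
  have hy1 : y ≤ P (β (k + 1)) := min_le_left _ _
  have hy2 : y ≤ 2 * Real.pi + (arcAt l (β k)).meas := min_le_right _ _
  have hy3 : 2 * Real.pi < y := lt_min hcon (by linarith)
  have hk := hB.lt k
  obtain ⟨i', hi1, hi2, hi3⟩ := exists_index (f := fun j => -P (β k + j)) (x := -y)
    (β (k + 1) - β k) (by simp [hP]; linarith [Real.pi_pos]) (by
      simp only [show β k + (β (k + 1) - β k) = β (k + 1) by omega]; linarith)
  set i := β k + i' with hi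
  have hiP : P (i + 1) = P i + (arcAt l i).meas := Finset.sum_Ico_succ_top (by omega) _
  simp only [← add_assoc, ← hi, hiP, neg_lt_neg_iff] at hi2 hi3
  -- A position in the overlap: inside the arc `i` of the block and, after subtraction of `2 π`,
  -- inside its first arc.
  set z := (max (P i) (2 * Real.pi) + y) / 2 with hz
  have hz1 := le_max_left (P i) (2 * Real.pi)
  have hz2 := le_max_right (P i) (2 * Real.pi)
  have hz3 : max (P i) (2 * Real.pi) < y := max_lt hi3 hy3
  have t1 := h.touch (β k) (z - 2 * Real.pi) (by linarith) (by linarith)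
  have n1 := h.pt_ne_a h0 hπ (i := β k) (x := z - 2 * Real.pi) (by linarith) (by linarith)
  have t2 := h.touch i (z - P i) (by linarith) (by linarith)
  have n2 := h.pt_ne_a h0 hπ (i := i) (x := z - P i) (by linarith) (by linarith)
  have epi : (arcAt l i).pt (z - P i) = (arcAt l (β k)).pt (z - 2 * Real.pi) := by
    rw [h.pt_add hB (k := k) (by omega) (by omega), show ∑ j ∈ Finset.Ico (β k) i,
      (arcAt l j).meas = P i from rfl]
    simp only [DirArc.pt]
    rw [← cis_add_two_pi (-(P i + (z - P i)))]
    congr 3; ring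
  rw [epi] at t2 n2
  obtain ⟨q, hq⟩ := t1.angle_unique h0 hπ t2 n1 n2
  have hne : i' ≠ 0 := by
    intro h'
    rw [show i = β k by omega] at hi2 hi3 hz
    simp only [hP, Finset.Ico_self, Finset.sum_empty] at hi2 hi3
    linarith
  have o1 := h.s_anti.antitone (show β k + 1 ≤ i by omega)
  have o2 := h.s_succ_le (β k)
  have hN : β (k + 1) < β k + l.length := by
    rw [← hB.add_length]; exact hB.strictMono (by omega)
  have o3 := h.s_anti (show i + 1 < β k + l.length by omega)
  rw [h.period h0 hπ (by omega)] at o3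
  have o4 := h.s_succ_le i
  have := h.he i
  have := h.he (β k)
  have := DirArc.eq_of_int_mul hq (by linarith) (by linarith)
  linarith

/-- Both measures lead from the common start to the common end, so they agree modulo `2 π`;
positivity and `block_meas_le` leave only equality. -/
theorem Chain.block_meas (h0 : 0 < ω) (hπ : ω < Real.pi) (h : Chain ω V l a b s e)
    (hB : Blocks m l β) (hm : 1 < m.length) (hseq : IsArcSequence m) (k : ℕ) :
    ∑ j ∈ Finset.Ico (β k) (β (k + 1)), (arcAt l j).meas = (arcAt m k).meas := by
  have hk := hB.lt k
  have hv := hseq.valid (by omega) k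
  obtain ⟨i, hi⟩ : ∃ i, β (k + 1) = i + 1 := ⟨β (k + 1) - 1, by omega⟩
  have e1 := hB.finish k
  rw [hi, Nat.add_sub_cancel, (h.valid i).meas_spec.2.2, h.pt_add hB (k := k) (by omega) (by omega),
    ← Finset.sum_Ico_succ_top (by omega), ← hi, DirArc.pt, hB.start, hB.center le_rfl hk,
    hv.meas_spec.2.2] at e1
  have hle := h.block_meas_le h0 hπ hB hm k
  obtain ⟨m0, m2, -⟩ := hv.meas_spec
  have hpos : 0 < ∑ j ∈ Finset.Ico (β k) (β (k + 1)), (arcAt l j).meas :=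
    Finset.sum_pos (fun j _ => (h.valid j).meas_spec.1) ⟨β k, by simp [hk]⟩
  exact DirArc.pt_inj' hv e1 (by linarith) (by linarith)

/-- The remaining part of a block. -/
theorem Chain.start_eq_of_block (h0 : 0 < ω) (hπ : ω < Real.pi) (h : Chain ω V l a b s e)
    (hB : Blocks m l β) (hm : 1 < m.length) (hseq : IsArcSequence m) {k i : ℕ} (h1 : β k ≤ i) (h2 : i < β (k + 1)) :
    (arcAt l i).start - (arcAt m k).center = ((arcAt m k).finish - (arcAt m k).center) *
      cis (∑ j ∈ Finset.Ico i (β (k + 1)), (arcAt l j).meas) := by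
  have hv := hseq.valid (by omega) k
  have e1 := h.pt_add hB h1 h2 0
  rw [DirArc.pt_zero, add_zero] at e1
  have e2 := hv.meas_spec.2.2
  rw [← h.block_meas h0 hπ hB hm hseq k, ← Finset.sum_Ico_consecutive _ h1 h2.le] at e2
  simp only [DirArc.pt] at e1 e2
  rw [hB.start, hB.center le_rfl (hB.lt k)] at e1
  rw [e1, e2, neg_add, cis_add]
  have := cis_neg_mul (∑ j ∈ Finset.Ico i (β (k + 1)), (arcAt l j).meas)
  linear_combination -(((arcAt m k).start - (arcAt m k).center) *
    cis (-(∑ j ∈ Finset.Ico (β k) i, (arcAt l j).meas))) * this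

end OmegaCloud

namespace OmegaCloud
open Complex (I)
open scoped ComplexConjugate

/-! ### The simulation follows the arcs of the cloud -/

variable {ω : ℝ} {V : Set ℂ} {l m : List DirArc} {a b : ℕ → ℂ} {s e : ℕ → ℝ} {β : ℕ → ℕ}

/-- The cloud with the arcs `l` can be merged into the sequence `m` by the blocks `β`. -/
structure Merged (ω : ℝ) (V : Set ℂ) (m l : List DirArc) (a b : ℕ → ℂ) (s e : ℕ → ℝ)
    (β : ℕ → ℕ) : Prop where
  chain : Chain ω V l a b s e
  blocks : Blocks m l β
  len : 1 < m.length
  seq : IsArcSequence m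
  ne : ∀ k, ¬ SameCircle (arcAt m k) (arcAt m (k + 1))

theorem IsMaximalCloud.exists_merged (h0 : 0 < ω) (hπ : ω < Real.pi) {vs : List ℂ}
    (hm : 1 < m.length) (hseq : IsArcSequence m) (h : IsMaximalCloud ω vs m) :
    ∃ V l a b s e β, Merged ω V m l a b s e β := by
  obtain ⟨bs, hc, hf, hne⟩ := h
  obtain ⟨β, hB⟩ := exists_blocks' (by omega) hf
  have := hB.one_lt_length hm
  obtain ⟨a, b, s, e, hch⟩ := exists_chain h0 hπ (by omega) hc
  exact ⟨_, _, a, b, s, e, β, hch, hB, hm, hseq,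
    fun k => hne _ ((mem_consecutive_iff (by omega) _).2 ⟨k, rfl⟩)⟩

namespace Merged

/-- The state of the simulation at the start of the `i`-th arc of the cloud. -/
noncomputable def state (l : List DirArc) (a : ℕ → ℂ) (s : ℕ → ℝ) (β : ℕ → ℕ) (k i : ℕ) : Sim :=
  ⟨k, Chain.tau l a i, ∑ j ∈ Finset.Ico i (β (k + 1)), (arcAt l j).meas, s 0 - s i⟩

section
variable {k i : ℕ}

theorem state_a (h0 : 0 < ω) (hπ : ω < Real.pi) (h : Merged ω V m l a b s e β) (h1 : β k ≤ i)
    (h2 : i < β (k + 1)) : (state l a s β k i).a m = a i := by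
  obtain ⟨R, p⟩ := h.chain.exists_phase h0 hπ i
  have e1 := h.chain.start_eq_of_block h0 hπ h.blocks h.len h.seq h1 h2
  have e2 := p.a_eq
  rw [Sim.a, state]
  simp only
  rw [cis_sub, ← mul_assoc, ← e1, e2, DirArc.pt, h.blocks.center h1 h2]

theorem state_b (h0 : 0 < ω) (hπ : ω < Real.pi) (h : Merged ω V m l a b s e β) (h1 : β k ≤ i)
    (h2 : i < β (k + 1)) : (state l a s β k i).b ω m = b i := by
  have e1 := h.state_a h0 hπ h1 h2
  have e2 := h.chain.b_sub h0 hπ i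
  rw [h.blocks.center h1 h2, ← e1] at e2
  rw [Sim.b, cis_add, ← mul_assoc]
  rw [Sim.a] at e2
  have : (state l a s β k i).k = k := rfl
  rw [this] at e2 ⊢
  linear_combination -e2

theorem finish_eq_of_lt (h0 : 0 < ω) (hπ : ω < Real.pi) (h : Merged ω V m l a b s e β)
    (h1 : β k ≤ i) (h2 : i + 1 < β (k + 1)) : (arcAt l i).finish = a i := by
  refine h.chain.finish_eq_of_center_eq h0 hπ (h.blocks.one_lt_length h.len) ?_
  rw [h.blocks.center h1 (by omega), h.blocks.center (by omega) h2]

theorem u_last (h2 : i + 1 = β (k + 1)) : (state l a s β k i).u = (arcAt l i).meas := by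
  simp [state, ← h2]

theorem u_first (h0 : 0 < ω) (hπ : ω < Real.pi) (h : Merged ω V m l a b s e β) :
    (state l a s β k (β k)).u = (arcAt m k).meas :=
  h.chain.block_meas h0 hπ h.blocks h.len h.seq k

/-- Inside a block the arcs share their circle, so they are separated by pivots of angle `π - ω`:
the first case of `Sim.step`. -/
theorem state_step_of_lt (h0 : 0 < ω) (hπ : ω < Real.pi) (h : Merged ω V m l a b s e β)
    (h1 : β k ≤ i) (h2 : i + 1 < β (k + 1)) :
    (state l a s β k i).τ < (state l a s β k i).u ∧
      (state l a s β k i).step ω m = state l a s β k (i + 1) := by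
  have hf := h.finish_eq_of_lt h0 hπ h1 h2
  obtain ⟨-, -, e3, e4⟩ := h.chain.pivot h0 hπ hf
  have e5 := h.chain.pivot_angle h0 hπ hf
    (by rw [h.blocks.center h1 (by omega), h.blocks.center (by omega) h2])
  have hu : (state l a s β k i).u = Chain.tau l a i + (state l a s β k (i + 1)).u := by
    simp only [state]
    rw [Finset.sum_eq_sum_Ico_succ_bot (by omega), e3]
  have hpos : 0 < (state l a s β k (i + 1)).u :=
    Finset.sum_pos (s := Finset.Ico (i + 1) (β (k + 1))) (fun j _ => (h.chain.valid j).meas_spec.1) ⟨i + 1, by simp [h2]⟩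
  have hlt : (state l a s β k i).τ < (state l a s β k i).u := by
    rw [hu]; simp only [state] at hpos ⊢; linarith
  refine ⟨hlt, ?_⟩
  rw [Sim.step_hidden hlt]
  refine Sim.ext rfl e4.symm ?_ ?_
  · simp only
    rw [hu]; simp only [state]; ring
  · simp only [state]
    rw [e5, h.chain.he, e3]; ring

/-- At the end of a block. -/
theorem state_step_of_eq (h0 : 0 < ω) (hπ : ω < Real.pi) (h : Merged ω V m l a b s e β)
    (h1 : β k ≤ i) (h2 : i + 1 = β (k + 1)) :
    (state l a s β k i).Ok ω m ∧ (state l a s β k i).u ≤ (state l a s β k i).τ ∧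
      (state l a s β k i).step ω m = state l a s β (k + 1) (i + 1) := by
  obtain ⟨R, p⟩ := h.chain.exists_phase h0 hπ i
  obtain ⟨R', p'⟩ := h.chain.exists_phase h0 hπ (i + 1)
  have hu := u_last (l := l) (a := a) (s := s) h2
  have hτ : (state l a s β k i).τ = Chain.tau l a i := rfl
  have hle : (state l a s β k i).u ≤ (state l a s β k i).τ := by rw [hu]; exact p.mT
  have hfin : (arcAt l i).finish = (arcAt m k).finish := by
    rw [← h.blocks.finish k, ← h2, Nat.add_sub_cancel]
  have hs : (arcAt l i).finish = (arcAt l (i + 1)).start := h.chain.link i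
  have hc := h.blocks.center h1 (by omega)
  have hk := h.blocks.lt (k + 1)
  have hc' := h.blocks.center h2.ge (by omega)
  have ha := h.state_a h0 hπ h1 (by omega)
  have hu' : (state l a s β (k + 1) (i + 1)).u = (arcAt m (k + 1)).meas := by
    rw [h2]; exact h.u_first h0 hπ
  have hcw : (arcAt m (k + 1)).clockwise = true := by
    rw [← h.blocks.cw (k + 1) _ h2.ge (by omega)]; exact h.chain.cw _
  have hpo : (state l a s β k i).pivotOut m = R' * cis (s (i + 1) + Chain.tau l a (i + 1) / 2 +
      Real.pi / 2) := by
    rw [← p'.start_sub, ← hs, hfin, hc']; rfl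
  have hpo0 : (state l a s β k i).pivotOut m ≠ 0 := by
    rw [hpo]; exact mul_ne_zero (by exact_mod_cast p'.R0.ne') (cis_ne_zero _)
  by_cases hf : (arcAt l i).finish = a i
  · obtain ⟨g1, g2, g3, g4⟩ := h.chain.pivot h0 hπ hf
    have hpi : (state l a s β k i).pivotIn ω m = R * cis (e i + (Real.pi - ω) + Real.pi / 2) := by
      have e1 := p.finish_sub (h.chain.valid i)
      rw [hfin, hc, g3] at e1
      rw [Sim.pivotIn, show (state l a s β k i).k = k from rfl, e1, mul_assoc, ← cis_add, h.chain.he,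
        g3]
      congr 2; ring
    have hpi0 : (state l a s β k i).pivotIn ω m ≠ 0 := by
      rw [hpi]; exact mul_ne_zero (by exact_mod_cast p.R0.ne') (cis_ne_zero _)
    obtain ⟨j1, j2⟩ := unAngle_eq (w := (state l a s β k i).pivotOut m) (r := R' / R)
      (θ := e i - s (i + 1)) hpi0 (div_pos p'.R0 p.R0) (by
        have hR : (R : ℂ) ≠ 0 := by exact_mod_cast p.R0.ne'
        rw [hpo, hpi, g4, mul_assoc, ← cis_add]
        push_cast
        rw [show s (i + 1) + 2 * (Real.pi - ω) / 2 + Real.pi / 2 =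
          e i + (Real.pi - ω) + Real.pi / 2 + -(e i - s (i + 1)) by ring]
        field_simp) (by linarith) (by linarith)
    have hpv : (state l a s β k i).u = (state l a s β k i).τ := by rw [hu, hτ, g3]
    refine ⟨Or.inr ⟨hcw, h.ne k, fun hlt => absurd hpv hlt.ne, fun _ => ⟨j2, ?_⟩⟩, hle, ?_⟩
    · rw [j1]; linarith
    · rw [Sim.step_pivot hpv, j1]
      refine Sim.ext rfl g4.symm hu'.symm ?_
      simp only
      rw [hu]; simp only [state]; rw [h.chain.he]; ring
  · obtain ⟨g1, r, r', hr, hrr, g2, g3⟩ := h.chain.flip h0 hπ hf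
    have hlt : (state l a s β k i).u < (state l a s β k i).τ := by
      rw [hu, hτ]; exact lt_of_le_of_ne p.mT fun hc => hf (p.finish_eq_iff.2 hc)
    have hnext : (state l a s β k i).nextA m = a (i + 1) := by
      rw [Sim.nextA, ha, show (state l a s β k i).k = k from rfl, ← hfin, g2, hs, ← hc', ← g1]
      exact p'.lineHit_eq hr.ne'
    have hcwa : cwAngle ((state l a s β k i).pivotOut m)
        ((state l a s β k i).nextA m - (arcAt m ((state l a s β k i).k + 1)).center) =
        Chain.tau l a (i + 1) := by
      rw [hnext, Chain.tau, hc', ← hs, hfin]; rfl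
    refine ⟨Or.inr ⟨hcw, h.ne k, fun _ => ?_, fun hpv => absurd hpv hlt.ne⟩, hle, ?_⟩
    · rw [hnext, ha, show (state l a s β k i).k = k from rfl, ← hfin, g2,
        show a (i + 1) - a i = ((r' - r : ℝ) : ℂ) * cis (e i) by push_cast; linear_combination g3 - g2,
        map_mul, Complex.conj_ofReal, conj_cis]
      rw [show ((r' - r : ℝ) : ℂ) * cis (e i) * (r * cis (-e i)) =
        ((r' - r) * r : ℝ) * (cis (e i) * cis (-e i)) by push_cast; ring, cis_mul_neg, mul_one,
        Complex.ofReal_re]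
      exact mul_nonneg (by linarith) hr.le
    · rw [Sim.step_flip hlt, hcwa]
      refine Sim.ext rfl rfl hu'.symm ?_
      simp only
      rw [hu, show (state l a s β (k + 1) (i + 1)).ρ = s 0 - s (i + 1) from rfl, g1, h.chain.he]
      simp only [state]; ring

theorem state_ok (h0 : 0 < ω) (hπ : ω < Real.pi) (h : Merged ω V m l a b s e β) (h1 : β k ≤ i)
    (h2 : i < β (k + 1)) : (state l a s β k i).Ok ω m := by
  rcases (show i + 1 < β (k + 1) ∨ i + 1 = β (k + 1) by omega) with h3 | h3
  · exact Or.inl (h.state_step_of_lt h0 hπ h1 h3).1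
  · exact (h.state_step_of_eq h0 hπ h1 h3).1

/-- Started from the true position of the left vertex, the simulation follows the cloud, with one
step per cloud arc. -/
theorem sim_eq (h0 : 0 < ω) (hπ : ω < Real.pi) (h : Merged ω V m l a b s e β) (h1 : β k ≤ i)
    (h2 : i < β (k + 1)) : sim ω m (Chain.tau l a 0) i = state l a s β k i := by
  induction i generalizing k with
  | zero =>
    have hk : k = 0 := by
      have := h.blocks.strictMono.id_le k
      simp only [id] at this; omega
    subst hk
    have hu := h.u_first h0 hπ (k := 0)
    rw [h.blocks.zero] at hu
    exact Sim.ext rfl rfl hu.symm (sub_self _).symm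
  | succ i ih =>
    rw [sim_succ]
    rcases (show β k ≤ i ∨ β k = i + 1 by omega) with h3 | h3
    · rw [ih h3 (by omega)]
      exact (h.state_step_of_lt h0 hπ h3 h2).2
    · obtain ⟨k', rfl⟩ : ∃ k', k = k' + 1 := by
        rcases k with _ | k
        · rw [h.blocks.zero] at h3; omega
        · exact ⟨k, rfl⟩
      have h4 := h.blocks.lt k'
      rw [ih (k := k') (by omega) (by omega)]
      exact (h.state_step_of_eq h0 hπ (by omega) h3.symm).2.2

theorem eps_eq (h0 : 0 < ω) (hπ : ω < Real.pi) (h : Merged ω V m l a b s e β) (h1 : β k ≤ i)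
    (h2 : i < β (k + 1)) : (state l a s β k i).eps = s 0 - e i := by
  have hmin : min (state l a s β k i).τ (state l a s β k i).u = (arcAt l i).meas := by
    rcases (show i + 1 < β (k + 1) ∨ i + 1 = β (k + 1) by omega) with h3 | h3
    · rw [min_eq_left (h.state_step_of_lt h0 hπ h1 h3).1.le]
      exact ((h.chain.pivot h0 hπ (h.finish_eq_of_lt h0 hπ h1 h3)).2.2.1).symm
    · rw [min_eq_right (h.state_step_of_eq h0 hπ h1 h3).2.1, u_last h3]
  rw [Sim.eps, hmin, h.chain.he]; simp only [state]; ring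

end

/-- For a genuine cloud the lag condition holds because both arms touch one polygon: the left arm at
rotation `x` and the right arm at rotation `x + (π - ω)` have the same support direction. -/
theorem passes (h0 : 0 < ω) (hπ : ω < Real.pi) (h : Merged ω V m l a b s e β) :
    Passes ω m (Chain.tau l a 0) l.length := by
  have hl := h.blocks.one_lt_length h.len
  have hN := h.blocks.β_length
  have simN := h.sim_eq h0 hπ hN.le (by rw [← hN]; exact h.blocks.lt _)
  have hper := h.chain.period h0 hπ (by omega) 0
  rw [zero_add] at hper
  have tauN : Chain.tau l a l.length = Chain.tau l a 0 := by
    have e1 := arcAt_add_length l 0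
    have e2 := h.chain.pa 0
    rw [zero_add] at e1 e2
    rw [Chain.tau, e1, e2]; rfl
  obtain ⟨R, p⟩ := h.chain.exists_phase h0 hπ 0
  have rho : ∀ i, (sim ω m (Chain.tau l a 0) i).ρ = s 0 - s i := by
    intro i
    obtain ⟨k, h1, h2⟩ := h.blocks.exists_block i
    rw [h.sim_eq h0 hπ h1 h2]; rfl
  have eps : ∀ i, (sim ω m (Chain.tau l a 0) i).eps = s 0 - e i := by
    intro i
    obtain ⟨k, h1, h2⟩ := h.blocks.exists_block i
    rw [h.sim_eq h0 hπ h1 h2]; exact h.eps_eq h0 hπ h1 h2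
  refine ⟨⟨p.T0, by linarith [p.T2], by rw [simN]; rfl, ?_, ?_, by rw [simN]; exact tauN, ?_⟩, ?_⟩
  · intro i hi
    obtain ⟨k, h1, h2⟩ := h.blocks.exists_block i
    rw [h.sim_eq h0 hπ h1 h2]
    exact h.blocks.strictMono.lt_iff_lt.1 (by rw [hN]; exact h1.trans_lt hi)
  · intro i hi
    obtain ⟨k, h1, h2⟩ := h.blocks.exists_block i
    rw [h.sim_eq h0 hπ h1 h2]; exact h.state_ok h0 hπ h1 h2
  · rw [rho, hper]; ring
  · intro i hi j x h1 h2 h3 h4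
    rw [rho] at h1 h2
    rw [eps] at h4
    obtain ⟨k, k1, k2⟩ := h.blocks.exists_block i
    obtain ⟨k', k1', k2'⟩ := h.blocks.exists_block j
    rw [h.sim_eq h0 hπ k1 k2, h.state_a h0 hπ k1 k2, h.sim_eq h0 hπ k1' k2', h.state_b h0 hπ k1' k2']
    -- `Supp.unique` needs two directions; `d` is the length of an interval in which both contacts
    -- persist.
    obtain ⟨d, hd0, hd⟩ : ∃ d, 0 < d ∧ d < Real.pi ∧ d < s 0 - x - s (i + 1) ∧
        d < s 0 - (x + (Real.pi - ω)) - e j := by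
      obtain ⟨d, hd0, hd⟩ := exists_between (show 0 < min Real.pi (min (s 0 - x - s (i + 1))
        (s 0 - (x + (Real.pi - ω)) - e j)) from
        lt_min Real.pi_pos (lt_min (by linarith) (by linarith)))
      exact ⟨d, hd0, by simpa using hd⟩
    have sb : ∀ y, e j ≤ y → y ≤ s 0 - (x + (Real.pi - ω)) → Supp V (b j) (y + (Real.pi - ω)) := by
      intro y hy1 hy2
      rcases j with _ | j
      · refine (h.chain.supp_ab 0 hy1 ?_).2
        linarith [h.chain.s_anti.antitone (Nat.zero_le i)]
      · have := h3 j rfl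
        rw [eps] at this
        exact h.chain.supp_b hπ j hy1 (by linarith)
    refine Supp.unique (x := s 0 - x - d) (y := s 0 - x) (h.chain.ma i) (h.chain.mb j)
      (h.chain.supp_a hπ i (by linarith) (by linarith)) (h.chain.supp_a hπ i (by linarith)
      (by linarith)) ?_ ?_ (by linarith) (by linarith)
    · have := sb (s 0 - (x + (Real.pi - ω)) - d) (by linarith) (by linarith)
      rwa [show s 0 - (x + (Real.pi - ω)) - d + (Real.pi - ω) = s 0 - x - d by ring] at this
    · have := sb (s 0 - (x + (Real.pi - ω))) (by linarith) le_rfl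
      rwa [show s 0 - (x + (Real.pi - ω)) + (Real.pi - ω) = s 0 - x by ring] at this

end Merged
end OmegaCloud

namespace OmegaCloud
open Complex (I)
open scoped ComplexConjugate

variable {ω : ℝ} {V : Set ℂ} {l m : List DirArc} {a b : ℕ → ℂ} {s e : ℕ → ℝ} {β : ℕ → ℕ}

/-! ### Rotation of the sequences -/

theorem arcAt_rotate (l : List DirArc) (i j : ℕ) : arcAt (l.rotate j) i = arcAt l (i + j) := by
  rcases Nat.eq_zero_or_pos l.length with h0 | hpos
  · rw [List.length_eq_zero_iff] at h0
    simp [arcAt, h0]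
  · have h1 : i % l.length < (l.rotate j).length := by
      rw [List.length_rotate]; exact Nat.mod_lt _ hpos
    rw [arcAt, List.length_rotate, List.getD_eq_getElem _ _ h1, List.getElem_rotate,
      ← arcAt_of_lt (Nat.mod_lt _ hpos), arcAt_mod, arcAt, arcAt, Nat.mod_add_mod]

theorem IsArcSequence.rotate (h : IsArcSequence l) (j : ℕ) : IsArcSequence (l.rotate j) := by
  refine ⟨fun A hA => h.1 A (List.mem_rotate.1 hA), fun p hp => ?_⟩
  have hl : 0 < l.length := by
    by_contra hc
    rw [List.length_eq_zero_iff.1 (Nat.eq_zero_of_not_pos hc)] at hp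
    simp [consecutive] at hp
  rw [mem_consecutive_iff (by simpa using hl)] at hp
  obtain ⟨i, rfl⟩ := hp
  simp only [arcAt_rotate]
  rw [add_right_comm]
  exact h.link hl _

theorem IsCloud.rotate {vs : List ℂ} (h : IsCloud ω vs l) (j : ℕ) : IsCloud ω vs (l.rotate j) := by
  refine ⟨h.1.rotate j, fun A hA => h.2.1 A (List.mem_rotate.1 hA), ?_, fun S => ?_⟩
  · rw [List.map_rotate, List.nodup_rotate]; exact h.2.2.1
  · rw [List.map_rotate, List.mem_rotate]; exact h.2.2.2 S

theorem IsMaximalCloud.rotate_one {vs : List ℂ} (h : IsMaximalCloud ω vs m) :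
    IsMaximalCloud ω vs (m.rotate 1) := by
  obtain ⟨bs, hc, hf, hne⟩ := h
  cases hf with
  | nil => exact ⟨[], hc, List.Forall₂.nil, by simp [consecutive]⟩
  | @cons A b m bs hA hm =>
    refine ⟨bs ++ [b], ?_, ?_, ?_⟩
    · have := hc.rotate b.length
      rw [List.flatten_cons, List.rotate_append_length_eq] at this
      simpa using this
    · rw [List.rotate_cons_succ, List.rotate_zero]
      exact List.rel_append hm (List.Forall₂.cons hA List.Forall₂.nil)
    · intro p hp
      rw [mem_consecutive_iff (by simp)] at hp
      obtain ⟨i, rfl⟩ := hp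
      simp only [arcAt_rotate]
      exact hne _ ((mem_consecutive_iff (by simp) _).2 ⟨i + 1, rfl⟩)

theorem IsMaximalCloud.rotate {vs : List ℂ} (h : IsMaximalCloud ω vs m) (j : ℕ) :
    IsMaximalCloud ω vs (m.rotate j) := by
  induction j with
  | zero => simpa using h
  | succ j ih => rw [← List.rotate_rotate]; exact ih.rotate_one

theorem IsMaximalCloud.of_rotate {vs : List ℂ} {j : ℕ} (h : IsMaximalCloud ω vs (m.rotate j)) :
    IsMaximalCloud ω vs m := by
  have := h.rotate (m.length * j - j)
  rcases Nat.eq_zero_or_pos m.length with h0 | h0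
  · rw [List.length_eq_zero_iff] at h0
    subst h0; simpa using h
  · have e : j + (m.length * j - j) = m.length * j :=
      Nat.add_sub_of_le (Nat.le_mul_of_pos_left j h0)
    rwa [List.rotate_rotate, e, List.rotate_length_mul] at this

theorem Chain.rotate (h : Chain ω V l a b s e) (hl : 0 < l.length)
    (j : ℕ) : Chain ω V (l.rotate j) (fun i => a (i + j)) (fun i => b (i + j))
      (fun i => s (i + j)) (fun i => e (i + j)) := by
  refine ⟨?_, ?_, ?_, ?_, ?_, fun i => h.ne _, ?_, ?_, ?_, ?_, ?_⟩
  · intro i; rw [arcAt_rotate]; exact h.valid _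
  · intro i; rw [arcAt_rotate]; exact h.cw _
  · intro i; rw [arcAt_rotate]; exact h.he _
  · intro i; rw [arcAt_rotate]; exact h.touch _
  · intro i; rw [arcAt_rotate]; exact h.center _
  · intro i; rw [arcAt_rotate, arcAt_rotate, add_right_comm]; exact h.link _
  · intro i; rw [arcAt_rotate, add_right_comm]; exact h.step _
  · intro i; rw [List.length_rotate, add_right_comm]; exact h.pa _
  · intro i; rw [List.length_rotate, add_right_comm]; exact h.pb _
  · intro i i' hi hi' e1 e2
    rw [List.length_rotate] at hi hi'
    have := h.index_eq hl e1 e2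
    have h3 : i ≡ i' [MOD l.length] := Nat.ModEq.add_right_cancel' j this
    exact Nat.ModEq.eq_of_lt_of_lt h3 hi hi'

theorem Blocks.rotate (hB : Blocks m l β) (j : ℕ) :
    Blocks (m.rotate j) (l.rotate (β j)) (fun k => β (k + j) - β j) := by
  have hle : ∀ k, β j ≤ β (k + j) := fun k => hB.strictMono.monotone (by omega)
  have hlt : ∀ k, β (k + j) < β (k + 1 + j) := fun k => hB.strictMono (by omega)
  refine ⟨by simp, ?_, ?_, ?_, ?_, ?_, ?_⟩
  · intro k
    have := hle k; have := hlt k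
    omega
  · intro k
    rw [List.length_rotate, List.length_rotate, add_right_comm, hB.add_length]
    have := hle k
    omega
  · intro k
    rw [arcAt_rotate, arcAt_rotate, Nat.sub_add_cancel (hle k)]; exact hB.start _
  · intro k
    have := hle k; have := hlt k
    rw [arcAt_rotate, arcAt_rotate, show β (k + 1 + j) - β j - 1 + β j = β (k + j + 1) - 1 by
      rw [add_right_comm k j]; omega]
    exact hB.finish _
  · intro k i h1 h2
    rw [arcAt_rotate, arcAt_rotate]
    exact hB.circle _ _ (by omega) (by rw [add_right_comm]; omega)
  · intro k i h1 h2
    rw [arcAt_rotate, arcAt_rotate]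
    exact hB.cw _ _ (by omega) (by rw [add_right_comm]; omega)

theorem Merged.rotate (h : Merged ω V m l a b s e β) (j : ℕ) :
    Merged ω V (m.rotate j) (l.rotate (β j)) (fun i => a (i + β j)) (fun i => b (i + β j))
      (fun i => s (i + β j)) (fun i => e (i + β j)) (fun k => β (k + j) - β j) := by
  have hl := h.blocks.one_lt_length h.len
  refine ⟨h.chain.rotate (by omega) _, h.blocks.rotate j, ?_, h.seq.rotate j, ?_⟩
  · rw [List.length_rotate]; exact h.len
  · intro k
    rw [arcAt_rotate, arcAt_rotate, add_right_comm]; exact h.ne _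

/-! ### The candidates for the initial position of the left arm -/

/-- The mirror image of the end of the first arc in the line through the first two centers. -/
noncomputable def reflectedVertex (l : List DirArc) : ℂ :=
  (arcAt l 0).center + conj (((arcAt l 0).finish - (arcAt l 0).center) /
    ((arcAt l 1).center - (arcAt l 0).center)) * ((arcAt l 1).center - (arcAt l 0).center)

/-- The total measure of the first `k` arcs. -/
noncomputable def measSum (l : List DirArc) (k : ℕ) : ℝ :=
  ∑ j ∈ Finset.range k, (arcAt l j).meas

/-- The index of the arc that contains the point at the measure `2 (π - ω)` from the start. -/
noncomputable def stopIndex (ω : ℝ) (l : List DirArc) : ℕ :=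
  sInf {k | l.length ≤ k ∨ 2 * (Real.pi - ω) ≤ measSum l (k + 1)}

/-- The point at the measure `2 (π - ω)` from the start. -/
noncomputable def stopPoint (ω : ℝ) (l : List DirArc) : ℂ :=
  (arcAt l (stopIndex ω l)).pt (2 * (Real.pi - ω) - measSum l (stopIndex ω l))

/-- The vertex on the line from the start to the point at the measure `2 (π - ω)`. -/
noncomputable def lineVertex (ω : ℝ) (l : List DirArc) : ℂ :=
  lineHit (arcAt l 0).center (arcAt l 0).start (stopPoint ω l - (arcAt l 0).start)

/-- The position on the first circle of a vertex. -/
noncomputable def tauOf (l : List DirArc) (v : ℂ) : ℝ :=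
  cwAngle ((arcAt l 0).start - (arcAt l 0).center) (v - (arcAt l 0).center)

/-- The three candidates for the initial position. -/
noncomputable def candidate (ω : ℝ) (l : List DirArc) : Fin 3 → ℝ
  | 0 => 2 * (Real.pi - ω)
  | 1 => tauOf l (reflectedVertex l)
  | 2 => tauOf l (lineVertex ω l)

/-- In a coordinate along `q - p`, the intersections of circles about `p` and `q` have equal real
and opposite imaginary parts. -/
theorem reflect_of_norm {p q f v : ℂ} (hpq : q ≠ p) (h1 : ‖f - p‖ = ‖v - p‖)
    (h2 : ‖f - q‖ = ‖v - q‖) (hne : f ≠ v) : v = p + conj ((f - p) / (q - p)) * (q - p) := by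
  have hd : q - p ≠ 0 := sub_ne_zero.2 hpq
  obtain ⟨z, rfl⟩ : ∃ z, f = p + z * (q - p) := ⟨(f - p) / (q - p), by field_simp; ring⟩
  obtain ⟨w, rfl⟩ : ∃ w, v = p + w * (q - p) := ⟨(v - p) / (q - p), by field_simp; ring⟩
  rw [add_sub_cancel_left, mul_div_cancel_right₀ _ hd]
  rw [add_sub_cancel_left, add_sub_cancel_left, norm_mul, norm_mul] at h1
  rw [show p + z * (q - p) - q = (z - 1) * (q - p) by ring,
    show p + w * (q - p) - q = (w - 1) * (q - p) by ring, norm_mul, norm_mul] at h2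
  have e1 := congrArg (· ^ 2) (mul_right_cancel₀ (norm_ne_zero_iff.2 hd) h1)
  have e2 := congrArg (· ^ 2) (mul_right_cancel₀ (norm_ne_zero_iff.2 hd) h2)
  simp only [← Complex.normSq_eq_norm_sq, Complex.normSq_apply, Complex.sub_re, Complex.sub_im,
    Complex.one_re, Complex.one_im, sub_zero] at e1 e2
  have hre : w.re = z.re := by linarith
  rw [hre] at e1
  have him : (w.im - z.im) * (w.im + z.im) = 0 := by linarith
  rcases mul_eq_zero.1 him with h | h
  · exfalso; apply hne
    rw [show z = w from Complex.ext hre.symm (by linarith)]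
  · rw [show conj z = w from Complex.ext hre.symm (by simp; linarith)]

namespace Chain

/-- A vertex passed by the apex is touched by the left arm before. -/
theorem a_eq_of_pivot (h0 : 0 < ω) (hπ : ω < Real.pi) (h : Chain ω V l a b s e) {i p : ℕ}
    (hp : (arcAt l p).finish = a p) (hip : i ≤ p) (hs : s (i + 1) < e p + (Real.pi - ω)) :
    a i = a p := by
  have t := h.touch_finish p
  -- At the pivot the apex is `a p`, so this vertex also lies on the right arm and supports at `e p
  -- + (π - ω)`, hence over the whole range between.
  have t2 : Supp V (a p) (e p + (Real.pi - ω)) := by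
    intro w hw
    rw [← hp, t.qb]; exact t.sb w hw
  have hb : ∀ x, e p ≤ x → x ≤ e p + (Real.pi - ω) → Supp V (a p) x := fun x h1 h2 =>
    t.sa.between t2 h1 h2 (by linarith)
  have h1 := h.s_anti.antitone hip
  have h2 := h.e_lt_s p
  have h3 := h.s_anti (Nat.lt_succ_self i)
  obtain ⟨x, hx1, hx2⟩ := exists_between (show max (s (i + 1)) (e p) <
    min (s i) (e p + (Real.pi - ω)) from max_lt (lt_min h3 hs) (lt_min (by linarith) (by linarith)))
  obtain ⟨y, hy1, hy2⟩ := exists_between hx2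
  rw [max_lt_iff] at hx1
  rw [lt_min_iff] at hy2
  exact Supp.unique (x := x) (y := y) (h.ma i) (h.ma p)
    (h.supp_a hπ i (by linarith) (by linarith)) (h.supp_a hπ i (by linarith) (by linarith))
    (hb x (by linarith) (by linarith)) (hb y (by linarith) (by linarith)) hy1 (by linarith)

/-- A vertex passed by the apex is touched by the right arm afterwards. -/
theorem b_eq_of_pivot (h0 : 0 < ω) (h : Chain ω V l a b s e) {i p : ℕ}
    (hp : (arcAt l p).start = b p) (hip : p ≤ i) (hs : s p - (Real.pi - ω) < s i) :
    b i = b p := by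
  have t := h.touch_start p
  have t2 : Supp V (b p) (s p) := by
    intro w hw
    rw [← hp, t.qa]; exact t.sa w hw
  have hb : ∀ x, s p ≤ x → x ≤ s p + (Real.pi - ω) → Supp V (b p) x := fun x h1 h2 =>
    t2.between t.sb h1 h2 (by linarith)
  have h1 := h.s_anti.antitone hip
  have h3 := h.e_lt_s i
  obtain ⟨x, hx1, hx2⟩ := exists_between (show max (e i) (s p - (Real.pi - ω)) <
    s i from max_lt h3 hs)
  rw [max_lt_iff] at hx1
  exact Supp.unique (x := x + (Real.pi - ω)) (y := s i + (Real.pi - ω)) (h.mb i) (h.mb p)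
    (h.supp_ab i (by linarith) (by linarith)).2 (h.supp_ab i (by linarith) (by linarith)).2
    (hb _ (by linarith) (by linarith)) (hb _ (by linarith) (by linarith)) (by linarith)
    (by linarith [h.s_lt_e i])

/-- Both arcs are shorter than `2 (π - ω)`. So the pivot at the end fixes the left vertex on both,
the pivot at the start the right vertex, and consecutive arcs would have the same pair. -/
theorem not_pivot_flip_pivot (h0 : 0 < ω) (hπ : ω < Real.pi) (h : Chain ω V l a b s e)
    (hl : 1 < l.length) {i : ℕ} (h1 : (arcAt l i).start = b i) (h2 : (arcAt l i).finish ≠ a i)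
    (h3 : (arcAt l (i + 1)).finish = a (i + 1)) : False := by
  obtain ⟨hs, -⟩ := h.flip h0 hπ h2
  obtain ⟨R, p⟩ := h.exists_phase h0 hπ i
  obtain ⟨R', p'⟩ := h.exists_phase h0 hπ (i + 1)
  have hlt : (arcAt l i).meas < 2 * (Real.pi - ω) :=
    lt_of_lt_of_le (lt_of_le_of_ne p.mT fun hc => h2 (p.finish_eq_iff.2 hc)) p.T2
  have hlt' : (arcAt l (i + 1)).meas < 2 * (Real.pi - ω) := by
    -- In the case of equality the arc `i + 1` starts at its right vertex, so the arc `i` ends in a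
    -- point of `V`, which must be its left vertex.
    refine lt_of_le_of_ne (p'.mT.trans p'.T2) fun hc => h2 ?_
    have := p'.start_eq_iff.2 (le_antisymm p'.T2 (hc ▸ p'.mT))
    have t := h.touch_finish i
    refine (t.eq_left_of_mem h0 hπ ?_ (h.supp_ab i (h.e_lt_s i).le le_rfl).1 (h.e_lt_s i)
      (by linarith [h.s_lt_e i])).symm
    rw [h.link, this]; exact h.mb _
  have ea := h.a_eq_of_pivot h0 hπ h3 (Nat.le_succ i) (by rw [h.he]; linarith)
  have eb := h.b_eq_of_pivot h0 h1 (Nat.le_succ i) (by rw [hs, h.he]; linarith)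
  exact h.pair_ne_succ hl ea.symm eb

end Chain

/-! ### One of the candidates is the true initial position -/

namespace Merged

theorem start_zero (h : Merged ω V m l a b s e β) :
    (arcAt l 0).start = (arcAt m 0).start ∧ (arcAt l 0).center = (arcAt m 0).center := by
  have h1 := h.blocks.start 0
  have h2 := h.blocks.center le_rfl (h.blocks.lt 0)
  rw [h.blocks.zero] at h1 h2
  exact ⟨h1, h2⟩

theorem tau_eq (h : Merged ω V m l a b s e β) : Chain.tau l a 0 = tauOf m (a 0) := by
  rw [Chain.tau, tauOf, h.start_zero.1, h.start_zero.2]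

/-- A left vertex that survives the first transition lies on the first two circles and is not the
end point at which the arcs meet. -/
theorem a_eq_reflectedVertex (h0 : 0 < ω) (hπ : ω < Real.pi) (h : Merged ω V m l a b s e β)
    (h1 : β 1 = 1) (hf : (arcAt l 0).finish ≠ a 0) (ha : a 1 = a 0) :
    a 0 = reflectedVertex m := by
  obtain ⟨R, p⟩ := h.chain.exists_phase h0 hπ 0
  obtain ⟨R', p'⟩ := h.chain.exists_phase h0 hπ 1
  have hfin : (arcAt l 0).finish = (arcAt m 0).finish := by
    have := h.blocks.finish 0
    rwa [zero_add, h1, Nat.sub_self] at this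
  have hc := h.start_zero.2
  have hc' : (arcAt l 1).center = (arcAt m 1).center :=
    h.blocks.center h1.le (by have := h.blocks.lt 1; omega)
  have hv := h.seq.valid (by have := h.len; omega) 0
  have hlink := h.seq.link (by have := h.len; omega) 0
  have hcc : (arcAt m 1).center ≠ (arcAt m 0).center := by
    intro hcc
    refine h.ne 0 ⟨hcc.symm, ?_⟩
    rw [zero_add, hcc, hv.2, hlink]
  refine reflect_of_norm hcc ?_ ?_ (hfin ▸ hf)
  · rw [← hfin, ← hc, p.finish_sub (h.chain.valid 0), p.a_sub, norm_sub_eq_one p.R0.le,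
      norm_sub_eq_one p.R0.le]
  · rw [← hfin, ← hc', h.chain.link, ← ha, zero_add, p'.start_sub, p'.a_sub,
      norm_sub_eq_one p'.R0.le, norm_sub_eq_one p'.R0.le]

/-- Without a pivot, a turn by `π - ω` brings the right arm onto the line on which the left arm lay
at the start. So the initial left vertex is on the line from the start to the apex then reached,
which is found by following the given arcs for the measure `2 (π - ω)`. -/
theorem a_eq_lineVertex (h0 : 0 < ω) (hπ : ω < Real.pi) (h : Merged ω V m l a b s e β)
    (hp : ∀ p, (arcAt l p).finish = a p → e p < s 0 - (Real.pi - ω)) : a 0 = lineVertex ω m := by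
  have hN := h.blocks.one_lt_length h.len
  have hper := h.chain.period h0 hπ (by omega) 0
  rw [zero_add] at hper
  set x := s 0 - (Real.pi - ω) with hx
  obtain ⟨j, hjN, hj1, hj2⟩ := exists_index (f := s) (x := x) l.length (by linarith) (by linarith)
  have hj3 : e j ≤ x := by
    by_contra! hcon
    rcases h.chain.step j with hs | hs
    · linarith [hs.1]
    · linarith [hp j hs.2.2.1]
  have hfl : ∀ i < j, (arcAt l i).finish ≠ a i := by
    intro i hi hc
    have := hp i hc
    have := h.chain.s_succ_le i
    have := h.chain.s_anti.antitone (show i + 1 ≤ j by omega)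
    linarith
  -- A block of several arcs contains a pivot, so before the index `j` the given arcs are arcs of
  -- the cloud.
  have hβ : ∀ k ≤ j, β k = k := by
    intro k hk
    induction k with
    | zero => exact h.blocks.zero
    | succ k ih =>
      have h1 := ih (by omega)
      have h2 := h.blocks.lt k
      by_contra hc
      exact hfl k (by omega) (h.finish_eq_of_lt h0 hπ (k := k) (i := k) h1.le (by omega))
  have hmeas : ∀ i < j, (arcAt m i).meas = (arcAt l i).meas := by
    intro i hi
    have := h.chain.block_meas h0 hπ h.blocks h.len h.seq i
    rw [hβ i hi.le, hβ (i + 1) hi, Nat.Ico_succ_singleton, Finset.sum_singleton] at this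
    exact this.symm
  have hP : ∀ i ≤ j, s i = s 0 - measSum m i / 2 := by
    intro i hi
    induction i with
    | zero => simp [measSum]
    | succ i ih =>
      have e1 := (h.chain.flip h0 hπ (hfl i hi)).1
      rw [e1, h.chain.he, ih (by omega), measSum, measSum, Finset.sum_range_succ, hmeas i hi]
      ring
  have hmj : (arcAt l j).meas ≤ (arcAt m j).meas := by
    have hlt := h.blocks.lt j
    rw [← h.chain.block_meas h0 hπ h.blocks h.len h.seq j]
    refine Finset.single_le_sum (fun i _ => (h.chain.valid i).meas_spec.1.le) ?_
    rw [Finset.mem_Ico]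
    have := hβ j le_rfl
    omega
  have hjn : j < m.length := by
    refine h.blocks.strictMono.lt_iff_lt.1 ?_
    rw [hβ j le_rfl, h.blocks.β_length]; exact hjN
  have hsj := hP j le_rfl
  have hej := h.chain.he j
  have stop_eq : stopIndex ω m = j := by
    refine le_antisymm (Nat.sInf_le (Or.inr ?_)) ?_
    · rw [measSum, Finset.sum_range_succ, ← measSum]; linarith
    · refine le_csInf ⟨m.length, Or.inl le_rfl⟩ fun k hk => ?_
      by_contra! hkj
      rcases hk with hk | hk
      · omega
      · have e1 := hP (k + 1) hkj
        have e2 := h.chain.s_anti.antitone (show k + 1 ≤ j from hkj)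
        linarith
  have hpt : stopPoint ω m = (arcAt l j).pt (2 * (Real.pi - ω) - measSum m j) := by
    have e1 := h.blocks.start j
    have e2 := h.blocks.center le_rfl (h.blocks.lt j)
    rw [hβ j le_rfl] at e1 e2
    rw [stopPoint, stop_eq]
    simp only [DirArc.pt, e1, e2]
  have t := h.chain.touch j (2 * (Real.pi - ω) - measSum m j) (by linarith) (by linarith)
  rw [← hpt, show s j - (2 * (Real.pi - ω) - measSum m j) / 2 = x by linarith] at t
  have t0 := h.chain.touch_start 0
  have hx0 : x + (Real.pi - ω) = s 0 := by linarith
  obtain ⟨r', hr'⟩ := exists_eq_add_of_ht_eq (v := stopPoint ω m) (w := a 0) (φ := s 0) (by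
    have e1 := t.qb
    have e2 := t.sb
    rw [hx0] at e1 e2
    rw [e1]
    exact le_antisymm (t0.sa _ t.mb) (e2 _ t0.ma))
  have hr0 : 0 ≤ r' := by
    have e1 := t.sa _ t0.ma
    rw [← t.qa, hr', ht_add, ht_real_mul, ht_cis] at e1
    have : 0 < Real.sin (s 0 - x) := Real.sin_pos_of_pos_of_lt_pi (by linarith) (by linarith)
    exact nonneg_of_mul_nonneg_left (by linarith) this
  obtain ⟨r, hr, er⟩ := t0.left_eq h0 hπ
  have hr : 0 < r := lt_of_le_of_ne hr (by
    rintro rfl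
    exact h.chain.start_ne_a h0 hπ 0 (by rw [er]; simp))
  obtain ⟨R, p⟩ := h.chain.exists_phase h0 hπ 0
  have := p.lineHit_eq (r := r' + r) (by linarith)
  rw [lineVertex, ← h.start_zero.1, ← h.start_zero.2, ← this, hr']
  congr 1
  push_cast
  linear_combination (-1 : ℂ) * er

/-- If a pivot happens within a turn of `π - ω`, its vertex is already the left contact on the first
two arcs (`a_eq_of_pivot`) and is found by reflection; otherwise `a_eq_lineVertex` applies. -/
theorem candidate_of_flip (h0 : 0 < ω) (hπ : ω < Real.pi) (h : Merged ω V m l a b s e β)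
    (h1 : β 1 = 1) (hf : (arcAt l 0).finish ≠ a 0) : ∃ c, Chain.tau l a 0 = candidate ω m c := by
  by_cases hp : ∀ p, (arcAt l p).finish = a p → e p < s 0 - (Real.pi - ω)
  · exact ⟨2, by rw [h.tau_eq, h.a_eq_lineVertex h0 hπ hp]; rfl⟩
  · push Not at hp
    obtain ⟨p, hp1, hp2⟩ := hp
    have hp0 : p ≠ 0 := by rintro rfl; exact hf hp1
    have g1 := h.chain.s_anti (show 0 < 0 + 1 by omega)
    have g2 := h.chain.s_anti (show 0 < 1 + 1 by omega)
    have e1 := h.chain.a_eq_of_pivot h0 hπ hp1 (i := 0) (by omega) (by linarith)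
    have e2 := h.chain.a_eq_of_pivot h0 hπ hp1 (i := 1) (by omega) (by linarith)
    exact ⟨1, by
      rw [h.tau_eq, h.a_eq_reflectedVertex h0 hπ h1 hf (e2.trans e1.symm)]; rfl⟩

/-- A pivot at the end of the first given arc gives `τ = 2 (π - ω)` on the second one. Without it,
the first given arc may be a single cloud arc, to which `candidate_of_flip` applies. If instead it
contains a pivot, then by `not_pivot_flip_pivot` the second given arc is single and does not end in
a pivot, and `candidate_of_flip` applies to it. -/
theorem exists_candidate (h0 : 0 < ω) (hπ : ω < Real.pi) (h : Merged ω V m l a b s e β) :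
    ∃ (j : Fin 2) (c : Fin 3) (N : ℕ),
      Passes ω (m.rotate j) (candidate ω (m.rotate j) c) N := by
  have hl := h.blocks.one_lt_length h.len
  have hβ := h.blocks.lt 0
  rw [h.blocks.zero, zero_add] at hβ
  have hβ1 := h.blocks.lt 1
  obtain ⟨i, hi⟩ : ∃ i, β 1 = i + 1 := ⟨β 1 - 1, by omega⟩
  have hr := h.rotate 1
  by_cases hf : (arcAt l i).finish = a i
  · refine ⟨1, 0, (l.rotate (β 1)).length, ?_⟩
    have e := hr.passes h0 hπ
    have e2 := (h.chain.pivot h0 hπ hf).2.2.2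
    have e3 : Chain.tau (l.rotate (β 1)) (fun i => a (i + β 1)) 0 = Chain.tau l a (i + 1) := by
      rw [Chain.tau, arcAt_rotate, zero_add, hi]; rfl
    rw [e3, e2] at e
    exact e
  · rcases Nat.eq_zero_or_pos i with rfl | hi0
    · obtain ⟨c, hc⟩ := h.candidate_of_flip h0 hπ hi hf
      refine ⟨0, c, l.length, ?_⟩
      have e := h.passes h0 hπ
      rw [hc] at e
      simpa using e
    · have hpre : (arcAt l (i - 1)).finish = a (i - 1) :=
        h.finish_eq_of_lt h0 hπ (k := 0) (by rw [h.blocks.zero]; omega) (by rw [zero_add]; omega)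
      have hst : (arcAt l i).start = b i := by
        obtain ⟨R, p⟩ := h.chain.exists_phase h0 hπ i
        refine p.start_eq_iff.2 ?_
        have := (h.chain.pivot h0 hπ hpre).2.2.2
        rwa [Nat.sub_add_cancel hi0] at this
      have hf1 : (arcAt l (β 1)).finish ≠ a (β 1) := by
        rw [hi]; exact fun hc => h.chain.not_pivot_flip_pivot h0 hπ hl hst hf hc
      have h2 : β 2 = β 1 + 1 := by
        by_contra hc
        exact hf1 (h.finish_eq_of_lt h0 hπ (k := 1) le_rfl (by rw [one_add_one_eq_two] at *; omega))
      obtain ⟨c, hc⟩ := hr.candidate_of_flip h0 hπ (by rw [one_add_one_eq_two, h2]; omega)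
        (by rw [arcAt_rotate, zero_add]; exact hf1)
      refine ⟨1, c, (l.rotate (β 1)).length, ?_⟩
      have e := hr.passes h0 hπ
      rw [hc] at e
      exact e

end Merged

theorem exists_candidate (h0 : 0 < ω) (hπ : ω < Real.pi) {vs : List ℂ} (hm : 1 < m.length)
    (hseq : IsArcSequence m) (h : IsMaximalCloud ω vs m) : ∃ (j : Fin 2) (c : Fin 3) (N : ℕ),
      Passes ω (m.rotate j) (candidate ω (m.rotate j) c) N := by
  obtain ⟨V, l, a, b, s, e, β, hM⟩ := h.exists_merged h0 hπ hm hseq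
  exact hM.exists_candidate h0 hπ

end OmegaCloud

namespace OmegaCloud
open Complex (I)
open scoped ComplexConjugate

/-! ### Execution of programs -/

namespace Program
variable {K H : ℕ}

open Classical in
/-- The final state of a program without loops. -/
noncomputable def run (l : List DirArc) : Program K H → State K H → State K H
  | skip, s => s
  | assign i e, s => { s with mem := Function.update s.mem i (e.eval l s) }
  | advance h, s => { s with pos := Function.update s.pos h (s.pos h + 1) }
  | emit x y, s => { s with out := s.out ++ [⟨x.eval l s, y.eval l s⟩] }
  | answer b, s => { s with verdict := some b }
  | seq p q, s => run l q (run l p s)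
  | ifLt a b p q, s => if a.eval l s < b.eval l s then run l p s else run l q s
  | whileLt _ _ _, s => s

/-- A bound for the number of steps of a program without loops. -/
def size : Program K H → ℕ
  | skip => 1
  | assign _ e => e.cost + 1
  | advance _ => 1
  | emit x y => x.cost + y.cost + 1
  | answer _ => 1
  | seq p q => p.size + q.size
  | ifLt a b p q => a.cost + b.cost + 1 + p.size + q.size
  | whileLt a b p => a.cost + b.cost + 1 + p.size

/-- The program contains no loop. -/
def LoopFree : Program K H → Prop
  | seq p q => p.LoopFree ∧ q.LoopFree
  | ifLt _ _ p q => p.LoopFree ∧ q.LoopFree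
  | whileLt _ _ _ => False
  | _ => True

end Program

theorem Program.run_seq {K H : ℕ} (l : List DirArc) (p q : Program K H) (s : State K H) :
    (seq p q).run l s = q.run l (p.run l s) := rfl

theorem Program.run_ifLt_pos {K H : ℕ} {l : List DirArc} {p q : Program K H} {s : State K H}
    {a b : Expr K H} (h : a.eval l s < b.eval l s) : (ifLt a b p q).run l s = p.run l s := if_pos h

theorem Program.run_ifLt_neg {K H : ℕ} {l : List DirArc} {p q : Program K H} {s : State K H}
    {a b : Expr K H} (h : ¬ a.eval l s < b.eval l s) : (ifLt a b p q).run l s = q.run l s :=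
  if_neg h

/-- The program leads from `s` to `s'` in at most `T` steps. -/
def Runs {K H : ℕ} (l : List DirArc) (p : Program K H) (s s' : State K H) (T : ℕ) : Prop :=
  ∃ t ≤ T, Exec l p s s' t

section
variable {K H : ℕ} {l : List DirArc} {p q : Program K H} {s s' s'' : State K H} {T T' : ℕ}

theorem Program.LoopFree.runs (hp : p.LoopFree) : Runs l p s (p.run l s) p.size := by
  induction p generalizing s with
  | skip => exact ⟨_, le_rfl, .skip s⟩
  | assign i e => exact ⟨_, le_rfl, .assign s i e⟩
  | advance h => exact ⟨_, le_rfl, .advance s h⟩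
  | emit x y => exact ⟨_, le_rfl, .emit s x y⟩
  | answer b => exact ⟨_, le_rfl, .answer s b⟩
  | seq p q ihp ihq =>
    obtain ⟨t, ht, h⟩ := ihp hp.1 (s := s)
    obtain ⟨t', ht', h'⟩ := ihq hp.2 (s := p.run l s)
    exact ⟨t + t', add_le_add ht ht', .seq h h'⟩
  | ifLt a b p q ihp ihq =>
    by_cases hc : a.eval l s < b.eval l s
    · obtain ⟨t, ht, h⟩ := ihp hp.1 (s := s)
      rw [Program.run, if_pos hc]
      exact ⟨_, by rw [Program.size]; omega, .ifTrue hc h⟩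
    · obtain ⟨t, ht, h⟩ := ihq hp.2 (s := s)
      rw [Program.run, if_neg hc]
      exact ⟨_, by rw [Program.size]; omega, .ifFalse hc h⟩
  | whileLt a b p _ => exact hp.elim

theorem Runs.mono (h : Runs l p s s' T) (hT : T ≤ T') : Runs l p s s' T' := by
  obtain ⟨t, ht, h⟩ := h
  exact ⟨t, ht.trans hT, h⟩

theorem Runs.seq (h : Runs l p s s' T) (h' : Runs l q s' s'' T') :
    Runs l (.seq p q) s s'' (T + T') := by
  obtain ⟨t, ht, h⟩ := h
  obtain ⟨t', ht', h'⟩ := h'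
  exact ⟨_, add_le_add ht ht', .seq h h'⟩

theorem Runs.ifTrue {a b : Expr K H} (hc : a.eval l s < b.eval l s) (h : Runs l p s s' T) :
    Runs l (.ifLt a b p q) s s' (a.cost + b.cost + 1 + T) := by
  obtain ⟨t, ht, h⟩ := h
  exact ⟨_, by omega, .ifTrue hc h⟩

theorem Runs.ifFalse {a b : Expr K H} (hc : ¬ a.eval l s < b.eval l s) (h : Runs l q s s' T) :
    Runs l (.ifLt a b p q) s s' (a.cost + b.cost + 1 + T) := by
  obtain ⟨t, ht, h⟩ := h
  exact ⟨_, by omega, .ifFalse hc h⟩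

/-- The rule for loops that run for `N` rounds. -/
theorem runs_loop (hp : p.LoopFree) {a b : Expr K H} (Inv : ℕ → State K H → Prop) (N : ℕ)
    (h0 : Inv 0 s)
    (hstep : ∀ i < N, ∀ s, Inv i s → a.eval l s < b.eval l s ∧ Inv (i + 1) (p.run l s))
    (hN : ∀ s, Inv N s → ¬ a.eval l s < b.eval l s) :
    ∃ s', Inv N s' ∧ Runs l (.whileLt a b p) s s' ((N + 1) * (Program.whileLt a b p).size) := by
  have key : ∀ d i s, i + d = N → Inv i s → ∃ s', Inv N s' ∧
      Runs l (.whileLt a b p) s s' ((d + 1) * (Program.whileLt a b p).size) := by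
    intro d
    induction d with
    | zero =>
      intro i s hi h
      rw [add_zero] at hi
      subst hi
      exact ⟨s, h, _, by rw [Program.size]; omega, .whileFalse (hN s h)⟩
    | succ d ih =>
      intro i s hi h
      obtain ⟨hc, h1⟩ := hstep i (by omega) s h
      obtain ⟨s', hs', t, ht, he⟩ := ih (i + 1) _ (by omega) h1
      obtain ⟨t1, ht1, he1⟩ := hp.runs (l := l) (s := s)
      refine ⟨s', hs', _, ?_, .whileTrue hc he1 he⟩
      rw [Nat.succ_mul (d + 1)]
      rw [Program.size] at ht ⊢
      omega
  exact key N 0 s (zero_add N) h0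

end

/-! ### Sequences of independent assignments -/

section
variable {K H : ℕ} {l : List DirArc} {s s' : State K H}

/-- The cells that are read by an expression. -/
def Expr.cells : Expr K H → List (Fin K)
  | const _ | read _ _ => []
  | cell i => [i]
  | add a b | sub a b | mul a b | div a b => a.cells ++ b.cells
  | sqrt a | sin a | cos a | arccos a => a.cells

theorem Expr.eval_congr {e : Expr K H} (h : ∀ i ∈ e.cells, s.mem i = s'.mem i)
    (hp : s.pos = s'.pos) : e.eval l s = e.eval l s' := by
  induction e with
  | const c => rfl
  | cell i => exact h i (by simp [cells])
  | read p f => simp only [eval, hp]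
  | add a b iha ihb | sub a b iha ihb | mul a b iha ihb | div a b iha ihb =>
    simp only [cells, List.mem_append] at h
    simp only [eval, iha fun i hi => h i (Or.inl hi), ihb fun i hi => h i (Or.inr hi)]
  | sqrt a ih | sin a ih | cos a ih | arccos a ih => simp only [eval, ih h]

/-- The program that performs the assignments of a list. -/
def Program.assigns (xs : List (Fin K × Expr K H)) : Program K H :=
  xs.foldr (fun x p => .seq (.assign x.1 x.2) p) .skip

/-- No assignment changes a cell that occurs in a later one. -/
def Indep (xs : List (Fin K × Expr K H)) : Prop :=
  xs.Pairwise fun x y => x.1 ≠ y.1 ∧ x.1 ∉ y.2.cells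

theorem Program.loopFree_assigns (xs : List (Fin K × Expr K H)) : (assigns xs).LoopFree := by
  induction xs with
  | nil => trivial
  | cons x xs ih => exact ⟨trivial, ih⟩

/-- Independence allows all right hand sides to be evaluated in the initial state. -/
theorem Program.run_assigns {xs : List (Fin K × Expr K H)} (h : Indep xs) :
    (∀ x ∈ xs, ((assigns xs).run l s).mem x.1 = x.2.eval l s) ∧
    (∀ c, (∀ x ∈ xs, c ≠ x.1) → ((assigns xs).run l s).mem c = s.mem c) ∧
    ((assigns xs).run l s).pos = s.pos ∧ ((assigns xs).run l s).out = s.out ∧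
    ((assigns xs).run l s).verdict = s.verdict := by
  induction xs generalizing s with
  | nil => exact ⟨by simp, fun _ _ => rfl, rfl, rfl, rfl⟩
  | cons x xs ih =>
    obtain ⟨h1, h2⟩ := List.pairwise_cons.1 h
    obtain ⟨g1, g2, g3, g4, g5⟩ :=
      ih (s := { s with mem := Function.update s.mem x.1 (x.2.eval l s) }) h2
    refine ⟨?_, ?_, g3, g4, g5⟩
    · intro y hy
      rcases List.mem_cons.1 hy with rfl | hy
      · exact (g2 _ fun z hz => (h1 z hz).1).trans (Function.update_self _ _ _)
      · refine (g1 y hy).trans (Expr.eval_congr (fun i hi => Function.update_of_ne ?_ _ _) rfl)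
        rintro rfl
        exact (h1 y hy).2 hi
    · intro c hc
      exact (g2 c fun z hz => hc z (List.mem_cons_of_mem _ hz)).trans
        (Function.update_of_ne (hc x List.mem_cons_self) _ _)

end

/-! ### Cells and expressions -/

/-- The cells are arranged in four groups of sixteen. -/
def cell (g : Fin 4) (i : Fin 16) : Fin 64 := finProdFinEquiv (g, i)

@[simp] theorem cell_inj {g g' : Fin 4} {i i' : Fin 16} :
    cell g i = cell g' i' ↔ g = g' ∧ i = i' := by
  simp [cell]

/-- The pointers are arranged in six groups of five. -/
def ptr (t : Fin 6) (i : Fin 5) : Fin 30 := finProdFinEquiv (t, i)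

@[simp] theorem ptr_inj {t t' : Fin 6} {i i' : Fin 5} : ptr t i = ptr t' i' ↔ t = t' ∧ i = i' := by
  simp [ptr]

/-- Expressions for complex numbers. -/
structure CExpr (K H : ℕ) where
  re : Expr K H
  im : Expr K H

namespace CExpr
variable {K H : ℕ} {l : List DirArc} {s : State K H}

noncomputable def eval (l : List DirArc) (s : State K H) (z : CExpr K H) : ℂ :=
  ⟨z.re.eval l s, z.im.eval l s⟩

def add (z w : CExpr K H) : CExpr K H := ⟨z.re.add w.re, z.im.add w.im⟩
def sub (z w : CExpr K H) : CExpr K H := ⟨z.re.sub w.re, z.im.sub w.im⟩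
def mul (z w : CExpr K H) : CExpr K H :=
  ⟨(z.re.mul w.re).sub (z.im.mul w.im), (z.re.mul w.im).add (z.im.mul w.re)⟩
def bar (z : CExpr K H) : CExpr K H := ⟨z.re, (Expr.const 0).sub z.im⟩
def normSq (z : CExpr K H) : Expr K H := (z.re.mul z.re).add (z.im.mul z.im)
def div (z w : CExpr K H) : CExpr K H :=
  ⟨(z.mul w.bar).re.div w.normSq, (z.mul w.bar).im.div w.normSq⟩
def cis (x : Expr K H) : CExpr K H := ⟨x.cos, x.sin⟩
def cell (i j : Fin K) : CExpr K H := ⟨.cell i, .cell j⟩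
def center (h : Fin H) : CExpr K H := ⟨.read h .centerX, .read h .centerY⟩
def start (h : Fin H) : CExpr K H := ⟨.read h .startX, .read h .startY⟩
def finish (h : Fin H) : CExpr K H := ⟨.read h .finishX, .read h .finishY⟩

variable {z w : CExpr K H}

@[simp] theorem eval_re : (z.eval l s).re = z.re.eval l s := rfl
@[simp] theorem eval_im : (z.eval l s).im = z.im.eval l s := rfl

@[simp] theorem eval_add : (z.add w).eval l s = z.eval l s + w.eval l s := rfl

@[simp] theorem eval_sub : (z.sub w).eval l s = z.eval l s - w.eval l s := rfl

@[simp] theorem eval_mul : (z.mul w).eval l s = z.eval l s * w.eval l s := by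
  apply Complex.ext <;> rfl

@[simp] theorem eval_bar : z.bar.eval l s = starRingEnd ℂ (z.eval l s) := by
  apply Complex.ext
  · rfl
  · rw [eval_im, bar, Expr.eval, Expr.eval]; simp

@[simp] theorem eval_normSq : z.normSq.eval l s = Complex.normSq (z.eval l s) := rfl

@[simp] theorem eval_div : (z.div w).eval l s = z.eval l s / w.eval l s := by
  have h := eval_mul (z := z) (w := w.bar) (l := l) (s := s)
  rw [eval_bar] at h
  have h1 := congrArg Complex.re h
  have h2 := congrArg Complex.im h
  rw [div_eq_mul_inv, Complex.inv_def, ← mul_assoc, ← h]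
  apply Complex.ext
  · rw [eval_re, div, Expr.eval, eval_normSq, Complex.re_mul_ofReal, div_eq_mul_inv]; rfl
  · rw [eval_im, div, Expr.eval, eval_normSq, Complex.im_mul_ofReal, div_eq_mul_inv]; rfl

@[simp] theorem eval_cis (x : Expr K H) : (cis x).eval l s = OmegaCloud.cis (x.eval l s) := by
  apply Complex.ext
  · rw [cis_re]; rfl
  · rw [cis_im]; rfl

@[simp] theorem eval_cell (i j : Fin K) : (cell i j).eval l s = ⟨s.mem i, s.mem j⟩ := rfl

@[simp] theorem eval_center (h : Fin H) :
    (center h : CExpr K H).eval l s = (arcAt l (s.pos h)).center := rfl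

@[simp] theorem eval_start (h : Fin H) :
    (start h : CExpr K H).eval l s = (arcAt l (s.pos h)).start := rfl

@[simp] theorem eval_finish (h : Fin H) :
    (finish h : CExpr K H).eval l s = (arcAt l (s.pos h)).finish := rfl

/-- An expression for `lineHit`. -/
def lineHit (c q w : CExpr K H) : CExpr K H := c.sub ((q.sub c).bar.mul (w.div w.bar))

@[simp] theorem eval_lineHit {c q : CExpr K H} : (lineHit c q w).eval l s =
    OmegaCloud.lineHit (c.eval l s) (q.eval l s) (w.eval l s) := by
  simp [lineHit, OmegaCloud.lineHit]

end CExpr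

namespace Expr
variable {K H : ℕ} {l : List DirArc} {s : State K H}

@[simp] theorem eval_const (c : ℚ) : (const c : Expr K H).eval l s = c := rfl
@[simp] theorem eval_cell (i : Fin K) : (cell i : Expr K H).eval l s = s.mem i := rfl
@[simp] theorem eval_add (a b : Expr K H) : (a.add b).eval l s = a.eval l s + b.eval l s := rfl
@[simp] theorem eval_sub (a b : Expr K H) : (a.sub b).eval l s = a.eval l s - b.eval l s := rfl
@[simp] theorem eval_mul (a b : Expr K H) : (a.mul b).eval l s = a.eval l s * b.eval l s := rfl
@[simp] theorem eval_div (a b : Expr K H) : (a.div b).eval l s = a.eval l s / b.eval l s := rfl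
@[simp] theorem eval_sqrt (a : Expr K H) : a.sqrt.eval l s = Real.sqrt (a.eval l s) := rfl
@[simp] theorem eval_arccos (a : Expr K H) : a.arccos.eval l s = Real.arccos (a.eval l s) := rfl

/-- Half of an expression. -/
def half (a : Expr K H) : Expr K H := a.div (const 2)

@[simp] theorem eval_half (a : Expr K H) : a.half.eval l s = a.eval l s / 2 := by simp [half]

/-- An expression for the minimum. -/
def min (a b : Expr K H) : Expr K H := ((a.add b).sub ((a.sub b).mul (a.sub b)).sqrt).half

@[simp] theorem eval_min (a b : Expr K H) :
    (min a b).eval l s = Min.min (a.eval l s) (b.eval l s) := by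
  simp only [min, eval_half, eval_sub, eval_add, eval_sqrt, eval_mul, Real.sqrt_mul_self_eq_abs]
  rcases le_total (a.eval l s) (b.eval l s) with h | h
  · rw [min_eq_left h, abs_of_nonpos (by linarith)]; ring
  · rw [min_eq_right h, abs_of_nonneg (by linarith)]; ring

/-- An expression for `π`. -/
def pi : Expr K H := (const (-1)).arccos

@[simp] theorem eval_pi : (pi : Expr K H).eval l s = Real.pi := by
  simp [pi]

/-- An expression for `cwAngle`. -/
def cwAngle (z w : CExpr K H) : Expr K H :=
  let p := w.mul z.bar
  (const 2).mul (((const 0).sub (p.im.div (p.im.mul p.im).sqrt)).mul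
    (((const 1).add (p.re.div ((p.re.mul p.re).add (p.im.mul p.im)).sqrt)).div (const 2)).sqrt).arccos

@[simp] theorem eval_cwAngle (z w : CExpr K H) :
    (cwAngle z w).eval l s = OmegaCloud.cwAngle (z.eval l s) (w.eval l s) := by
  have h : (w.mul z.bar).eval l s = w.eval l s * starRingEnd ℂ (z.eval l s) := by simp
  have h1 : (w.mul z.bar).re.eval l s = _ := congrArg Complex.re h
  have h2 : (w.mul z.bar).im.eval l s = _ := congrArg Complex.im h
  simp only [cwAngle, eval_mul, eval_const, eval_arccos, eval_sub, eval_div, eval_sqrt, eval_add,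
    h1, h2, OmegaCloud.cwAngle, Rat.cast_ofNat, Rat.cast_zero, Rat.cast_one, zero_sub]

/-- An expression for `unAngle`. -/
def unAngle (z w : CExpr K H) : Expr K H :=
  let p := w.mul z.bar
  (p.re.div ((p.re.mul p.re).add (p.im.mul p.im)).sqrt).arccos

@[simp] theorem eval_unAngle (z w : CExpr K H) :
    (unAngle z w).eval l s = OmegaCloud.unAngle (z.eval l s) (w.eval l s) := by
  have h : (w.mul z.bar).eval l s = w.eval l s * starRingEnd ℂ (z.eval l s) := by simp
  have h1 : (w.mul z.bar).re.eval l s = _ := congrArg Complex.re h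
  have h2 : (w.mul z.bar).im.eval l s = _ := congrArg Complex.im h
  simp only [unAngle, eval_mul, eval_arccos, eval_div, eval_sqrt, eval_add, h1, h2,
    OmegaCloud.unAngle]

/-- An expression for the measure of the arc under the pointer `h`. -/
def meas (h : Fin H) : Expr K H :=
  cwAngle ((CExpr.start h).sub (CExpr.center h)) ((CExpr.finish h).sub (CExpr.center h))

@[simp] theorem eval_meas (h : Fin H) :
    (meas h : Expr K H).eval l s = (arcAt l (s.pos h)).meas := by
  simp [meas, DirArc.meas]

end Expr

end OmegaCloud

namespace OmegaCloud
open Complex (I)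
open scoped ComplexConjugate

/-! ### The program for one step of the simulation -/

/-- The content of a cell. -/
def reg (g : Fin 4) (i : Fin 16) : Expr 64 30 := .cell (cell g i)

/-- The content of two cells. -/
def creg (g : Fin 4) (i j : Fin 16) : CExpr 64 30 := .cell (cell g i) (cell g j)

/-- The angle `π - ω`. -/
def supp : Expr 64 30 := Expr.pi.sub (reg 0 0)

/-- The vertex touched by the left arm. -/
def leftVertex (g : Fin 4) (p : Fin 30) : CExpr 64 30 :=
  (CExpr.center p).add (((CExpr.finish p).sub (CExpr.center p)).mul
    (CExpr.cis ((reg g 1).sub (reg g 0))))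

/-- The vertex touched by the right arm. -/
def rightVertex (g : Fin 4) (p : Fin 30) : CExpr 64 30 :=
  (CExpr.center p).add (((CExpr.finish p).sub (CExpr.center p)).mul
    (CExpr.cis (((reg g 1).sub (reg g 0)).add ((Expr.const 2).mul supp))))

/-- The cells `0`–`3` of the group `g` hold the state of a simulation with the pointer `p`; this
saves the data of the current state in the other cells. -/
def simSave (g : Fin 4) (p : Fin 30) : List (Fin 64 × Expr 64 30) := [
  (cell g 8, (CExpr.center p).re), (cell g 9, (CExpr.center p).im),
  (cell g 10, (CExpr.finish p).re), (cell g 11, (CExpr.finish p).im),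
  (cell g 4, (leftVertex g p).re), (cell g 5, (leftVertex g p).im),
  (cell g 6, reg g 2), (cell g 7, reg g 3), (cell g 12, reg g 0), (cell g 13, reg g 1)]

/-- In this and the following lists the old `ρ`, `k`, `τ`, `u` are read from the copies in the cells
`6`, `7`, `12`, `13`, so that no assignment disturbs a later one. -/
def simHidden (g : Fin 4) : List (Fin 64 × Expr 64 30) := [
  (cell g 0, (Expr.const 2).mul supp), (cell g 1, (reg g 13).sub (reg g 12)),
  (cell g 2, ((reg g 6).add (reg g 12).half).add supp)]

/-- An expression for `Sim.nextA`. -/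
def nextVertex (g : Fin 4) (p : Fin 30) : CExpr 64 30 :=
  .lineHit (.center p) (creg g 10 11) ((creg g 4 5).sub (creg g 10 11))

/-- The pointer is already at the next arc; the end of the old arc and the old left vertex come from
the saved cells. -/
def simNext (g : Fin 4) (p : Fin 30) : List (Fin 64 × Expr 64 30) := [
  (cell g 3, (reg g 7).add (.const 1)),
  (cell g 14, (nextVertex g p).re), (cell g 15, (nextVertex g p).im)]

def simFlip (g : Fin 4) (p : Fin 30) : List (Fin 64 × Expr 64 30) := [
  (cell g 0, .cwAngle ((creg g 10 11).sub (.center p)) ((creg g 14 15).sub (.center p))),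
  (cell g 1, .meas p), (cell g 2, (reg g 6).add (reg g 13).half)]

/-- The expressions for `Sim.pivotIn` and `Sim.pivotOut`. -/
def pivotInExpr (g : Fin 4) : CExpr 64 30 :=
  ((creg g 10 11).sub (creg g 8 9)).mul (CExpr.cis supp)

def pivotOutExpr (g : Fin 4) (p : Fin 30) : CExpr 64 30 := (creg g 10 11).sub (.center p)

def simPivot (g : Fin 4) (p : Fin 30) : List (Fin 64 × Expr 64 30) := [
  (cell g 0, (Expr.const 2).mul supp), (cell g 1, .meas p),
  (cell g 2, ((reg g 6).add (reg g 13).half).add (.unAngle (pivotInExpr g) (pivotOutExpr g p)))]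

/-- One step of the simulation. -/
def simStep (g : Fin 4) (p : Fin 30) : Program 64 30 := .seq (.assigns (simSave g p))
  (.ifLt (reg g 12) (reg g 13) (.assigns (simHidden g)) (.seq (.advance p)
    (.seq (.assigns (simNext g p))
      (.ifLt (reg g 13) (reg g 12) (.assigns (simFlip g p)) (.assigns (simPivot g p))))))

/-- Only the cells of the group `g` and the pointer `p` have changed. -/
structure Frame (g : Fin 4) (p : Fin 30) (s s' : State 64 30) : Prop where
  mem : ∀ g' i, g' ≠ g → s'.mem (cell g' i) = s.mem (cell g' i)
  pos : ∀ q, q ≠ p → s'.pos q = s.pos q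
  out : s'.out = s.out
  verdict : s'.verdict = s.verdict

theorem Frame.trans {g : Fin 4} {p : Fin 30} {s s' s'' : State 64 30} (h : Frame g p s s')
    (h' : Frame g p s' s'') : Frame g p s s'' :=
  ⟨fun g' i hg => (h'.mem g' i hg).trans (h.mem g' i hg), fun q hq => (h'.pos q hq).trans
    (h.pos q hq), h'.out.trans h.out, h'.verdict.trans h.verdict⟩

/-- The group `g` and the pointer `p` hold the state `S` of a simulation that has been started at
the arc with the index `j`. -/
structure SimAt (g : Fin 4) (p : Fin 30) (j : ℕ) (S : Sim) (s : State 64 30) : Prop where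
  τ : s.mem (cell g 0) = S.τ
  u : s.mem (cell g 1) = S.u
  ρ : s.mem (cell g 2) = S.ρ
  k : s.mem (cell g 3) = S.k
  pos : s.pos p = S.k + j

section
variable {ω : ℝ} {l : List DirArc} {g : Fin 4} {p : Fin 30} {j : ℕ} {S : Sim} {s : State 64 30}

theorem SimAt.arcAt_eq (h : SimAt g p j S s) : arcAt l (s.pos p) = arcAt (l.rotate j) S.k := by
  rw [arcAt_rotate, h.pos]

theorem SimAt.eval_leftVertex (h : SimAt g p j S s) :
    (leftVertex g p).eval l s = S.a (l.rotate j) := by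
  simp only [leftVertex, CExpr.eval_add, CExpr.eval_center, CExpr.eval_mul, CExpr.eval_sub,
    CExpr.eval_finish, CExpr.eval_cis, Expr.eval_sub, reg, Expr.eval_cell, h.arcAt_eq, h.u, h.τ,
    Sim.a]

theorem eval_supp (hω : s.mem (cell 0 0) = ω) : supp.eval l s = Real.pi - ω := by
  simp [supp, reg, hω]

theorem SimAt.eval_rightVertex (h : SimAt g p j S s) (hω : s.mem (cell 0 0) = ω) :
    (rightVertex g p).eval l s = S.b ω (l.rotate j) := by
  simp only [rightVertex, CExpr.eval_add, CExpr.eval_center, CExpr.eval_mul, CExpr.eval_sub,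
    CExpr.eval_finish, CExpr.eval_cis, Expr.eval_sub, Expr.eval_add, Expr.eval_mul, Expr.eval_const,
    eval_supp hω, reg, Expr.eval_cell, h.arcAt_eq, h.u, h.τ, Sim.b, Rat.cast_ofNat]

/-- The group `g` holds the data saved by `simSave`. -/
structure SavedAt (g : Fin 4) (l : List DirArc) (S : Sim) (s : State 64 30) : Prop where
  c : (creg g 8 9).eval l s = (arcAt l S.k).center
  f : (creg g 10 11).eval l s = (arcAt l S.k).finish
  a : (creg g 4 5).eval l s = S.a l
  ρ : s.mem (cell g 6) = S.ρ
  k : s.mem (cell g 7) = S.k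
  τ : s.mem (cell g 12) = S.τ
  u : s.mem (cell g 13) = S.u

theorem indep_simSave : Indep (simSave g p) := by
  simp [Indep, simSave, leftVertex, CExpr.center, CExpr.finish, CExpr.add, CExpr.mul, CExpr.sub,
    CExpr.cis, reg, Expr.cells]

theorem indep_simHidden (hg : g ≠ 0) : Indep (simHidden g) := by
  simp [Indep, simHidden, supp, Expr.pi, Expr.half, reg, Expr.cells, hg]

theorem indep_simNext : Indep (simNext g p) := by
  simp [Indep, simNext, nextVertex, CExpr.lineHit, creg, CExpr.cell, CExpr.center, CExpr.div,
    CExpr.bar, CExpr.normSq, CExpr.mul, CExpr.sub, reg, Expr.cells]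

theorem indep_simFlip : Indep (simFlip g p) := by
  simp [Indep, simFlip, Expr.cwAngle, Expr.meas, creg, CExpr.cell, CExpr.center, CExpr.start,
    CExpr.finish, CExpr.bar, CExpr.mul, CExpr.sub, reg, Expr.half, Expr.cells]

theorem indep_simPivot (hg : g ≠ 0) : Indep (simPivot g p) := by
  simp [Indep, simPivot, Expr.cwAngle, Expr.unAngle, Expr.meas, creg, CExpr.cell, CExpr.center,
    CExpr.start, CExpr.finish, CExpr.bar, CExpr.mul, CExpr.sub, CExpr.cis, pivotInExpr,
    pivotOutExpr, supp, Expr.pi, reg, Expr.half, Expr.cells, hg]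

theorem simSave_spec (h : SimAt g p j S s) :
    SimAt g p j S ((Program.assigns (simSave g p)).run l s) ∧
      Frame g p s ((Program.assigns (simSave g p)).run l s) ∧
      SavedAt g (l.rotate j) S ((Program.assigns (simSave g p)).run l s) := by
  obtain ⟨h1, h2, h3, h4, h5⟩ := Program.run_assigns (l := l) (s := s) (indep_simSave (g := g) (p := p))
  generalize (Program.assigns (simSave g p)).run l s = s' at *
  have ha := h.eval_leftVertex (l := l)
  have hc := h.arcAt_eq (l := l)
  simp only [simSave, List.forall_mem_cons, List.not_mem_nil, false_imp_iff, implies_true, and_true,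
    reg, Expr.eval_cell] at h1 h2
  obtain ⟨a1, a2, a3, a4, a5, a6, a7, a8, a9, a10⟩ := h1
  refine ⟨⟨?_, ?_, ?_, ?_, ?_⟩, ⟨?_, ?_, h4, h5⟩, ?_, ?_, ?_, ?_, ?_, ?_, ?_⟩
  · rw [h2 _ (by simp), h.τ]
  · rw [h2 _ (by simp), h.u]
  · rw [h2 _ (by simp), h.ρ]
  · rw [h2 _ (by simp), h.k]
  · rw [h3, h.pos]
  · intro g' i hg; exact h2 _ (by simp [hg])
  · intro q _; rw [h3]
  · rw [creg, CExpr.eval_cell, a1, a2, ← hc]; rfl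
  · rw [creg, CExpr.eval_cell, a3, a4, ← hc]; rfl
  · rw [creg, CExpr.eval_cell, a5, a6, ← ha]; rfl
  · rw [a7, h.ρ]
  · rw [a8, h.k]
  · rw [a9, h.τ]
  · rw [a10, h.u]

theorem SavedAt.congr {m : List DirArc} {s' : State 64 30} (h : SavedAt g m S s)
    (hs : ∀ i : Fin 16, 4 ≤ i → i ≤ 13 → s'.mem (cell g i) = s.mem (cell g i)) :
    SavedAt g m S s' := by
  obtain ⟨h1, h2, h3, h4, h5, h6, h7⟩ := h
  simp only [creg, CExpr.eval_cell] at h1 h2 h3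
  refine ⟨?_, ?_, ?_, ?_, ?_, ?_, ?_⟩
  · rw [creg, CExpr.eval_cell, hs 8 (by decide) (by decide), hs 9 (by decide) (by decide), h1]
  · rw [creg, CExpr.eval_cell, hs 10 (by decide) (by decide), hs 11 (by decide) (by decide), h2]
  · rw [creg, CExpr.eval_cell, hs 4 (by decide) (by decide), hs 5 (by decide) (by decide), h3]
  · rw [hs 6 (by decide) (by decide), h4]
  · rw [hs 7 (by decide) (by decide), h5]
  · rw [hs 12 (by decide) (by decide), h6]
  · rw [hs 13 (by decide) (by decide), h7]

theorem simHidden_spec {m : List DirArc} (hg : g ≠ 0) (hω : s.mem (cell 0 0) = ω)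
    (h : SimAt g p j S s) (ho : SavedAt g m S s) (hc : S.τ < S.u) :
    SimAt g p j (S.step ω m) ((Program.assigns (simHidden g)).run l s) ∧
      Frame g p s ((Program.assigns (simHidden g)).run l s) ∧
      SavedAt g m S ((Program.assigns (simHidden g)).run l s) := by
  obtain ⟨h1, h2, h3, h4, h5⟩ := Program.run_assigns (l := l) (s := s) (indep_simHidden hg)
  generalize (Program.assigns (simHidden g)).run l s = s' at *
  simp only [simHidden, List.forall_mem_cons, List.not_mem_nil, false_imp_iff, implies_true,
    and_true, reg, Expr.eval_cell, Expr.eval_mul, Expr.eval_const, eval_supp hω, Expr.eval_sub,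
    Expr.eval_add, Expr.eval_half, ho.τ, ho.u, ho.ρ, Rat.cast_ofNat] at h1 h2
  obtain ⟨a1, a2, a3⟩ := h1
  rw [Sim.step_hidden hc]
  refine ⟨⟨a1, a2, a3, ?_, ?_⟩, ⟨?_, ?_, h4, h5⟩, ho.congr fun i hi _ => h2 _ ?_⟩
  · rw [h2 _ (by simp), h.k]
  · rw [h3, h.pos]
  · intro g' i hg; exact h2 _ (by simp [hg])
  · intro q _; rw [h3]
  · simp only [ne_eq, cell_inj, true_and]
    refine ⟨?_, ?_, ?_⟩ <;> rintro rfl <;> revert hi <;> decide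

theorem simNext_spec {m : List DirArc} (hp : (arcAt l (s.pos p)).center = (arcAt m (S.k + 1)).center)
    (ho : SavedAt g m S s) :
    Frame g p s ((Program.assigns (simNext g p)).run l s) ∧
      SavedAt g m S ((Program.assigns (simNext g p)).run l s) ∧
      ((Program.assigns (simNext g p)).run l s).pos = s.pos ∧
      ((Program.assigns (simNext g p)).run l s).mem (cell g 3) = S.k + 1 ∧
      (creg g 14 15).eval l ((Program.assigns (simNext g p)).run l s) = S.nextA m := by
  obtain ⟨h1, h2, h3, h4, h5⟩ := Program.run_assigns (l := l) (s := s) (indep_simNext (g := g) (p := p))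
  generalize (Program.assigns (simNext g p)).run l s = s' at *
  have hn : (nextVertex g p).eval l s = S.nextA m := by
    have hf : (creg g 10 11).eval l s = _ := ho.f
    have ha : (creg g 4 5).eval l s = _ := ho.a
    simp only [nextVertex, CExpr.eval_lineHit, CExpr.eval_center, CExpr.eval_sub, hf, ha, hp,
      Sim.nextA]
  simp only [simNext, List.forall_mem_cons, List.not_mem_nil, false_imp_iff, implies_true,
    and_true, reg, Expr.eval_cell, Expr.eval_add, Expr.eval_const, ho.k, Rat.cast_one] at h1 h2
  obtain ⟨a1, a2, a3⟩ := h1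
  refine ⟨⟨?_, ?_, h4, h5⟩, ho.congr fun i hi hi' => h2 _ ?_, h3, a1, ?_⟩
  · intro g' i hg; exact h2 _ (by simp [hg])
  · intro q _; rw [h3]
  · simp only [ne_eq, cell_inj, true_and]
    refine ⟨?_, ?_, ?_⟩ <;> rintro rfl <;> revert hi hi' <;> decide
  · rw [creg, CExpr.eval_cell, a2, a3, ← hn]; rfl

theorem simFlip_spec {m : List DirArc} (hp : arcAt l (s.pos p) = arcAt m (S.k + 1))
    (hpos : s.pos p = S.k + 1 + j) (hk : s.mem (cell g 3) = S.k + 1)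
    (hn : (creg g 14 15).eval l s = S.nextA m) (ho : SavedAt g m S s) (hc : S.u < S.τ) :
    SimAt g p j (S.step ω m) ((Program.assigns (simFlip g p)).run l s) ∧
      Frame g p s ((Program.assigns (simFlip g p)).run l s) ∧
      SavedAt g m S ((Program.assigns (simFlip g p)).run l s) := by
  obtain ⟨h1, h2, h3, h4, h5⟩ := Program.run_assigns (l := l) (s := s) (indep_simFlip (g := g) (p := p))
  generalize (Program.assigns (simFlip g p)).run l s = s' at *
  have hf : (creg g 10 11).eval l s = _ := ho.f
  simp only [simFlip, List.forall_mem_cons, List.not_mem_nil, false_imp_iff, implies_true,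
    and_true, reg, Expr.eval_cell, Expr.eval_cwAngle, CExpr.eval_sub, CExpr.eval_center,
    Expr.eval_meas, Expr.eval_add, Expr.eval_half, hf, hn, hp, ho.u, ho.ρ] at h1 h2
  obtain ⟨a1, a2, a3⟩ := h1
  rw [Sim.step_flip hc]
  refine ⟨⟨a1, a2, a3, ?_, ?_⟩, ⟨?_, ?_, h4, h5⟩, ho.congr fun i hi _ => h2 _ ?_⟩
  · rw [h2 _ (by simp), hk]; push_cast; rfl
  · rw [h3, hpos]
  · intro g' i hg; exact h2 _ (by simp [hg])
  · intro q _; rw [h3]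
  · simp only [ne_eq, cell_inj, true_and]
    refine ⟨?_, ?_, ?_⟩ <;> rintro rfl <;> revert hi <;> decide

theorem eval_pivotInExpr {m : List DirArc} (hω : s.mem (cell 0 0) = ω) (ho : SavedAt g m S s) :
    (pivotInExpr g).eval l s = S.pivotIn ω m := by
  have hf : (creg g 10 11).eval l s = _ := ho.f
  have hc : (creg g 8 9).eval l s = _ := ho.c
  simp only [pivotInExpr, CExpr.eval_mul, CExpr.eval_sub, CExpr.eval_cis, eval_supp hω, hf, hc,
    Sim.pivotIn]

theorem eval_pivotOutExpr {m : List DirArc} (hp : arcAt l (s.pos p) = arcAt m (S.k + 1))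
    (ho : SavedAt g m S s) : (pivotOutExpr g p).eval l s = S.pivotOut m := by
  have hf : (creg g 10 11).eval l s = _ := ho.f
  simp only [pivotOutExpr, CExpr.eval_sub, CExpr.eval_center, hp, hf, Sim.pivotOut]

theorem simPivot_spec {m : List DirArc} (hg : g ≠ 0) (hω : s.mem (cell 0 0) = ω)
    (hp : arcAt l (s.pos p) = arcAt m (S.k + 1))
    (hpos : s.pos p = S.k + 1 + j) (hk : s.mem (cell g 3) = S.k + 1)
    (ho : SavedAt g m S s) (hc : S.u = S.τ) :
    SimAt g p j (S.step ω m) ((Program.assigns (simPivot g p)).run l s) ∧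
      Frame g p s ((Program.assigns (simPivot g p)).run l s) ∧
      SavedAt g m S ((Program.assigns (simPivot g p)).run l s) := by
  obtain ⟨h1, h2, h3, h4, h5⟩ := Program.run_assigns (l := l) (s := s) (indep_simPivot (p := p) hg)
  generalize (Program.assigns (simPivot g p)).run l s = s' at *
  simp only [simPivot, List.forall_mem_cons, List.not_mem_nil, false_imp_iff, implies_true,
    and_true, reg, Expr.eval_cell, Expr.eval_unAngle, eval_pivotInExpr hω ho,
    eval_pivotOutExpr hp ho, Expr.eval_mul, Expr.eval_const, eval_supp hω,
    Expr.eval_meas, Expr.eval_add, Expr.eval_half, hp, ho.u, ho.ρ, Rat.cast_ofNat] at h1 h2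
  obtain ⟨a1, a2, a3⟩ := h1
  rw [Sim.step_pivot hc]
  refine ⟨⟨a1, a2, a3, ?_, ?_⟩, ⟨?_, ?_, h4, h5⟩, ho.congr fun i hi _ => h2 _ ?_⟩
  · rw [h2 _ (by simp), hk]; push_cast; rfl
  · rw [h3, hpos]
  · intro g' i hg; exact h2 _ (by simp [hg])
  · intro q _; rw [h3]
  · simp only [ne_eq, cell_inj, true_and]
    refine ⟨?_, ?_, ?_⟩ <;> rintro rfl <;> revert hi <;> decide

theorem loopFree_simStep : (simStep g p).LoopFree := by
  simp [simStep, Program.LoopFree, Program.loopFree_assigns]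

/-- Besides the new state, the data of the old one stay available, since the checks involve both. -/
theorem simStep_spec (hg : g ≠ 0) (hω : s.mem (cell 0 0) = ω) (h : SimAt g p j S s) :
    SimAt g p j (S.step ω (l.rotate j)) ((simStep g p).run l s) ∧
      Frame g p s ((simStep g p).run l s) ∧ SavedAt g (l.rotate j) S ((simStep g p).run l s) ∧
      (S.u ≤ S.τ → (creg g 14 15).eval l ((simStep g p).run l s) = S.nextA (l.rotate j)) := by
  obtain ⟨h1, h2, h3⟩ := simSave_spec (l := l) h
  have hω1 : ((Program.assigns (simSave g p)).run l s).mem (cell 0 0) = ω := by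
    rw [h2.mem _ _ hg.symm, hω]
  rw [simStep, Program.run_seq]
  generalize (Program.assigns (simSave g p)).run l s = s1 at *
  have e12 : (reg g 12).eval l s1 = S.τ := h3.τ
  have e13 : (reg g 13).eval l s1 = S.u := h3.u
  by_cases hc : S.τ < S.u
  · rw [Program.run_ifLt_pos (by rwa [e12, e13])]
    obtain ⟨g1, g2, g3⟩ := simHidden_spec (l := l) hg hω1 h1 h3 hc
    exact ⟨g1, h2.trans g2, g3, fun h => absurd hc h.not_gt⟩
  · rw [Program.run_ifLt_neg (by rwa [e12, e13]), Program.run_seq, Program.run_seq]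
    set s2 : State 64 30 := { s1 with pos := Function.update s1.pos p (s1.pos p + 1) } with hs2
    have hf2 : Frame g p s1 s2 :=
      ⟨fun _ _ _ => rfl, fun q hq => Function.update_of_ne hq _ _, rfl, rfl⟩
    have ho2 : SavedAt g (l.rotate j) S s2 := h3.congr fun _ _ _ => rfl
    have hp2 : s2.pos p = S.k + 1 + j := by
      rw [hs2]; simp only [Function.update_self, h1.pos]; ring
    have ha2 : arcAt l (s2.pos p) = arcAt (l.rotate j) (S.k + 1) := by rw [arcAt_rotate, hp2]
    rw [show (Program.advance p).run l s1 = s2 from rfl]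
    clear_value s2
    obtain ⟨g1, g2, g3, g4, g5⟩ := simNext_spec (l := l) (congrArg _ ha2) ho2
    generalize (Program.assigns (simNext g p)).run l s2 = s3 at *
    have hω3 : s3.mem (cell 0 0) = ω := by
      rw [g1.mem _ _ hg.symm, hf2.mem _ _ hg.symm, hω1]
    have f12 : (reg g 12).eval l s3 = S.τ := g2.τ
    have f13 : (reg g 13).eval l s3 = S.u := g2.u
    have keep : ∀ s4 : State 64 30, s4.mem (cell g 14) = s3.mem (cell g 14) →
        s4.mem (cell g 15) = s3.mem (cell g 15) →
        (creg g 14 15).eval l s4 = S.nextA (l.rotate j) := by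
      intro s4 e1 e2
      rw [← g5, creg, CExpr.eval_cell, CExpr.eval_cell, e1, e2]
    by_cases hc' : S.u < S.τ
    · rw [Program.run_ifLt_pos (by rwa [f12, f13])]
      obtain ⟨f1, f2, f3⟩ := simFlip_spec (ω := ω) (l := l) (by rw [g3, ha2]) (by rw [g3, hp2]) g4 g5
        g2 hc'
      obtain ⟨-, e2, -⟩ := Program.run_assigns (l := l) (s := s3) (indep_simFlip (g := g) (p := p))
      exact ⟨f1, ((h2.trans hf2).trans g1).trans f2, f3, fun _ =>
        keep _ (e2 _ (by simp [simFlip])) (e2 _ (by simp [simFlip]))⟩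
    · rw [Program.run_ifLt_neg (by rwa [f12, f13])]
      obtain ⟨f1, f2, f3⟩ := simPivot_spec (l := l) hg hω3 (by rw [g3, ha2]) (by rw [g3, hp2]) g4
        g2 (le_antisymm (not_lt.1 hc) (not_lt.1 hc'))
      obtain ⟨-, e2, -⟩ := Program.run_assigns (l := l) (s := s3) (indep_simPivot (p := p) hg)
      exact ⟨f1, ((h2.trans hf2).trans g1).trans f2, f3, fun _ =>
        keep _ (e2 _ (by simp [simPivot])) (e2 _ (by simp [simPivot]))⟩

end
end OmegaCloud

namespace OmegaCloud
open Complex (I)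
open scoped ComplexConjugate

/-! ### The number of steps of the simulation -/

variable {ω : ℝ} {l : List DirArc} {τ : ℝ} {N : ℕ}

/-- A bound for the number of the steps of the simulation on one arc. -/
noncomputable def roundBound (ω : ℝ) : ℕ := ⌈Real.pi / (Real.pi - ω) + 2⌉₊

/-- A potential argument. A step within an arc lowers `u` by `τ`, and after it `τ = 2 (π - ω)`; so
`u / (2 (π - ω))` pays for these steps, and one more unit for a first step with smaller `τ`. A new
arc adds at most `π / (π - ω) + 1` to the potential, and the passage itself is one step. -/
theorem sim_index_le (hπ : ω < Real.pi) (hseq : IsArcSequence l) (hl : 0 < l.length)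
    (hτ : 0 ≤ τ) (i : ℕ) : i ≤ ((sim ω l τ i).k + 1) * roundBound ω := by
  set σ := Real.pi - ω with hσ
  have hσ0 : 0 < σ := by linarith
  set W := Real.pi / σ + 2 with hW
  have key : ∀ i, 0 ≤ (sim ω l τ i).τ ∧ 0 ≤ (sim ω l τ i).u ∧ (i : ℝ) +
      ((sim ω l τ i).u / (2 * σ) + if (sim ω l τ i).τ < 2 * σ then 1 else 0) ≤
      ((sim ω l τ i).k + 1) * W := by
    have hm : ∀ k, (arcAt l k).meas / (2 * σ) ≤ Real.pi / σ := by
      intro k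
      rw [div_le_div_iff₀ (by linarith) hσ0]
      have := mul_le_mul_of_nonneg_right (hseq.valid hl k).meas_spec.2.1.le hσ0.le
      linarith
    have hm0 : ∀ k, 0 ≤ (arcAt l k).meas := fun k => (hseq.valid hl k).meas_spec.1.le
    have hif : ∀ x : ℝ, (if x < 2 * σ then (1 : ℝ) else 0) ≤ 1 := by
      intro x; split_ifs <;> norm_num
    have hif0 : ∀ x : ℝ, 0 ≤ (if x < 2 * σ then (1 : ℝ) else 0) := by
      intro x; split_ifs <;> norm_num
    intro i
    induction i with
    | zero =>
      refine ⟨hτ, hm0 0, ?_⟩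
      rw [show (sim ω l τ 0).k = 0 from rfl]
      rw [Nat.cast_zero, zero_add, zero_add, one_mul]
      refine (add_le_add (hm 0) (hif _)).trans ?_
      rw [hW]; linarith
    | succ i ih =>
      obtain ⟨g1, g2, g3⟩ := ih
      have next : ∀ T ρ : ℝ, 0 ≤ T → sim ω l τ (i + 1) = ⟨(sim ω l τ i).k + 1, T,
          (arcAt l ((sim ω l τ i).k + 1)).meas, ρ⟩ → 0 ≤ (sim ω l τ (i + 1)).τ ∧
          0 ≤ (sim ω l τ (i + 1)).u ∧ ((i + 1 : ℕ) : ℝ) + ((sim ω l τ (i + 1)).u / (2 * σ) +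
          if (sim ω l τ (i + 1)).τ < 2 * σ then 1 else 0) ≤ ((sim ω l τ (i + 1)).k + 1) * W := by
        intro T ρ hT h
        rw [h]
        refine ⟨hT, hm0 _, ?_⟩
        have h1 := hm ((sim ω l τ i).k + 1)
        have h2 := hif T
        have h3 := hif0 (sim ω l τ i).τ
        have h4 : 0 ≤ (sim ω l τ i).u / (2 * σ) := by positivity
        push_cast
        linarith
      rcases lt_trichotomy (sim ω l τ i).τ (sim ω l τ i).u with hc | hc | hc
      · rw [sim_succ, Sim.step_hidden hc]
        refine ⟨by simp only; linarith, by simp only; linarith, ?_⟩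
        simp only [← hσ, lt_irrefl, if_false, add_zero]
        push_cast
        rw [sub_div]
        split_ifs at g3 with h
        · have : 0 ≤ (sim ω l τ i).τ / (2 * σ) := by positivity
          linarith
        · have : 1 ≤ (sim ω l τ i).τ / (2 * σ) := by
            rw [le_div_iff₀ (by linarith)]; linarith
          linarith
      · exact next (2 * (Real.pi - ω)) _ (by linarith) (by rw [sim_succ, Sim.step_pivot hc.symm])
      · exact next _ _ (cwAngle_nonneg _ _) (by rw [sim_succ, Sim.step_flip hc])
  obtain ⟨-, h1, h2⟩ := key i
  have h3 : 0 ≤ (sim ω l τ i).u / (2 * σ) := by positivity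
  have h4 : (0 : ℝ) ≤ if (sim ω l τ i).τ < 2 * σ then 1 else 0 := by split_ifs <;> norm_num
  have h5 : W ≤ (roundBound ω : ℕ) := Nat.le_ceil _
  have h6 := mul_le_mul_of_nonneg_left h5 (show (0 : ℝ) ≤ (sim ω l τ i).k + 1 by positivity)
  have : (i : ℝ) ≤ (((sim ω l τ i).k + 1) * roundBound ω : ℕ) := by push_cast; linarith
  exact_mod_cast this

theorem sim_k_succ (i : ℕ) : (sim ω l τ (i + 1)).k = (sim ω l τ i).k ∨
    (sim ω l τ (i + 1)).k = (sim ω l τ i).k + 1 := by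
  rw [sim_succ]
  rcases Sim.step_k (ω := ω) (l := l) (S := sim ω l τ i) with h | h
  · exact Or.inl h.1
  · exact Or.inr h.1

/-- The simulation arrives at the end of the sequence. -/
theorem exists_round (hπ : ω < Real.pi) (hseq : IsArcSequence l) (hl : 0 < l.length)
    (hτ : 0 ≤ τ) : ∃ N, (sim ω l τ N).k = l.length ∧ (∀ i < N, (sim ω l τ i).k < l.length) ∧
      N ≤ l.length * roundBound ω + 1 := by
  have hidx := sim_index_le hπ hseq hl hτ
  have hex : ∃ i, l.length ≤ (sim ω l τ i).k := by
    refine ⟨l.length * roundBound ω + 1, ?_⟩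
    by_contra! hc
    have h1 := hidx (l.length * roundBound ω + 1)
    have h2 := Nat.mul_le_mul_right (roundBound ω) (Nat.succ_le_of_lt hc)
    rw [Nat.succ_eq_add_one] at h2
    omega
  classical
  have hmin : ∀ i < Nat.find hex, (sim ω l τ i).k < l.length := fun i hi =>
    not_le.1 (Nat.find_min hex hi)
  have hspec := Nat.find_spec hex
  generalize Nat.find hex = N at *
  rcases N with _ | N
  · have : (sim ω l τ 0).k = 0 := rfl
    omega
  · have h1 := hmin N (Nat.lt_succ_self N)
    have h2 : (sim ω l τ (N + 1)).k = l.length := by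
      rcases sim_k_succ (ω := ω) (l := l) (τ := τ) N with h | h <;> omega
    refine ⟨N + 1, h2, hmin, ?_⟩
    have h3 := hidx N
    have h4 := Nat.mul_le_mul_right (roundBound ω) (Nat.succ_le_of_lt h1)
    rw [Nat.succ_eq_add_one] at h4
    omega

/-! ### The comparison of the vertices touched by the two arms -/

/-- The rotation at the start of the contact of the right arm with its `j`-th vertex. -/
noncomputable def epsPrev (ω : ℝ) (l : List DirArc) (τ : ℝ) : ℕ → ℝ
  | 0 => 0
  | j + 1 => (sim ω l τ j).eps

/-- If the contacts overlap, after a delay, then the vertices agree. -/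
def LagOk (ω : ℝ) (l : List DirArc) (τ : ℝ) (x : ℕ × ℕ) : Prop :=
  (sim ω l τ x.1).ρ + (Real.pi - ω) < (sim ω l τ x.2).eps →
    epsPrev ω l τ x.2 < (sim ω l τ (x.1 + 1)).ρ + (Real.pi - ω) →
    (sim ω l τ x.1).a l = (sim ω l τ x.2).b ω l

open Classical in
/-- The pairs of contacts, in the order in which they begin. -/
noncomputable def lagPath (ω : ℝ) (l : List DirArc) (τ : ℝ) : ℕ → ℕ × ℕ
  | 0 => (0, 0)
  | t + 1 =>
    if (sim ω l τ (lagPath ω l τ t).2).eps <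
        (sim ω l τ ((lagPath ω l τ t).1 + 1)).ρ + (Real.pi - ω) then
      ((lagPath ω l τ t).1, (lagPath ω l τ t).2 + 1)
    else ((lagPath ω l τ t).1 + 1, (lagPath ω l τ t).2)

theorem lagPath_add (t : ℕ) : (lagPath ω l τ t).1 + (lagPath ω l τ t).2 = t := by
  induction t with
  | zero => rfl
  | succ t ih => rw [lagPath]; split_ifs <;> simp only <;> omega

namespace Returns

theorem eps_mono (h0 : 0 < ω) (hπ : ω < Real.pi) (hseq : IsArcSequence l) (hl : 0 < l.length)
    (h : Returns ω l τ N) : StrictMono fun i => (sim ω l τ i).eps :=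
  strictMono_nat_of_lt_succ fun i => (eps_succ_le hπ i).trans_lt (h.ρ_lt_eps h0 hπ hseq hl (i + 1))

theorem epsPrev_lt (h0 : 0 < ω) (hπ : ω < Real.pi) (hseq : IsArcSequence l) (hl : 0 < l.length)
    (h : Returns ω l τ N) (j : ℕ) : epsPrev ω l τ j < (sim ω l τ j).eps := by
  rcases j with _ | j
  · exact h.ρ_lt_eps h0 hπ hseq hl 0
  · exact h.eps_mono h0 hπ hseq hl (Nat.lt_succ_self j)

/-- Contacts are open intervals of rotations: `Passes.lag` compares vertices at every common
rotation, `LagOk` once if the intervals meet. -/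
theorem passes_iff (h0 : 0 < ω) (hπ : ω < Real.pi) (hseq : IsArcSequence l) (hl : 0 < l.length)
    (h : Returns ω l τ N) : Passes ω l τ N ↔ ∀ i < N, ∀ j, LagOk ω l τ (i, j) := by
  have hρ := h.ρ_mono h0 hπ hseq hl
  constructor
  · intro hp i hi j h1 h2
    simp only at h1 h2
    obtain ⟨y, hy1, hy2⟩ := exists_between (show
      max ((sim ω l τ i).ρ + (Real.pi - ω)) (epsPrev ω l τ j) <
      min ((sim ω l τ (i + 1)).ρ + (Real.pi - ω)) (sim ω l τ j).eps from
      max_lt (lt_min (by linarith [hρ (Nat.lt_succ_self i)]) h1)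
        (lt_min h2 (h.epsPrev_lt h0 hπ hseq hl j)))
    rw [max_lt_iff] at hy1
    rw [lt_min_iff] at hy2
    refine hp.lag i hi j (y - (Real.pi - ω)) (by linarith) (by linarith) ?_ (by linarith)
    rintro j' rfl
    rw [sub_add_cancel]; exact hy1.2
  · intro hlag
    refine ⟨h, fun i hi j x h1 h2 h3 h4 => hlag i hi j (by simp only; linarith) ?_⟩
    simp only
    rcases j with _ | j
    · have : (sim ω l τ 0).ρ ≤ (sim ω l τ i).ρ := hρ.monotone (Nat.zero_le i)
      rw [show (sim ω l τ 0).ρ = 0 from rfl] at this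
      rw [epsPrev]; linarith
    · have := h3 j rfl
      rw [epsPrev]; linarith

/-- Each step of the path leaves the contact that ends first, so it cannot leave the rectangle below
an overlapping pair `(i, j)` and is there after `i + j` steps. Hence linearly many comparisons cover
all overlaps. -/
theorem lagOk_of_path (h0 : 0 < ω) (hπ : ω < Real.pi) (hseq : IsArcSequence l)
    (hl : 0 < l.length) (h : Returns ω l τ N)
    (hp : ∀ t, (lagPath ω l τ t).1 < N → LagOk ω l τ (lagPath ω l τ t)) :
    ∀ i < N, ∀ j, LagOk ω l τ (i, j) := by
  intro i hi j h1 h2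
  simp only at h1 h2
  have hρ := h.ρ_mono h0 hπ hseq hl
  have hε := h.eps_mono h0 hπ hseq hl
  have key : ∀ t ≤ i + j, (lagPath ω l τ t).1 ≤ i ∧ (lagPath ω l τ t).2 ≤ j := by
    intro t ht
    induction t with
    | zero => exact ⟨Nat.zero_le _, Nat.zero_le _⟩
    | succ t ih =>
      obtain ⟨g1, g2⟩ := ih (by omega)
      have g3 := lagPath_add (ω := ω) (l := l) (τ := τ) t
      rw [lagPath]
      generalize lagPath ω l τ t = x at *
      split_ifs with hc
      · refine ⟨g1, ?_⟩
        simp only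
        by_contra hcon
        have hx : x.2 = j := by omega
        have h3 : (sim ω l τ (x.1 + 1)).ρ ≤ (sim ω l τ i).ρ :=
          hρ.monotone (show x.1 + 1 ≤ i by omega)
        rw [hx] at hc
        linarith
      · refine ⟨?_, g2⟩
        simp only
        by_contra hcon
        have hx : x.1 = i := by omega
        obtain ⟨j', rfl⟩ : ∃ j', j = j' + 1 := ⟨j - 1, by omega⟩
        have h3 : (sim ω l τ x.2).eps ≤ (sim ω l τ j').eps :=
          hε.monotone (show x.2 ≤ j' by omega)
        rw [hx] at hc
        rw [epsPrev] at h2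
        linarith
  obtain ⟨g1, g2⟩ := key (i + j) le_rfl
  have g3 := lagPath_add (ω := ω) (l := l) (τ := τ) (i + j)
  have hx : lagPath ω l τ (i + j) = (i, j) := Prod.ext (by simp only; omega) (by simp only; omega)
  have := hp (i + j) (by rw [hx]; exact hi)
  rw [hx] at this
  exact this h1 h2

/-- The right arm does not go round more than twice. -/
theorem k_lt_of_eps_lt (h0 : 0 < ω) (hπ : ω < Real.pi) (hseq : IsArcSequence l)
    (hl : 0 < l.length) (h : Returns ω l τ N) {i j : ℕ} (hi : i < N)
    (hj : (sim ω l τ j).eps < (sim ω l τ (i + 1)).ρ + (Real.pi - ω)) :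
    (sim ω l τ (j + 1)).k < 2 * l.length := by
  have hρ := h.ρ_mono h0 hπ hseq hl
  have h1 : (sim ω l τ (i + 1)).ρ ≤ (sim ω l τ N).ρ := hρ.monotone (show i + 1 ≤ N from hi)
  rw [h.ρN] at h1
  -- The turn after an event is at most `π`, so the right arm stays below `2 π + (π - ω) + π < 4 π`,
  -- that is, two rounds.
  have h2 : (sim ω l τ (j + 1)).ρ ≤ (sim ω l τ j).eps + Real.pi := by
    rw [sim_succ, Sim.eps]
    rcases lt_trichotomy (sim ω l τ j).τ (sim ω l τ j).u with hc | hc | hc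
    · rw [Sim.step_hidden hc, min_eq_left hc.le]; simp only; linarith
    · rw [Sim.step_pivot hc.symm, hc, min_self]
      have : unAngle ((sim ω l τ j).pivotIn ω l) ((sim ω l τ j).pivotOut l) ≤ Real.pi :=
        Real.arccos_le_pi _
      simp only; linarith
    · rw [Sim.step_flip hc, min_eq_right hc.le]; simp only; linarith [Real.pi_pos]
  have h3 := (h.sim_add_mul hl 0 2).2.2.1
  rw [show (sim ω l τ 0).ρ = 0 from rfl, zero_add] at h3
  push_cast at h3
  have h4 : j + 1 < 2 * N := hρ.lt_iff_lt.1 (show (sim ω l τ (j + 1)).ρ < (sim ω l τ (2 * N)).ρ by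
    linarith)
  rcases lt_or_ge (j + 1) N with h5 | h5
  · have := h.klt _ h5
    omega
  · obtain ⟨d, hd⟩ := Nat.exists_eq_add_of_le' h5
    have h6 := h.klt d (by omega)
    rw [hd, h.sim_add hl]
    simp only [Sim.shift]; omega

/-- The comparison comes to an end. -/
theorem exists_lagEnd (h0 : 0 < ω) (hπ : ω < Real.pi) (hseq : IsArcSequence l)
    (hl : 0 < l.length) (h : Returns ω l τ N) : ∃ T, (lagPath ω l τ T).1 = N ∧
      (∀ t < T, (lagPath ω l τ t).1 < N) ∧ (∀ t ≤ T, (sim ω l τ (lagPath ω l τ t).2).k < 2 * l.length) ∧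
      T ≤ N + 2 * l.length * roundBound ω := by
  have hk : ∀ T, (∀ t < T, (lagPath ω l τ t).1 < N) → ∀ t ≤ T,
      (sim ω l τ (lagPath ω l τ t).2).k < 2 * l.length ∧ (lagPath ω l τ t).1 ≤ N := by
    intro T hT t ht
    induction t with
    | zero => exact ⟨by have : (sim ω l τ 0).k = 0 := rfl; simp only [lagPath]; omega, Nat.zero_le N⟩
    | succ t ih =>
      have h1 := hT t (by omega)
      obtain ⟨h2, -⟩ := ih (by omega)
      rw [lagPath]
      split_ifs with hc
      · exact ⟨h.k_lt_of_eps_lt h0 hπ hseq hl h1 hc, h1.le⟩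
      · exact ⟨h2, h1⟩
  have hidx := sim_index_le (τ := τ) hπ hseq hl h.pos.le
  have hbd : ∀ T, (∀ t < T, (lagPath ω l τ t).1 < N) → T ≤ N + 2 * l.length * roundBound ω := by
    intro T hT
    obtain ⟨h1, h2⟩ := hk T hT T le_rfl
    have h3 := hidx (lagPath ω l τ T).2
    have h4 := Nat.mul_le_mul_right (roundBound ω) (Nat.succ_le_of_lt h1)
    rw [Nat.succ_eq_add_one] at h4
    have h5 := lagPath_add (ω := ω) (l := l) (τ := τ) T
    omega
  have hex : ∃ t, N ≤ (lagPath ω l τ t).1 := by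
    by_contra! hc
    have := hbd (N + 2 * l.length * roundBound ω + 1) fun t _ => hc t
    omega
  classical
  have hmin : ∀ t < Nat.find hex, (lagPath ω l τ t).1 < N := fun i hi =>
    not_le.1 (Nat.find_min hex hi)
  have hspec := Nat.find_spec hex
  generalize Nat.find hex = T at *
  have h1 := hk T hmin
  exact ⟨T, le_antisymm (h1 T le_rfl).2 hspec, hmin, fun t ht => (h1 t ht).1, hbd T hmin⟩

end Returns

/-! ### The program that checks the conditions at an event -/

/-- Consecutive arcs share a point, so equal centres imply equal radii. -/
theorem sameCircle_iff {k : ℕ} (hseq : IsArcSequence l) (hl : 0 < l.length) :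
    SameCircle (arcAt l k) (arcAt l (k + 1)) ↔ (arcAt l k).center = (arcAt l (k + 1)).center := by
  refine ⟨fun h => h.1, fun h => ⟨h, ?_⟩⟩
  rw [(hseq.valid hl k).2, hseq.link hl, h]

/-- The cells `0` to `7` of the group `0` hold `ω`, the length, the success mark, the failure flag,
the candidate, the measure walked, the loop counter and the start of the right contact. -/
def fail : Program 64 30 := .assign (cell 0 3) (.const 1)

/-- Checks the conditions for the last event. -/
def check (g : Fin 4) (p : Fin 30) : Program 64 30 :=
  .ifLt (reg g 12) (reg g 13) .skip (.ifLt (.read p .orientation) (.const (1 / 2)) fail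
    (.ifLt (.const 0) ((creg g 8 9).sub (.center p)).normSq
      (.ifLt (reg g 13) (reg g 12)
        (.ifLt (((creg g 14 15).sub (creg g 4 5)).mul ((creg g 4 5).sub (creg g 10 11)).bar).re
          (.const 0) fail .skip)
        (.ifLt (.const 0) ((pivotOutExpr g p).mul (pivotInExpr g).bar).im fail
          (.ifLt (reg 0 0) (.unAngle (pivotInExpr g) (pivotOutExpr g p)) fail .skip))) fail))

theorem loopFree_check (g : Fin 4) (p : Fin 30) : (check g p).LoopFree := by
  simp [check, fail, Program.LoopFree]

theorem check_spec {g : Fin 4} {p : Fin 30} {j : ℕ} {S : Sim} {s : State 64 30}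
    (hseq : IsArcSequence (l.rotate j)) (hl : 0 < l.length) (hω : s.mem (cell 0 0) = ω)
    (h : SimAt g p j (S.step ω (l.rotate j)) s) (ho : SavedAt g (l.rotate j) S s)
    (hn : S.u ≤ S.τ → (creg g 14 15).eval l s = S.nextA (l.rotate j)) :
    (S.Ok ω (l.rotate j) → (check g p).run l s = s) ∧
      (¬ S.Ok ω (l.rotate j) → (check g p).run l s = fail.run l s) := by
  have hl' : 0 < (l.rotate j).length := by rwa [List.length_rotate]
  have e12 : (reg g 12).eval l s = S.τ := ho.τ
  have e13 : (reg g 13).eval l s = S.u := ho.u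
  unfold Sim.Ok check
  by_cases hc : S.τ < S.u
  · rw [Program.run_ifLt_pos (by rwa [e12, e13])]
    exact ⟨fun _ => rfl, fun h => absurd (Or.inl hc) h⟩
  · rw [Program.run_ifLt_neg (by rwa [e12, e13])]
    have hk : (S.step ω (l.rotate j)).k = S.k + 1 := by
      rcases Sim.step_k (ω := ω) (l := l.rotate j) (S := S) with h | h
      · exact absurd h.2 hc
      · exact h.1
    have harc : arcAt l (s.pos p) = arcAt (l.rotate j) (S.k + 1) := by rw [h.arcAt_eq, hk]
    by_cases hcw : (arcAt (l.rotate j) (S.k + 1)).clockwise = true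
    swap
    · rw [Program.run_ifLt_pos (by
        simp only [Expr.eval, harc, ArcField.value, hcw]; norm_num)]
      exact ⟨fun h => absurd (h.resolve_left hc).1 hcw, fun _ => rfl⟩
    rw [Program.run_ifLt_neg (by
      simp only [Expr.eval, harc, ArcField.value, hcw]; norm_num)]
    have hcc : (creg g 8 9).eval l s = _ := ho.c
    have hf : (creg g 10 11).eval l s = _ := ho.f
    have ha : (creg g 4 5).eval l s = _ := ho.a
    have ec : (0 : ℝ) < (((creg g 8 9).sub (.center p)).normSq).eval l s ↔
        ¬ SameCircle (arcAt (l.rotate j) S.k) (arcAt (l.rotate j) (S.k + 1)) := by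
      rw [CExpr.eval_normSq, Complex.normSq_pos, CExpr.eval_sub, CExpr.eval_center, hcc, harc,
        sameCircle_iff hseq hl', sub_ne_zero]
    by_cases hsc : SameCircle (arcAt (l.rotate j) S.k) (arcAt (l.rotate j) (S.k + 1))
    · rw [Program.run_ifLt_neg (by rw [Expr.eval_const, Rat.cast_zero, ec]; exact not_not.2 hsc)]
      exact ⟨fun h => absurd hsc (h.resolve_left hc).2.1, fun _ => rfl⟩
    rw [Program.run_ifLt_pos (by rwa [Expr.eval_const, Rat.cast_zero, ec])]
    have eout := eval_pivotOutExpr harc ho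
    have ein := eval_pivotInExpr (l := l) hω ho
    by_cases hlt : S.u < S.τ
    · rw [Program.run_ifLt_pos (by rwa [e12, e13])]
      have ere : (((creg g 14 15).sub (creg g 4 5)).mul ((creg g 4 5).sub (creg g 10 11)).bar).re.eval
          l s = ((S.nextA (l.rotate j) - S.a (l.rotate j)) *
            conj (S.a (l.rotate j) - (arcAt (l.rotate j) S.k).finish)).re := by
        rw [← CExpr.eval_re, CExpr.eval_mul, CExpr.eval_bar, CExpr.eval_sub, CExpr.eval_sub,
          hn hlt.le, ha, hf]
      by_cases h1 : 0 ≤ ((S.nextA (l.rotate j) - S.a (l.rotate j)) *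
            conj (S.a (l.rotate j) - (arcAt (l.rotate j) S.k).finish)).re
      · rw [Program.run_ifLt_neg (by rw [Expr.eval_const, Rat.cast_zero, ere]; exact not_lt.2 h1)]
        exact ⟨fun _ => rfl, fun h => absurd (Or.inr ⟨hcw, hsc, fun _ => h1,
          fun h => absurd h hlt.ne⟩) h⟩
      · rw [Program.run_ifLt_pos (by rw [Expr.eval_const, Rat.cast_zero, ere]; exact not_le.1 h1)]
        exact ⟨fun h => absurd ((h.resolve_left hc).2.2.1 hlt) h1, fun _ => rfl⟩
    · rw [Program.run_ifLt_neg (by rwa [e12, e13])]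
      have heq : S.u = S.τ := le_antisymm (not_lt.1 hc) (not_lt.1 hlt)
      have eim : ((pivotOutExpr g p).mul (pivotInExpr g).bar).im.eval l s =
          (S.pivotOut (l.rotate j) * conj (S.pivotIn ω (l.rotate j))).im := by
        rw [← CExpr.eval_im, CExpr.eval_mul, CExpr.eval_bar, eout, ein]
      have eun : (Expr.unAngle (pivotInExpr g) (pivotOutExpr g p)).eval l s =
          unAngle (S.pivotIn ω (l.rotate j)) (S.pivotOut (l.rotate j)) := by
        rw [Expr.eval_unAngle, eout, ein]
      have e0 : (reg 0 0).eval l s = ω := hω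
      by_cases h1 : (S.pivotOut (l.rotate j) * conj (S.pivotIn ω (l.rotate j))).im ≤ 0
      swap
      · rw [Program.run_ifLt_pos (by rw [Expr.eval_const, Rat.cast_zero, eim]; exact not_le.1 h1)]
        exact ⟨fun h => absurd ((h.resolve_left hc).2.2.2 heq).1 h1, fun _ => rfl⟩
      rw [Program.run_ifLt_neg (by rw [Expr.eval_const, Rat.cast_zero, eim]; exact not_lt.2 h1)]
      by_cases h2 : unAngle (S.pivotIn ω (l.rotate j)) (S.pivotOut (l.rotate j)) ≤ ω
      · rw [Program.run_ifLt_neg (by rw [e0, eun]; exact not_lt.2 h2)]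
        exact ⟨fun _ => rfl, fun h => absurd (Or.inr ⟨hcw, hsc, fun h => absurd h hlt,
          fun _ => ⟨h1, h2⟩⟩) h⟩
      · rw [Program.run_ifLt_pos (by rw [e0, eun]; exact not_le.1 h2)]
        exact ⟨fun h => absurd ((h.resolve_left hc).2.2.2 heq).2 h2, fun _ => rfl⟩

end OmegaCloud

namespace OmegaCloud
open Complex (I)
open scoped ComplexConjugate

/-! ### Running times as multiples of the size of the program -/

/-- The program leads from `s` to `s'`, in a time of at most `M` times its size. -/
def Steps {K H : ℕ} (M : ℕ) (l : List DirArc) (p : Program K H) (s s' : State K H) : Prop :=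
  Runs l p s s' (M * p.size)

section
variable {K H M : ℕ} {l : List DirArc} {p q : Program K H} {s s' s'' : State K H} {a b : Expr K H}

theorem Program.LoopFree.steps (hp : p.LoopFree) (hM : 1 ≤ M) : Steps M l p s (p.run l s) :=
  hp.runs.mono (Nat.le_mul_of_pos_left _ hM)

theorem Steps.seq (h : Steps M l p s s') (h' : Steps M l q s' s'') :
    Steps M l (.seq p q) s s'' :=
  (Runs.seq h h').mono (by rw [Program.size, mul_add])

theorem Steps.ifTrue (hM : 1 ≤ M) (hc : a.eval l s < b.eval l s) (h : Steps M l p s s') :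
    Steps M l (.ifLt a b p q) s s' :=
  (Runs.ifTrue hc h).mono (by
    rw [Program.size, mul_add, mul_add]
    have := Nat.le_mul_of_pos_left (a.cost + b.cost + 1) hM
    omega)

theorem Steps.ifFalse (hM : 1 ≤ M) (hc : ¬ a.eval l s < b.eval l s) (h : Steps M l q s s') :
    Steps M l (.ifLt a b p q) s s' :=
  (Runs.ifFalse hc h).mono (by
    rw [Program.size, mul_add, mul_add]
    have := Nat.le_mul_of_pos_left (a.cost + b.cost + 1) hM
    omega)

/-- `M` exceeds the number of rounds of the loop; as loop bodies are loop-free, one factor serves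
for a whole program and the factors do not multiply. -/
theorem steps_loop (hp : p.LoopFree) (Inv : ℕ → State K H → Prop) (N : ℕ) (hM : N + 1 ≤ M)
    (h0 : Inv 0 s)
    (hstep : ∀ i < N, ∀ s, Inv i s → a.eval l s < b.eval l s ∧ Inv (i + 1) (p.run l s))
    (hN : ∀ s, Inv N s → ¬ a.eval l s < b.eval l s) :
    ∃ s', Inv N s' ∧ Steps M l (.whileLt a b p) s s' := by
  obtain ⟨s', h, h'⟩ := runs_loop hp Inv N h0 hstep hN
  exact ⟨s', h, h'.mono (Nat.mul_le_mul_right _ hM)⟩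

end

/-! ### Frame conditions -/

/-- Of the cells of the group `0` and of the pointers, only those in `G` and in `Q` have changed. -/
structure Own (G : Set (Fin 16)) (Q : Set (Fin 30)) (s s' : State 64 30) : Prop where
  mem : ∀ x ∉ G, s'.mem (cell 0 x) = s.mem (cell 0 x)
  pos : ∀ q ∉ Q, s'.pos q = s.pos q
  out : s'.out = s.out
  verdict : s'.verdict = s.verdict

section
variable {G G' : Set (Fin 16)} {Q Q' : Set (Fin 30)} {s s' s'' : State 64 30} {l : List DirArc}

theorem Own.refl (s : State 64 30) : Own G Q s s := ⟨fun _ _ => rfl, fun _ _ => rfl, rfl, rfl⟩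

theorem Own.trans (h : Own G Q s s') (h' : Own G Q s' s'') : Own G Q s s'' :=
  ⟨fun x hx => (h'.mem x hx).trans (h.mem x hx), fun q hq => (h'.pos q hq).trans (h.pos q hq),
    h'.out.trans h.out, h'.verdict.trans h.verdict⟩

theorem Own.mono (h : Own G Q s s') (hG : G ⊆ G') (hQ : Q ⊆ Q') : Own G' Q' s s' :=
  ⟨fun x hx => h.mem x fun h => hx (hG h), fun q hq => h.pos q fun h => hq (hQ h), h.out,
    h.verdict⟩

theorem Frame.own {g : Fin 4} {p : Fin 30} (h : Frame g p s s') (hg : g ≠ 0) (hp : p ∈ Q) :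
    Own G Q s s' :=
  ⟨fun x _ => h.mem 0 x hg.symm, fun q hq => h.pos q (by rintro rfl; exact hq hp), h.out,
    h.verdict⟩

theorem own_assign {x : Fin 16} (hx : x ∈ G) (e : Expr 64 30) :
    Own G Q s ((Program.assign (cell 0 x) e).run l s) :=
  ⟨fun y hy => Function.update_of_ne (by
    rw [ne_eq, cell_inj]; rintro ⟨-, rfl⟩; exact hy hx) _ _, fun _ _ => rfl, rfl, rfl⟩

theorem run_assign_mem_self (c : Fin 64) (e : Expr 64 30) :
    ((Program.assign c e).run l s).mem c = e.eval l s := Function.update_self _ _ _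

theorem run_assign_mem_ne {c c' : Fin 64} (h : c' ≠ c) (e : Expr 64 30) :
    ((Program.assign c e).run l s).mem c' = s.mem c' := Function.update_of_ne h _ _

theorem run_assign_pos (c : Fin 64) (e : Expr 64 30) :
    ((Program.assign c e).run l s).pos = s.pos := rfl

theorem SimAt.congr {g : Fin 4} {p : Fin 30} {j : ℕ} {S : Sim} (h : SimAt g p j S s)
    (hm : ∀ i, s'.mem (cell g i) = s.mem (cell g i)) (hp : s'.pos p = s.pos p) :
    SimAt g p j S s' :=
  ⟨(hm _).trans h.τ, (hm _).trans h.u, (hm _).trans h.ρ, (hm _).trans h.k, hp.trans h.pos⟩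

/-! ### Flags -/

/-- The flag has been raised unless the condition holds. -/
def Flag (P : Prop) (s : State 64 30) : Prop :=
  (P → s.mem (cell 0 3) = 0) ∧ (¬ P → s.mem (cell 0 3) = 1)

theorem Flag.and {P R : Prop} (h : Flag P s) (hR : R → s' = s)
    (hR' : ¬ R → s' = fail.run l s) : Flag (P ∧ R) s' := by
  by_cases hr : R
  · rw [hR hr]
    exact ⟨fun hp => h.1 hp.1, fun hp => h.2 fun hP => hp ⟨hP, hr⟩⟩
  · rw [hR' hr]
    refine ⟨fun hp => absurd hp.2 hr, fun _ => ?_⟩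
    rw [fail, run_assign_mem_self]; simp

theorem Flag.congr {P R : Prop} (h : Flag P s) (hPR : P ↔ R)
    (hs : s'.mem (cell 0 3) = s.mem (cell 0 3)) : Flag R s' := by
  rw [Flag, hs, ← hPR]; exact h

/-- Raises the flag if `a < b`. -/
def failIf (a b : Expr 64 30) : Program 64 30 := .ifLt a b fail .skip

theorem failIf_spec {P : Prop} (h : Flag P s) (a b : Expr 64 30) (hG : 3 ∈ G) :
    Flag (P ∧ b.eval l s ≤ a.eval l s) ((failIf a b).run l s) ∧
      Own G Q s ((failIf a b).run l s) ∧
      (∀ c, c ≠ cell 0 3 → ((failIf a b).run l s).mem c = s.mem c) ∧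
      ((failIf a b).run l s).pos = s.pos := by
  by_cases hc : a.eval l s < b.eval l s
  · rw [failIf, Program.run_ifLt_pos hc]
    exact ⟨h.and (fun h => absurd hc h.not_gt) fun _ => rfl, own_assign hG _,
      fun c hc => run_assign_mem_ne hc _, rfl⟩
  · rw [failIf, Program.run_ifLt_neg hc]
    exact ⟨h.and (l := l) (fun _ => rfl) (fun h => absurd (not_lt.1 hc) h), .refl s, fun _ _ => rfl, rfl⟩

end

/-! ### The verification of the first part of the conditions -/

/-- Starts a simulation. -/
def load (g : Fin 4) (p : Fin 30) : Program 64 30 := .assigns [(cell g 0, reg 0 4),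
  (cell g 1, .meas p), (cell g 2, .const 0), (cell g 3, .const 0)]

section
variable {ω τ : ℝ} {l : List DirArc} {s : State 64 30} {p : Fin 30} {j N M : ℕ} {g : Fin 4}

theorem load_spec (hτ : s.mem (cell 0 4) = τ) (hp : s.pos p = j) :
    SimAt g p j (sim ω (l.rotate j) τ 0) ((load g p).run l s) ∧ Frame g p s ((load g p).run l s) := by
  have hi : Indep [(cell g 0, reg 0 4), (cell g 1, Expr.meas p), (cell g 2, .const 0),
      (cell g 3, .const 0)] := by
    simp [Indep, reg, Expr.cells, Expr.meas, Expr.cwAngle, CExpr.start, CExpr.finish,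
      CExpr.center, CExpr.mul, CExpr.sub, CExpr.bar]
  obtain ⟨h1, h2, h3, h4, h5⟩ := Program.run_assigns (l := l) (s := s) hi
  rw [load]
  generalize Program.run l _ s = s' at *
  simp only [List.forall_mem_cons, List.not_mem_nil, false_imp_iff, implies_true, and_true,
    reg, Expr.eval_cell, Expr.eval_meas, Expr.eval_const, hτ, hp, Rat.cast_zero] at h1 h2
  obtain ⟨a1, a2, a3, a4⟩ := h1
  refine ⟨⟨a1, ?_, a3, ?_, ?_⟩, fun g' i hg' => h2 _ (by simp [hg']), fun q _ => by rw [h3], h4, h5⟩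
  · rw [a2, sim_zero, arcAt_rotate, zero_add]
  · rw [a4, sim_zero, Nat.cast_zero]
  · rw [h3, hp, sim_zero, zero_add]

theorem loopFree_load : (load g p).LoopFree := Program.loopFree_assigns _

theorem check_own {G : Set (Fin 16)} {Q : Set (Fin 30)} {P : Prop} (hP : P → (check g p).run l s = s)
    (hP' : ¬ P → (check g p).run l s = fail.run l s) (hG : 3 ∈ G) :
    Own G Q s ((check g p).run l s) ∧
    (∀ c, c ≠ cell 0 3 → ((check g p).run l s).mem c = s.mem c) ∧
      ((check g p).run l s).pos = s.pos := by
  by_cases h : P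
  · rw [hP h]; exact ⟨.refl s, fun _ _ => rfl, rfl⟩
  · rw [hP' h]; exact ⟨own_assign hG _, fun c hc => run_assign_mem_ne hc _, rfl⟩

def verifyLoop (p : Fin 30) : Program 64 30 :=
  .whileLt (reg 1 3) (reg 0 1) (.seq (simStep 1 p) (check 1 p))

/-- The machine compares strictly, so each equality is tested from both sides. -/
def verifyEnd : Program 64 30 :=
  .seq (failIf (reg 1 2) ((Expr.const 2).mul .pi)) (.seq (failIf ((Expr.const 2).mul .pi) (reg 1 2))
    (.seq (failIf (reg 1 0) (reg 0 4)) (.seq (failIf (reg 0 4) (reg 1 0))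
      (.ifLt (.const 0) (reg 0 4) .skip fail))))

/-- Raises the flag unless the simulation returns to its initial position. -/
def verify (p : Fin 30) : Program 64 30 := .seq (load 1 p) (.seq (verifyLoop p) verifyEnd)

theorem verifyEnd_spec {P : Prop} {Q : Set (Fin 30)} (h : Flag P s) :
    Own {3} Q s (verifyEnd.run l s) ∧ (verifyEnd.run l s).pos = s.pos ∧
    Flag (P ∧ s.mem (cell 1 2) = 2 * Real.pi ∧ s.mem (cell 1 0) = s.mem (cell 0 4) ∧
      0 < s.mem (cell 0 4)) (verifyEnd.run l s) := by
  have hG : (3 : Fin 16) ∈ ({3} : Set (Fin 16)) := rfl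
  simp only [verifyEnd, Program.run_seq]
  obtain ⟨f1, o1, m1, p1⟩ := failIf_spec (l := l) (Q := Q) h (reg 1 2) ((Expr.const 2).mul .pi) hG
  generalize (failIf (reg 1 2) ((Expr.const 2).mul .pi)).run l s = s1 at *
  obtain ⟨f2, o2, m2, p2⟩ := failIf_spec (l := l) (Q := Q) f1 ((Expr.const 2).mul .pi) (reg 1 2) hG
  generalize (failIf ((Expr.const 2).mul .pi) (reg 1 2)).run l s1 = s2 at *
  obtain ⟨f3, o3, m3, p3⟩ := failIf_spec (l := l) (Q := Q) f2 (reg 1 0) (reg 0 4) hG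
  generalize (failIf (reg 1 0) (reg 0 4)).run l s2 = s3 at *
  obtain ⟨f4, o4, m4, p4⟩ := failIf_spec (l := l) (Q := Q) f3 (reg 0 4) (reg 1 0) hG
  generalize (failIf (reg 0 4) (reg 1 0)).run l s3 = s4 at *
  have e0 : (reg 0 4).eval l s4 = s.mem (cell 0 4) := by
    rw [reg, Expr.eval_cell, m4 _ (by simp), m3 _ (by simp), m2 _ (by simp), m1 _ (by simp)]
  have ho := ((o1.trans o2).trans o3).trans o4
  have hpos : s4.pos = s.pos := by rw [p4, p3, p2, p1]
  simp only [reg, Expr.eval_cell, Expr.eval_mul, Expr.eval_const, Expr.eval_pi,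
    m1 (cell 1 2) (by simp), m2 (cell 1 0) (by simp), m1 (cell 1 0) (by simp),
    m2 (cell 0 4) (by simp), m1 (cell 0 4) (by simp), m3 (cell 0 4) (by simp),
    m3 (cell 1 0) (by simp), Rat.cast_ofNat] at f4
  have key : Own {3} Q s4 ((Program.ifLt (.const 0) (reg 0 4) .skip fail).run l s4) ∧
      ((Program.ifLt (.const 0) (reg 0 4) .skip fail).run l s4).pos = s4.pos := by
    by_cases hc : 0 < s.mem (cell 0 4)
    · rw [Program.run_ifLt_pos (by rw [e0]; simpa using hc)]
      exact ⟨.refl s4, rfl⟩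
    · rw [Program.run_ifLt_neg (by rw [e0]; simpa using hc)]
      exact ⟨own_assign hG _, rfl⟩
  refine ⟨ho.trans key.1, key.2.trans hpos, ?_⟩
  refine (f4.and (R := 0 < s.mem (cell 0 4)) (l := l) (fun hc => ?_) (fun hc => ?_)).congr ?_ rfl
  · rw [Program.run_ifLt_pos (by rw [e0]; simpa using hc)]; rfl
  · rw [Program.run_ifLt_neg (by rw [e0]; simpa using hc)]
  · constructor
    · rintro ⟨⟨⟨⟨⟨a1, a2⟩, a3⟩, a4⟩, a5⟩, a6⟩
      exact ⟨a1, le_antisymm a3 a2, le_antisymm a5 a4, a6⟩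
    · rintro ⟨a1, a2, a3, a6⟩
      exact ⟨⟨⟨⟨⟨a1, a2.ge⟩, a2.le⟩, a3.ge⟩, a3.le⟩, a6⟩

theorem loopFree_verifyEnd : verifyEnd.LoopFree := by
  simp [verifyEnd, failIf, fail, Program.LoopFree]

theorem verify_spec (hseq : IsArcSequence (l.rotate j)) (hl : 0 < l.length)
    (hω : s.mem (cell 0 0) = ω) (hn : s.mem (cell 0 1) = l.length)
    (hτ : s.mem (cell 0 4) = τ) (hp : s.pos p = j) (hflag : s.mem (cell 0 3) = 0)
    (hτ2 : τ ≤ 2 * Real.pi) (hkN : (sim ω (l.rotate j) τ N).k = l.length)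
    (hk : ∀ i < N, (sim ω (l.rotate j) τ i).k < l.length) (hM : N + 1 ≤ M) :
    ∃ s', Steps M l (verify p) s s' ∧ Own {3} {p} s s' ∧ s'.pos p = l.length + j ∧
      Flag (Returns ω (l.rotate j) τ N) s' := by
  obtain ⟨a1, a2⟩ := load_spec (ω := ω) (l := l) (g := 1) hτ hp
  have hM1 : 1 ≤ M := by omega
  have st1 := (loopFree_load (g := 1) (p := p)).steps (l := l) (s := s) hM1
  generalize (load 1 p).run l s = s1 at *
  have hG : (3 : Fin 16) ∈ ({3} : Set (Fin 16)) := rfl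
  have o1 : Own {3} {p} s s1 := a2.own (by decide) rfl
  obtain ⟨s2, ⟨b1, b2, b3⟩, st2⟩ := steps_loop (l := l) (s := s1) (M := M) (a := reg 1 3)
    (b := reg 0 1) (p := .seq (simStep 1 p) (check 1 p)) ⟨loopFree_simStep, loopFree_check 1 p⟩
    (fun i s' => SimAt 1 p j (sim ω (l.rotate j) τ i) s' ∧ Own {3} {p} s s' ∧
      Flag (∀ i' < i, (sim ω (l.rotate j) τ i').Ok ω (l.rotate j)) s') N hM
    ⟨a1, o1, fun _ => by rw [a2.mem _ _ (by decide), hflag], fun h => absurd (by simp) h⟩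
    (by
      rintro i hi s' ⟨c1, c2, c3⟩
      refine ⟨?_, ?_⟩
      · rw [reg, reg, Expr.eval_cell, Expr.eval_cell, c1.k, c2.mem 1 (by simp), hn]
        exact_mod_cast hk i hi
      have hω' : s'.mem (cell 0 0) = ω := (c2.mem 0 (by simp)).trans hω
      obtain ⟨d1, d2, d3, d4⟩ := simStep_spec (l := l) (g := 1) (by decide) hω' c1
      rw [Program.run_seq]
      generalize (simStep 1 p).run l s' = s3 at *
      rw [← sim_succ] at d1
      obtain ⟨e1, e2⟩ := check_spec (g := 1) (p := p) hseq hl ((d2.mem 0 0 (by decide)).trans hω')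
        (by rwa [← sim_succ]) d3 d4
      obtain ⟨f1, f2, f3⟩ := check_own (G := {3}) (Q := {p}) e1 e2 hG
      refine ⟨d1.congr (fun i => f2 _ (by simp)) (by rw [f3]),
        (c2.trans (d2.own (by decide) rfl)).trans f1, ?_⟩
      refine ((c3.congr Iff.rfl (d2.mem 0 3 (by decide))).and e1 e2).congr ?_ rfl
      rw [Nat.forall_lt_succ_right])
    (by
      rintro s' ⟨c1, c2, -⟩
      rw [reg, reg, Expr.eval_cell, Expr.eval_cell, c1.k, c2.mem 1 (by simp), hn, hkN]
      exact lt_irrefl _)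
  have st3 := loopFree_verifyEnd.steps (l := l) (s := s2) hM1
  obtain ⟨f1, f2, f3⟩ := verifyEnd_spec (l := l) (Q := {p}) b3
  generalize verifyEnd.run l s2 = s3 at *
  refine ⟨s3, st1.seq (st2.seq st3), b2.trans f1, ?_, f3.congr ?_ rfl⟩
  · rw [f2, b1.pos, hkN]
  · rw [b1.ρ, b1.τ, b2.mem 4 (by simp), hτ]
    constructor
    · rintro ⟨g1, g2, g3, g4⟩
      exact ⟨g4, hτ2, by rw [hkN, List.length_rotate], fun i hi => by
        rw [List.length_rotate]; exact hk i hi, g1, g3, g2⟩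
    · intro h
      exact ⟨h.ok, h.ρN, h.τN, h.pos⟩

end
end OmegaCloud

namespace OmegaCloud
open Complex (I)
open scoped ComplexConjugate

/-! ### The comparison of the vertices touched by the two arms -/

/-- The rotation at the next event of the simulation in the group `3`. -/
def epsExpr : Expr 64 30 := (reg 3 2).add (Expr.min (reg 3 0) (reg 3 1)).half

/-- Raises the flag if the contacts overlap, after a delay, and the vertices differ. -/
def lagCheck (r : Fin 30) : Program 64 30 :=
  .ifLt ((reg 2 6).add supp) epsExpr (.ifLt (reg 0 7) ((reg 2 2).add supp)
    (failIf (.const 0) ((creg 2 4 5).sub (rightVertex 3 r)).normSq) .skip) .skip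

/-- The simulation whose contact ends first is advanced; for the right arm the end of the old
contact is kept as the start of the new one. -/
def lagMove (p r : Fin 30) : Program 64 30 :=
  .ifLt epsExpr ((reg 2 2).add supp) (.seq (.assign (cell 0 7) epsExpr) (simStep 3 r)) (simStep 2 p)

def lagLoop (p r : Fin 30) : Program 64 30 :=
  .whileLt (reg 2 7) (reg 0 1) (.seq (lagCheck r) (lagMove p r))

/-- The simulation in the group `2` runs one step ahead: its saved cells describe the left contact,
its state the rotation at which this contact ends. -/
def lagStart (p r : Fin 30) : Program 64 30 :=
  .seq (load 2 p) (.seq (load 3 r) (.seq (.assign (cell 0 7) (.const 0)) (simStep 2 p)))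

/-- Raises the flag unless the same polygon is touched by both arms. -/
def lag (p r : Fin 30) : Program 64 30 := .seq (lagStart p r) (lagLoop p r)

section
variable {ω τ : ℝ} {l : List DirArc} {s : State 64 30} {p r : Fin 30} {j N M : ℕ}

/-- The loop invariant of the comparison. -/
structure LagAt (ω τ : ℝ) (l : List DirArc) (j : ℕ) (p r : Fin 30) (x : ℕ × ℕ) (s : State 64 30) :
    Prop where
  left : SimAt 2 p j (sim ω (l.rotate j) τ (x.1 + 1)) s
  saved : SavedAt 2 (l.rotate j) (sim ω (l.rotate j) τ x.1) s
  right : SimAt 3 r j (sim ω (l.rotate j) τ x.2) s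
  prev : s.mem (cell 0 7) = epsPrev ω (l.rotate j) τ x.2

theorem loopFree_lagCheck : (lagCheck r).LoopFree := by
  simp [lagCheck, failIf, fail, Program.LoopFree]

theorem loopFree_lagMove : (lagMove p r).LoopFree := by
  simp [lagMove, Program.LoopFree, loopFree_simStep]

theorem loopFree_lagStart : (lagStart p r).LoopFree := by
  simp [lagStart, Program.LoopFree, loopFree_simStep, loopFree_load]

theorem SimAt.eval_epsExpr {S : Sim} (h : SimAt 3 r j S s) : epsExpr.eval l s = S.eps := by
  simp only [epsExpr, Expr.eval_add, Expr.eval_half, Expr.eval_min, reg, Expr.eval_cell, h.ρ, h.τ,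
    h.u, Sim.eps]

theorem lagCheck_spec {x : ℕ × ℕ} {P : Prop} (hω : s.mem (cell 0 0) = ω)
    (h : LagAt ω τ l j p r x s) (hP : Flag P s) :
    LagAt ω τ l j p r x ((lagCheck r).run l s) ∧ Own {3, 7} {p, r} s ((lagCheck r).run l s) ∧
      Flag (P ∧ LagOk ω (l.rotate j) τ x) ((lagCheck r).run l s) := by
  have e1 : ((reg 2 6).add supp).eval l s = (sim ω (l.rotate j) τ x.1).ρ + (Real.pi - ω) := by
    rw [Expr.eval_add, eval_supp hω, reg, Expr.eval_cell, h.saved.ρ]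
  have e2 : ((reg 2 2).add supp).eval l s = (sim ω (l.rotate j) τ (x.1 + 1)).ρ + (Real.pi - ω) := by
    rw [Expr.eval_add, eval_supp hω, reg, Expr.eval_cell, h.left.ρ]
  have e3 := h.right.eval_epsExpr (l := l)
  have e4 : (reg 0 7).eval l s = epsPrev ω (l.rotate j) τ x.2 := h.prev
  have e5 := h.right.eval_rightVertex (l := l) hω
  have e6 : (creg 2 4 5).eval l s = (sim ω (l.rotate j) τ x.1).a (l.rotate j) := h.saved.a
  have trivialCase : LagOk ω (l.rotate j) τ x → LagAt ω τ l j p r x s ∧ Own {3, 7} {p, r} s s ∧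
      Flag (P ∧ LagOk ω (l.rotate j) τ x) s := fun hx =>
    ⟨h, .refl s, hP.congr (by simp [hx]) rfl⟩
  rw [lagCheck]
  by_cases h1 : (sim ω (l.rotate j) τ x.1).ρ + (Real.pi - ω) < (sim ω (l.rotate j) τ x.2).eps
  swap
  · rw [Program.run_ifLt_neg (by rwa [e1, e3])]
    exact trivialCase fun h => absurd h h1
  rw [Program.run_ifLt_pos (by rwa [e1, e3])]
  by_cases h2 : epsPrev ω (l.rotate j) τ x.2 < (sim ω (l.rotate j) τ (x.1 + 1)).ρ + (Real.pi - ω)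
  swap
  · rw [Program.run_ifLt_neg (by rwa [e2, e4])]
    exact trivialCase fun _ h => absurd h h2
  rw [Program.run_ifLt_pos (by rwa [e2, e4])]
  obtain ⟨f1, f2, f3, f4⟩ := failIf_spec (l := l) (G := {3, 7}) (Q := {p, r}) hP (.const 0)
    ((creg 2 4 5).sub (rightVertex 3 r)).normSq (by simp)
  generalize (failIf (.const 0) ((creg 2 4 5).sub (rightVertex 3 r)).normSq).run l s = s' at *
  refine ⟨⟨h.left.congr (fun i => f3 _ (by simp)) (by rw [f4]), h.saved.congr fun i _ _ =>
    f3 _ (by simp), h.right.congr (fun i => f3 _ (by simp)) (by rw [f4]), ?_⟩, f2, f1.congr ?_ rfl⟩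
  · rw [f3 _ (by simp), h.prev]
  · rw [CExpr.eval_normSq, CExpr.eval_sub, e5, e6, Expr.eval_const, Rat.cast_zero]
    refine and_congr_right fun _ => ⟨fun h3 _ _ => ?_, fun h3 => ?_⟩
    · by_contra hne
      exact absurd (Complex.normSq_pos.2 (sub_ne_zero.2 hne)) h3.not_gt
    · rw [h3 h1 h2, sub_self, map_zero]

theorem lagMove_spec {t : ℕ} (hpr : p ≠ r) (hω : s.mem (cell 0 0) = ω)
    (h : LagAt ω τ l j p r (lagPath ω (l.rotate j) τ t) s) :
    LagAt ω τ l j p r (lagPath ω (l.rotate j) τ (t + 1)) ((lagMove p r).run l s) ∧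
      Own {3, 7} {p, r} s ((lagMove p r).run l s) ∧
      ((lagMove p r).run l s).mem (cell 0 3) = s.mem (cell 0 3) := by
  rw [lagPath]
  generalize lagPath ω (l.rotate j) τ t = x at *
  have e2 : ((reg 2 2).add supp).eval l s = (sim ω (l.rotate j) τ (x.1 + 1)).ρ + (Real.pi - ω) := by
    rw [Expr.eval_add, eval_supp hω, reg, Expr.eval_cell, h.left.ρ]
  have e3 := h.right.eval_epsExpr (l := l)
  rw [lagMove]
  by_cases hc : (sim ω (l.rotate j) τ x.2).eps < (sim ω (l.rotate j) τ (x.1 + 1)).ρ + (Real.pi - ω)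
  · rw [if_pos hc, Program.run_ifLt_pos (by rwa [e2, e3]), Program.run_seq]
    have g1 := run_assign_mem_self (l := l) (s := s) (cell 0 7) epsExpr
    have g2 := fun c hc => run_assign_mem_ne (l := l) (s := s) (c := cell 0 7) (c' := c) hc epsExpr
    have g3 := run_assign_pos (l := l) (s := s) (cell 0 7) epsExpr
    have g4 : Own {3, 7} {p, r} s _ := own_assign (l := l) (s := s) (x := 7) (by simp) epsExpr
    generalize (Program.assign (cell 0 7) epsExpr).run l s = s1 at *
    obtain ⟨k1, k2, -, -⟩ := simStep_spec (ω := ω) (l := l) (g := 3) (by decide)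
      (by rw [g2 _ (by simp), hω]) (h.right.congr (s' := s1) (fun i => g2 _ (by simp)) (by rw [g3]))
    generalize (simStep 3 r).run l s1 = s2 at *
    rw [← sim_succ] at k1
    refine ⟨⟨h.left.congr (fun i => ?_) ?_, h.saved.congr fun i _ _ => ?_, k1, ?_⟩,
      g4.trans (k2.own (by decide) (by simp)), ?_⟩
    · rw [k2.mem _ _ (by decide), g2 _ (by simp)]
    · rw [k2.pos _ hpr, g3]
    · rw [k2.mem _ _ (by decide), g2 _ (by simp)]
    · rw [k2.mem _ _ (by decide), g1, e3]; rfl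
    · rw [k2.mem _ _ (by decide), g2 _ (by simp)]
  · rw [if_neg hc, Program.run_ifLt_neg (by rwa [e2, e3])]
    obtain ⟨k1, k2, k3, -⟩ := simStep_spec (ω := ω) (l := l) (g := 2) (by decide) hω h.left
    generalize (simStep 2 p).run l s = s2 at *
    rw [← sim_succ] at k1
    refine ⟨⟨k1, k3, h.right.congr (fun i => k2.mem _ _ (by decide)) (k2.pos _ hpr.symm), ?_⟩,
      k2.own (by decide) (by simp), k2.mem _ _ (by decide)⟩
    rw [k2.mem _ _ (by decide), h.prev]

theorem lagStart_spec (hpr : p ≠ r) (hω : s.mem (cell 0 0) = ω) (hτ : s.mem (cell 0 4) = τ)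
    (hp : s.pos p = j) (hr : s.pos r = j) :
    LagAt ω τ l j p r (0, 0) ((lagStart p r).run l s) ∧
      Own {3, 7} {p, r} s ((lagStart p r).run l s) ∧
      ((lagStart p r).run l s).mem (cell 0 3) = s.mem (cell 0 3) := by
  simp only [lagStart, Program.run_seq]
  obtain ⟨a1, a2⟩ := load_spec (ω := ω) (l := l) (g := 2) hτ hp
  generalize (load 2 p).run l s = s1 at *
  obtain ⟨b1, b2⟩ := load_spec (ω := ω) (l := l) (g := 3) (s := s1) (p := r) (j := j) (τ := τ)
    (by rw [a2.mem _ _ (by decide), hτ]) (by rw [a2.pos _ hpr.symm, hr])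
  generalize (load 3 r).run l s1 = s2 at *
  have g1 := run_assign_mem_self (l := l) (s := s2) (cell 0 7) (.const 0)
  have g2 := fun c hc => run_assign_mem_ne (l := l) (s := s2) (c := cell 0 7) (c' := c) hc (.const 0)
  have g3 := run_assign_pos (l := l) (s := s2) (cell 0 7) (.const 0)
  have g4 : Own {3, 7} {p, r} s2 _ := own_assign (l := l) (s := s2) (x := 7) (by simp) (.const 0)
  generalize (Program.assign (cell 0 7) (.const 0)).run l s2 = s3 at *
  have a3 : SimAt 2 p j (sim ω (l.rotate j) τ 0) s3 := a1.congr
    (fun i => by rw [g2 _ (by simp), b2.mem _ _ (by decide)]) (by rw [g3, b2.pos _ hpr])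
  obtain ⟨k1, k2, k3, -⟩ := simStep_spec (ω := ω) (l := l) (g := 2) (by decide)
    (by rw [g2 _ (by simp), b2.mem _ _ (by decide), a2.mem _ _ (by decide), hω]) a3
  generalize (simStep 2 p).run l s3 = s4 at *
  rw [← sim_succ] at k1
  refine ⟨⟨k1, k3, b1.congr (fun i => ?_) ?_, ?_⟩, ?_, ?_⟩
  · rw [k2.mem _ _ (by decide), g2 _ (by simp)]
  · rw [k2.pos _ hpr.symm, g3]
  · rw [k2.mem _ _ (by decide), g1, Expr.eval_const, Rat.cast_zero]; rfl
  · exact (((a2.own (by decide) (by simp)).trans (b2.own (by decide) (by simp))).trans g4).trans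
      (k2.own (by decide) (by simp))
  · rw [k2.mem _ _ (by decide), g2 _ (by simp), b2.mem _ _ (by decide), a2.mem _ _ (by decide)]

theorem lag_spec (h0 : 0 < ω) (hπ : ω < Real.pi) (hseq : IsArcSequence (l.rotate j))
    (hl : 1 < l.length) (hj : j ≤ 1) (hpr : p ≠ r)
    (hω : s.mem (cell 0 0) = ω) (hn : s.mem (cell 0 1) = l.length)
    (hτ : s.mem (cell 0 4) = τ) (hp : s.pos p = j) (hr : s.pos r = j)
    (hflag : s.mem (cell 0 3) = 0) (h : Returns ω (l.rotate j) τ N)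
    (hM : N + 2 * l.length * roundBound ω + 1 ≤ M) :
    ∃ s', Steps M l (lag p r) s s' ∧ Own {3, 7} {p, r} s s' ∧ s'.pos p ≤ 2 * l.length ∧
      s'.pos r ≤ 2 * l.length ∧ Flag (Passes ω (l.rotate j) τ N) s' := by
  have hM1 : 1 ≤ M := by omega
  have hl0 : 0 < (l.rotate j).length := by rw [List.length_rotate]; omega
  obtain ⟨T, hT1, hT2, hT3, hT4⟩ := h.exists_lagEnd h0 hπ hseq hl0
  rw [List.length_rotate] at hT3 hT4
  have hkN := h.kN
  have hklt := h.klt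
  rw [List.length_rotate] at hkN hklt
  have st1 := (loopFree_lagStart (p := p) (r := r)).steps (l := l) (s := s) hM1
  obtain ⟨a1, a2, a3⟩ := lagStart_spec (l := l) hpr hω hτ hp hr
  generalize (lagStart p r).run l s = s1 at *
  obtain ⟨s2, ⟨b1, b2, b3⟩, st2⟩ := steps_loop (l := l) (s := s1) (M := M) (a := reg 2 7)
    (b := reg 0 1) (p := .seq (lagCheck r) (lagMove p r)) ⟨loopFree_lagCheck, loopFree_lagMove⟩
    (fun t s' => LagAt ω τ l j p r (lagPath ω (l.rotate j) τ t) s' ∧ Own {3, 7} {p, r} s s' ∧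
      Flag (∀ t' < t, LagOk ω (l.rotate j) τ (lagPath ω (l.rotate j) τ t')) s') T (by omega)
    ⟨a1, a2, fun _ => by rw [a3, hflag], fun h => absurd (by simp) h⟩
    (by
      rintro t ht s' ⟨c1, c2, c3⟩
      refine ⟨?_, ?_⟩
      · rw [reg, reg, Expr.eval_cell, Expr.eval_cell, c1.saved.k, c2.mem 1 (by simp), hn]
        exact_mod_cast hklt _ (hT2 t ht)
      rw [Program.run_seq]
      have hω' : s'.mem (cell 0 0) = ω := (c2.mem 0 (by simp)).trans hω
      obtain ⟨d1, d2, d3⟩ := lagCheck_spec hω' c1 c3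
      generalize (lagCheck r).run l s' = s3 at *
      obtain ⟨e1, e2, e3⟩ := lagMove_spec hpr ((d2.mem 0 (by simp)).trans hω') d1
      exact ⟨e1, (c2.trans d2).trans e2, d3.congr (by rw [Nat.forall_lt_succ_right]) e3⟩)
    (by
      rintro s' ⟨c1, c2, -⟩
      rw [reg, reg, Expr.eval_cell, Expr.eval_cell, c1.saved.k, c2.mem 1 (by simp), hn, hT1, hkN]
      exact lt_irrefl _)
  refine ⟨s2, st1.seq st2, b2, ?_, ?_, b3.congr ?_ rfl⟩
  -- One step ahead of the round and started at `j ≤ 1`, the pointer has made at most `l.length + 2`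
  -- moves, which is within two rounds because `1 < l.length`.
  · rw [b1.left.pos, hT1]
    have := sim_k_succ (ω := ω) (l := l.rotate j) (τ := τ) N
    omega
  · rw [b1.right.pos]
    have := hT3 T le_rfl
    omega
  · rw [h.passes_iff h0 hπ hseq hl0]
    constructor
    · intro hall
      refine h.lagOk_of_path h0 hπ hseq hl0 fun t ht => hall t ?_
      -- From the step `T` on the left index is at least `N`, so no comparison is missing.
      by_contra! hc
      have hmono : Monotone fun t => (lagPath ω (l.rotate j) τ t).1 := by
        refine monotone_nat_of_le_succ fun t => ?_
        rw [lagPath]; split_ifs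
        · exact le_rfl
        · exact Nat.le_succ _
      have := hmono hc
      simp only at this
      omega
    · intro hall t ht
      exact hall _ (hT2 t ht) _

/-! ### The output -/

/-- A vertex is written when the left arm leaves it. In the last step of a returning round the
comparison is with the first contact again, which avoids a repetition across the ends. -/
def outputLoop (p : Fin 30) : Program 64 30 :=
  .whileLt (reg 1 3) (reg 0 1) (.seq (simStep 1 p)
    (.ifLt (.const 0) ((leftVertex 1 p).sub (creg 1 4 5)).normSq (.emit (reg 1 4) (reg 1 5)) .skip))

/-- Writes the vertices touched by the left arm. -/
def output (p : Fin 30) : Program 64 30 :=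
  .seq (load 1 p) (.seq (outputLoop p) (.seq (.answer true) (.assign (cell 0 2) (.const 1))))

theorem vertexList_succ (a : ℕ → ℂ) (i : ℕ) :
    (a (i + 1) ≠ a i → vertexList a (i + 1) = vertexList a i ++ [a i]) ∧
      (a (i + 1) = a i → vertexList a (i + 1) = vertexList a i) := by
  refine ⟨fun h => ?_, fun h => ?_⟩ <;>
    simp [vertexList, List.range_succ, List.filter_append, h]

theorem output_spec (hω : s.mem (cell 0 0) = ω) (hn : s.mem (cell 0 1) = l.length)
    (hτ : s.mem (cell 0 4) = τ) (hp : s.pos p = j) (hout : s.out = [])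
    (h : Returns ω (l.rotate j) τ N) (hM : N + 1 ≤ M) :
    ∃ s', Steps M l (output p) s s' ∧ s'.mem (cell 0 0) = ω ∧ s'.mem (cell 0 1) = l.length ∧
      s'.mem (cell 0 2) = 1 ∧ (∀ q, q ≠ p → s'.pos q = s.pos q) ∧ s'.pos p = l.length + j ∧
      s'.verdict = some true ∧
      s'.out = vertexList (fun i => (sim ω (l.rotate j) τ i).a (l.rotate j)) N := by
  have hM1 : 1 ≤ M := by omega
  have hkN := h.kN
  have hklt := h.klt
  rw [List.length_rotate] at hkN hklt
  obtain ⟨a1, a2⟩ := load_spec (ω := ω) (l := l) (g := 1) hτ hp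
  have st1 := (loopFree_load (g := 1) (p := p)).steps (l := l) (s := s) hM1
  generalize (load 1 p).run l s = s1 at *
  obtain ⟨s2, ⟨b1, b2, b3, b4, b5⟩, st2⟩ := steps_loop (l := l) (s := s1) (M := M) (a := reg 1 3)
    (b := reg 0 1) (p := .seq (simStep 1 p) (.ifLt (.const 0)
      ((leftVertex 1 p).sub (creg 1 4 5)).normSq (.emit (reg 1 4) (reg 1 5)) .skip))
    ⟨loopFree_simStep, trivial, trivial⟩
    (fun i s' => SimAt 1 p j (sim ω (l.rotate j) τ i) s' ∧ s'.mem (cell 0 0) = ω ∧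
      s'.mem (cell 0 1) = l.length ∧ (∀ q, q ≠ p → s'.pos q = s.pos q) ∧
      s'.out = vertexList (fun i => (sim ω (l.rotate j) τ i).a (l.rotate j)) i) N hM
    ⟨a1, by rw [a2.mem _ _ (by decide), hω], by rw [a2.mem _ _ (by decide), hn], a2.pos,
      by rw [a2.out, hout]; rfl⟩
    (by
      rintro i hi s' ⟨c1, c2, c3, c4, c5⟩
      refine ⟨?_, ?_⟩
      · rw [reg, reg, Expr.eval_cell, Expr.eval_cell, c1.k, c3]
        exact_mod_cast hklt i hi
      obtain ⟨d1, d2, d3, -⟩ := simStep_spec (l := l) (g := 1) (by decide) c2 c1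
      rw [Program.run_seq]
      generalize (simStep 1 p).run l s' = s3 at *
      rw [← sim_succ] at d1
      have e1 := d1.eval_leftVertex (l := l)
      have e2 : (creg 1 4 5).eval l s3 = _ := d3.a
      have hv := vertexList_succ (fun i => (sim ω (l.rotate j) τ i).a (l.rotate j)) i
      have e3 : ((leftVertex 1 p).sub (creg 1 4 5)).normSq.eval l s3 = Complex.normSq
          ((sim ω (l.rotate j) τ (i + 1)).a (l.rotate j) - (sim ω (l.rotate j) τ i).a (l.rotate j)) := by
        rw [CExpr.eval_normSq, CExpr.eval_sub, e1, e2]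
      have k1 : s3.mem (cell 0 0) = ω := by rw [d2.mem _ _ (by decide), c2]
      have k2 : s3.mem (cell 0 1) = l.length := by rw [d2.mem _ _ (by decide), c3]
      have k3 : ∀ q, q ≠ p → s3.pos q = s.pos q := fun q hq => (d2.pos q hq).trans (c4 q hq)
      by_cases hc : (sim ω (l.rotate j) τ (i + 1)).a (l.rotate j) =
          (sim ω (l.rotate j) τ i).a (l.rotate j)
      · rw [Program.run_ifLt_neg (by
          rw [e3, hc, sub_self, map_zero, Expr.eval_const, Rat.cast_zero]; exact lt_irrefl _)]
        exact ⟨d1, k1, k2, k3, by rw [hv.2 hc, ← c5]; exact d2.out⟩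
      · rw [Program.run_ifLt_pos (by
          rw [e3, Expr.eval_const, Rat.cast_zero]
          exact Complex.normSq_pos.2 (sub_ne_zero.2 hc))]
        refine ⟨⟨d1.τ, d1.u, d1.ρ, d1.k, d1.pos⟩, k1, k2, k3, ?_⟩
        rw [hv.1 hc, ← c5, ← d2.out, ← e2]
        rfl)
    (by
      rintro s' ⟨c1, c2, c3, -, -⟩
      rw [reg, reg, Expr.eval_cell, Expr.eval_cell, c1.k, c3, hkN]
      exact lt_irrefl _)
  have st3 := (show (Program.seq (.answer true) (.assign (cell 0 2) (.const 1)) :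
    Program 64 30).LoopFree from ⟨trivial, trivial⟩).steps (l := l) (s := s2) hM1
  refine ⟨_, st1.seq (st2.seq st3), ?_, ?_, ?_, b4, ?_, rfl, b5⟩
  · rw [Program.run_seq, run_assign_mem_ne (by simp)]; exact b2
  · rw [Program.run_seq, run_assign_mem_ne (by simp)]; exact b3
  · rw [Program.run_seq, run_assign_mem_self]; simp
  · exact b1.pos.trans (by rw [hkN])

end
end OmegaCloud

namespace OmegaCloud
open Complex (I)
open scoped ComplexConjugate

/-! ### The computation of the candidates -/

/-- Advances all pointers of a group. -/
def shiftAll (t : Fin 6) (j : Fin 2) : Program 64 30 :=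
  if j = 0 then .skip else .seq (.advance (ptr t 0)) (.seq (.advance (ptr t 1))
    (.seq (.advance (ptr t 2)) (.seq (.advance (ptr t 3)) (.advance (ptr t 4)))))

/-- An expression for the candidate that belongs to a vertex. -/
def tauExpr (v : CExpr 64 30) : Expr 64 30 :=
  .cwAngle ((creg 1 12 13).sub (creg 1 8 9)) (v.sub (creg 1 8 9))

def saveFirst (p : Fin 30) : List (Fin 64 × Expr 64 30) := [
  (cell 1 8, (CExpr.center p).re), (cell 1 9, (CExpr.center p).im),
  (cell 1 10, (CExpr.finish p).re), (cell 1 11, (CExpr.finish p).im),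
  (cell 1 12, (CExpr.start p).re), (cell 1 13, (CExpr.start p).im),
  (cell 0 5, .const 0), (cell 0 6, .const 0)]

def reflectedExpr (p : Fin 30) : CExpr 64 30 :=
  (creg 1 8 9).add ((((creg 1 10 11).sub (creg 1 8 9)).div ((CExpr.center p).sub (creg 1 8 9))).bar.mul
    ((CExpr.center p).sub (creg 1 8 9)))

/-- The counter makes one round of the loop per arc; once the arc with the stop point is reached,
the pointer and the sum no longer change. -/
def walkStep (p : Fin 30) : Program 64 30 :=
  .seq (.assign (cell 0 6) ((reg 0 6).add (.const 1)))
    (.ifLt ((reg 0 5).add (.meas p)) ((Expr.const 2).mul supp)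
      (.seq (.assign (cell 0 5) ((reg 0 5).add (.meas p))) (.advance p)) .skip)

def stopExpr (p : Fin 30) : CExpr 64 30 :=
  (CExpr.center p).add (((CExpr.start p).sub (CExpr.center p)).mul
    (CExpr.cis ((Expr.const 0).sub (((Expr.const 2).mul supp).sub (reg 0 5)))))

def lineExpr (p : Fin 30) : CExpr 64 30 :=
  .lineHit (creg 1 8 9) (creg 1 12 13) ((stopExpr p).sub (creg 1 12 13))

/-- Computes a candidate. -/
def guess (p : Fin 30) (c : Fin 3) : Program 64 30 :=
  .seq (.assign (cell 0 3) (.const 0)) (.seq (.assigns (saveFirst p))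
    (if c = 0 then .assign (cell 0 4) ((Expr.const 2).mul supp)
    else if c = 1 then .seq (.advance p) (.assign (cell 0 4) (tauExpr (reflectedExpr p)))
    else .seq (.whileLt (reg 0 6) (reg 0 1) (walkStep p))
      (.assign (cell 0 4) (tauExpr (lineExpr p)))))

section
variable {ω : ℝ} {l : List DirArc} {s : State 64 30} {p : Fin 30} {j M : ℕ}

theorem loopFree_shiftAll (t : Fin 6) (j : Fin 2) : (shiftAll t j).LoopFree := by
  rw [shiftAll]; split_ifs <;> simp [Program.LoopFree]

theorem shiftAll_spec (t : Fin 6) (j : Fin 2) : ((shiftAll t j).run l s).mem = s.mem ∧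
    (∀ i, ((shiftAll t j).run l s).pos (ptr t i) = s.pos (ptr t i) + j) ∧
    (∀ q, (∀ i, q ≠ ptr t i) → ((shiftAll t j).run l s).pos q = s.pos q) ∧
    ((shiftAll t j).run l s).out = s.out ∧ ((shiftAll t j).run l s).verdict = s.verdict := by
  fin_cases j
  · exact ⟨rfl, fun _ => rfl, fun _ _ => rfl, rfl, rfl⟩
  · refine ⟨rfl, fun i => ?_, fun q hq => ?_, rfl, rfl⟩
    · fin_cases i <;> simp [shiftAll, Program.run]
    · simp [shiftAll, Program.run, hq]

theorem stopIndex_le : stopIndex ω l ≤ l.length := Nat.sInf_le (Or.inl le_rfl)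

theorem measSum_succ (k : ℕ) : measSum l (k + 1) = measSum l k + (arcAt l k).meas :=
  Finset.sum_range_succ _ _

theorem lt_stopIndex_iff {i : ℕ} (hi : i < l.length) (hle : i ≤ stopIndex ω l) :
    measSum l (i + 1) < 2 * (Real.pi - ω) ↔ i < stopIndex ω l := by
  constructor
  · intro h
    refine lt_of_le_of_ne hle ?_
    rintro rfl
    rcases Nat.sInf_mem (s := {k | l.length ≤ k ∨ 2 * (Real.pi - ω) ≤ measSum l (k + 1)})
      ⟨l.length, Or.inl le_rfl⟩ with h' | h'
    · exact absurd hi (not_lt.2 h')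
    · exact absurd h (not_lt.2 h')
  · intro h
    by_contra! hc
    exact absurd h (not_lt.2 (Nat.sInf_le (Or.inr hc)))

/-- The data of the first arc. -/
structure FirstAt (l : List DirArc) (s : State 64 30) : Prop where
  c : (creg 1 8 9).eval l s = (arcAt l 0).center
  f : (creg 1 10 11).eval l s = (arcAt l 0).finish
  st : (creg 1 12 13).eval l s = (arcAt l 0).start

theorem FirstAt.congr {m : List DirArc} {s' : State 64 30} (h : FirstAt m s)
    (hs : ∀ i, s'.mem (cell 1 i) = s.mem (cell 1 i)) : FirstAt m s' := by
  obtain ⟨h1, h2, h3⟩ := h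
  simp only [creg, CExpr.eval_cell] at h1 h2 h3
  refine ⟨?_, ?_, ?_⟩
  · rw [creg, CExpr.eval_cell, hs, hs, h1]
  · rw [creg, CExpr.eval_cell, hs, hs, h2]
  · rw [creg, CExpr.eval_cell, hs, hs, h3]

theorem saveFirst_spec (hp : s.pos p = j) :
    FirstAt (l.rotate j) ((Program.assigns (saveFirst p)).run l s) ∧
    Own {5, 6} {p} s ((Program.assigns (saveFirst p)).run l s) ∧
    ((Program.assigns (saveFirst p)).run l s).pos = s.pos ∧
    ((Program.assigns (saveFirst p)).run l s).mem (cell 0 5) = 0 ∧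
    ((Program.assigns (saveFirst p)).run l s).mem (cell 0 6) = 0 := by
  have hi : Indep (saveFirst p) := by
    simp [Indep, saveFirst, Expr.cells, CExpr.center, CExpr.finish, CExpr.start]
  obtain ⟨h1, h2, h3, h4, h5⟩ := Program.run_assigns (l := l) (s := s) hi
  generalize (Program.assigns (saveFirst p)).run l s = s' at *
  have harc : arcAt l (s.pos p) = arcAt (l.rotate j) 0 := by rw [arcAt_rotate, hp, zero_add]
  simp only [saveFirst, List.forall_mem_cons, List.not_mem_nil, false_imp_iff, implies_true,
    and_true, Expr.eval_const, Rat.cast_zero] at h1 h2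
  obtain ⟨a1, a2, a3, a4, a5, a6, a7, a8⟩ := h1
  refine ⟨⟨?_, ?_, ?_⟩, ⟨fun x hx => h2 _ ?_, fun q _ => by rw [h3], h4, h5⟩, h3, a7, a8⟩
  · rw [creg, CExpr.eval_cell, a1, a2, ← harc]; rfl
  · rw [creg, CExpr.eval_cell, a3, a4, ← harc]; rfl
  · rw [creg, CExpr.eval_cell, a5, a6, ← harc]; rfl
  · simp only [Set.mem_insert_iff, Set.mem_singleton_iff, not_or] at hx
    simp [hx.1, hx.2]

theorem FirstAt.eval_tauExpr {m : List DirArc} (h : FirstAt m s) (v : CExpr 64 30) :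
    (tauExpr v).eval l s = tauOf m (v.eval l s) := by
  have h1 : (creg 1 8 9).eval l s = _ := h.c
  have h3 : (creg 1 12 13).eval l s = _ := h.st
  rw [tauExpr, Expr.eval_cwAngle, CExpr.eval_sub, CExpr.eval_sub, h1, h3, tauOf]

theorem FirstAt.eval_reflectedExpr {m : List DirArc} (h : FirstAt m s)
    (hp : arcAt l (s.pos p) = arcAt m 1) : (reflectedExpr p).eval l s = reflectedVertex m := by
  have h1 : (creg 1 8 9).eval l s = _ := h.c
  have h2 : (creg 1 10 11).eval l s = _ := h.f
  simp only [reflectedExpr, CExpr.eval_add, CExpr.eval_mul, CExpr.eval_bar, CExpr.eval_div,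
    CExpr.eval_sub, CExpr.eval_center, h1, h2, hp, reflectedVertex]

theorem FirstAt.eval_lineExpr {m : List DirArc} (h : FirstAt m s) (hω : s.mem (cell 0 0) = ω)
    (hp : arcAt l (s.pos p) = arcAt m (stopIndex ω m))
    (ha : s.mem (cell 0 5) = measSum m (stopIndex ω m)) :
    (lineExpr p).eval l s = lineVertex ω m := by
  have h1 : (creg 1 8 9).eval l s = _ := h.c
  have h3 : (creg 1 12 13).eval l s = _ := h.st
  have h4 : (reg 0 5).eval l s = _ := ha
  simp only [lineExpr, stopExpr, CExpr.eval_lineHit, CExpr.eval_add, CExpr.eval_mul, CExpr.eval_cis,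
    CExpr.eval_sub, CExpr.eval_center, CExpr.eval_start, Expr.eval_sub, Expr.eval_mul,
    Expr.eval_const, eval_supp hω, h1, h3, h4, hp, lineVertex, stopPoint, DirArc.pt, Rat.cast_zero,
    Rat.cast_ofNat, zero_sub]

/-- The invariant of the walk to the point at the measure `2 (π - ω)` from the start. -/
structure WalkAt (ω : ℝ) (m : List DirArc) (j : ℕ) (p : Fin 30) (i : ℕ) (s : State 64 30) :
    Prop where
  count : s.mem (cell 0 6) = i
  acc : s.mem (cell 0 5) = measSum m (min i (stopIndex ω m))
  pos : s.pos p = min i (stopIndex ω m) + j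

theorem walkStep_spec {i : ℕ} (hi : i < l.length) (hω : s.mem (cell 0 0) = ω)
    (h : WalkAt ω (l.rotate j) j p i s) :
    WalkAt ω (l.rotate j) j p (i + 1) ((walkStep p).run l s) ∧
    Own {5, 6} {p} s ((walkStep p).run l s) ∧
    ∀ x, ((walkStep p).run l s).mem (cell 1 x) = s.mem (cell 1 x) := by
  rw [walkStep, Program.run_seq]
  have g1 := run_assign_mem_self (l := l) (s := s) (cell 0 6) ((reg 0 6).add (.const 1))
  have g2 := fun c hc => run_assign_mem_ne (l := l) (s := s) (c := cell 0 6) (c' := c) hc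
    ((reg 0 6).add (.const 1))
  have g3 := run_assign_pos (l := l) (s := s) (cell 0 6) ((reg 0 6).add (.const 1))
  have g4 : Own {5, 6} {p} s _ := own_assign (l := l) (s := s) (x := 6) (by simp)
    ((reg 0 6).add (.const 1))
  generalize (Program.assign (cell 0 6) ((reg 0 6).add (.const 1))).run l s = s1 at *
  rw [Expr.eval_add, Expr.eval_const, reg, Expr.eval_cell, h.count, Rat.cast_one] at g1
  have ha : (reg 0 5).eval l s1 = measSum (l.rotate j) (min i (stopIndex ω (l.rotate j))) := by
    rw [reg, Expr.eval_cell, g2 _ (by simp), h.acc]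
  have harc : arcAt l (s1.pos p) = arcAt (l.rotate j) (min i (stopIndex ω (l.rotate j))) := by
    rw [arcAt_rotate, g3, h.pos]
  have hle : measSum (l.rotate j) (min i (stopIndex ω (l.rotate j))) +
      (arcAt (l.rotate j) (min i (stopIndex ω (l.rotate j)))).meas =
      measSum (l.rotate j) (min i (stopIndex ω (l.rotate j)) + 1) := (measSum_succ _).symm
  have hiff := lt_stopIndex_iff (ω := ω) (l := l.rotate j)
    (i := min i (stopIndex ω (l.rotate j))) (by rw [List.length_rotate]; omega) (min_le_right _ _)
  have e1 : ((reg 0 5).add (.meas p)).eval l s1 = measSum (l.rotate j)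
      (min i (stopIndex ω (l.rotate j)) + 1) := by
    rw [Expr.eval_add, ha, Expr.eval_meas, harc, hle]
  have e2 : ((Expr.const 2).mul supp).eval l s1 = 2 * (Real.pi - ω) := by
    rw [Expr.eval_mul, Expr.eval_const, eval_supp (by rw [g2 _ (by simp), hω]), Rat.cast_ofNat]
  by_cases hc : i < stopIndex ω (l.rotate j)
  · rw [Program.run_ifLt_pos (by rw [e1, e2, hiff]; omega), Program.run_seq]
    have k1 := run_assign_mem_self (l := l) (s := s1) (cell 0 5) ((reg 0 5).add (.meas p))
    have k2 := fun c hc => run_assign_mem_ne (l := l) (s := s1) (c := cell 0 5) (c' := c) hc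
      ((reg 0 5).add (.meas p))
    have k3 := run_assign_pos (l := l) (s := s1) (cell 0 5) ((reg 0 5).add (.meas p))
    have k4 : Own {5, 6} {p} s1 _ := own_assign (l := l) (s := s1) (x := 5) (by simp)
      ((reg 0 5).add (.meas p))
    generalize (Program.assign (cell 0 5) ((reg 0 5).add (.meas p))).run l s1 = s2 at *
    have hadv : Own {5, 6} {p} s2 ((Program.advance p).run l s2) :=
      ⟨fun _ _ => rfl, fun q hq => Function.update_of_ne hq _ _, rfl, rfl⟩
    refine ⟨⟨?_, ?_, ?_⟩, (g4.trans k4).trans hadv, fun x => ?_⟩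
    · refine (k2 _ (by simp)).trans ?_
      rw [g1]; push_cast; rfl
    · refine k1.trans ?_
      rw [e1, min_eq_left hc.le, min_eq_left (show i + 1 ≤ _ from hc)]
    · refine (Function.update_self _ _ _).trans ?_
      rw [k3, g3, h.pos, min_eq_left hc.le, min_eq_left (show i + 1 ≤ _ from hc)]
      ring
    · exact (k2 _ (by simp)).trans (g2 _ (by simp))
  · rw [Program.run_ifLt_neg (by rw [e1, e2, hiff]; omega)]
    have e3 : min (i + 1) (stopIndex ω (l.rotate j)) = min i (stopIndex ω (l.rotate j)) := by omega
    refine ⟨⟨?_, ?_, ?_⟩, g4, fun x => g2 _ (by simp)⟩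
    · refine g1.trans ?_
      push_cast; rfl
    · rw [e3, ← h.acc]; exact g2 _ (by simp)
    · rw [e3, ← h.pos]; exact congrFun g3 p

theorem guess_spec (c : Fin 3) (hl : 1 < l.length) (hj : j ≤ 1) (hω : s.mem (cell 0 0) = ω)
    (hn : s.mem (cell 0 1) = l.length) (hp : s.pos p = j) (hM : l.length + 1 ≤ M) :
    ∃ s', Steps M l (guess p c) s s' ∧ Own {3, 4, 5, 6} {p} s s' ∧ s'.pos p ≤ 2 * l.length ∧
      s'.mem (cell 0 3) = 0 ∧ s'.mem (cell 0 4) = candidate ω (l.rotate j) c := by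
  have hM1 : 1 ≤ M := by omega
  have st0 := (show (Program.assign (cell 0 3) (.const 0) : Program 64 30).LoopFree from
    trivial).steps (l := l) (s := s) hM1
  have g1 := run_assign_mem_self (l := l) (s := s) (cell 0 3) (.const 0)
  have g3 := run_assign_pos (l := l) (s := s) (cell 0 3) (.const 0)
  have g4 : Own {3, 4, 5, 6} {p} s _ := own_assign (l := l) (s := s) (x := 3) (by simp) (.const 0)
  generalize (Program.assign (cell 0 3) (.const 0)).run l s = s1 at *
  rw [Expr.eval_const, Rat.cast_zero] at g1
  have st1 := (Program.loopFree_assigns (saveFirst p)).steps (l := l) (s := s1) hM1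
  obtain ⟨a1, a2, a3, a4, a5⟩ := saveFirst_spec (l := l) (s := s1) (p := p) (by rw [g3, hp])
  generalize (Program.assigns (saveFirst p)).run l s1 = s2 at *
  have hsub : ({5, 6} : Set (Fin 16)) ⊆ {3, 4, 5, 6} := by
    intro x hx
    simp only [Set.mem_insert_iff, Set.mem_singleton_iff] at hx ⊢
    tauto
  have o2 := g4.trans (a2.mono hsub le_rfl)
  have hω2 : s2.mem (cell 0 0) = ω := by rw [o2.mem _ (by simp), hω]
  have hn2 : s2.mem (cell 0 1) = l.length := by rw [o2.mem _ (by simp), hn]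
  have hf2 : s2.mem (cell 0 3) = 0 := by rw [a2.mem _ (by simp), g1]
  have hp2 : s2.pos p = j := by rw [a3, g3, hp]
  have fin : ∀ (e : Expr 64 30) (s3 : State 64 30), Own {4, 5, 6} {p} s2 s3 →
      s3.pos p ≤ 2 * l.length →
      Steps M l (.assign (cell 0 4) e) s3 ((Program.assign (cell 0 4) e).run l s3) ∧
      Own {3, 4, 5, 6} {p} s ((Program.assign (cell 0 4) e).run l s3) ∧
      ((Program.assign (cell 0 4) e).run l s3).pos p ≤ 2 * l.length ∧
      ((Program.assign (cell 0 4) e).run l s3).mem (cell 0 3) = 0 ∧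
      ((Program.assign (cell 0 4) e).run l s3).mem (cell 0 4) = e.eval l s3 := by
    intro e s3 h3 hp3
    refine ⟨(show (Program.assign (cell 0 4) e : Program 64 30).LoopFree from
      trivial).steps hM1, (o2.trans (h3.mono (by simp) le_rfl)).trans (own_assign (by simp) e), hp3,
      ?_, run_assign_mem_self _ _⟩
    rw [run_assign_mem_ne (by simp), h3.mem _ (by simp), hf2]
  rw [guess]
  fin_cases c
  · obtain ⟨f1, f2, f3, f4, f5⟩ := fin ((Expr.const 2).mul supp) s2 (.refl s2) (by omega)
    exact ⟨_, st0.seq (st1.seq f1), f2, f3, f4, f5.trans (by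
      rw [Expr.eval_mul, Expr.eval_const, eval_supp hω2, Rat.cast_ofNat]; rfl)⟩
  · have hadv : Own {4, 5, 6} {p} s2 ((Program.advance p).run l s2) :=
      ⟨fun _ _ => rfl, fun q hq => Function.update_of_ne hq _ _, rfl, rfl⟩
    have hpa : ((Program.advance p).run l s2).pos p = j + 1 :=
      (Function.update_self _ _ _).trans (by rw [hp2])
    have st2 := (show (Program.advance p : Program 64 30).LoopFree from trivial).steps (l := l)
      (s := s2) hM1
    have a1' : FirstAt (l.rotate j) ((Program.advance p).run l s2) := a1.congr fun _ => rfl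
    generalize (Program.advance p).run l s2 = s3 at *
    obtain ⟨f1, f2, f3, f4, f5⟩ := fin (tauExpr (reflectedExpr p)) s3 hadv (by omega)
    exact ⟨_, st0.seq (st1.seq (st2.seq f1)), f2, f3, f4, f5.trans (by
      rw [a1'.eval_tauExpr, a1'.eval_reflectedExpr (by rw [arcAt_rotate, hpa, add_comm])]; rfl)⟩
  · obtain ⟨s3, ⟨b1, b2, b3⟩, st2⟩ := steps_loop (l := l) (s := s2) (M := M) (a := reg 0 6)
      (b := reg 0 1) (p := walkStep p) ⟨trivial, ⟨trivial, trivial⟩, trivial⟩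
      (fun i s' => WalkAt ω (l.rotate j) j p i s' ∧ Own {5, 6} {p} s2 s' ∧
        ∀ x, s'.mem (cell 1 x) = s2.mem (cell 1 x)) l.length hM
      ⟨⟨by rw [a5, Nat.cast_zero], by rw [a4, Nat.zero_min]; rfl, by rw [hp2, Nat.zero_min, zero_add]⟩,
        .refl s2, fun _ => rfl⟩
      (by
        rintro i hi s' ⟨c1, c2, c3⟩
        refine ⟨?_, ?_⟩
        · rw [reg, reg, Expr.eval_cell, Expr.eval_cell, c1.count, c2.mem 1 (by simp), hn2]
          exact_mod_cast hi
        obtain ⟨d1, d2, d3⟩ := walkStep_spec hi ((c2.mem 0 (by simp)).trans hω2) c1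
        exact ⟨d1, c2.trans d2, fun x => (d3 x).trans (c3 x)⟩)
      (by
        rintro s' ⟨c1, c2, -⟩
        rw [reg, reg, Expr.eval_cell, Expr.eval_cell, c1.count, c2.mem 1 (by simp), hn2]
        exact lt_irrefl _)
    have hle := stopIndex_le (ω := ω) (l := l.rotate j)
    rw [List.length_rotate] at hle
    have hpos := b1.pos
    have hacc := b1.acc
    rw [min_eq_right hle] at hpos hacc
    have a1' := a1.congr b3
    obtain ⟨f1, f2, f3, f4, f5⟩ := fin (tauExpr (lineExpr p)) s3 (b2.mono (by simp) le_rfl) (by omega)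
    exact ⟨_, st0.seq (st1.seq (st2.seq f1)), f2, f3, f4, f5.trans (by
      rw [a1'.eval_tauExpr, a1'.eval_lineExpr ((b2.mem 0 (by simp)).trans hω2)
        (by rw [arcAt_rotate, hpos]) hacc]; rfl)⟩

end
end OmegaCloud

namespace OmegaCloud
open Complex (I)
open scoped ComplexConjugate

/-! ### The algorithm -/

/-- Tries one of the candidates. -/
def trial (t : Fin 6) (j : Fin 2) (c : Fin 3) : Program 64 30 :=
  -- Pointers never move back, so each phase has its own: `0` for the guess, `1` for the
  -- verification, `2` and `3` for the two arms, `4` for the output.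
  .seq (shiftAll t j) (.seq (guess (ptr t 0) c) (.seq (verify (ptr t 1))
    (.ifLt (reg 0 3) (.const (1 / 2)) (.seq (lag (ptr t 2) (ptr t 3))
      (.ifLt (reg 0 3) (.const (1 / 2)) (output (ptr t 4)) .skip)) .skip)))

/-- The parameters of the trials. -/
def trialKind : Fin 6 ≃ Fin 2 × Fin 3 := (finProdFinEquiv (m := 2) (n := 3)).symm

/-- Tries some of the candidates, until one of them is successful. -/
def search : List (Fin 6) → Program 64 30
  | [] => .skip
  | t :: ts => .seq (trial t (trialKind t).1 (trialKind t).2)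
      (.ifLt (reg 0 2) (.const (1 / 2)) (search ts) .skip)

/-- The algorithm that recognizes the maximal clouds. -/
def recognize : Program 64 30 := .seq (.answer false) (search (List.finRange 6))

/-- The list consists of the vertices found by the simulation. -/
def Found (ω : ℝ) (l : List DirArc) (vs : List ℂ) : Prop :=
  ∃ (j : Fin 2) (c : Fin 3) (N : ℕ), Passes ω (l.rotate j) (candidate ω (l.rotate j) c) N ∧
    vs = vertexList (fun i =>
      (sim ω (l.rotate j) (candidate ω (l.rotate j) c) i).a (l.rotate j)) N

theorem candidate_nonneg {ω : ℝ} (hπ : ω < Real.pi) (l : List DirArc) (c : Fin 3) :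
    0 ≤ candidate ω l c := by
  fin_cases c
  · show 0 ≤ 2 * (Real.pi - ω); linarith
  · exact cwAngle_nonneg _ _
  · exact cwAngle_nonneg _ _

theorem candidate_le {ω : ℝ} (h0 : 0 < ω) (l : List DirArc) (c : Fin 3) :
    candidate ω l c ≤ 2 * Real.pi := by
  fin_cases c
  · show 2 * (Real.pi - ω) ≤ _; linarith
  · exact cwAngle_le _ _
  · exact cwAngle_le _ _

/-- The number of steps of a round depends on the index `k` alone and is known whether or not the
checks hold. -/
theorem Returns.unique {ω τ : ℝ} {l : List DirArc} {N N' : ℕ} (h : Returns ω l τ N)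
    (hk : (sim ω l τ N').k = l.length) (hlt : ∀ i < N', (sim ω l τ i).k < l.length) : N = N' := by
  rcases lt_trichotomy N N' with hc | hc | hc
  · exact absurd h.kN (hlt N hc).ne
  · exact hc
  · exact absurd hk (h.klt N' hc).ne

section
variable {ω : ℝ} {l : List DirArc} {s : State 64 30} {M : ℕ}

theorem Flag.lt_iff {P : Prop} (h : Flag P s) :
    (reg 0 3).eval l s < (Expr.const (1 / 2) : Expr 64 30).eval l s ↔ P := by
  rw [reg, Expr.eval_cell, Expr.eval_const]
  by_cases hP : P
  · rw [h.1 hP]; norm_num [hP]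
  · rw [h.2 hP]; norm_num [hP]

theorem trial_spec (h0 : 0 < ω) (hπ : ω < Real.pi) (hseq : IsArcSequence l) (hl : 1 < l.length)
    (hω : s.mem (cell 0 0) = ω) (hn : s.mem (cell 0 1) = l.length) (hd : s.mem (cell 0 2) = 0)
    (hout : s.out = []) (hv : s.verdict = some false)
    (t : Fin 6) (hp : ∀ i, s.pos (ptr t i) = 0) (j : Fin 2) (c : Fin 3)
    (hM : l.length * (3 * roundBound ω + 3) ≤ M) :
    ∃ s', Steps M l (trial t j c) s s' ∧ s'.mem (cell 0 0) = ω ∧ s'.mem (cell 0 1) = l.length ∧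
      (∀ q, (∀ i, q ≠ ptr t i) → s'.pos q = s.pos q) ∧ (∀ i, s'.pos (ptr t i) ≤ 2 * l.length) ∧
      ((s'.verdict = some true ∧ s'.mem (cell 0 2) = 1 ∧ Found ω l s'.out) ∨
        (s'.verdict = some false ∧ s'.mem (cell 0 2) = 0 ∧ s'.out = [] ∧
          ¬ ∃ N, Passes ω (l.rotate j) (candidate ω (l.rotate j) c) N)) := by
  have hl0 : 0 < (l.rotate j).length := by rw [List.length_rotate]; omega
  have hseq' := hseq.rotate (j : ℕ)
  have hj : (j : ℕ) ≤ 1 := by omega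
  obtain ⟨N, hN1, hN2, hN3⟩ := exists_round hπ hseq' hl0 (candidate_nonneg hπ (l.rotate j) c)
  have hcand := candidate_le h0 (l.rotate j) c
  have huniq : ∀ N', Returns ω (l.rotate j) (candidate ω (l.rotate j) c) N' → N' = N := fun N' h =>
    h.unique hN1 hN2
  rw [List.length_rotate] at hN1 hN2 hN3
  have hM' : 3 * (l.length * roundBound ω) + 3 * l.length ≤ M := by
    refine le_of_eq_of_le ?_ hM
    ring
  have hassoc : 2 * l.length * roundBound ω = 2 * (l.length * roundBound ω) := Nat.mul_assoc _ _ _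
  have hM1 : 1 ≤ M := by omega
  have st1 := (loopFree_shiftAll t j).steps (l := l) (s := s) hM1
  obtain ⟨a1, a2, a3, a4, a5⟩ := shiftAll_spec (l := l) (s := s) t j
  generalize (shiftAll t j).run l s = s1 at *
  simp only [hp, zero_add] at a2
  obtain ⟨s2, st2, b1, b2, b3, b4⟩ := guess_spec (ω := ω) (M := M) (s := s1) (p := ptr t 0) c hl hj
    (by rw [a1, hω]) (by rw [a1, hn]) (a2 0) (by omega)
  generalize hcτ : candidate ω (l.rotate j) c = τ at *
  obtain ⟨s3, st3, c1, c2, c3⟩ := verify_spec (M := M) (s := s2) (p := ptr t 1) hseq' (by omega)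
    (by rw [b1.mem _ (by simp), a1, hω]) (by rw [b1.mem _ (by simp), a1, hn]) b4
    (by rw [b1.pos _ (by simp), a2]) b3 hcand hN1 hN2 (by omega)
  have w0 : s3.mem (cell 0 0) = ω := by rw [c1.mem _ (by simp), b1.mem _ (by simp), a1, hω]
  have w1 : s3.mem (cell 0 1) = l.length := by rw [c1.mem _ (by simp), b1.mem _ (by simp), a1, hn]
  have w2 : s3.mem (cell 0 2) = 0 := by rw [c1.mem _ (by simp), b1.mem _ (by simp), a1, hd]
  have w4 : s3.mem (cell 0 4) = τ := by rw [c1.mem _ (by simp), b4]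
  have wp : ∀ i, i ≠ 0 → i ≠ 1 → s3.pos (ptr t i) = j := fun i h h' => by
    rw [c1.pos _ (by simpa using h'), b1.pos _ (by simpa using h), a2]
  have wp0 : s3.pos (ptr t 0) ≤ 2 * l.length := by rw [c1.pos _ (by simp)]; exact b2
  have wp1 : s3.pos (ptr t 1) ≤ 2 * l.length := by omega
  have wq : ∀ q, (∀ i, q ≠ ptr t i) → s3.pos q = s.pos q := fun q hq => by
    rw [c1.pos _ (hq 1), b1.pos _ (hq 0), a3 q hq]
  have wo : s3.out = [] := by rw [c1.out, b1.out, a4, hout]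
  have wv : s3.verdict = some false := by rw [c1.verdict, b1.verdict, a5, hv]
  have five : ∀ i : Fin 5, i = 0 ∨ i = 1 ∨ i = 2 ∨ i = 3 ∨ i = 4 := by decide
  by_cases hR : Returns ω (l.rotate j) τ N
  swap
  · have st4 := Steps.ifFalse (M := M) (l := l) (s := s3) (s' := s3) hM1
      (mt (c3.lt_iff (l := l)).1 hR) (p := .seq (lag (ptr t 2) (ptr t 3))
      (.ifLt (reg 0 3) (.const (1 / 2)) (output (ptr t 4)) .skip))
      ((show (Program.skip : Program 64 30).LoopFree from trivial).steps hM1)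
    refine ⟨s3, st1.seq (st2.seq (st3.seq st4)), w0, w1, wq, fun i => ?_, Or.inr ⟨wv, w2, wo, ?_⟩⟩
    · rcases five i with rfl | rfl | rfl | rfl | rfl
      · exact wp0
      · exact wp1
      all_goals rw [wp _ (by decide) (by decide)]; omega
    · rintro ⟨N', h⟩
      obtain rfl := huniq N' h.toReturns
      exact hR h.toReturns
  obtain ⟨s4, st4, d1, d2, d3, d4⟩ := lag_spec (M := M) (s := s3) (p := ptr t 2) (r := ptr t 3) h0 hπ
    hseq' hl hj (by simp) w0 w1 w4 (wp _ (by decide) (by decide)) (wp _ (by decide) (by decide))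
    (c3.1 hR) hR (by omega)
  have v0 : s4.mem (cell 0 0) = ω := by rw [d1.mem _ (by simp), w0]
  have v1 : s4.mem (cell 0 1) = l.length := by rw [d1.mem _ (by simp), w1]
  have v2 : s4.mem (cell 0 2) = 0 := by rw [d1.mem _ (by simp), w2]
  have v4 : s4.mem (cell 0 4) = τ := by rw [d1.mem _ (by simp), w4]
  have vp : ∀ i, i ≠ 4 → s4.pos (ptr t i) ≤ 2 * l.length := fun i hi => by
    rcases five i with rfl | rfl | rfl | rfl | rfl
    · rw [d1.pos _ (by simp)]; exact wp0
    · rw [d1.pos _ (by simp)]; exact wp1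
    · exact d2
    · exact d3
    · exact absurd rfl hi
  have vp4 : s4.pos (ptr t 4) = j := by rw [d1.pos _ (by simp), wp _ (by decide) (by decide)]
  have vq : ∀ q, (∀ i, q ≠ ptr t i) → s4.pos q = s.pos q := fun q hq => by
    rw [d1.pos _ (by simp [hq]), wq q hq]
  have vo : s4.out = [] := by rw [d1.out, wo]
  have vv : s4.verdict = some false := by rw [d1.verdict, wv]
  by_cases hP : Passes ω (l.rotate j) τ N
  swap
  · have st5 := Steps.ifFalse (M := M) (l := l) (s := s4) (s' := s4) hM1
      (mt (d4.lt_iff (l := l)).1 hP) (p := output (ptr t 4))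
      ((show (Program.skip : Program 64 30).LoopFree from trivial).steps hM1)
    refine ⟨s4, st1.seq (st2.seq (st3.seq (.ifTrue hM1 (c3.lt_iff.2 hR) (st4.seq st5)))), v0, v1, vq,
      fun i => ?_, Or.inr ⟨vv, v2, vo, ?_⟩⟩
    · by_cases hi : i = 4
      · rw [hi, vp4]; omega
      · exact vp i hi
    · rintro ⟨N', h⟩
      obtain rfl := huniq N' h.toReturns
      exact hP h
  obtain ⟨s5, st5, e0, e1, e2, e3, e4, e5, e6⟩ := output_spec (M := M) (s := s4) (p := ptr t 4) v0 v1
    v4 vp4 vo hR (by omega)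
  refine ⟨s5, st1.seq (st2.seq (st3.seq (.ifTrue hM1 (c3.lt_iff.2 hR) (st4.seq (.ifTrue hM1
    (d4.lt_iff.2 hP) st5))))), e0, e1, fun q hq => by rw [e3 q (hq 4), vq q hq], fun i => ?_,
    Or.inl ⟨e5, e2, ?_⟩⟩
  · by_cases hi : i = 4
    · rw [hi, e4]; omega
    · rw [e3 _ (by simpa using hi)]; exact vp i hi
  · exact ⟨j, c, N, by rwa [hcτ], by rw [hcτ, e6]⟩

theorem search_spec (h0 : 0 < ω) (hπ : ω < Real.pi) (hseq : IsArcSequence l) (hl : 1 < l.length)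
    (hM : l.length * (3 * roundBound ω + 3) ≤ M) (ts : List (Fin 6)) (hts : ts.Nodup)
    (hω : s.mem (cell 0 0) = ω) (hn : s.mem (cell 0 1) = l.length) (hd : s.mem (cell 0 2) = 0)
    (hout : s.out = []) (hv : s.verdict = some false) (hp : ∀ t ∈ ts, ∀ i, s.pos (ptr t i) = 0)
    (hq : ∀ q, s.pos q ≤ 2 * l.length) :
    ∃ s', Steps M l (search ts) s s' ∧ (∀ q, s'.pos q ≤ 2 * l.length) ∧
      ((s'.verdict = some true ∧ Found ω l s'.out) ∨
        (s'.verdict = some false ∧ ∀ t ∈ ts, ¬ ∃ N, Passes ω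
          (l.rotate (trialKind t).1)
          (candidate ω (l.rotate (trialKind t).1)
            (trialKind t).2) N)) := by
  have hM1 : 1 ≤ M := by
    have : 0 < l.length * (3 * roundBound ω + 3) := Nat.mul_pos (by omega) (by omega)
    omega
  have hskip : ∀ s : State 64 30, Steps M l .skip s s := fun s =>
    (show (Program.skip : Program 64 30).LoopFree from trivial).steps hM1
  induction ts generalizing s with
  | nil => exact ⟨s, hskip s, hq, Or.inr ⟨hv, by simp⟩⟩
  | cons t ts ih =>
    obtain ⟨ht, hts⟩ := List.nodup_cons.1 hts
    obtain ⟨s1, st1, a0, a1, a2, a3, a4⟩ := trial_spec h0 hπ hseq hl hω hn hd hout hv t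
      (hp t List.mem_cons_self) (trialKind t).1 (trialKind t).2 hM
    have hq1 : ∀ q, s1.pos q ≤ 2 * l.length := by
      intro q
      by_cases h : ∀ i, q ≠ ptr t i
      · rw [a2 q h]; exact hq q
      · push Not at h
        obtain ⟨i, rfl⟩ := h
        exact a3 i
    rcases a4 with ⟨b1, b2, b3⟩ | ⟨b1, b2, b3, b4⟩
    · exact ⟨s1, st1.seq (.ifFalse hM1 (by rw [reg, Expr.eval_cell, Expr.eval_const, b2]; norm_num)
        (hskip s1)), hq1, Or.inl ⟨b1, b3⟩⟩
    · obtain ⟨s2, st2, c1, c2⟩ := ih hts a0 a1 b2 b3 b1 (fun t' ht' i => by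
        rw [a2 _ fun i' => ?_, hp t' (List.mem_cons_of_mem _ ht')]
        rw [ne_eq, ptr_inj]
        rintro ⟨rfl, -⟩
        exact ht ht') hq1
      refine ⟨s2, st1.seq (.ifTrue hM1 (by
        rw [reg, Expr.eval_cell, Expr.eval_const, b2]; norm_num) st2), c1, ?_⟩
      rcases c2 with c2 | ⟨c2, c3⟩
      · exact Or.inl c2
      · exact Or.inr ⟨c2, List.forall_mem_cons.2 ⟨b4, c3⟩⟩

theorem Found.isMaximalCloud {vs : List ℂ} (h0 : 0 < ω) (hπ : ω < Real.pi)
    (hseq : IsArcSequence l) (hl : 1 < l.length) (h : Found ω l vs) :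
    IsConvexPolygon vs ∧ IsMaximalCloud ω vs l := by
  obtain ⟨j, c, N, hP, rfl⟩ := h
  obtain ⟨h1, h2⟩ := hP.isMaximalCloud h0 hπ (hseq.rotate j) (by rw [List.length_rotate]; omega)
  exact ⟨h1, h2.of_rotate⟩

/-- A positive answer is correct by `Found.isMaximalCloud`; if all six trials fail,
`exists_candidate` excludes every polygon. -/
theorem recognize_spec (h0 : 0 < ω) (hπ : ω < Real.pi) (hseq : IsArcSequence l)
    (hl : 1 < l.length) : ∃ s, Steps (l.length * (3 * roundBound ω + 3)) l recognize
      (initial 64 30 ω l) s ∧ (∀ q, s.pos q ≤ 2 * l.length) ∧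
      ((s.verdict = some true ∧ IsConvexPolygon s.out ∧ IsMaximalCloud ω s.out l) ∨
        (s.verdict = some false ∧ ¬ ∃ vs, IsConvexPolygon vs ∧ IsMaximalCloud ω vs l)) := by
  have hM1 : 1 ≤ l.length * (3 * roundBound ω + 3) := Nat.mul_pos (by omega) (by omega)
  have st1 := (show (Program.answer false : Program 64 30).LoopFree from trivial).steps (l := l)
    (s := initial 64 30 ω l) hM1
  -- The first two cells of the group `0` are the cells `0` and `1` of the machine, which `initial`
  -- fills with `ω` and the length.
  obtain ⟨s, st2, h1, h2⟩ := search_spec (s := (Program.answer false).run l (initial 64 30 ω l))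
    h0 hπ hseq hl le_rfl (List.finRange 6) (List.nodup_finRange 6) rfl rfl rfl rfl rfl
    (fun _ _ _ => rfl) (fun _ => Nat.zero_le _)
  refine ⟨s, st1.seq st2, h1, ?_⟩
  rcases h2 with ⟨h2, h3⟩ | ⟨h2, h3⟩
  · exact Or.inl ⟨h2, h3.isMaximalCloud h0 hπ hseq hl⟩
  · refine Or.inr ⟨h2, ?_⟩
    rintro ⟨vs, -, h⟩
    obtain ⟨j, c, hN⟩ := exists_candidate h0 hπ hl hseq h
    refine h3 (trialKind.symm (j, c)) (List.mem_finRange _) ?_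
    rwa [Equiv.apply_symm_apply]

end
end OmegaCloud

theorem mainTheorem5 :
    ∃ (K H : ℕ) (prog : OmegaCloud.Program K H),
      ∀ ω : ℝ, 0 < ω → ω < Real.pi →
        ∃ C : ℕ, ∀ Ω : List OmegaCloud.DirArc,
          1 < Ω.length → OmegaCloud.IsArcSequence Ω →
            ∃ (s : OmegaCloud.State K H) (t : ℕ),
              OmegaCloud.Exec Ω prog (OmegaCloud.initial K H ω Ω) s t ∧
              t ≤ C * Ω.length ∧
              (∀ h : Fin H, s.pos h ≤ 2 * Ω.length) ∧
              ((s.verdict = some true ∧ OmegaCloud.IsConvexPolygon s.out ∧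
                  OmegaCloud.IsMaximalCloud ω s.out Ω) ∨
                (s.verdict = some false ∧
                  ¬ ∃ vs : List ℂ, OmegaCloud.IsConvexPolygon vs ∧
                    OmegaCloud.IsMaximalCloud ω vs Ω)) := by
  -- Four groups of sixteen cells, and five pointers for each of the six trials. The factor `3 *
  -- roundBound ω + 3`, times the length, exceeds the number of rounds of every loop.
  refine ⟨64, 30, OmegaCloud.recognize, fun ω h0 hπ =>
    ⟨(3 * OmegaCloud.roundBound ω + 3) * OmegaCloud.recognize.size, fun Ω hl hseq => ?_⟩⟩
  obtain ⟨s, ⟨t, ht, he⟩, h1, h2⟩ := OmegaCloud.recognize_spec h0 hπ hseq hl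
  exact ⟨s, t, he, ht.trans_eq (by ring), h1, h2⟩
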